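/- Let $(M,\varphi)$ be a simply connected $G_2$ manifold ($M$ a $7$-manifold; the $G_2$-structure $\varphi$ and the dual form $*\varphi$ are closed) with a smooth $\varphi$-preserving action of $T^2\times SU(2)$ of cohomogeneity two, i.e. the maximal dimension of the orbits is $5$. Let $U_1,U_2$ be the generating vector fields of $T^2$ and $V_1,V_2,V_3$ those of $SU(2)$, with $[V_i,V_j]=\epsilon_{ijk}V_k$. Let $\nu:M\to\mathbb R$ and $\mu:M\to\mathbb R^3$ be the multi-moment maps, i.e. smooth maps with $d\nu=\varphi(U_1,U_2,\cdot)$ and $d\mu_i=*\varphi(U_1,U_2,V_i,\cdot)$, where the additive constants of $\mu$ are normalised by $\mu_k=-*\varphi(U_1,U_2,V_i,V_j)$ for $(i,j,k)$ a cyclic permutation of $(1,2,3)$. Let $M_P$ be the set of points on principal orbits, let $B=M_P/(T^2\times SU(2))$, let $\Gamma$ be the kernel of the action, and let $G^{SU(2)}$ be the quotient of $SU(2)$ by the projection of $\Gamma$ to $SU(2)$, so that $M_P/T^2\to B$ is a principal $G^{SU(2)}$-bundle. The functions $|\mu|,\nu$ descend to $B$, the vector field $U_1\times U_2$ descends to $M_P/T^2$.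 (1) Let $\mathcal U\subset B$ be open (for instance $\mathcal U=B$) such that $(|\mu|,\nu):\mathcal U\to\mathbb R^2$ is a diffeomorphism onto its image and the image is convex. Then there is a trivialization $\Phi:\mathcal U\times G^{SU(2)}\to M_P/T^2$ over $\mathcal U$ of the principal bundle such that $U_1\times U_2$ is horizontal, i.e. $U_1\times U_2\in T\mathcal U\times\{0\}$. Let $M_{\mathcal U}\subset M_P$ be the preimage of $\mathcal U$ and let $p:M_{\mathcal U}\to G^{SU(2)}$ be the projection given by $\Phi$. Then $(|\mu|,p)$ is a smooth fibre bundle map from $M_{\mathcal U}$ onto $|\mu|(M_{\mathcal U})\times G^{SU(2)}$, and its fibres are (embedded, $3$-dimensional) associative submanifolds of $M$. (2) If $(|\mu|,\nu):B\to\mathbb R^2$ is a diffeomorphism onto its image and the image is convex, then $M$ admits a global $T^2$-invariant associative fibration, that is, a family of $T^2$-invariant, possibly singular associative submanifolds $N_b\subset M$, parametrised by the points $b$ of a (Hausdorff) $4$-dimensional topological space $\mathcal B$, such that: the $N_b$ cover $M$; $N_b$ is smooth for all $b$ in an open dense subset of $\mathcal B$; and there are an open dense subset $M'\subset M$, an open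 dense subset $\mathcal B'\subset\mathcal B$ that carries the structure of a smooth $4$-manifold, and a smooth fibre bundle $\pi:M'\to\mathcal B'$ whose fibre over each $b\in\mathcal B'$ is $N_b\cap M'$. (A possibly singular associative submanifold is a nonempty subset with a relatively open dense part which is an associative submanifold, the rest having zero $3$-dimensional Hausdorff measure.) -/

import Mathlib

open Set Topology
open scoped Manifold ContDiff Quaternion

noncomputable section

/-! ### The linear model of `G₂`-geometry -/

/-- Coordinates `(x₁, x₂, x₃, a₀, a₁, a₂, a₃)` are numbered `0, …, 6`. -/
abbrev E7 : Type := EuclideanSpace ℝ (Fin 7)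

/-- The elementary form `dy_{c 0} ∧ … ∧ dy_{c (k-1)}` on `ℝ⁷`. -/
def elemForm {k : ℕ} (c : Fin k → Fin 7) : E7 [⋀^Fin k]→L[ℝ] ℝ :=
  { (Matrix.detRowAlternating (R := ℝ) (n := Fin k)).compLinearMap
      (LinearMap.pi fun b => (EuclideanSpace.proj (c b) : E7 →L[ℝ] ℝ).toLinearMap) with
    cont := by
      change Continuous fun v : Fin k → E7 => Matrix.det fun a b => v a (c b)
      refine Continuous.matrix_det ?_
      fun_prop }

theorem elemForm_apply {k : ℕ} (c : Fin k → Fin 7) (v : Fin k → E7) :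
    elemForm c v = Matrix.det (fun a b => v a (c b)) := rfl

/-- `φ₀ = dx₁₂₃ + ∑ dxᵢ ∧ Ωᵢ` with `Ωᵢ = da₀ ∧ daᵢ - daⱼ ∧ daₖ`, `(i,j,k)` cyclic. -/
def phi0 : E7 [⋀^Fin 3]→L[ℝ] ℝ :=
  elemForm ![0, 1, 2]
    + (elemForm ![0, 3, 4] - elemForm ![0, 5, 6])
    + (elemForm ![1, 3, 5] - elemForm ![1, 6, 4])
    + (elemForm ![2, 3, 6] - elemForm ![2, 4, 5])

/-- `∗φ₀ = da₀₁₂₃ - ∑ dxⱼ ∧ dxₖ ∧ Ωᵢ`, `(i,j,k)` cyclic. -/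
def starPhi0 : E7 [⋀^Fin 4]→L[ℝ] ℝ :=
  elemForm ![3, 4, 5, 6]
    - (elemForm ![1, 2, 3, 4] - elemForm ![1, 2, 5, 6])
    - (elemForm ![2, 0, 3, 5] - elemForm ![2, 0, 6, 4])
    - (elemForm ![0, 1, 3, 6] - elemForm ![0, 1, 4, 5])

/-! ### Differential forms on a `7`-manifold -/

section Forms

variable {M : Type*} [TopologicalSpace M] [ChartedSpace E7 M]

/-- A (not necessarily smooth) differential `k`-form. -/
abbrev FormOn (M : Type*) [TopologicalSpace M] [ChartedSpace E7 M] (k : ℕ) : Type _ :=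
  ∀ x : M, TangentSpace (𝓡 7) x [⋀^Fin k]→L[ℝ] ℝ

/-- The expression of a form in a chart `e`, i.e. its pull-back by `e.symm`. -/
def formInChart {k : ℕ} (η : FormOn M k) (e : OpenPartialHomeomorph M E7) :
    E7 → E7 [⋀^Fin k]→L[ℝ] ℝ :=
  fun y => (η (e.symm y)).compContinuousLinearMap (mfderiv (𝓡 7) (𝓡 7) e.symm y)

/-- Smoothness of a form, tested in the charts `chartAt`. -/
def IsSmoothForm {k : ℕ} (η : FormOn M k) : Prop :=
  ∀ x : M, ContDiffOn ℝ ∞ (formInChart η (chartAt E7 x)) (chartAt E7 x).target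

/-- A smooth form with `dη = 0`. -/
def IsClosedForm {k : ℕ} (η : FormOn M k) : Prop :=
  IsSmoothForm η ∧ ∀ x : M, ∀ y ∈ (chartAt E7 x).target,
    extDeriv (formInChart η (chartAt E7 x)) y = 0

end Forms

/-- A tangent vector of `ℝⁿ` at a point, as a vector of `ℝⁿ`. -/
def tangentCoord {n : ℕ} {y : EuclideanSpace ℝ (Fin n)} (w : TangentSpace (𝓡 n) y) :
    EuclideanSpace ℝ (Fin n) := w

/-! ### `G₂`-structures -/

/-- A smooth `3`-form which at each point is identified with `φ₀` by some linear isomorphism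
`ℝ⁷ ≃ TₓM`. -/
structure G2Structure (M : Type*) [TopologicalSpace M] [ChartedSpace E7 M] where
  form : FormOn M 3
  smooth : IsSmoothForm form
  exists_frame : ∀ x : M, ∃ p : E7 ≃L[ℝ] TangentSpace (𝓡 7) x,
    ∀ v : Fin 3 → E7, form x (fun i => p (v i)) = phi0 v

namespace G2Structure

variable {M : Type*} [TopologicalSpace M] [ChartedSpace E7 M] (φ : G2Structure M)

/-- An adapted isomorphism `pₓ : ℝ⁷ ≃ TₓM` with `pₓ^* φ = φ₀`. It is unique up to the stabilizer
of `φ₀`, which is contained in `SO(7)`; so the metric and the `4`-form defined from it below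
do not depend on the choice. -/
def frame (x : M) : E7 ≃L[ℝ] TangentSpace (𝓡 7) x := (φ.exists_frame x).choose

theorem frame_spec (x : M) (v : Fin 3 → E7) :
    φ.form x (fun i => φ.frame x (v i)) = phi0 v := (φ.exists_frame x).choose_spec v

/-- The metric `g_φ`: the one for which `pₓ` is an isometry. -/
def metric (x : M) (u v : TangentSpace (𝓡 7) x) : ℝ :=
  inner ℝ ((φ.frame x).symm u) ((φ.frame x).symm v)

/-- The coassociative form `∗φ`: the one with `pₓ^* (∗φ) = ∗φ₀`. -/
def star : FormOn M 4 := fun x =>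
  starPhi0.compContinuousLinearMap ((φ.frame x).symm : TangentSpace (𝓡 7) x →L[ℝ] E7)

/-- `(M, φ)` is a `G₂` manifold: `φ` and `∗φ` are closed. -/
def IsG2Manifold : Prop := IsClosedForm φ.form ∧ IsClosedForm φ.star

/-- The cross product `u × v = (v ⌟ u ⌟ φ)^♯`, see `metric_cross`. -/
def cross (x : M) (u v : TangentSpace (𝓡 7) x) : TangentSpace (𝓡 7) x :=
  φ.frame x (∑ i : Fin 7,
    φ.form x ![u, v, φ.frame x (EuclideanSpace.single i 1)] • EuclideanSpace.single i (1 : ℝ))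

theorem metric_cross (x : M) (u v w : TangentSpace (𝓡 7) x) :
    φ.metric x (φ.cross x u v) w = φ.form x ![u, v, w] := by
  obtain ⟨b, rfl⟩ := (φ.frame x).surjective w
  have hb : b = ∑ i : Fin 7, b i • EuclideanSpace.single i (1 : ℝ) := by
    ext j
    simp [Finset.sum_apply, Pi.single_apply]
  have hlin : ∀ c : Fin 7 → ℝ, ∀ z : Fin 7 → TangentSpace (𝓡 7) x,
      φ.form x ![u, v, ∑ i, c i • z i] = ∑ i, c i * φ.form x ![u, v, z i] := by
    intro c z
    have h : ∀ w', φ.form x ![u, v, w'] =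
        (φ.form x).toMultilinearMap.toLinearMap ![u, v, 0] 2 w' := by
      intro w'
      have h3 : Function.update ![u, v, 0] 2 w' = ![u, v, w'] := by
        ext i; fin_cases i <;> simp [Function.update]
      simp [MultilinearMap.toLinearMap, h3]
    simp only [h, map_sum, map_smul, smul_eq_mul]
  have h2 : φ.frame x b = ∑ i : Fin 7, b i • φ.frame x (EuclideanSpace.single i 1) := by
    conv_lhs => rw [hb]
    simp only [map_sum, map_smul]
  unfold metric cross
  rw [ContinuousLinearEquiv.symm_apply_apply, ContinuousLinearEquiv.symm_apply_apply, h2, hlin,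
    sum_inner]
  refine Finset.sum_congr rfl fun i _ => ?_
  rw [inner_smul_left, EuclideanSpace.inner_single_left]
  simp [mul_comm]

/-- `L ⊆ M` is an embedded `3`-dimensional submanifold (around each of its points there is a chart
`e` of the smooth structure in which `L` is `ℝ³ × {0}`) whose tangent spaces are calibrated by `φ`:
each has an orthonormal basis `v` with `φ(v₀, v₁, v₂) = 1`. -/
def IsAssociativeSubmanifold (L : Set M) : Prop :=
  ∀ x ∈ L, ∃ e ∈ IsManifold.maximalAtlas (𝓡 7) ∞ M, x ∈ e.source ∧
    (∀ y ∈ e.source, y ∈ L ↔ ∀ i : Fin 7, 3 ≤ (i : ℕ) → (e y : E7) i = 0) ∧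
    ∃ v : Fin 3 → TangentSpace (𝓡 7) x,
      (∀ i j, φ.metric x (v i) (v j) = if i = j then 1 else 0) ∧
      φ.form x v = 1 ∧
      ∀ u : TangentSpace (𝓡 7) x, u ∈ Submodule.span ℝ (range v) ↔
        ∀ i : Fin 7, 3 ≤ (i : ℕ) → tangentCoord (mfderiv (𝓡 7) (𝓡 7) e x u) i = 0

/-- A possibly singular associative submanifold: a set `N` with a relatively open dense part that
is an associative submanifold, the remaining singular set being of `3`-dimensional Hausdorff
measure zero (in charts). -/
def IsPossiblySingularAssociative (N : Set M) : Prop :=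
  ∃ O : Set M, IsOpen O ∧ N ⊆ closure (N ∩ O) ∧ φ.IsAssociativeSubmanifold (N ∩ O) ∧
    ∀ x : M, MeasureTheory.Measure.hausdorffMeasure (3 : ℝ)
      (chartAt E7 x '' ((chartAt E7 x).source ∩ (N \ O))) = 0

end G2Structure

/-! ### Smooth maps between quotients, fibre bundles -/

section Quotients

variable {E H X E' H' Y Q R : Type*}
  [NormedAddCommGroup E] [NormedSpace ℝ E] [TopologicalSpace H]
  [TopologicalSpace X] [ChartedSpace H X]
  [NormedAddCommGroup E'] [NormedSpace ℝ E'] [TopologicalSpace H']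
  [TopologicalSpace Y] [ChartedSpace H' Y]

/-- Let `A ⊆ X`, `B ⊆ Y` be open in manifolds and let `q : X → Q`, `r : Y → R` be quotient maps
(orbit maps of free actions, coverings, or identity maps). A map between the quotient manifolds
`q(A)` and `r(B)` is smooth when it lifts locally to smooth maps `A → B`. This predicate says that
`f` restricts to a diffeomorphism `q(A) → r(B)`: it is a bijection, and it and its inverse are
smooth. -/
structure IsQuotientDiffeo (I : ModelWithCorners ℝ E H) (J : ModelWithCorners ℝ E' H')
    (A : Set X) (B : Set Y) (q : X → Q) (r : Y → R) (f : Q → R) : Prop where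
  bijOn : BijOn f (q '' A) (r '' B)
  smooth : ∀ x ∈ A, ∃ F : X → Y, ContMDiffWithinAt I J ∞ F A x ∧
    ∀ᶠ x' in 𝓝[A] x, F x' ∈ B ∧ r (F x') = f (q x')
  smooth_symm : ∀ y ∈ B, ∃ F : Y → X, ContMDiffWithinAt J I ∞ F B y ∧
    ∀ᶠ y' in 𝓝[B] y, F y' ∈ A ∧ f (q (F y')) = r y'

/-- `π : A → r(D)` is a smooth fibre bundle, with typical fibre a `d`-dimensional manifold, over
the manifold `r(D)`; here `A ⊆ X` is open and `r(D)` is a quotient of the open set `D ⊆ Y`. -/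
def IsSmoothFibreBundle (I : ModelWithCorners ℝ E H) (J : ModelWithCorners ℝ E' H') (d : ℕ)
    (A : Set X) (D : Set Y) (r : Y → R) (π : X → R) : Prop :=
  IsOpen A ∧ π '' A = r '' D ∧
  ∃ (F : Type) (_ : TopologicalSpace F) (_ : ChartedSpace (EuclideanSpace ℝ (Fin d)) F),
    IsManifold (𝓡 d) ∞ F ∧
    ∀ y ∈ D, ∃ V : Set Y, IsOpen V ∧ y ∈ V ∧ V ⊆ D ∧ ∃ Ψ : R × F → X,
      IsQuotientDiffeo (J.prod (𝓡 d)) I (V ×ˢ univ) (A ∩ π ⁻¹' (r '' V))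
        (Prod.map r id) id Ψ ∧
      ∀ b ∈ r '' V, ∀ z : F, π (Ψ (b, z)) = b

end Quotients

/-! ### Associative fibrations -/

/-- The family `N_b`, `b ∈ 𝓑`, is an associative fibration of `(M, φ)`:
the parameter space is Hausdorff and `4`-dimensional (it has inductive dimension at most four and
contains a dense open `4`-manifold `𝓑'`), the members are possibly singular associatives that
cover `M`, those over a dense open `𝓑°` are smooth, and over `𝓑'` they are, within a dense
open `M' ⊆ M`, the fibres of a smooth fibre bundle `π : M' → 𝓑'`. -/
def IsAssociativeFibration {M : Type*} [TopologicalSpace M] [ChartedSpace E7 M]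
    (φ : G2Structure M) {𝓑 : Type} [TopologicalSpace 𝓑] (N : 𝓑 → Set M) : Prop :=
  T2Space 𝓑 ∧ HasSmallInductiveDimensionLE 𝓑 4 ∧
  (∀ b, (N b).Nonempty ∧ φ.IsPossiblySingularAssociative (N b)) ∧
  (⋃ b, N b) = univ ∧
  (∃ 𝓑₀ : Set 𝓑, IsOpen 𝓑₀ ∧ Dense 𝓑₀ ∧ ∀ b ∈ 𝓑₀, φ.IsAssociativeSubmanifold (N b)) ∧
  ∃ (M' : Set M) (𝓑' : Set 𝓑), IsOpen M' ∧ Dense M' ∧ IsOpen 𝓑' ∧ Dense 𝓑' ∧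
    ∃ _ : ChartedSpace (EuclideanSpace ℝ (Fin 4)) 𝓑', IsManifold (𝓡 4) ∞ 𝓑' ∧
    ∃ π : M → 𝓑', IsSmoothFibreBundle (𝓡 7) (𝓡 4) 3 M' (univ : Set 𝓑') id π ∧
      ∀ b : 𝓑', M' ∩ π ⁻¹' {b} = N b ∩ M'

/-! ### The group `T² × SU(2)` and its actions -/

instance factFinrankQuaternion : Fact (Module.finrank ℝ ℍ = 3 + 1) :=
  ⟨Quaternion.finrank_eq_four⟩

/-- `SU(2)` as the Lie group of unit quaternions, with the smooth structure of the `3`-sphere. -/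
abbrev SU2 : Type := Metric.sphere (0 : ℍ) 1

abbrev T2SU2 : Type := (Circle × Circle) × SU2

abbrev modelT2SU2 := (((𝓡 1).prod (𝓡 1)).prod (𝓡 3))

/-- The imaginary quaternion `a₀ i + a₁ j + a₂ k`. -/
def imQuaternion (a : Fin 3 → ℝ) : ℍ := ⟨0, a 0, a 1, a 2⟩

/-- The exponential map of `SU(2)`, with `𝔰𝔲(2)` the imaginary quaternions. -/
def su2Exp (a : Fin 3 → ℝ) : SU2 :=
  ⟨NormedSpace.exp (imQuaternion a), by
    rw [mem_sphere_zero_iff_norm, Quaternion.norm_exp, imQuaternion]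
    simp⟩

/-- `T² × {1}`. -/
abbrev torusSubgroup : Subgroup T2SU2 := Subgroup.prod ⊤ ⊥

section Action

variable (M : Type*) [MulAction T2SU2 M]

/-- The projection to `SU(2)` of the kernel `Γ` of the action. -/
def gammaTwo : Subgroup SU2 :=
  (MulAction.toPermHom T2SU2 M).ker.map (MonoidHom.snd (Circle × Circle) SU2)

/-- The structure group `G^{SU(2)}`: the quotient of `SU(2)` by the projection of `Γ`. -/
abbrev GSU2 : Type := SU2 ⧸ gammaTwo M

variable {M}

/-- The principal set `M_P`: points whose stabilizer is, up to conjugation, contained in every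
other stabilizer. -/
def principalSet : Set M :=
  {x | ∀ y : M, ∃ g : T2SU2,
    MulAction.stabilizer T2SU2 x ≤ MulAction.stabilizer T2SU2 (g • y)}

/-- The orbit map of the full group. The image of `M_P` is the surface `B`. -/
def baseProj (x : M) : MulAction.orbitRel.Quotient T2SU2 M := Quotient.mk'' x

/-- The orbit map of `T²`. -/
def torusProj (x : M) : MulAction.orbitRel.Quotient torusSubgroup M := Quotient.mk'' x

variable (M) in
/-- The surface `B = M_P / (T² × SU(2))`, inside the orbit space. -/
def baseB : Set (MulAction.orbitRel.Quotient T2SU2 M) := baseProj '' (principalSet : Set M)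

/-- The map `(|μ|, ν)` on the orbit space; `|μ|` and `ν` are invariant, so that the choice of the
point in the orbit does not matter. -/
def baseMap (μ : M → EuclideanSpace ℝ (Fin 3)) (ν : M → ℝ)
    (b : MulAction.orbitRel.Quotient T2SU2 M) : ℝ × ℝ := (‖μ b.out‖, ν b.out)

variable [TopologicalSpace M] [ChartedSpace E7 M]

/-- The velocity at `t = 0` of `t ↦ c(t) • x`, for a curve `c` in the group with `c(0) = 1`. -/
def velocity (c : ℝ → T2SU2) (x : M) : TangentSpace (𝓡 7) x :=
  (mfderiv 𝓘(ℝ, ℝ) (𝓡 7) (fun t : ℝ => c t • x) 0 (1 : ℝ) : E7)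

/-- The generators `U₁ = genU 0`, `U₂ = genU 1` of the torus: `d/dt exp(-tξ) • x` at `t = 0`. -/
def genU (l : Fin 2) (x : M) : TangentSpace (𝓡 7) x :=
  velocity (fun t => (if l = 0 then (Circle.exp (-t), 1) else (1, Circle.exp (-t)), 1)) x

/-- The generators `V₁, V₂, V₃` of `SU(2)`, given by the elements `i/2, j/2, k/2` of the Lie
algebra, so that `[Vᵢ, Vⱼ] = εᵢⱼₖ Vₖ`. -/
def genV (i : Fin 3) (x : M) : TangentSpace (𝓡 7) x :=
  velocity (fun t => (1, su2Exp (Pi.single i (-(t / 2))))) x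

/-- The dimension of the orbit of `x`, i.e. of the span of the generating vector fields. -/
def orbitDim (x : M) : ℕ :=
  Module.finrank ℝ (Submodule.span ℝ
    (range (fun l => genU l x) ∪ range (fun i => genV i x) : Set (TangentSpace (𝓡 7) x)))

variable (M) in
/-- The orbits have maximal dimension `5`. -/
def IsCohomogeneityTwo : Prop := IsGreatest (range (orbitDim : M → ℕ)) 5

/-- The group acts by maps that preserve `φ`. -/
def PreservesG2 (φ : G2Structure M) : Prop :=
  ∀ (g : T2SU2) (x : M) (v : Fin 3 → TangentSpace (𝓡 7) x),
    φ.form (g • x) (fun i => mfderiv (𝓡 7) (𝓡 7) (fun y : M => g • y) x (v i)) = φ.form x v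

/-- `ν` is a multi-moment map: `dν = φ(U₁, U₂, ·)`. -/
structure IsMultimomentNu (φ : G2Structure M) (ν : M → ℝ) : Prop where
  smooth : ContMDiff (𝓡 7) 𝓘(ℝ, ℝ) ∞ ν
  deriv : ∀ (x : M) (w : TangentSpace (𝓡 7) x),
    mfderiv (𝓡 7) 𝓘(ℝ, ℝ) ν x w = φ.form x ![genU 0 x, genU 1 x, w]

/-- `μ` is the multi-moment map with `dμᵢ = ∗φ(U₁, U₂, Vᵢ, ·)`, its additive constants
being normalised by `μₖ = -∗φ(U₁, U₂, Vᵢ, Vⱼ)` for `(i, j, k)` cyclic. -/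
structure IsMultimomentMu (φ : G2Structure M) (μ : M → EuclideanSpace ℝ (Fin 3)) : Prop where
  smooth : ContMDiff (𝓡 7) (𝓡 3) ∞ μ
  deriv : ∀ (x : M) (w : TangentSpace (𝓡 7) x) (i : Fin 3),
    tangentCoord (mfderiv (𝓡 7) (𝓡 3) μ x w) i
      = φ.star x ![genU 0 x, genU 1 x, genV i x, w]
  normalised : ∀ (x : M) (k : Fin 3),
    μ x k = -φ.star x ![genU 0 x, genU 1 x, genV (k + 1) x, genV (k + 2) x]

/-- `(|μ|, ν)` restricts to a diffeomorphism of `𝓤 ⊆ B` onto its image, which is a convex open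
subset of `ℝ²`. -/
def IsConvexChart (μ : M → EuclideanSpace ℝ (Fin 3)) (ν : M → ℝ)
    (𝓤 : Set (MulAction.orbitRel.Quotient T2SU2 M)) : Prop :=
  IsOpen (baseMap μ ν '' 𝓤) ∧ Convex ℝ (baseMap μ ν '' 𝓤) ∧
    IsQuotientDiffeo (𝓡 7) 𝓘(ℝ, ℝ × ℝ) (baseProj ⁻¹' 𝓤) (baseMap μ ν '' 𝓤)
      baseProj id (baseMap μ ν)

/-- For `𝓤 ⊆ B` open, `Φ : 𝓤 × G^{SU(2)} → M_P / T²` is a trivialization over `𝓤` of the principal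
`G^{SU(2)}`-bundle `M_P / T² → B`: a diffeomorphism onto the part of `M_P / T²` over `𝓤`,
compatible with the projections to `𝓤` and with the actions of `SU(2)`. -/
structure IsPrincipalTrivialization (𝓤 : Set (MulAction.orbitRel.Quotient T2SU2 M))
    (Φ : MulAction.orbitRel.Quotient T2SU2 M × GSU2 M →
      MulAction.orbitRel.Quotient torusSubgroup M) : Prop where
  diffeo : IsQuotientDiffeo ((𝓡 7).prod (𝓡 3)) (𝓡 7)
    ((baseProj ⁻¹' 𝓤 : Set M) ×ˢ (univ : Set SU2)) (baseProj ⁻¹' 𝓤 : Set M)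
    (Prod.map baseProj (fun s : SU2 => (s : GSU2 M))) torusProj Φ
  over_base : ∀ b ∈ 𝓤, ∀ (h : GSU2 M) (x : M), torusProj x = Φ (b, h) → baseProj x = b
  equivariant : ∀ b ∈ 𝓤, ∀ (s h : SU2) (x : M),
    torusProj x = Φ (b, (h : GSU2 M)) →
      torusProj (((1, s) : T2SU2) • x) = Φ (b, ((s * h : SU2) : GSU2 M))

/-- For a `G^{SU(2)}`-valued map `p` on the part of `M_P` over `𝓤`: `dp(U₁ × U₂) = 0`, computed
with local lifts of `p` along the covering `SU(2) → G^{SU(2)}`. If `p` is the second component of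
a trivialization, this says that `U₁ × U₂` is tangent to `𝓤 × {pt}`. -/
def IsConstantAlongCross (φ : G2Structure M) (𝓤 : Set (MulAction.orbitRel.Quotient T2SU2 M))
    (p : M → GSU2 M) : Prop :=
  ∀ x ∈ (baseProj ⁻¹' 𝓤 : Set M), ∃ P : M → SU2, ContMDiffAt (𝓡 7) (𝓡 3) ∞ P x ∧
    (∀ᶠ y in 𝓝 x, (P y : GSU2 M) = p y) ∧
    mfderiv (𝓡 7) (𝓡 3) P x (φ.cross x (genU 0 x) (genU 1 x)) = 0

end Action

end

set_option linter.unusedSectionVars false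

noncomputable section

open Function (Injective Surjective)
open LinearMap (ker mem_ker toContinuousLinearMap)
open Submodule (smul_mem subset_span span mem_orthogonal)
open Module (finrank)
open Pi (single)
open Prod (fst snd)
open LinearIndependent (pair_iff)
open ContinuousLinearEquiv (symm_apply_apply apply_symm_apply)
open ContinuousLinearMap (toSpanSingleton)
open Quaternion (normSq_eq_norm_mul_self imK_mul imJ_mul imI_mul re_mul normSq_def')
open Filter (Tendsto inter_mem)
open Metric (ball mem_ball)

local notation "E3" => EuclideanSpace ℝ (Fin 3)
local notation "R2" => ℝ × ℝ
local notation "R3" => Fin 3 → ℝ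
local notation "I7" => 𝓡 7
local notation "ch" => chartAt E7
local notation "imQ" => imQuaternion
local notation "L7" => E7 →L[ℝ] E7

/-! ### Linear algebra of `φ₀` -/

lemma inner_E7 (u v : E7) : inner ℝ u v =
    u 0 * v 0 + u 1 * v 1 + u 2 * v 2 + u 3 * v 3 + u 4 * v 4 + u 5 * v 5 + u 6 * v 6 := by
  simp [PiLp.inner_apply, Fin.sum_univ_succ]
  ring

/-- The cross product of `ℝ⁷` defined by `φ₀`. -/
def cross0 (u v : E7) : E7 := !₂[
  u 1 * v 2 - u 2 * v 1 + (u 3 * v 4 - u 4 * v 3) - (u 5 * v 6 - u 6 * v 5),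
  u 2 * v 0 - u 0 * v 2 + (u 3 * v 5 - u 5 * v 3) + (u 4 * v 6 - u 6 * v 4),
  u 0 * v 1 - u 1 * v 0 + (u 3 * v 6 - u 6 * v 3) - (u 4 * v 5 - u 5 * v 4),
  u 4 * v 0 - u 0 * v 4 + (u 5 * v 1 - u 1 * v 5) + (u 6 * v 2 - u 2 * v 6),
  u 0 * v 3 - u 3 * v 0 + (u 6 * v 1 - u 1 * v 6) - (u 5 * v 2 - u 2 * v 5),
  u 1 * v 3 - u 3 * v 1 - (u 6 * v 0 - u 0 * v 6) - (u 2 * v 4 - u 4 * v 2),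
  u 2 * v 3 - u 3 * v 2 - (u 0 * v 5 - u 5 * v 0) + (u 1 * v 4 - u 4 * v 1)]


lemma E7_ext {u v : E7} (h0 : u 0 = v 0) (h1 : u 1 = v 1) (h2 : u 2 = v 2) (h3 : u 3 = v 3)
    (h4 : u 4 = v 4) (h5 : u 5 = v 5) (h6 : u 6 = v 6) : u = v := by
  ext i; fin_cases i <;> assumption

lemma elemForm_three (a b c : Fin 7) (u v w : E7) : elemForm ![a, b, c] ![u, v, w] =
    u a * (v b * w c - v c * w b) - u b * (v a * w c - v c * w a)
      + u c * (v a * w b - v b * w a) := by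
  have h : elemForm ![a, b, c] ![u, v, w]
      = Matrix.det !![u a, u b, u c; v a, v b, v c; w a, w b, w c] := by
    rw [elemForm_apply]
    congr 1
    ext i j
    fin_cases i <;> fin_cases j <;> rfl
  rw [h, Matrix.det_fin_three]
  simp only [Matrix.of_apply, Matrix.cons_val_zero, Matrix.cons_val_one, Matrix.cons_val]
  ring

lemma elemForm_four (a b c d : Fin 7) (u v w z : E7) :
    elemForm ![a, b, c, d] ![u, v, w, z] =
      u a * elemForm ![b, c, d] ![v, w, z] - u b * elemForm ![a, c, d] ![v, w, z]
      + u c * elemForm ![a, b, d] ![v, w, z] - u d * elemForm ![a, b, c] ![v, w, z] := by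
  have h : elemForm ![a, b, c, d] ![u, v, w, z]
      = Matrix.det !![u a, u b, u c, u d; v a, v b, v c, v d; w a, w b, w c, w d;
        z a, z b, z c, z d] := by
    rw [elemForm_apply]
    congr 1
    ext i j
    fin_cases i <;> fin_cases j <;> rfl
  rw [h, Matrix.det_succ_row_zero]
  simp only [Fin.sum_univ_four, elemForm_three, Matrix.det_fin_three, Matrix.submatrix_apply]
  simp [Fin.succAbove, Fin.lt_def]
  ring

lemma phi0_apply (u v w : E7) : phi0 ![u, v, w] = inner ℝ (cross0 u v) w := by
  simp only [inner_E7, cross0, Matrix.cons_val, phi0, ContinuousAlternatingMap.add_apply, ContinuousAlternatingMap.sub_apply,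
    elemForm_three]
  ring

lemma cross0_swap (u v : E7) : cross0 v u = -cross0 u v := by
  apply E7_ext <;>
    simp only [PiLp.neg_apply, cross0, Matrix.cons_val] <;> ring

lemma cross0_add_left (u u' v : E7) : cross0 (u + u') v = cross0 u v + cross0 u' v := by
  apply E7_ext <;>
    simp only [PiLp.add_apply, cross0, Matrix.cons_val] <;> ring

lemma cross0_smul_left (c : ℝ) (u v : E7) : cross0 (c • u) v = c • cross0 u v := by
  apply E7_ext <;>
    simp only [PiLp.smul_apply, smul_eq_mul, cross0, Matrix.cons_val] <;> ring

lemma cross0_add_right (u v v' : E7) : cross0 u (v + v') = cross0 u v + cross0 u v' := by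
  rw [cross0_swap, cross0_add_left, cross0_swap u v, cross0_swap u v']; simp [add_comm]

lemma cross0_smul_right (c : ℝ) (u v : E7) : cross0 u (c • v) = c • cross0 u v := by
  rw [cross0_swap, cross0_smul_left, cross0_swap u v]; simp

lemma cross0_self (u : E7) : cross0 u u = 0 := by
  apply E7_ext <;>
    simp only [PiLp.zero_apply, cross0, Matrix.cons_val] <;> ring

def crossBilin : E7 →ₗ[ℝ] E7 →ₗ[ℝ] E7 :=
  LinearMap.mk₂ ℝ cross0 cross0_add_left cross0_smul_left cross0_add_right cross0_smul_right

lemma cross0_sub_right (u v w : E7) : cross0 u (v - w) = cross0 u v - cross0 u w :=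
  map_sub (crossBilin u) v w

lemma cross0_zero_right (u : E7) : cross0 u 0 = 0 := map_zero (crossBilin u)

lemma cross0_neg_right (u v : E7) : cross0 u (-v) = -cross0 u v := map_neg (crossBilin u) v

lemma inner_cross0_cyc (u v w : E7) : inner ℝ (cross0 u v) w = inner ℝ (cross0 v w) u := by
  simp only [inner_E7, cross0, Matrix.cons_val]
  ring

lemma inner_cross0_left (u v : E7) : inner ℝ (cross0 u v) u = 0 := by
  rw [← inner_cross0_cyc, cross0_self, inner_zero_left]

lemma inner_cross0_right (u v : E7) : inner ℝ (cross0 u v) v = 0 := by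
  rw [inner_cross0_cyc, cross0_self, inner_zero_left]

lemma cross0_cross0 (u v : E7) :
    cross0 u (cross0 u v) = (inner ℝ u v) • u - (inner ℝ u u) • v := by
  apply E7_ext <;>
    simp only [inner_E7, PiLp.sub_apply, PiLp.smul_apply, smul_eq_mul, cross0, Matrix.cons_val] <;> ring

lemma inner_cross0_cross0 (u v w : E7) : inner ℝ (cross0 u v) (cross0 u w) =
    inner ℝ u u * inner ℝ v w - inner ℝ u v * inner ℝ u w := by
  rw [real_inner_comm, inner_cross0_cyc, inner_cross0_cyc, cross0_swap, cross0_cross0,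
    ← neg_sub, neg_neg, inner_sub_left, inner_smul_left, inner_smul_left]
  simp

lemma starPhi0_apply (u v w z : E7) : starPhi0 ![u, v, w, z] =
    inner ℝ (cross0 u (cross0 v w)) z + inner ℝ u v * inner ℝ w z
      - inner ℝ u w * inner ℝ v z := by
  simp only [inner_E7, cross0, Matrix.cons_val, starPhi0, ContinuousAlternatingMap.sub_apply,
    elemForm_four, elemForm_three]
  ring

lemma cross0_cross0_add (u v w : E7) :
    cross0 u (cross0 v w) + cross0 v (cross0 u w) =
      (inner ℝ u w) • v + (inner ℝ v w) • u - (2 * inner ℝ u v) • w := by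
  apply E7_ext <;>
    simp only [inner_E7, PiLp.sub_apply, PiLp.add_apply, PiLp.smul_apply, smul_eq_mul, cross0, Matrix.cons_val] <;> ring

lemma cross0_cross0_anti {u v w : E7} (huv : inner ℝ u v = 0)
    (huw : inner ℝ u w = 0) (hvw : inner ℝ v w = 0) :
    cross0 u (cross0 v w) = -cross0 (cross0 u v) w := by
  have h1 := cross0_cross0_add u w v
  have h2 := cross0_swap (cross0 u v) w
  have h3 := cross0_swap v w
  rw [real_inner_comm] at hvw
  rw [huv, hvw, huw, h2, h3, cross0_neg_right] at h1
  simp only [zero_smul, mul_zero, add_zero, sub_zero] at h1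
  exact eq_of_sub_eq_zero (by rw [← neg_eq_zero, ← h1]; abel)

/-! ### Eigenvectors of symmetric maps -/

lemma exists_eigenvector_mem {S : E7 →ₗ[ℝ] E7} (hS : S.IsSymmetric) {N : Submodule ℝ E7}
    (hN : N ≠ ⊥) (hinv : ∀ x ∈ N, S x ∈ N) : ∃ w ∈ N, w ≠ 0 ∧ ∃ c : ℝ, S w = c • w := by
  have h1 : (S.restrict hinv).IsSymmetric := hS.restrict_invariant hinv
  have : Nontrivial N := Submodule.nontrivial_iff_ne_bot.2 hN
  obtain ⟨w, hw⟩ := h1.hasEigenvalue_iSup_of_finiteDimensional.exists_hasEigenvector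
  exact ⟨w, w.2, fun h => hw.2 (Subtype.ext h), _, congrArg Subtype.val hw.apply_eq_smul⟩

/-! ### Invertible maps that preserve `φ₀` -/

section Stabilizer

variable {A : E7 →ₗ[ℝ] E7} (hA : ∀ u v w, phi0 ![A u, A v, A w] = phi0 ![u, v, w])
include hA

lemma stab_inner (u v w : E7) :
    inner ℝ (cross0 (A u) (A v)) (A w) = inner ℝ (cross0 u v) w := by
  have := hA u v w
  rwa [phi0_apply, phi0_apply] at this

lemma stab_injective : Injective A := by
  rw [injective_iff_map_eq_zero]
  intro u hu
  have h : ∀ v, cross0 u v = 0 := by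
    intro v
    have := stab_inner hA u v (cross0 u v)
    rw [hu, show cross0 0 (A v) = 0 from by rw [cross0_swap, cross0_zero_right, neg_zero],
      inner_zero_left] at this
    exact inner_self_eq_zero.1 this.symm
  by_contra hne
  obtain ⟨w, hw, hw0⟩ : ∃ w : E7, inner ℝ u w = 0 ∧ w ≠ 0 := by
    have : (ℝ ∙ u)ᗮ ≠ ⊥ := by
      intro hb
      rw [Submodule.orthogonal_eq_bot_iff] at hb
      have h1 : finrank ℝ (ℝ ∙ u) ≤ 1 := finrank_span_singleton (K := ℝ) hne |>.le
      rw [hb, finrank_top, finrank_euclideanSpace_fin] at h1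
      omega
    obtain ⟨w, hw, hw0⟩ := Submodule.exists_mem_ne_zero_of_ne_bot this
    exact ⟨w, Submodule.mem_orthogonal_singleton_iff_inner_right.1 hw, hw0⟩
  have h2 := cross0_cross0 u w
  rw [h w, h, hw, zero_smul, zero_sub] at h2
  rcases smul_eq_zero.1 (neg_eq_zero.1 h2.symm) with h3 | h3
  · exact hne (inner_self_eq_zero.1 h3)
  · exact hw0 h3

lemma stab_eig_cross {f g : E7} {a b : ℝ} (hf : ∀ w, inner ℝ (A f) (A w) = a * inner ℝ f w)
    (hg : ∀ w, inner ℝ (A g) (A w) = b * inner ℝ g w) (hfg : inner ℝ f g = 0)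
    (hf1 : inner ℝ f f = 1) (hab : a * b ≠ 0) (w : E7) :
    inner ℝ (A (cross0 f g)) (A w) = (1 / (a * b)) * inner ℝ (cross0 f g) w := by
  have hinj := stab_injective hA
  have hsurj : Surjective A := LinearMap.injective_iff_surjective.1 hinj
  obtain ⟨x, hx⟩ := hsurj (cross0 (A f) (A g))
  have h1 : cross0 (A f) (A x) = -(a • A g) := by
    rw [hx, cross0_cross0, hf, hf, hfg, hf1]; simp
  have h2 : cross0 f x = -((a * b) • g) := by
    apply ext_inner_right ℝ
    intro y
    rw [← stab_inner hA, h1, inner_neg_left, inner_smul_left, hg, inner_neg_left, inner_smul_left]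
    simp [mul_assoc]
  have h3 : inner ℝ f x = 0 := by
    have := hf x
    rw [hx, real_inner_comm, inner_cross0_left] at this
    rcases mul_eq_zero.1 this.symm with h | h
    · exact absurd h (left_ne_zero_of_mul hab)
    · exact h
  have h4 : x = (a * b) • cross0 f g := by
    have := cross0_cross0 f x
    rw [h2, h3, hf1, cross0_neg_right, cross0_smul_right] at this
    simpa using this.symm
  have h5 : cross0 (A f) (A g) = (a * b) • A (cross0 f g) := by rw [← hx, h4, map_smul]
  have h6 := stab_inner hA f g w
  rw [h5, inner_smul_left] at h6
  rw [← h6, conj_trivial, ← mul_assoc, one_div, inv_mul_cancel₀ hab, one_mul]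

lemma stab_eig_pos {f : E7} {a : ℝ} (hf : ∀ w, inner ℝ (A f) (A w) = a * inner ℝ f w)
    (hf1 : inner ℝ f f = 1) : 0 < a := by
  have h := hf f
  rw [hf1, mul_one] at h
  rw [← h]
  refine real_inner_self_pos.2 fun h0 => ?_
  have : f = 0 := stab_injective hA (by rw [h0, map_zero])
  simp [this] at hf1

lemma stab_eig_eq {f g k : E7} {a b d : ℝ}
    (hf : ∀ w, inner ℝ (A f) (A w) = a * inner ℝ f w)
    (hg : ∀ w, inner ℝ (A g) (A w) = b * inner ℝ g w)
    (hk : ∀ w, inner ℝ (A k) (A w) = d * inner ℝ k w)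
    (hf1 : inner ℝ f f = 1) (hg1 : inner ℝ g g = 1) (hk1 : inner ℝ k k = 1)
    (hfg : inner ℝ f g = 0) (hfk : inner ℝ f k = 0) (hgk : inner ℝ g k = 0)
    (h : inner ℝ (cross0 f g) k = 0) : a = d := by
  have ha := stab_eig_pos hA hf hf1
  have hb := stab_eig_pos hA hg hg1
  have hd := stab_eig_pos hA hk hk1
  have e1 := stab_eig_cross hA hf hg hfg hf1 (by positivity)
  have n1 : inner ℝ (cross0 f g) (cross0 f g) = 1 := by
    rw [inner_cross0_cross0, hf1, hg1, hfg]; norm_num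
  have e2 := stab_eig_cross hA hg hk hgk hg1 (by positivity)
  have h' : inner ℝ f (cross0 g k) = 0 := by rw [real_inner_comm, ← inner_cross0_cyc, h]
  have e3 := stab_eig_cross hA hf e2 h' hf1 (by positivity)
  have e4 := stab_eig_cross hA e1 hk h n1 (by positivity)
  rw [cross0_cross0_anti hfg hfk hgk] at e3
  have n4 : inner ℝ (cross0 (cross0 f g) k) (cross0 (cross0 f g) k) = 1 := by
    rw [inner_cross0_cross0, n1, hk1, h]; norm_num
  have e5 := e3 (cross0 (cross0 f g) k)
  have e6 := e4 (cross0 (cross0 f g) k)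
  rw [map_neg, inner_neg_left, inner_neg_left, n4, e6, n4] at e5
  have e7 : a ^ 2 = d ^ 2 := by
    field_simp at e5
    linarith
  exact (pow_left_inj₀ ha.le hd.le two_ne_zero).1 e7

lemma stab_isometry (u v : E7) : inner ℝ (A u) (A v) = inner ℝ u v := by
  set S : E7 →ₗ[ℝ] E7 := (LinearMap.adjoint A) ∘ₗ A with hSdef
  have hSi : ∀ x y, inner ℝ (S x) y = inner ℝ (A x) (A y) := fun x y => by
    rw [hSdef, LinearMap.comp_apply, LinearMap.adjoint_inner_left]
  have hS : S.IsSymmetric := fun x y => by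
    rw [hSi, real_inner_comm, ← hSi, real_inner_comm]
  have eig : ∀ x (c : ℝ), S x = c • x → ∀ w, inner ℝ (A x) (A w) = c * inner ℝ x w := by
    intro x c h w
    rw [← hSi, h, inner_smul_left]; rfl
  -- an eigenvector orthogonal to few eigenvectors
  have step : ∀ s : Finset E7, s.card ≤ 3 → (∀ x ∈ s, ∃ c : ℝ, S x = c • x) →
      ∃ f : E7, inner ℝ f f = 1 ∧ (∃ c : ℝ, S f = c • f) ∧ ∀ x ∈ s, inner ℝ x f = 0 := by
    intro s hs hx
    set N := (span ℝ (s : Set E7))ᗮ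
    have hN : N ≠ ⊥ := by
      intro hb
      rw [Submodule.orthogonal_eq_bot_iff] at hb
      have h1 := finrank_span_finset_le_card (R := ℝ) s
      rw [Set.finrank, hb, finrank_top, finrank_euclideanSpace_fin] at h1
      omega
    have hin : ∀ y ∈ N, S y ∈ N := by
      intro y hy
      rw [mem_orthogonal] at hy ⊢
      intro z hz
      induction hz using Submodule.span_induction with
      | mem z hz =>
        obtain ⟨c, hc⟩ := hx z hz
        rw [← hS, hc, inner_smul_left, hy z (subset_span hz), mul_zero]
      | zero => simp
      | add z z' _ _ h h' => rw [inner_add_left, h, h', add_zero]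
      | smul c z _ h => rw [inner_smul_left, h, mul_zero]
    obtain ⟨w, hw, hw0, c, hc⟩ := exists_eigenvector_mem hS hN hin
    refine ⟨(‖w‖)⁻¹ • w, ?_, ⟨c, ?_⟩, ?_⟩
    · have : ‖w‖ ≠ 0 := norm_ne_zero_iff.2 hw0
      rw [inner_smul_left, inner_smul_right, real_inner_self_eq_norm_sq]
      simp; field_simp
    · rw [map_smul, hc, smul_comm]
    · intro x hx
      rw [inner_smul_right, (mem_orthogonal _ _).1 hw x (subset_span hx), mul_zero]
  have main : ∀ f (a : ℝ), inner ℝ f f = 1 → S f = a • f → a = 1 := by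
    classical
    intro f a hf1 hf
    obtain ⟨g, hg1, ⟨b, hg⟩, hfg⟩ := step {f} (by simp) (by simpa using ⟨a, hf⟩)
    have hfg := hfg f (by simp)
    have ef := eig _ _ hf
    have eg := eig _ _ hg
    have ha := stab_eig_pos hA ef hf1
    have hb := stab_eig_pos hA eg hg1
    have ec := stab_eig_cross hA ef eg hfg hf1 (by positivity)
    have n1 : inner ℝ (cross0 f g) (cross0 f g) = 1 := by
      rw [inner_cross0_cross0, hf1, hg1, hfg]; norm_num
    have hc : S (cross0 f g) = (1 / (a * b)) • cross0 f g := by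
      apply ext_inner_right ℝ
      intro y
      rw [hSi, ec, inner_smul_left]; rfl
    obtain ⟨k, hk1, ⟨d, hk⟩, hks⟩ := step {f, g, cross0 f g} Finset.card_le_three (by
      intro x hx
      simp only [Finset.mem_insert, Finset.mem_singleton] at hx
      rcases hx with rfl | rfl | rfl
      exacts [⟨a, hf⟩, ⟨b, hg⟩, ⟨_, hc⟩])
    have hfk := hks f (by simp)
    have hgk := hks g (by simp)
    have hck := hks (cross0 f g) (by simp)
    have ek := eig _ _ hk
    have e1 := stab_eig_eq hA ef eg ek hf1 hg1 hk1 hfg hfk hgk hck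
    have hgf : inner ℝ g f = 0 := by rw [real_inner_comm]; exact hfg
    have e2 := stab_eig_eq hA eg ef ek hg1 hf1 hk1 hgf hgk hfk
      (by rw [cross0_swap, inner_neg_left, hck, neg_zero])
    have hcf : cross0 (cross0 f g) f = g := by
      rw [cross0_swap, cross0_cross0, hfg, hf1]; simp
    have e3 := stab_eig_eq hA ec ef ek n1 hf1 hk1 (inner_cross0_left _ _) hck hfk
      (by rw [hcf, hgk])
    have hd := stab_eig_pos hA ek hk1
    subst e1
    rw [← e2] at ec
    rw [e2] at e3
    have h3 : a ^ 3 = 1 := by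
      field_simp at e3
      nlinarith
    exact (pow_eq_one_iff_of_nonneg ha.le three_ne_zero).1 h3
  have hS1 : S = LinearMap.id := by
    have hn : finrank ℝ E7 = 7 := finrank_euclideanSpace_fin
    refine (hS.eigenvectorBasis hn).toBasis.ext fun i => ?_
    have h1 : inner ℝ (hS.eigenvectorBasis hn i) (hS.eigenvectorBasis hn i) = 1 := by
      rw [real_inner_self_eq_norm_sq, (hS.eigenvectorBasis hn).orthonormal.1 i]; norm_num
    have h2 := hS.apply_eigenvectorBasis hn i
    have h3 := main _ _ h1 h2
    rw [OrthonormalBasis.coe_toBasis, h2, h3]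
    simp
  rw [← hSi, hS1]; rfl

lemma stab_cross (u v : E7) : cross0 (A u) (A v) = A (cross0 u v) := by
  have hsurj : Surjective A := LinearMap.injective_iff_surjective.1 (stab_injective hA)
  apply ext_inner_right ℝ
  intro y
  obtain ⟨z, rfl⟩ := hsurj y
  rw [stab_inner hA, stab_isometry hA]

lemma stab_star (u v w z : E7) :
    starPhi0 ![A u, A v, A w, A z] = starPhi0 ![u, v, w, z] := by
  simp only [starPhi0_apply, stab_cross hA, stab_isometry hA]

end Stabilizer

/-! ### Associative subspaces -/

lemma cross0_ne_zero {u v : E7} (h : LinearIndependent ℝ ![u, v]) : cross0 u v ≠ 0 := by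
  intro h0
  have h1 := cross0_cross0 u v
  rw [h0, cross0_zero_right] at h1
  rw [pair_iff] at h
  have h2 := h (inner ℝ u v) (-(inner ℝ u u)) (by rw [neg_smul, ← sub_eq_add_neg, ← h1])
  have h3 : u = 0 := inner_self_eq_zero.1 (neg_eq_zero.1 h2.2)
  have := h 1 0 (by simp [h3])
  simp at this

/-- The span of `u`, `v` and `u × v`. -/
def assocSpan (u v : E7) : Submodule ℝ E7 := span ℝ {u, v, cross0 u v}

lemma left_mem_assocSpan (u v : E7) : u ∈ assocSpan u v := subset_span (by simp)
lemma right_mem_assocSpan (u v : E7) : v ∈ assocSpan u v := subset_span (by simp)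
lemma cross_mem_assocSpan (u v : E7) : cross0 u v ∈ assocSpan u v := subset_span (by simp)

lemma assocSpan_le {u v : E7} {S : Submodule ℝ E7} (hu : u ∈ S) (hv : v ∈ S)
    (h : cross0 u v ∈ S) : assocSpan u v ≤ S := by
  rw [assocSpan, Submodule.span_le]
  rintro x (rfl | rfl | rfl) <;> assumption

lemma starPhi0_perp {u v w z : E7} (hw : w ∈ (assocSpan u v)ᗮ) :
    starPhi0 ![u, v, w, z] = inner ℝ (cross0 w (cross0 u v)) z := by
  rw [mem_orthogonal] at hw
  have h1 := cross0_cross0_add u w v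
  have h2 : inner ℝ u w = 0 := hw _ (left_mem_assocSpan u v)
  have h3 : inner ℝ w v = 0 := by
    rw [real_inner_comm]; exact hw _ (right_mem_assocSpan u v)
  rw [h2, h3] at h1
  simp only [zero_smul, mul_zero, add_zero, sub_zero] at h1
  have h4 : cross0 u (cross0 v w) = cross0 w (cross0 u v) - (inner ℝ u v) • w := by
    rw [← h1, cross0_swap w v, cross0_neg_right]; abel
  rw [starPhi0_apply, h4, h2, inner_sub_left, inner_smul_left]
  simp

lemma starPhi0_cross (u v z : E7) : starPhi0 ![u, v, cross0 u v, z] = 0 := by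
  have h : cross0 v (cross0 u v) = (inner ℝ v v) • u - (inner ℝ u v) • v := by
    rw [cross0_swap v u, cross0_neg_right, cross0_cross0, real_inner_comm]; abel
  rw [starPhi0_apply, h, cross0_sub_right, cross0_smul_right, cross0_smul_right, cross0_self,
    real_inner_comm (cross0 u v) u, inner_cross0_left, smul_zero, zero_sub, inner_neg_left,
    inner_smul_left]
  simp

lemma starPhi0_left (u v z : E7) : starPhi0 ![u, v, u, z] = 0 :=
  starPhi0.map_eq_zero_of_eq _ (i := 0) (j := 2) rfl (by decide)

lemma starPhi0_right (u v z : E7) : starPhi0 ![u, v, v, z] = 0 :=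
  starPhi0.map_eq_zero_of_eq _ (i := 1) (j := 2) rfl (by decide)

/-- `(w, z) ↦ ∗φ₀(u, v, w, z)` as a bilinear map. -/
def starBilin (u v : E7) : E7 →ₗ[ℝ] E7 →ₗ[ℝ] ℝ :=
  LinearMap.mk₂ ℝ (fun w z => inner ℝ (cross0 u (cross0 v w)) z + inner ℝ u v * inner ℝ w z
      - inner ℝ u w * inner ℝ v z)
    (fun w w' z => by simp only [cross0_add_right, inner_add_left, inner_add_right]; ring)
    (fun c w z => by
      simp only [cross0_smul_right, inner_smul_left, inner_smul_right, conj_trivial, smul_eq_mul]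
      ring)
    (fun w z z' => by simp only [inner_add_right]; ring)
    (fun c w z => by simp only [inner_smul_right, smul_eq_mul]; ring)

lemma starBilin_apply (u v w z : E7) : starBilin u v w z = starPhi0 ![u, v, w, z] := by
  rw [starPhi0_apply]; rfl

lemma assocSpan_le_ker (u v : E7) : assocSpan u v ≤ ker (starBilin u v) := by
  apply assocSpan_le <;> refine mem_ker.2 (LinearMap.ext fun z => ?_) <;>
    rw [starBilin_apply]
  exacts [starPhi0_left u v z, starPhi0_right u v z, starPhi0_cross u v z]

lemma starPhi0_eq_zero_iff {u v : E7} (h : LinearIndependent ℝ ![u, v]) (w : E7) :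
    (∀ z, starPhi0 ![u, v, w, z] = 0) ↔ w ∈ assocSpan u v := by
  constructor
  · intro hw
    obtain ⟨w₁, hw₁, w₂, hw₂, rfl⟩ := (assocSpan u v).exists_add_mem_mem_orthogonal w
    have h1 : ∀ z, inner ℝ (cross0 w₂ (cross0 u v)) z = 0 := fun z => by
      have h0 := hw z
      rw [← starBilin_apply, map_add, mem_ker.1 (assocSpan_le_ker u v hw₁), zero_add,
        starBilin_apply, starPhi0_perp hw₂] at h0
      exact h0
    have h2 : cross0 w₂ (cross0 u v) = 0 := inner_self_eq_zero.1 (h1 _)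
    have h3 := cross0_cross0 (cross0 u v) w₂
    rw [cross0_swap w₂ (cross0 u v), h2, (mem_orthogonal _ _).1 hw₂ _ (cross_mem_assocSpan u v)] at h3
    simp only [cross0_zero_right, zero_smul, zero_sub, neg_zero] at h3
    rcases smul_eq_zero.1 (neg_eq_zero.1 h3.symm) with h4 | h4
    · exact absurd (inner_self_eq_zero.1 h4) (cross0_ne_zero h)
    · rw [h4, add_zero]; exact hw₁
  · intro hw z
    rw [← starBilin_apply, mem_ker.1 (assocSpan_le_ker u v hw), LinearMap.zero_apply]

lemma exists_orthonormal_assocSpan {u v : E7} (h : LinearIndependent ℝ ![u, v]) :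
    ∃ f : Fin 3 → E7, (∀ i j, inner ℝ (f i) (f j) = if i = j then (1 : ℝ) else 0) ∧
      phi0 f = 1 ∧ span ℝ (range f) = assocSpan u v := by
  have hu : u ≠ 0 := by simpa using h.ne_zero 0
  have hu2 : inner ℝ u u ≠ (0 : ℝ) := fun h0 => hu (inner_self_eq_zero.1 h0)
  set v' : E7 := v - (inner ℝ u v / inner ℝ u u : ℝ) • u with hv'
  have huv' : inner ℝ u v' = 0 := by
    rw [hv', inner_sub_right, inner_smul_right]; field_simp; ring
  have hv'0 : v' ≠ 0 := by
    intro h0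
    rw [pair_iff] at h
    have := h (-(inner ℝ u v / inner ℝ u u : ℝ)) 1 (by rw [← h0, hv']; module)
    simp at this
  have hnu : ‖u‖ ≠ 0 := norm_ne_zero_iff.2 hu
  have hnv : ‖v'‖ ≠ 0 := norm_ne_zero_iff.2 hv'0
  set a : E7 := ‖u‖⁻¹ • u with ha
  set b : E7 := ‖v'‖⁻¹ • v' with hb
  have haa : inner ℝ a a = 1 := by
    rw [ha, inner_smul_left, inner_smul_right, real_inner_self_eq_norm_sq]
    simp; field_simp
  have hbb : inner ℝ b b = 1 := by
    rw [hb, inner_smul_left, inner_smul_right, real_inner_self_eq_norm_sq]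
    simp; field_simp
  have hab : inner ℝ a b = 0 := by
    rw [ha, hb, inner_smul_left, inner_smul_right, huv']; simp
  have hcc : inner ℝ (cross0 a b) (cross0 a b) = 1 := by
    rw [inner_cross0_cross0, haa, hbb, hab]; norm_num
  have hcab : cross0 a b = (‖u‖⁻¹ * ‖v'‖⁻¹) • cross0 u v := by
    rw [ha, hb, cross0_smul_left, cross0_smul_right, hv', cross0_sub_right, cross0_smul_right,
      cross0_self, smul_zero, sub_zero, smul_smul]
  refine ⟨![a, b, cross0 a b], ?_, ?_, ?_⟩
  · intro i j
    fin_cases i <;> fin_cases j <;>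
      simp [-inner_self_eq_norm_sq_to_K, haa, hbb, hab, hcc, real_inner_comm a b,
        inner_cross0_left, inner_cross0_right, real_inner_comm (cross0 a b) a,
        real_inner_comm (cross0 a b) b]
  · rw [phi0_apply, hcc]
  · have hr : range ![a, b, cross0 a b] = {a, b, cross0 a b} := by
      ext x
      simp [Matrix.range_cons, Matrix.range_empty]
      tauto
    rw [hr]
    apply le_antisymm
    · rw [Submodule.span_le]
      have m1 : u ∈ assocSpan u v := left_mem_assocSpan u v
      rintro x (rfl | rfl | rfl)
      · exact smul_mem _ _ m1
      · exact smul_mem _ _ (Submodule.sub_mem _ (right_mem_assocSpan u v)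
          (smul_mem _ _ m1))
      · rw [hcab]
        exact smul_mem _ _ (cross_mem_assocSpan u v)
    · have ma : a ∈ span ℝ {a, b, cross0 a b} := subset_span (by simp)
      have mb : b ∈ span ℝ {a, b, cross0 a b} := subset_span (by simp)
      have mc : cross0 a b ∈ span ℝ {a, b, cross0 a b} := subset_span (by simp)
      have eu : u = ‖u‖ • a := by rw [ha, smul_smul, mul_inv_cancel₀ hnu, one_smul]
      have ev' : v' = ‖v'‖ • b := by rw [hb, smul_smul, mul_inv_cancel₀ hnv, one_smul]
      have mu : u ∈ span ℝ {a, b, cross0 a b} := by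
        rw [eu]; exact smul_mem _ _ ma
      have mv' : v' ∈ span ℝ {a, b, cross0 a b} := by
        rw [ev']; exact smul_mem _ _ mb
      apply assocSpan_le mu
      · have : v = v' + (inner ℝ u v / inner ℝ u u : ℝ) • u := by rw [hv']; abel
        rw [this]
        exact Submodule.add_mem _ mv' (smul_mem _ _ mu)
      · have : cross0 u v = (‖u‖ * ‖v'‖) • cross0 a b := by
          rw [hcab, smul_smul]
          have : ‖u‖ * ‖v'‖ * (‖u‖⁻¹ * ‖v'‖⁻¹) = 1 := by field_simp
          rw [this, one_smul]
        rw [this]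
        exact smul_mem _ _ mc

lemma finrank_assocSpan {u v : E7} (h : LinearIndependent ℝ ![u, v]) :
    finrank ℝ (assocSpan u v) = 3 := by
  obtain ⟨f, hf, -, hs⟩ := exists_orthonormal_assocSpan h
  rw [← hs]
  have : Orthonormal ℝ f := orthonormal_iff_ite.2 hf
  simpa using finrank_span_eq_card this.linearIndependent

/-- A subspace closed under the cross product that strictly contains an associative `3`-plane is
everything. -/
lemma eq_top_of_cross_closed {S : Submodule ℝ E7}
    (hS : ∀ x ∈ S, ∀ y ∈ S, cross0 x y ∈ S) {u v w : E7} (hu : u ∈ S) (hv : v ∈ S) (hw : w ∈ S)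
    (h : LinearIndependent ℝ ![u, v]) (hwn : w ∉ assocSpan u v) : S = ⊤ := by
  have hle : assocSpan u v ≤ S := assocSpan_le hu hv (hS u hu v hv)
  obtain ⟨f, hf, hf1, hs⟩ := exists_orthonormal_assocSpan h
  have hfS : ∀ i, f i ∈ S := fun i => hle (hs ▸ subset_span (mem_range_self i))
  obtain ⟨w₁, hw₁, w₂, hw₂, rfl⟩ := (assocSpan u v).exists_add_mem_mem_orthogonal w
  have hw₂0 : w₂ ≠ 0 := by rintro rfl; exact hwn (by simpa using hw₁)
  have hw₂S : w₂ ∈ S := by simpa using S.sub_mem hw (hle hw₁)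
  set a := f 0
  set b := f 1
  have haS : a ∈ S := hfS 0
  have hbS : b ∈ S := hfS 1
  have hab : inner ℝ a b = 0 := by simpa using hf 0 1
  have haa : inner ℝ a a = 1 := by simpa using hf 0 0
  have hbb : inner ℝ b b = 1 := by simpa using hf 1 1
  have hcS : cross0 a b ∈ S := hS a haS b hbS
  have hperp : ∀ x ∈ assocSpan u v, inner ℝ x w₂ = 0 := fun x hx => (mem_orthogonal _ _).1 hw₂ x hx
  have haP : a ∈ assocSpan u v := hs ▸ subset_span (mem_range_self 0)
  have hbP : b ∈ assocSpan u v := hs ▸ subset_span (mem_range_self 1)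
  have hcc : inner ℝ (cross0 a b) (cross0 a b) = 1 := by
    rw [inner_cross0_cross0, haa, hbb, hab]; norm_num
  have hc2 : cross0 a b = f 2 := by
    have h1 : phi0 f = phi0 ![f 0, f 1, f 2] := by
      congr 1; ext i; fin_cases i <;> rfl
    rw [h1, phi0_apply] at hf1
    have h2 : inner ℝ (f 2) (f 2) = 1 := by simpa using hf 2 2
    rw [← sub_eq_zero, ← inner_self_eq_zero (𝕜 := ℝ), inner_sub_left, inner_sub_right,
      inner_sub_right, hcc, hf1, real_inner_comm, hf1, h2]
    norm_num
  have hcP : cross0 a b ∈ assocSpan u v := hc2 ▸ hs ▸ subset_span (mem_range_self 2)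
  have haw := hperp a haP
  have hbw := hperp b hbP
  have hcw := hperp _ hcP
  rw [← Submodule.orthogonal_eq_bot_iff, Submodule.eq_bot_iff]
  intro z hz
  rw [mem_orthogonal] at hz
  have hmod : ∀ x ∈ S, ∀ y ∈ S, inner ℝ x (cross0 y z) = 0 := fun x hx y hy => by
    rw [real_inner_comm, ← inner_cross0_cyc, hz _ (hS x hx y hy)]
  have e1 : cross0 a (cross0 b (cross0 w₂ z)) = -cross0 (cross0 (cross0 a b) w₂) z := by
    rw [cross0_cross0_anti hbw (hz b hbS) (hz w₂ hw₂S), cross0_neg_right,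
      cross0_cross0_anti (by rw [real_inner_comm, ← inner_cross0_cyc, hcw]) (hz a haS)
        (hz _ (hS b hbS w₂ hw₂S)), neg_neg, cross0_cross0_anti hab haw hbw]
    rw [cross0_swap, cross0_neg_right, cross0_swap z]
  have e2 : cross0 a (cross0 b (cross0 w₂ z)) = cross0 (cross0 (cross0 a b) w₂) z := by
    rw [cross0_cross0_anti hab (hmod a haS w₂ hw₂S) (hmod b hbS w₂ hw₂S),
      cross0_cross0_anti hcw (hz _ hcS) (hz w₂ hw₂S), neg_neg]
  have e3 : cross0 (cross0 (cross0 a b) w₂) z = 0 := by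
    have : (2 : ℝ) • cross0 (cross0 (cross0 a b) w₂) z = 0 := by
      rw [two_smul]; nth_rewrite 1 [← e2]; rw [e1]; simp
    exact (smul_eq_zero.1 this).resolve_left two_ne_zero
  have e4 := inner_cross0_cross0 (cross0 (cross0 a b) w₂) z z
  rw [e3, hz _ (hS _ hcS _ hw₂S), inner_cross0_cross0, hcc, hcw] at e4
  simp only [inner_zero_left, mul_zero, sub_zero, one_mul] at e4
  rcases mul_eq_zero.1 e4.symm with h5 | h5
  · exact absurd (inner_self_eq_zero.1 h5) hw₂0
  · exact inner_self_eq_zero.1 h5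

/-! ### Infinitesimal symmetries of `φ₀` -/

structure IsSkewDer (A : E7 →ₗ[ℝ] E7) : Prop where
  skew : ∀ u v, inner ℝ (A u) v = -inner ℝ u (A v)
  der : ∀ u v, A (cross0 u v) = cross0 (A u) v + cross0 u (A v)

namespace IsSkewDer

variable {A B C : E7 →ₗ[ℝ] E7}

lemma sub_smul (hA : IsSkewDer A) (hB : IsSkewDer B) (t : ℝ) : IsSkewDer (B - t • A) where
  skew u v := by
    simp only [LinearMap.sub_apply, LinearMap.smul_apply, inner_sub_left, inner_sub_right,
      inner_smul_left, inner_smul_right, hA.skew u v, hB.skew u v, conj_trivial]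
    ring
  der u v := by
    have h : ∀ x y z : E7, cross0 (x - y) z = cross0 x z - cross0 y z := fun x y z => by
      rw [cross0_swap, cross0_sub_right, cross0_swap x, cross0_swap y]; simp [sub_eq_add_neg, add_comm]
    simp only [LinearMap.sub_apply, LinearMap.smul_apply, hA.der, hB.der, h, cross0_sub_right,
      cross0_smul_left, cross0_smul_right, smul_add]
    abel

lemma ker_cross (hA : IsSkewDer A) : ∀ x ∈ ker A, ∀ y ∈ ker A, cross0 x y ∈ ker A := by
  intro x hx y hy
  rw [mem_ker] at *
  rw [hA.der, hx, hy, cross0_zero_right, cross0_swap, cross0_zero_right]; simp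

lemma eq_zero (hA : IsSkewDer A) {u v w : E7} (hu : A u = 0) (hv : A v = 0) (hw : A w = 0)
    (h : LinearIndependent ℝ ![u, v]) (hwn : w ∉ assocSpan u v) : A = 0 :=
  LinearMap.ker_eq_top.1 (eq_top_of_cross_closed hA.ker_cross hu hv hw h hwn)

lemma assocSpan_le_ker (hA : IsSkewDer A) {u v : E7} (hu : A u = 0) (hv : A v = 0) :
    assocSpan u v ≤ ker A :=
  assocSpan_le hu hv (hA.ker_cross u hu v hv)

lemma ker_eq (hA : IsSkewDer A) (h0 : A ≠ 0) {u v : E7} (hu : A u = 0) (hv : A v = 0)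
    (h : LinearIndependent ℝ ![u, v]) : ker A = assocSpan u v := by
  refine le_antisymm (fun w hw => ?_) (hA.assocSpan_le_ker hu hv)
  by_contra hwn
  exact h0 (hA.eq_zero hu hv hw h hwn)

lemma apply_eq_zero (hA : IsSkewDer A) {w : E7} (h : A (A w) = 0) : A w = 0 := by
  have h1 := hA.skew w (A w)
  rw [h, inner_zero_right, neg_zero] at h1
  exact inner_self_eq_zero.1 h1

lemma linearIndependent_apply (hA : IsSkewDer A) {w : E7} (h : A w ≠ 0) :
    LinearIndependent ℝ ![w, A w] := by
  rw [pair_iff]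
  intro s t hst
  have hw : inner ℝ (A w) w = 0 := by
    have := hA.skew w w
    rw [real_inner_comm w (A w)] at this
    linarith [real_inner_comm (A w) w]
  have h1 : inner ℝ (A w) (s • w + t • A w) = 0 := by rw [hst, inner_zero_right]
  rw [inner_add_right, inner_smul_right, inner_smul_right, hw, mul_zero, zero_add] at h1
  have ht : t = 0 := (mul_eq_zero.1 h1).resolve_right fun h2 => h (inner_self_eq_zero.1 h2)
  have hw0 : w ≠ 0 := by rintro rfl; simp at h
  rw [ht, zero_smul, add_zero] at hst
  exact ⟨(smul_eq_zero.1 hst).resolve_right hw0, ht⟩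

/-- Two commuting skew maps have a common eigenvector in the sense of pencils. -/
lemma exists_pencil (hA : IsSkewDer A) (hB : IsSkewDer B) (hAB : ∀ x, A (B x) = B (A x))
    (N : Submodule ℝ E7) (hNA : ∀ x ∈ N, A x ∈ N) (hNB : ∀ x ∈ N, B x ∈ N)
    (h0 : ∃ x ∈ N, A x ≠ 0) : ∃ w ∈ N, A w ≠ 0 ∧ ∃ t : ℝ, B w = t • A w := by
  obtain ⟨x, hx, hx0⟩ := h0
  have hsA : (A ∘ₗ A).IsSymmetric := fun u v => by
    simp [hA.skew]
  have hsB : (A ∘ₗ B).IsSymmetric := fun u v => by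
    simp [hA.skew, hB.skew, hAB]
  obtain ⟨w, hw, hw0, c, hc⟩ := exists_eigenvector_mem hsA (N := N.map A)
    (Submodule.ne_bot_iff _ |>.2 ⟨A x, Submodule.mem_map_of_mem hx, hx0⟩)
    (by
      rintro _ ⟨y, hy, rfl⟩
      exact Submodule.mem_map_of_mem (hNA _ (hNA _ hy)))
  obtain ⟨y, hy, rfl⟩ := hw
  have hc0 : c ≠ 0 := by
    rintro rfl
    rw [zero_smul, LinearMap.comp_apply] at hc
    exact hw0 (hA.apply_eq_zero (hA.apply_eq_zero hc))
  set N' := N ⊓ ker (A ∘ₗ A - c • LinearMap.id) with hN'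
  have hmem : ∀ z, z ∈ N' ↔ z ∈ N ∧ A (A z) = c • z := fun z => by
    simp [hN', Submodule.mem_inf, sub_eq_zero]
  obtain ⟨z, hz, hz0, d, hd⟩ := exists_eigenvector_mem hsB (N := N')
    (Submodule.ne_bot_iff _ |>.2 ⟨A y, (hmem _).2 ⟨hNA _ hy, hc⟩, hw0⟩)
    (by
      intro z hz
      rw [hmem] at hz ⊢
      refine ⟨hNA _ (hNB _ hz.1), ?_⟩
      simp only [LinearMap.comp_apply]
      rw [← map_smul, ← map_smul, ← hz.2, hAB, hAB])
  rw [hmem] at hz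
  have hAz : A z ≠ 0 := by
    intro h
    have h2 := hz.2
    rw [h, map_zero] at h2
    exact hz0 ((smul_eq_zero.1 h2.symm).resolve_left hc0)
  refine ⟨z, hz.1, hAz, d / c, ?_⟩
  have h1 : A (B z - (d / c) • A z) = 0 := by
    rw [map_sub, map_smul, hz.2, smul_smul, div_mul_cancel₀ _ hc0, ← hd]; simp
  have h2 : A (A (B z - (d / c) • A z)) = c • (B z - (d / c) • A z) := by
    rw [map_sub, map_sub, hAB, hAB, hz.2, map_smul, map_smul, hz.2, map_smul, map_smul, smul_sub,
      smul_comm c]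
  rw [h1, map_zero] at h2
  exact sub_eq_zero.1 ((smul_eq_zero.1 h2.symm).resolve_left hc0)

/-- Commuting derivations with a common kernel of dimension at least two are dependent. -/
lemma dependent_of_ker (hA : IsSkewDer A) (hB : IsSkewDer B) (hAB : ∀ x, A (B x) = B (A x))
    {u v : E7} (huA : A u = 0) (hvA : A v = 0) (huB : B u = 0) (hvB : B v = 0)
    (h : LinearIndependent ℝ ![u, v]) : A = 0 ∨ ∃ t : ℝ, B = t • A := by
  by_cases h0 : A = 0
  · exact Or.inl h0
  right
  obtain ⟨x, hx⟩ : ∃ x, A x ≠ 0 := by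
    by_contra! hx; exact h0 (LinearMap.ext hx)
  obtain ⟨w, -, hw, t, ht⟩ := hA.exists_pencil hB hAB ⊤ (by simp) (by simp) ⟨x, by simp, hx⟩
  refine ⟨t, ?_⟩
  refine sub_eq_zero.1 ((hA.sub_smul hB t).eq_zero (u := u) (v := v) (w := w) ?_ ?_ ?_ h ?_)
  · simp [huA, huB]
  · simp [hvA, hvB]
  · simp [ht]
  · exact fun hm => hw (hA.assocSpan_le_ker huA hvA hm)

lemma dependent_three (hA : IsSkewDer A) (hB : IsSkewDer B) (hC : IsSkewDer C)
    (hAB : ∀ x, A (B x) = B (A x)) (hAC : ∀ x, A (C x) = C (A x))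
    (hBC : ∀ x, B (C x) = C (B x)) :
    ∃ a b c : ℝ, (a, b, c) ≠ 0 ∧ a • A + b • B + c • C = 0 := by
  by_cases h0 : A = 0
  · exact ⟨1, 0, 0, by simp, by simp [h0]⟩
  obtain ⟨x, hx⟩ : ∃ x, A x ≠ 0 := by
    by_contra! hx; exact h0 (LinearMap.ext hx)
  obtain ⟨w, -, hw, t, ht⟩ := hA.exists_pencil hB hAB ⊤ (by simp) (by simp) ⟨x, by simp, hx⟩
  set B' := B - t • A with hB'
  have hdB' : IsSkewDer B' := hA.sub_smul hB t
  have hAB' : ∀ x, A (B' x) = B' (A x) := fun x => by simp [hB', hAB]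
  have hCB' : ∀ x, C (B' x) = B' (C x) := fun x => by simp [hB', hBC, hAC]
  obtain ⟨w₂, hw₂N, hw₂, s, hs⟩ := hA.exists_pencil hC hAC (ker B')
    (fun x hx => by rw [mem_ker] at *; rw [← hAB', hx, map_zero])
    (fun x hx => by rw [mem_ker] at *; rw [← hCB', hx, map_zero])
    ⟨w, by simp [hB', ht], hw⟩
  have hdC' := hA.sub_smul hC s
  rw [mem_ker] at hw₂N
  have e : (C - s • A) w₂ = 0 := by simp [hs]
  rcases hdB'.dependent_of_ker hdC' (u := w₂) (v := A w₂)
    (fun x => by simp [← hAB', ← hCB']) hw₂N (by rw [← hAB', hw₂N, map_zero]) e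
    (by
      have : (C - s • A) (A w₂) = A ((C - s • A) w₂) := by simp [hAC]
      rw [this, e, map_zero]) (hA.linearIndependent_apply hw₂) with h | ⟨r, hr⟩
  · refine ⟨-t, 1, 0, by simp, ?_⟩
    rw [← h, hB']; module
  · refine ⟨-s + r * t, -r, 1, by simp, ?_⟩
    have : C - s • A - r • B' = 0 := sub_eq_zero.2 hr
    rw [← this, hB']; module

end IsSkewDer

/-! ### The exponential map of `T² × SU(2)` -/

abbrev groupT2SU2 : Group T2SU2 := Prod.instGroup

abbrev monoidT2SU2 : Monoid T2SU2 := Prod.instMonoid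

abbrev semigroupT2SU2 : Semigroup T2SU2 := Prod.instSemigroup

attribute [local instance] groupT2SU2 monoidT2SU2 semigroupT2SU2

/-- The Lie algebra of `T² × SU(2)`. -/
abbrev LieT : Type := (Fin 2 → ℝ) × R3

/-- The exponential map, normalised so that the coordinate vectors give the generating fields. -/
def gexp (v : LieT) : T2SU2 :=
  ((Circle.exp (-v.1 0), Circle.exp (-v.1 1)), su2Exp fun i => -(v.2 i / 2))

lemma coe_su2Exp (a : R3) : (su2Exp a : ℍ) = NormedSpace.exp (imQ a) := rfl

lemma imQ_add (a b : R3) :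
    imQ (a + b) = imQ a + imQ b :=
  Quaternion.ext _ _ (add_zero (0 : ℝ)).symm rfl rfl rfl

lemma imQ_smul (c : ℝ) (a : R3) :
    imQ (c • a) = c • imQ a :=
  Quaternion.ext _ _ (mul_zero c).symm rfl rfl rfl

lemma imQ_zero : imQ 0 = 0 := rfl

lemma contDiff_imQ : ContDiff ℝ ∞ imQ := by
  let L : R3 →ₗ[ℝ] ℍ := { toFun := imQ, map_add' := imQ_add, map_smul' := imQ_smul }
  exact (toContinuousLinearMap L).contDiff

lemma contMDiff_su2Exp : ContMDiff 𝓘(ℝ, R3) (𝓡 3) ∞ su2Exp := by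
  have h : ContMDiff 𝓘(ℝ, R3) 𝓘(ℝ, ℍ) ∞
      (fun a : R3 => NormedSpace.exp (imQ a)) := by
    rw [contMDiff_iff_contDiff]
    have h1 : ContDiff ℝ ∞ (NormedSpace.exp : ℍ → ℍ) :=
      contDiff_iff_contDiffAt.2 fun x => (NormedSpace.exp_analytic (𝕂 := ℝ) x).contDiffAt
    exact h1.comp contDiff_imQ
  exact h.codRestrict_sphere fun a => (su2Exp a).2

lemma contMDiff_gexp : ContMDiff 𝓘(ℝ, LieT) modelT2SU2 ∞ gexp := by
  have h1 : ∀ i : Fin 2, ContMDiff 𝓘(ℝ, LieT) (𝓡 1) ∞ (fun v : LieT => Circle.exp (-v.1 i)) :=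
    fun i => contMDiff_circleExp.comp
      (contMDiff_iff_contDiff.2 (by fun_prop : ContDiff ℝ ∞ fun v : LieT => -v.1 i))
  have h2 : ContMDiff 𝓘(ℝ, LieT) (𝓡 3) ∞ (fun v : LieT => su2Exp fun i => -(v.2 i / 2)) :=
    contMDiff_su2Exp.comp
      (contMDiff_iff_contDiff.2 (by fun_prop : ContDiff ℝ ∞ fun v : LieT => fun i => -(v.2 i / 2)))
  exact ((h1 0).prodMk (h1 1)).prodMk h2

lemma su2Exp_zero : su2Exp 0 = 1 := by
  apply Subtype.ext
  rw [coe_su2Exp, imQ_zero, NormedSpace.exp_zero]; rfl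

lemma su2Exp_add_of_commute {a b : R3}
    (h : Commute (imQ a) (imQ b)) : su2Exp (a + b) = su2Exp a * su2Exp b := by
  apply Subtype.ext
  rw [Metric.unitSphere.coe_mul, coe_su2Exp, coe_su2Exp, coe_su2Exp, imQ_add]
  let _ : NormedAlgebra ℚ ℍ := NormedAlgebra.restrictScalars ℚ ℝ ℍ
  exact NormedSpace.exp_add_of_commute h

lemma gexp_add_of_commute {v w : LieT}
    (h : Commute (imQ v.2) (imQ w.2)) : gexp (v + w) = gexp v * gexp w := by
  have e : ∀ a : R3, (fun i => -(a i / 2)) = (-(1 / 2) : ℝ) • a := fun a => by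
    ext i; simp; ring
  refine Prod.ext (Prod.ext ?_ ?_) ?_
  · change Circle.exp (-(v.1 0 + w.1 0)) = Circle.exp _ * Circle.exp _
    rw [← Circle.exp_add]; congr 1; ring
  · change Circle.exp (-(v.1 1 + w.1 1)) = Circle.exp _ * Circle.exp _
    rw [← Circle.exp_add]; congr 1; ring
  · change su2Exp _ = su2Exp _ * su2Exp _
    simp only [e]
    rw [← su2Exp_add_of_commute]
    · congr 1
      simp [smul_add]
    · rw [imQ_smul, imQ_smul]
      exact (h.smul_left _).smul_right _

lemma gexp_zero : gexp 0 = 1 := by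
  have h := gexp_add_of_commute (v := 0) (w := 0) (Commute.refl _)
  rw [add_zero] at h
  exact (mul_eq_left.1 h.symm)

lemma gexp_add_smul (s t : ℝ) (v : LieT) : gexp ((s + t) • v) = gexp (s • v) * gexp (t • v) := by
  rw [add_smul, gexp_add_of_commute]
  simp only [Prod.smul_snd, imQ_smul]
  exact ((Commute.refl _).smul_left _).smul_right _

lemma gexp_neg (v : LieT) : gexp (-v) = (gexp v)⁻¹ := by
  rw [eq_inv_iff_mul_eq_one, ← gexp_add_of_commute, neg_add_cancel, gexp_zero]
  have : imQ (-v).2 = (-1 : ℝ) • imQ v.2 := by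
    rw [← imQ_smul]; congr 1; simp
  rw [this]
  exact (Commute.refl _).smul_left _

def imPart (q : ℍ) : R3 := ![q.imI, q.imJ, q.imK]

lemma imPart_imQ (a : R3) : imPart (imQ a) = a := by
  ext i; fin_cases i <;> rfl

lemma imQ_imPart {q : ℍ} (h : q.re = 0) : imQ (imPart q) = q := by
  exact Quaternion.ext _ _ h.symm rfl rfl rfl

lemma imQ_injective : Injective imQ := fun a b h => by
  rw [← imPart_imQ a, h, imPart_imQ]

lemma SU2.star_mul_self (s : SU2) : star (s : ℍ) * s = 1 := by
  rw [Quaternion.star_mul_self, normSq_eq_norm_mul_self, norm_eq_of_mem_sphere]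
  simp

lemma SU2.self_mul_star (s : SU2) : (s : ℍ) * star (s : ℍ) = 1 := by
  rw [Quaternion.self_mul_star, normSq_eq_norm_mul_self, norm_eq_of_mem_sphere]
  simp

lemma SU2.coe_inv (s : SU2) : ((s⁻¹ : SU2) : ℍ) = star (s : ℍ) := by
  have h : ((s⁻¹ : SU2) : ℍ) * s = 1 := by
    rw [← Metric.unitSphere.coe_mul, inv_mul_cancel]; rfl
  calc ((s⁻¹ : SU2) : ℍ) = ((s⁻¹ : SU2) : ℍ) * (s * star (s : ℍ)) := by
        rw [SU2.self_mul_star, mul_one]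
    _ = star (s : ℍ) := by rw [← mul_assoc, h, one_mul]

/-- The rotation of `ℝ³` given by a unit quaternion. -/
def rot (s : SU2) (a : R3) : R3 := imPart ((s : ℍ) * imQ a * star (s : ℍ))

lemma imQ_rot (s : SU2) (a : R3) :
    imQ (rot s a) = (s : ℍ) * imQ a * star (s : ℍ) := by
  apply imQ_imPart
  have h0 : (imQ a).re = 0 := rfl
  simp only [re_mul, imI_mul, imJ_mul, imK_mul,
    Quaternion.re_star, Quaternion.imI_star, Quaternion.imJ_star, Quaternion.imK_star, h0]
  ring

lemma rot_one (a : R3) : rot 1 a = a := by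
  apply imQ_injective
  rw [imQ_rot]; simp

lemma rot_mul (s s' : SU2) (a : R3) : rot (s * s') a = rot s (rot s' a) := by
  apply imQ_injective
  simp only [imQ_rot, Metric.unitSphere.coe_mul, star_mul, mul_assoc]

lemma rot_inv_rot (s : SU2) (a : R3) : rot s⁻¹ (rot s a) = a := by
  rw [← rot_mul, inv_mul_cancel, rot_one]

lemma rot_rot_inv (s : SU2) (a : R3) : rot s (rot s⁻¹ a) = a := by
  rw [← rot_mul, mul_inv_cancel, rot_one]

def rotL (s : SU2) : R3 →L[ℝ] R3 := toContinuousLinearMap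
    { toFun := rot s
      map_add' := fun a b => by
        apply imQ_injective
        simp only [imQ_rot, imQ_add, mul_add, add_mul]
      map_smul' := fun c a => by
        apply imQ_injective
        simp only [imQ_rot, imQ_smul, RingHom.id_apply, mul_smul_comm, smul_mul_assoc] }

lemma rotL_apply (s : SU2) (a : R3) : rotL s a = rot s a := rfl

def adj (k : T2SU2) : LieT →L[ℝ] LieT := (ContinuousLinearMap.id ℝ (Fin 2 → ℝ)).prodMap (rotL k.2)

lemma adj_apply (k : T2SU2) (v : LieT) : adj k v = (v.1, rot k.2 v.2) := rfl

lemma su2Exp_rot (s : SU2) (a : R3) : su2Exp (rot s a) = s * su2Exp a * s⁻¹ := by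
  apply Subtype.ext
  rw [Metric.unitSphere.coe_mul, Metric.unitSphere.coe_mul, coe_su2Exp, coe_su2Exp,
    imQ_rot, SU2.coe_inv]
  let _ : NormedAlgebra ℚ ℍ := NormedAlgebra.restrictScalars ℚ ℝ ℍ
  let y : ℍˣ := ⟨s, star s, SU2.self_mul_star s, SU2.star_mul_self s⟩
  exact NormedSpace.exp_units_conj y (imQ a)

lemma gexp_adj (k : T2SU2) (v : LieT) : gexp (adj k v) = k * gexp v * k⁻¹ := by
  rw [adj_apply]
  refine Prod.ext (Prod.ext ?_ ?_) ?_
  · change Circle.exp _ = k.1.1 * Circle.exp _ * k.1.1⁻¹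
    rw [mul_comm, ← mul_assoc, inv_mul_cancel, one_mul]
  · change Circle.exp _ = k.1.2 * Circle.exp _ * k.1.2⁻¹
    rw [mul_comm, ← mul_assoc, inv_mul_cancel, one_mul]
  · change su2Exp _ = k.2 * su2Exp _ * k.2⁻¹
    rw [← su2Exp_rot]
    congr 1
    change (fun i => -(rot k.2 v.2 i / 2)) = rotL k.2 _
    have : (fun i => -(v.2 i / 2)) = (-(1 / 2) : ℝ) • v.2 := by ext i; simp; ring
    rw [this, map_smul, rotL_apply]
    ext i; simp; ring

/-! ### Smooth actions -/

section Action

variable {M : Type*} [TopologicalSpace M] [ChartedSpace E7 M] [MulAction T2SU2 M]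

abbrev SmoothAction (M : Type*) [TopologicalSpace M] [ChartedSpace E7 M] [MulAction T2SU2 M] :
    Prop :=
  ContMDiff (modelT2SU2.prod I7) I7 ∞ (fun a : T2SU2 × M => a.1 • a.2)

/-- The differential of the orbit map of `x`. -/
def infAct (x : M) : LieT →L[ℝ] E7 := mfderiv 𝓘(ℝ, LieT) I7 (fun v : LieT => gexp v • x) 0

/-- The differential of `k` at `x`. -/
def dact (k : T2SU2) (x : M) : L7 := mfderiv I7 I7 (fun y : M => k • y) x

variable (hact : SmoothAction M)
include hact

lemma contMDiffAt_act {E' H' N : Type*} [NormedAddCommGroup E'] [NormedSpace ℝ E']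
    [TopologicalSpace H'] {J : ModelWithCorners ℝ E' H'} [TopologicalSpace N] [ChartedSpace H' N]
    {f : N → T2SU2} {g : N → M} {z : N} (hf : ContMDiffAt J modelT2SU2 ∞ f z)
    (hg : ContMDiffAt J I7 ∞ g z) : ContMDiffAt J I7 ∞ (fun z => f z • g z) z :=
  (hact (f z, g z)).comp z (hf.prodMk hg)

lemma contMDiff_smul_const (k : T2SU2) : ContMDiff I7 I7 ∞ (fun y : M => k • y) :=
  fun _ => contMDiffAt_act hact contMDiffAt_const contMDiffAt_id

lemma hasMFDerivAt_dact (k : T2SU2) (x : M) :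
    HasMFDerivAt I7 I7 (fun y : M => k • y) x (dact k x) :=
  ((contMDiff_smul_const hact k x).mdifferentiableAt (by simp)).hasMFDerivAt

lemma hasMFDerivAt_infAct (x : M) :
    HasMFDerivAt 𝓘(ℝ, LieT) I7 (fun v : LieT => gexp v • x) 0 (infAct x) :=
  ((contMDiffAt_act hact contMDiff_gexp.contMDiffAt contMDiffAt_const).mdifferentiableAt
    (by simp)).hasMFDerivAt

lemma dact_mul (k k' : T2SU2) (x : M) : dact (k * k') x = (dact k (k' • x)).comp (dact k' x) := by
  have h := (hasMFDerivAt_dact hact k (k' • x)).comp x (hasMFDerivAt_dact hact k' x)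
  have e : ((fun y : M => k • y) ∘ fun y : M => k' • y) = fun y : M => (k * k') • y := by
    funext y; exact (mul_smul k k' y).symm
  rw [e] at h
  exact h.mfderiv

omit hact in
lemma dact_one (x : M) : dact 1 x = .id ℝ E7 := by
  have e : (fun y : M => (1 : T2SU2) • y) = id := funext fun y => one_smul _ y
  rw [dact, e]
  exact mfderiv_id

lemma dact_infAct (k : T2SU2) (x : M) (v : LieT) :
    dact k x (infAct x v) = infAct (k • x) (adj k v) := by
  have h0 : gexp (0 : LieT) • x = x := by rw [gexp_zero, one_smul]
  have hd : HasMFDerivAt I7 I7 (fun y : M => k • y) (gexp (0 : LieT) • x) (dact k x) := by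
    rw [h0]; exact hasMFDerivAt_dact hact k x
  have h1 := hd.comp (0 : LieT) (hasMFDerivAt_infAct hact x)
  have ha : HasMFDerivAt 𝓘(ℝ, LieT) 𝓘(ℝ, LieT) (adj k) 0 (adj k) := (adj k).hasFDerivAt.hasMFDerivAt
  have hd2 : HasMFDerivAt 𝓘(ℝ, LieT) I7 (fun v : LieT => gexp v • (k • x)) (adj k 0)
      (infAct (k • x)) := by
    rw [map_zero]; exact hasMFDerivAt_infAct hact (k • x)
  have h2 := hd2.comp (0 : LieT) ha
  have e : ((fun v : LieT => gexp v • (k • x)) ∘ adj k) =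
      (fun y : M => k • y) ∘ fun v : LieT => gexp v • x := by
    funext v
    change gexp (adj k v) • k • x = k • gexp v • x
    rw [gexp_adj, mul_smul (k * gexp v) k⁻¹ (k • x), mul_smul k (gexp v), inv_smul_smul]
  rw [e] at h2
  exact DFunLike.congr_fun (hasMFDerivAt_unique h1 h2) v

lemma hasMFDerivAt_flow (x : M) (v : LieT) (t : ℝ) :
    HasMFDerivAt 𝓘(ℝ, ℝ) I7 (fun t : ℝ => gexp (t • v) • x) t
      (toSpanSingleton ℝ (infAct (gexp (t • v) • x) v)) := by
  set y := gexp (t • v) • x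
  have h1 : HasFDerivAt (fun s : ℝ => (s - t) • v) (toSpanSingleton ℝ v) t := by
    have : HasDerivAt (fun s : ℝ => (s - t) • v) ((1 : ℝ) • v) t :=
      ((hasDerivAt_id t).sub_const t).smul_const v
    rw [one_smul] at this
    exact this.hasFDerivAt
  have h2 : HasMFDerivAt 𝓘(ℝ, LieT) I7 (fun v : LieT => gexp v • y) ((t - t) • v)
      (infAct y) := by
    rw [sub_self, zero_smul]; exact hasMFDerivAt_infAct hact y
  have h3 := h2.comp t h1.hasMFDerivAt
  have e : ((fun v : LieT => gexp v • y) ∘ fun s : ℝ => (s - t) • v) =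
      fun s : ℝ => gexp (s • v) • x := by
    funext s
    change gexp ((s - t) • v) • gexp (t • v) • x = gexp (s • v) • x
    rw [smul_smul (gexp ((s - t) • v)) (gexp (t • v)) x, ← gexp_add_smul, sub_add_cancel]
  rw [e] at h3
  have e2 : toSpanSingleton ℝ (infAct y v) = (infAct y).comp (toSpanSingleton ℝ v) := by
    ext; simp
  exact h3.congr_mfderiv e2.symm

lemma velocity_flow (x : M) (v : LieT) :
    velocity (fun t : ℝ => gexp (t • v)) x = infAct x v := by
  have h := (hasMFDerivAt_flow hact x v 0).mfderiv
  have h' : gexp ((0 : ℝ) • v) • x = x := by rw [zero_smul, gexp_zero, one_smul]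
  rw [velocity, h, h']
  exact one_smul ℝ _

lemma genU_eq (l : Fin 2) (x : M) : genU l x = infAct x (single l 1, 0) := by
  rw [genU, ← velocity_flow hact]
  congr 1
  ext t : 1
  refine Prod.ext ?_ ?_
  · fin_cases l <;> simp [gexp]
  · change (1 : SU2) = su2Exp fun i => -((t • (0 : R3)) i / 2)
    have : (fun i => -((t • (0 : R3)) i / 2)) = 0 := by ext i; simp
    rw [this, su2Exp_zero]

lemma genV_eq (i : Fin 3) (x : M) : genV i x = infAct x (0, single i 1) := by
  rw [genV, ← velocity_flow hact]
  congr 1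
  ext t : 1
  refine Prod.ext ?_ ?_
  · simp [gexp]; rfl
  · change su2Exp _ = su2Exp _
    congr 1
    ext j
    by_cases h : j = i
    · subst h; simp
    · simp [h]

lemma range_infAct (x : M) : LinearMap.range (infAct x : LieT →ₗ[ℝ] E7) =
    span ℝ (range (fun l => genU l x) ∪ range (fun i => genV i x) : Set E7) := by
  apply le_antisymm
  · rintro _ ⟨v, rfl⟩
    have : v = ∑ l, v.1 l • ((single l 1, 0) : LieT) + ∑ i, v.2 i • ((0, single i 1) : LieT) := by
      refine Prod.ext ?_ ?_
      · ext j; fin_cases j <;> simp [Fin.sum_univ_two, Fin.sum_univ_three]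
      · ext j; fin_cases j <;> simp [Fin.sum_univ_two, Fin.sum_univ_three]
    change infAct x v ∈ _
    rw [this, map_add, map_sum, map_sum]
    refine Submodule.add_mem _ (Submodule.sum_mem _ fun l _ => ?_)
      (Submodule.sum_mem _ fun i _ => ?_)
    · rw [map_smul, ← genU_eq hact]
      exact smul_mem _ _ (subset_span (Or.inl ⟨l, rfl⟩))
    · rw [map_smul, ← genV_eq hact]
      exact smul_mem _ _ (subset_span (Or.inr ⟨i, rfl⟩))
  · rw [Submodule.span_le]
    rintro _ (⟨l, rfl⟩ | ⟨i, rfl⟩)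
    · exact ⟨(single l 1, 0), (genU_eq hact l x).symm⟩
    · exact ⟨(0, single i 1), (genV_eq hact i x).symm⟩

lemma orbitDim_eq (x : M) :
    orbitDim x = finrank ℝ (LinearMap.range (infAct x : LieT →ₗ[ℝ] E7)) := by
  rw [range_infAct hact]; rfl

lemma orbitDim_eq_five_iff (x : M) : orbitDim x = 5 ↔ Injective (infAct x) := by
  rw [orbitDim_eq hact]
  have h := LinearMap.finrank_range_add_finrank_ker (infAct x : LieT →ₗ[ℝ] E7)
  have h5 : finrank ℝ LieT = 5 := by simp
  rw [h5] at h
  constructor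
  · intro h1
    have : ker (infAct x : LieT →ₗ[ℝ] E7) = ⊥ := Submodule.finrank_eq_zero.1 (by omega)
    exact LinearMap.ker_eq_bot.1 this
  · intro h1
    have : ker (infAct x : LieT →ₗ[ℝ] E7) = ⊥ := LinearMap.ker_eq_bot.2 h1
    rw [this, finrank_bot] at h
    omega

lemma injective_infAct_smul {k : T2SU2} {x : M} (h : Injective (infAct x)) :
    Injective (infAct (k • x)) := by
  rw [injective_iff_map_eq_zero] at h ⊢
  intro v hv
  have h1 := dact_infAct hact k⁻¹ (k • x) v
  rw [hv, map_zero, inv_smul_smul] at h1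
  have h2 := h _ h1.symm
  have h3 : adj k (adj k⁻¹ v) = v := by
    rw [adj_apply, adj_apply]
    exact Prod.ext rfl (rot_rot_inv _ _)
  rw [← h3, h2, map_zero]

end Action

local notation "LR" => LieT × R2

/-! ### The exponential map is onto -/

lemma su2Exp_surjective : Surjective su2Exp := by
  intro s
  have hs : (s : ℍ).re ^ 2 + ((s : ℍ).imI ^ 2 + (s : ℍ).imJ ^ 2 + (s : ℍ).imK ^ 2) = 1 := by
    have h1 : ‖(s : ℍ)‖ * ‖(s : ℍ)‖ = 1 := by rw [norm_eq_of_mem_sphere]; simp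
    rw [← normSq_eq_norm_mul_self, normSq_def'] at h1
    linarith
  set c := (s : ℍ).re with hc
  set m := Real.sqrt ((s : ℍ).imI ^ 2 + (s : ℍ).imJ ^ 2 + (s : ℍ).imK ^ 2) with hm
  have hm2 : m ^ 2 = (s : ℍ).imI ^ 2 + (s : ℍ).imJ ^ 2 + (s : ℍ).imK ^ 2 :=
    Real.sq_sqrt (by positivity)
  have hm0 : 0 ≤ m := Real.sqrt_nonneg _
  have hcm : c ^ 2 + m ^ 2 = 1 := by rw [hm2]; exact hs
  set t := Real.arccos c with ht
  have hct : Real.cos t = c := Real.cos_arccos (by nlinarith) (by nlinarith)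
  have hst : Real.sin t = m := by
    rw [ht, Real.sin_arccos, ← hcm, add_sub_cancel_left, Real.sqrt_sq hm0]
  have ht0 : 0 ≤ t := Real.arccos_nonneg _
  have hn : ∀ a : R3, a 0 ^ 2 + a 1 ^ 2 + a 2 ^ 2 = 1 →
      (su2Exp (t • a) : ℍ) = (c : ℍ) + m • imQ a := by
    intro a ha
    have h1 : ‖imQ a‖ = 1 := by
      have h2 : ‖imQ a‖ * ‖imQ a‖ = 1 := by
        rw [← normSq_eq_norm_mul_self, normSq_def']
        change (0 : ℝ) ^ 2 + a 0 ^ 2 + a 1 ^ 2 + a 2 ^ 2 = 1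
        linarith
      nlinarith [norm_nonneg (imQ a)]
    have h3 : ‖imQ (t • a)‖ = t := by
      rw [imQ_smul, norm_smul, h1, mul_one, Real.norm_of_nonneg ht0]
    rw [coe_su2Exp, Quaternion.exp_of_re_eq_zero _ rfl, h3, hct, hst, imQ_smul, smul_smul]
    rcases eq_or_ne t 0 with h0 | h0
    · have : m = 0 := by rw [← hst, h0, Real.sin_zero]
      simp [this]
    · rw [div_mul_cancel₀ _ h0]
  rcases eq_or_ne m 0 with h0 | h0
  · refine ⟨t • single 0 1, Subtype.ext ?_⟩
    rw [hn _ (by simp), h0, zero_smul, add_zero]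
    have h4 : (s : ℍ).imI ^ 2 + (s : ℍ).imJ ^ 2 + (s : ℍ).imK ^ 2 = 0 := by rw [← hm2, h0]; ring
    have hI : (s : ℍ).imI = 0 := by nlinarith [sq_nonneg (s : ℍ).imJ, sq_nonneg (s : ℍ).imK]
    have hJ : (s : ℍ).imJ = 0 := by nlinarith [sq_nonneg (s : ℍ).imI, sq_nonneg (s : ℍ).imK]
    have hK : (s : ℍ).imK = 0 := by nlinarith [sq_nonneg (s : ℍ).imI, sq_nonneg (s : ℍ).imJ]
    exact Quaternion.ext _ _ rfl hI.symm hJ.symm hK.symm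
  · have e : ∀ y : ℝ, m * (y / m) = y := fun y => by field_simp
    refine ⟨t • (fun i => imPart s i / m), Subtype.ext ?_⟩
    rw [hn]
    · refine Quaternion.ext _ _ ?_ ?_ ?_ ?_
      · change c + m * 0 = c; ring
      · change 0 + m * ((s : ℍ).imI / m) = _; rw [e, zero_add]
      · change 0 + m * ((s : ℍ).imJ / m) = _; rw [e, zero_add]
      · change 0 + m * ((s : ℍ).imK / m) = _; rw [e, zero_add]
    · change ((s : ℍ).imI / m) ^ 2 + ((s : ℍ).imJ / m) ^ 2 + ((s : ℍ).imK / m) ^ 2 = 1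
      field_simp
      exact hm2.symm

lemma gexp_surjective : Surjective gexp := by
  rintro ⟨⟨a, b⟩, s⟩
  obtain ⟨α, hα⟩ := Circle.exp_surjective a
  obtain ⟨β, hβ⟩ := Circle.exp_surjective b
  obtain ⟨w, hw⟩ := su2Exp_surjective s
  refine ⟨(![-α, -β], fun i => -(2 * w i)), ?_⟩
  refine Prod.ext (Prod.ext ?_ ?_) ?_
  · change Circle.exp (-(-α)) = a; rw [neg_neg, hα]
  · change Circle.exp (-(-β)) = b; rw [neg_neg, hβ]
  · change su2Exp (fun i => -(-(2 * w i) / 2)) = s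
    rw [← hw]; congr 1; ext i; ring

/-! ### Rotations of `ℝ³` -/

lemma imQ_cross (a b : R3) : imQ (crossProduct a b) =
    (1 / 2 : ℝ) • (imQ a * imQ b - imQ b * imQ a) := by
  have h : ∀ a : R3, (imQ a).re = 0 ∧ (imQ a).imI = a 0 ∧
    (imQ a).imJ = a 1 ∧ (imQ a).imK = a 2 := fun a => ⟨rfl, rfl, rfl, rfl⟩
  refine Quaternion.ext _ _ ?_ ?_ ?_ ?_
  all_goals
    simp only [Quaternion.re_smul, Quaternion.imI_smul, Quaternion.imJ_smul, Quaternion.imK_smul,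
      Quaternion.re_sub, Quaternion.imI_sub, Quaternion.imJ_sub, Quaternion.imK_sub,
      re_mul, imI_mul, imJ_mul, imK_mul, h,
      cross_apply, smul_eq_mul]
    simp
    try ring

lemma re_mul_imQ (a b : R3) :
    (imQ a * imQ b).re = -(a ⬝ᵥ b) := by
  have h : ∀ a : R3, (imQ a).re = 0 ∧ (imQ a).imI = a 0 ∧
    (imQ a).imJ = a 1 ∧ (imQ a).imK = a 2 := fun a => ⟨rfl, rfl, rfl, rfl⟩
  simp only [re_mul, h, dotProduct, Fin.sum_univ_three]
  ring

lemma rot_cross (s : SU2) (a b : R3) :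
    rot s (crossProduct a b) = crossProduct (rot s a) (rot s b) := by
  apply imQ_injective
  rw [imQ_rot, imQ_cross, imQ_cross, imQ_rot, imQ_rot]
  have h := SU2.star_mul_self s
  have e : ∀ p q : ℍ, (s : ℍ) * p * star (s : ℍ) * ((s : ℍ) * q * star (s : ℍ)) =
      (s : ℍ) * (p * q) * star (s : ℍ) := fun p q => by
    calc _ = (s : ℍ) * p * (star (s : ℍ) * (s : ℍ)) * q * star (s : ℍ) := by noncomm_ring
      _ = _ := by rw [h]; noncomm_ring
  rw [e, e, mul_smul_comm, smul_mul_assoc, mul_sub, sub_mul]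

lemma re_conj (s : SU2) (q : ℍ) : ((s : ℍ) * q * star (s : ℍ)).re = q.re := by
  have hs : (s : ℍ).re ^ 2 + (s : ℍ).imI ^ 2 + (s : ℍ).imJ ^ 2 + (s : ℍ).imK ^ 2 = 1 := by
    have h1 : ‖(s : ℍ)‖ * ‖(s : ℍ)‖ = 1 := by rw [norm_eq_of_mem_sphere]; simp
    rwa [← normSq_eq_norm_mul_self, normSq_def'] at h1
  simp only [re_mul, imI_mul, imJ_mul, imK_mul,
    Quaternion.re_star, Quaternion.imI_star, Quaternion.imJ_star, Quaternion.imK_star]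
  linear_combination q.re * hs

lemma rot_dot (s : SU2) (a b : R3) : rot s a ⬝ᵥ rot s b = a ⬝ᵥ b := by
  rw [← neg_inj, ← re_mul_imQ, ← re_mul_imQ, imQ_rot, imQ_rot]
  have h := SU2.star_mul_self s
  have e : (s : ℍ) * imQ a * star (s : ℍ) * ((s : ℍ) * imQ b * star (s : ℍ)) =
      (s : ℍ) * (imQ a * imQ b) * star (s : ℍ) := by
    calc _ = (s : ℍ) * imQ a * (star (s : ℍ) * (s : ℍ)) * imQ b *
        star (s : ℍ) := by noncomm_ring
      _ = _ := by rw [h]; noncomm_ring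
  rw [e, re_conj]

lemma rot_smul (s : SU2) (c : ℝ) (a : R3) : rot s (c • a) = c • rot s a := map_smul (rotL s) c a

lemma rot_zero (s : SU2) : rot s 0 = 0 := map_zero (rotL s)

/-! ### `G₂`-structures in frames -/

section Frames

variable {M : Type*} [TopologicalSpace M] [ChartedSpace E7 M]

namespace G2Structure

variable (φ : G2Structure M)

/-- The adapted coordinates on the tangent space at `x`. -/
def fi (x : M) : E7 ≃L[ℝ] E7 := (φ.frame x).symm

/-- `∗φ` as a function of four vectors. -/
def st (x : M) (u v w z : E7) : ℝ := starPhi0 ![φ.fi x u, φ.fi x v, φ.fi x w, φ.fi x z]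

/-- `φ` as a function of three vectors. -/
def ph (x : M) (u v w : E7) : ℝ := phi0 ![φ.fi x u, φ.fi x v, φ.fi x w]

def cr (x : M) (u v : E7) : E7 := (φ.fi x).symm (cross0 (φ.fi x u) (φ.fi x v))

lemma form_eq (x : M) (u v w : TangentSpace I7 x) :
    φ.form x ![u, v, w] = φ.ph x u v w := by
  change _ = phi0 _
  rw [← φ.frame_spec x]
  congr 1
  ext i
  fin_cases i <;> exact ((φ.frame x).apply_symm_apply _).symm

lemma star_eq (x : M) (u v w z : TangentSpace I7 x) :
    φ.star x ![u, v, w, z] = φ.st x u v w z := by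
  change starPhi0 _ = starPhi0 _
  congr 1
  ext i
  fin_cases i <;> rfl

lemma cross_eq (x : M) (u v : TangentSpace I7 x) : φ.cross x u v = φ.cr x u v := by
  apply (φ.fi x).injective
  change _ = φ.fi x ((φ.fi x).symm _)
  rw [apply_symm_apply]
  apply ext_inner_right ℝ
  intro y
  have h := φ.metric_cross x u v ((φ.frame x) y)
  rw [form_eq] at h
  change _ = phi0 _ at h
  rw [phi0_apply] at h
  have e : φ.fi x (φ.frame x y) = y := (φ.frame x).symm_apply_apply y
  rw [e] at h
  rw [← h]
  change _ = inner ℝ _ ((φ.frame x).symm _)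
  rw [(φ.frame x).symm_apply_apply y]
  rfl

/-- `w ↦ ∗φ(u, v, w, z)` as a bilinear map. -/
def stB (x : M) (u v : E7) : E7 →ₗ[ℝ] E7 →ₗ[ℝ] ℝ :=
  LinearMap.mk₂ ℝ (fun w z => starBilin (φ.fi x u) (φ.fi x v) (φ.fi x w) (φ.fi x z))
    (fun _ _ _ => by simp only [map_add, LinearMap.add_apply])
    (fun _ _ _ => by simp only [map_smul, LinearMap.smul_apply])
    (fun _ _ _ => by simp only [map_add])
    (fun _ _ _ => by simp only [map_smul])

lemma stB_apply (x : M) (u v w z : E7) : φ.stB x u v w z = φ.st x u v w z := by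
  rw [stB, LinearMap.mk₂_apply, starBilin_apply, st]

/-- The associative plane spanned by `u` and `v`. -/
def asp (x : M) (u v : E7) : Submodule ℝ E7 :=
  (assocSpan (φ.fi x u) (φ.fi x v)).comap (φ.fi x : E7 →ₗ[ℝ] E7)

lemma mem_asp {x : M} {u v w : E7} :
    w ∈ φ.asp x u v ↔ φ.fi x w ∈ assocSpan (φ.fi x u) (φ.fi x v) := Iff.rfl

lemma left_mem_asp (x : M) (u v : E7) : u ∈ φ.asp x u v := left_mem_assocSpan _ _
lemma right_mem_asp (x : M) (u v : E7) : v ∈ φ.asp x u v := right_mem_assocSpan _ _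
lemma cr_mem_asp (x : M) (u v : E7) : φ.cr x u v ∈ φ.asp x u v := by
  rw [mem_asp, cr, apply_symm_apply]
  exact cross_mem_assocSpan _ _

lemma linearIndependent_fi {x : M} {u v : E7} (h : LinearIndependent ℝ ![u, v]) :
    LinearIndependent ℝ ![φ.fi x u, φ.fi x v] := by
  rw [pair_iff] at h ⊢
  intro s t hst
  refine h s t ((φ.fi x).injective ?_)
  rw [map_add, map_smul, map_smul, hst, map_zero]

lemma mem_asp_iff_st {x : M} {u v : E7} (h : LinearIndependent ℝ ![u, v]) (w : E7) :
    w ∈ φ.asp x u v ↔ ∀ z, φ.st x u v w z = 0 := by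
  rw [mem_asp, ← starPhi0_eq_zero_iff (φ.linearIndependent_fi h)]
  constructor
  · exact fun h z => h _
  · intro h z
    have := h ((φ.fi x).symm z)
    rwa [st, apply_symm_apply] at this

lemma finrank_asp {x : M} {u v : E7} (h : LinearIndependent ℝ ![u, v]) :
    finrank ℝ (φ.asp x u v) = 3 := by
  rw [← finrank_assocSpan (φ.linearIndependent_fi h)]
  exact LinearEquiv.finrank_eq
    (((φ.fi x).toLinearEquiv.submoduleMap (φ.asp x u v)).trans (LinearEquiv.ofEq _ _ (by
      change Submodule.map _ (Submodule.comap _ _) = _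
      exact Submodule.map_comap_eq_of_surjective (φ.fi x).surjective _)))

lemma st_swap (x : M) (u v w z : E7) : φ.st x u v z w = -φ.st x u v w z := by
  rw [st, st, starPhi0_apply, starPhi0_apply]
  have h2 : ∀ a b c d : E7, inner ℝ (cross0 a (cross0 b c)) d +
      inner ℝ (cross0 a (cross0 b d)) c = -(2 * (inner ℝ a b * inner ℝ c d))
        + inner ℝ a c * inner ℝ b d + inner ℝ a d * inner ℝ b c := fun a b c d => by
    simp only [inner_E7, cross0, Matrix.cons_val]
    ring
  have := h2 (φ.fi x u) (φ.fi x v) (φ.fi x w) (φ.fi x z)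
  rw [real_inner_comm (φ.fi x w) (φ.fi x z)]
  linarith

lemma ph_left (x : M) (u v : E7) : φ.ph x u v u = 0 := by
  rw [ph, phi0_apply, inner_cross0_left]

lemma ph_right (x : M) (u v : E7) : φ.ph x u v v = 0 := by
  rw [ph, phi0_apply, inner_cross0_right]

lemma ph_cr_ne_zero {x : M} {u v : E7} (h : LinearIndependent ℝ ![u, v]) :
    φ.ph x u v (φ.cr x u v) ≠ 0 := by
  rw [ph, phi0_apply, cr, apply_symm_apply, Ne, inner_self_eq_zero]
  exact cross0_ne_zero (φ.linearIndependent_fi h)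

def phL (x : M) (u v : E7) : E7 →ₗ[ℝ] ℝ :=
  (innerSL ℝ (cross0 (φ.fi x u) (φ.fi x v)) : E7 →ₗ[ℝ] ℝ) ∘ₗ (φ.fi x : E7 →ₗ[ℝ] E7)

lemma phL_apply (x : M) (u v w : E7) : φ.phL x u v w = φ.ph x u v w := by
  rw [ph, phi0_apply]; rfl

end G2Structure

end Frames

variable {M : Type*} [TopologicalSpace M] [ChartedSpace E7 M] [MulAction T2SU2 M]
  {φ : G2Structure M} {μ : M → E3} {ν : M → ℝ}

/-! ### Equivariance of the multi-moment maps -/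

def tv (l : Fin 2) : LieT := (single l 1, 0)

/-- The element `a` of the Lie algebra of `SU(2)`. -/
def sv (a : R3) : LieT := (0, a)

lemma sv_add (a b : R3) : sv (a + b) = sv a + sv b := by simp [sv]
lemma sv_smul (c : ℝ) (a : R3) : sv (c • a) = c • sv a := by simp [sv]

lemma lieT_eq (v : LieT) : v = v.1 0 • tv 0 + v.1 1 • tv 1 + sv v.2 := by
  refine Prod.ext ?_ ?_
  · ext j; fin_cases j <;> simp [tv, sv]
  · simp [tv, sv]

lemma adj_tv (k : T2SU2) (l : Fin 2) : adj k (tv l) = tv l := Prod.ext rfl (rot_zero _)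

lemma adj_sv (k : T2SU2) (a : R3) : adj k (sv a) = sv (rot k.2 a) := rfl

lemma sum_fin_three (a : R3) :
    a = a 0 • single 0 1 + a 1 • single 1 1 + a 2 • single 2 1 := by
  ext j; fin_cases j <;> simp

section Equivariance

/-- The torus generators are independent at `x`. -/
def Uind (x : M) : Prop := LinearIndependent ℝ ![infAct x (tv 0), infAct x (tv 1)]

lemma dact_inv_left (hact : SmoothAction M) (k : T2SU2) (x : M) (w : E7) :
    dact k⁻¹ (k • x) (dact k x w) = w := by
  have h := dact_mul hact k⁻¹ k x
  rw [inv_mul_cancel, dact_one] at h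
  exact (DFunLike.congr_fun h w).symm

lemma dact_injective (hact : SmoothAction M) (k : T2SU2) (x : M) :
    Injective (dact k x) :=
  Function.LeftInverse.injective (dact_inv_left hact k x)

lemma dact_surjective (hact : SmoothAction M) (k : T2SU2) (x : M) :
    Surjective (dact k x) :=
  LinearMap.injective_iff_surjective (f := (dact k x : E7 →ₗ[ℝ] E7)).1 (dact_injective hact k x)

lemma dact_tv (hact : SmoothAction M) (k : T2SU2) (x : M) (l : Fin 2) :
    dact k x (infAct x (tv l)) = infAct (k • x) (tv l) := by
  rw [dact_infAct hact, adj_tv]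

lemma dact_sv (hact : SmoothAction M) (k : T2SU2) (x : M) (a : R3) :
    dact k x (infAct x (sv a)) = infAct (k • x) (sv (rot k.2 a)) := by
  rw [dact_infAct hact, adj_sv]

lemma Uind.smul (hact : SmoothAction M) {x : M} (h : Uind x) (k : T2SU2) : Uind (k • x) := by
  rw [Uind, pair_iff] at *
  intro s t hst
  refine h s t (dact_injective hact k x ?_)
  rw [map_add, map_smul, map_smul, dact_tv hact, dact_tv hact, hst, map_zero]

variable (hpres : PreservesG2 φ)
include hpres

lemma pres_ph (k : T2SU2) (x : M) (u v w : E7) :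
    φ.ph (k • x) (dact k x u) (dact k x v) (dact k x w) = φ.ph x u v w := by
  have h := hpres k x ![u, v, w]
  have e : (fun i => mfderiv I7 I7 (fun y : M => k • y) x
      ((![u, v, w] : Fin 3 → TangentSpace I7 x) i)) =
      ![dact k x u, dact k x v, dact k x w] := by
    ext i; fin_cases i <;> rfl
  rw [e] at h
  exact (φ.form_eq _ _ _ _).symm.trans (h.trans (φ.form_eq _ _ _ _))

lemma pres_phi0 (k : T2SU2) (x : M) (u v w : E7) :
    let A : E7 →ₗ[ℝ] E7 := ((φ.fi (k • x) : L7).comp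
      ((dact k x).comp ((φ.fi x).symm : L7)) : L7)
    phi0 ![A u, A v, A w] = phi0 ![u, v, w] := by
  have h := pres_ph hpres k x ((φ.fi x).symm u) ((φ.fi x).symm v) ((φ.fi x).symm w)
  rw [G2Structure.ph, G2Structure.ph] at h
  simp only [apply_symm_apply] at h
  exact h

lemma pres_cr (k : T2SU2) (x : M) (u v : E7) :
    φ.cr (k • x) (dact k x u) (dact k x v) = dact k x (φ.cr x u v) := by
  have h := stab_cross (pres_phi0 hpres k x) (φ.fi x u) (φ.fi x v)
  simp only [ContinuousLinearMap.coe_coe, ContinuousLinearMap.comp_apply,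
    ContinuousLinearEquiv.coe_coe, symm_apply_apply] at h
  rw [G2Structure.cr, h, symm_apply_apply]
  rfl

lemma pres_st (k : T2SU2) (x : M) (u v w z : E7) :
    φ.st (k • x) (dact k x u) (dact k x v) (dact k x w) (dact k x z) = φ.st x u v w z := by
  have h := stab_star (pres_phi0 hpres k x) (φ.fi x u) (φ.fi x v) (φ.fi x w) (φ.fi x z)
  simpa [G2Structure.st] using h

variable (hact : SmoothAction M)
include hact
variable (hν : IsMultimomentNu φ ν)

omit hpres hact in
lemma hasMFDerivAt_nu (hν : IsMultimomentNu φ ν) (x : M) :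
    HasMFDerivAt I7 𝓘(ℝ, ℝ) ν x (mfderiv I7 𝓘(ℝ, ℝ) ν x) :=
  (hν.smooth.mdifferentiableAt (by simp)).hasMFDerivAt

def dnu (ν : M → ℝ) (x : M) : E7 →L[ℝ] ℝ := mfderiv I7 𝓘(ℝ, ℝ) ν x

omit hpres in
lemma dnu_apply (hν : IsMultimomentNu φ ν) (x : M) (w : E7) :
    dnu ν x w = φ.ph x (infAct x (tv 0)) (infAct x (tv 1)) w := by
  have h := (hν.deriv x w).trans (φ.form_eq x (genU 0 x) (genU 1 x) w)
  rw [genU_eq hact, genU_eq hact] at h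
  exact h

omit hpres in
lemma hasDerivAt_nu_flow (hν : IsMultimomentNu φ ν) (x : M) (v : LieT) (t : ℝ) :
    HasDerivAt (fun t : ℝ => ν (gexp (t • v) • x))
      (dnu ν (gexp (t • v) • x) (infAct (gexp (t • v) • x) v)) t := by
  have h := (hasMFDerivAt_nu hν (gexp (t • v) • x)).comp t (hasMFDerivAt_flow hact x v t)
  have e : (dnu ν (gexp (t • v) • x)).comp
      (toSpanSingleton ℝ (infAct (gexp (t • v) • x) v)) =
      toSpanSingleton ℝ
        (dnu ν (gexp (t • v) • x) (infAct (gexp (t • v) • x) v)) := by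
    ext; simp
  exact (h.congr_mfderiv (f₁' := toSpanSingleton ℝ
        (dnu ν (gexp (t • v) • x) (infAct (gexp (t • v) • x) v))) e).hasFDerivAt

lemma ph_infAct (hν : IsMultimomentNu φ ν) (x : M) (v : LieT) :
    φ.ph x (infAct x (tv 0)) (infAct x (tv 1)) (infAct x v) = 0 := by
  have hcont : Continuous fun k : T2SU2 => ν (k • x) := by
    refine hν.smooth.continuous.comp ?_
    exact (hact.continuous).comp (Continuous.prodMk_left x)
  obtain ⟨k, -, hk⟩ := isCompact_univ.exists_isMaxOn (α := ℝ) univ_nonempty hcont.continuousOn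
  have hmax : ∀ w : LieT, dnu ν (k • x) (infAct (k • x) w) = 0 := by
    intro w
    have h := hasDerivAt_nu_flow hact hν (k • x) w 0
    have h0 : gexp ((0 : ℝ) • w) • k • x = k • x := by rw [zero_smul, gexp_zero, one_smul]
    rw [h0] at h
    refine IsLocalMax.hasDerivAt_eq_zero ?_ h
    refine .of_forall fun t => ?_
    change ν (gexp (t • w) • k • x) ≤ ν (gexp ((0 : ℝ) • w) • k • x)
    rw [h0, smul_smul (gexp (t • w)) k x]
    exact hk (mem_univ _)
  have h1 := hmax (adj k v)
  rw [dnu_apply hact hν, ← dact_infAct hact, ← dact_tv hact, ← dact_tv hact, pres_ph hpres] at h1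
  exact h1

lemma nu_smul (hν : IsMultimomentNu φ ν) (k : T2SU2) (x : M) : ν (k • x) = ν x := by
  obtain ⟨v, rfl⟩ := gexp_surjective k
  have h : ∀ t : ℝ, HasDerivAt (fun t : ℝ => ν (gexp (t • v) • x)) 0 t := by
    intro t
    have := hasDerivAt_nu_flow hact hν x v t
    rwa [dnu_apply hact hν, ph_infAct hpres hact hν] at this
  have h2 := is_const_of_deriv_eq_zero (fun t => (h t).differentiableAt) (fun t => (h t).deriv) 1 0
  simpa [gexp_zero] using h2

variable (hμ : IsMultimomentMu φ μ)

omit hpres in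
lemma st_sv_sv (hμ : IsMultimomentMu φ μ) (x : M) (a b : R3) :
    φ.st x (infAct x (tv 0)) (infAct x (tv 1)) (infAct x (sv a)) (infAct x (sv b)) =
      -((μ x).ofLp ⬝ᵥ crossProduct a b) := by
  have hk : ∀ k : Fin 3, φ.st x (infAct x (tv 0)) (infAct x (tv 1))
      (infAct x (sv (single (k + 1) 1))) (infAct x (sv (single (k + 2) 1))) = -μ x k := by
    intro k
    have h := hμ.normalised x k
    rw [φ.star_eq, genU_eq hact, genU_eq hact, genV_eq hact, genV_eq hact] at h
    rw [h, neg_neg]; rfl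
  have h0 := hk 0
  have h1 := hk 1
  have h2 := hk 2
  simp only [Fin.isValue, zero_add, show (1 : Fin 3) + 1 = 2 from rfl,
    show (1 : Fin 3) + 2 = 0 from rfl, show (2 : Fin 3) + 1 = 0 from rfl,
    show (2 : Fin 3) + 2 = 1 from rfl] at h0 h1 h2
  have hself : ∀ w, φ.st x (infAct x (tv 0)) (infAct x (tv 1)) w w = 0 := fun w => by
    have := φ.st_swap x (infAct x (tv 0)) (infAct x (tv 1)) w w
    linarith
  have hs := φ.st_swap x (infAct x (tv 0)) (infAct x (tv 1))
  simp only [← φ.stB_apply] at *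
  rw [sum_fin_three a, sum_fin_three b]
  simp only [sv_add, sv_smul, map_add, map_smul, LinearMap.add_apply, LinearMap.smul_apply,
    hself, h0, h1, h2, hs (infAct x (sv (single 0 1))) (infAct x (sv (single 1 1))),
    hs (infAct x (sv (single 1 1))) (infAct x (sv (single 2 1))),
    hs (infAct x (sv (single 2 1))) (infAct x (sv (single 0 1)))]
  simp [dotProduct, Fin.sum_univ_three, cross_apply]
  ring

lemma mu_smul (hμ : IsMultimomentMu φ μ) (k : T2SU2) (x : M) :
    (μ (k • x)).ofLp = rot k.2 (μ x).ofLp := by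
  have h : ∀ a b : R3, (μ (k • x)).ofLp ⬝ᵥ crossProduct (rot k.2 a) (rot k.2 b) =
      rot k.2 (μ x).ofLp ⬝ᵥ crossProduct (rot k.2 a) (rot k.2 b) := by
    intro a b
    rw [← rot_cross, rot_dot, rot_cross]
    have h1 := st_sv_sv hact hμ x a b
    rw [← pres_st hpres k, dact_tv hact, dact_tv hact, dact_sv hact, dact_sv hact,
      st_sv_sv hact hμ] at h1
    linarith
  have h2 : ∀ a b : R3, (μ (k • x)).ofLp ⬝ᵥ crossProduct a b =
      rot k.2 (μ x).ofLp ⬝ᵥ crossProduct a b := by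
    intro a b
    have := h (rot k.2⁻¹ a) (rot k.2⁻¹ b)
    rwa [rot_rot_inv, rot_rot_inv] at this
  ext i
  have h0 := h2 (single 1 1) (single 2 1)
  have h1 := h2 (single 2 1) (single 0 1)
  have h2 := h2 (single 0 1) (single 1 1)
  simp [dotProduct, Fin.sum_univ_three, cross_apply] at h0 h1 h2
  fin_cases i
  exacts [h0, h1, h2]

lemma norm_mu_smul (hμ : IsMultimomentMu φ μ) (k : T2SU2) (x : M) : ‖μ (k • x)‖ = ‖μ x‖ := by
  have h : ∀ y : M, ‖μ y‖ = Real.sqrt ((μ y).ofLp ⬝ᵥ (μ y).ofLp) := fun y => by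
    rw [EuclideanSpace.norm_eq]
    congr 1
    simp [dotProduct, sq]
  rw [h, h, mu_smul hpres hact hμ, rot_dot]

def dmu (μ : M → E3) (x : M) : E7 →L[ℝ] E3 := mfderiv I7 (𝓡 3) μ x

omit hpres hact in
lemma hasMFDerivAt_mu (hμ : IsMultimomentMu φ μ) (x : M) :
    HasMFDerivAt I7 (𝓡 3) μ x (dmu μ x) :=
  (hμ.smooth.mdifferentiableAt (by simp)).hasMFDerivAt

omit hpres in
lemma dmu_apply (hμ : IsMultimomentMu φ μ) (x : M) (w : E7) (a : R3) :
    a ⬝ᵥ (dmu μ x w).ofLp = φ.st x (infAct x (tv 0)) (infAct x (tv 1)) (infAct x (sv a)) w := by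
  have h : ∀ i, dmu μ x w i = φ.st x (infAct x (tv 0)) (infAct x (tv 1))
      (infAct x (sv (single i 1))) w := by
    intro i
    have h := (hμ.deriv x w i).trans (φ.star_eq x (genU 0 x) (genU 1 x) (genV i x) w)
    rw [genU_eq hact, genU_eq hact, genV_eq hact] at h
    exact h
  conv_rhs => rw [sum_fin_three a]
  rw [← φ.stB_apply]
  simp only [sv_add, sv_smul, map_add, map_smul, LinearMap.add_apply, LinearMap.smul_apply,
    φ.stB_apply, ← h]
  simp [dotProduct, Fin.sum_univ_three]

end Equivariance

/-! ### Fixed points of compact groups -/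

/-- Averaging a local action of a compact group over its linearisation: the fixed vectors of the
linearisation are tangent to fixed points. -/
lemma exists_fixed_of_linear_fixed {K : Type*} [Group K] [TopologicalSpace K]
    [IsTopologicalGroup K] [CompactSpace K] {E : Type*} [NormedAddCommGroup E] [NormedSpace ℝ E]
    [CompleteSpace E] {ρ : K → E →L[ℝ] E} (hρ : Continuous ρ)
    (hmul : ∀ k h w, ρ (k * h) w = ρ k (ρ h w)) (hone : ∀ w, ρ 1 w = w) {F : K → E → E} {p : E}
    (hFp : ∀ k, F k p = p) (hF1 : ∀ᶠ y in 𝓝 p, F 1 y = y)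
    (hFc : ∀ᶠ y in 𝓝 p, Continuous fun k => F k y)
    (hFmul : ∀ᶠ y in 𝓝 p, ∀ k h, F (k * h) y = F k (F h y))
    (hunif : ∀ ε > 0, ∀ᶠ q in 𝓝 (p, p), ∀ k,
      ‖F k q.1 - F k q.2 - ρ k (q.1 - q.2)‖ ≤ ε * ‖q.1 - q.2‖) :
    ∃ Y : E → E, HasStrictFDerivAt Y (.id ℝ E) 0 ∧ Y 0 = p ∧
      ∀ᶠ w in 𝓝 0, (∀ k, ρ k w = w) → ∀ k, F k (Y w) = Y w := by
  let _ : MeasurableSpace K := borel K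
  have : BorelSpace K := ⟨rfl⟩
  let m : MeasureTheory.Measure K :=
    MeasureTheory.Measure.haarMeasure (⊤ : TopologicalSpace.PositiveCompacts K)
  have hm : MeasureTheory.IsProbabilityMeasure m := ⟨MeasureTheory.Measure.haarMeasure_self⟩
  -- a bound for the linear parts
  obtain ⟨C, hC⟩ : ∃ C : ℝ, ∀ k, ‖ρ k‖ ≤ C := by
    obtain ⟨C, hC⟩ := (isCompact_range hρ).isBounded.exists_norm_le
    exact ⟨C, fun k => hC _ ⟨k, rfl⟩⟩
  have hC0 : 0 ≤ C := (norm_nonneg _).trans (hC 1)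
  set Φ : E → E := fun y => ∫ k, ρ k (F k⁻¹ y - p) ∂m with hΦ
  have hcont : ∀ᶠ y in 𝓝 p, Continuous fun k => ρ k (F k⁻¹ y - p) := by
    filter_upwards [hFc] with y hy
    exact hρ.clm_apply ((hy.comp continuous_inv).sub continuous_const)
  have hint : ∀ᶠ y in 𝓝 p, MeasureTheory.Integrable (fun k => ρ k (F k⁻¹ y - p)) m := by
    filter_upwards [hcont] with y hy
    exact hy.integrable_of_hasCompactSupport (HasCompactSupport.of_compactSpace _)
  have hρi : ∀ k w, ρ k (ρ k⁻¹ w) = w := fun k w => by rw [← hmul, mul_inv_cancel, hone]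
  have hΦp : Φ p = 0 := by simp [hΦ, hFp]
  have hstrict : HasStrictFDerivAt Φ (.id ℝ E) p := by
    refine HasStrictFDerivAt.of_isLittleO (Asymptotics.isLittleO_iff.2 fun ε hε => ?_)
    have hε' : 0 < ε / (C + 1) := by positivity
    rw [nhds_prod_eq]
    have h1 := hunif _ hε'
    rw [nhds_prod_eq] at h1
    filter_upwards [h1, hint.prod_mk hint] with q hq hi
    have h2 : Φ q.1 - Φ q.2 - (q.1 - q.2) =
        ∫ k, ρ k (F k⁻¹ q.1 - F k⁻¹ q.2 - ρ k⁻¹ (q.1 - q.2)) ∂m := by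
      have h3 : (q.1 - q.2) = ∫ _k, (q.1 - q.2) ∂m := by simp
      have h5 : MeasureTheory.Integrable
          (fun k => ρ k (F k⁻¹ q.1 - p) - ρ k (F k⁻¹ q.2 - p)) m := hi.1.sub hi.2
      conv_lhs => rw [h3]
      rw [hΦ, ← MeasureTheory.integral_sub hi.1 hi.2,
        ← MeasureTheory.integral_sub h5 (MeasureTheory.integrable_const _)]
      congr 1
      funext k
      rw [map_sub _ _ (ρ k⁻¹ _), hρi, ← map_sub]
      congr 2
      abel
    change ‖Φ q.1 - Φ q.2 - (q.1 - q.2)‖ ≤ _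
    rw [h2]
    have h4 : ∀ k, ‖ρ k (F k⁻¹ q.1 - F k⁻¹ q.2 - ρ k⁻¹ (q.1 - q.2))‖ ≤ ε * ‖q.1 - q.2‖ := by
      intro k
      calc _ ≤ ‖ρ k‖ * ‖F k⁻¹ q.1 - F k⁻¹ q.2 - ρ k⁻¹ (q.1 - q.2)‖ := (ρ k).le_opNorm _
        _ ≤ (C + 1) * (ε / (C + 1) * ‖q.1 - q.2‖) := by
          gcongr
          · exact (hC k).trans (by linarith)
          · exact hq k⁻¹
        _ = ε * ‖q.1 - q.2‖ := by field_simp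
    calc _ ≤ ε * ‖q.1 - q.2‖ * m.real univ :=
          MeasureTheory.norm_integral_le_of_norm_le_const (.of_forall h4)
      _ = ε * ‖q.1 - q.2‖ := by simp
  have hequiv : ∀ᶠ y in 𝓝 p, ∀ h, Φ (F h y) = ρ h (Φ y) := by
    filter_upwards [hFmul, hint] with y hy hi h
    have h1 : Φ (F h y) = ∫ k, ρ k (F (k⁻¹ * h) y - p) ∂m := by
      simp only [hΦ, hy]
    rw [h1, ← MeasureTheory.integral_mul_left_eq_self _ h]
    simp only [hΦ]
    rw [← ContinuousLinearMap.integral_comp_comm _ hi]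
    congr 1
    funext k
    rw [hmul, mul_inv_rev, inv_mul_cancel_right]
  let e' : E ≃L[ℝ] E := ContinuousLinearEquiv.refl ℝ E
  have hs' : HasStrictFDerivAt Φ (e' : E →L[ℝ] E) p := hstrict
  set L := hs'.toOpenPartialHomeomorph Φ
  have hLsrc : L.source ∈ 𝓝 p := L.open_source.mem_nhds hs'.mem_toOpenPartialHomeomorph_source
  have hLe : ∀ y, L y = Φ y := fun y => rfl
  have hY0 : L.symm 0 = p := by
    rw [← hΦp, ← hLe]; exact L.left_inv hs'.mem_toOpenPartialHomeomorph_source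
  have hYs : HasStrictFDerivAt L.symm (.id ℝ E) 0 := by
    have := hs'.to_localInverse
    rwa [hΦp] at this
  refine ⟨L.symm, hYs, hY0, ?_⟩
  have h0t : (0 : E) ∈ L.target := by
    rw [← hΦp, ← hLe]; exact L.map_source hs'.mem_toOpenPartialHomeomorph_source
  have hYc : Tendsto L.symm (𝓝 0) (𝓝 p) := by
    have := hYs.continuousAt
    rwa [ContinuousAt, hY0] at this
  -- `F k y` is uniformly close to `p`
  have hclose : ∀ᶠ y in 𝓝 p, ∀ k, F k y ∈ L.source := by
    obtain ⟨r, hr, hball⟩ := Metric.mem_nhds_iff.1 hLsrc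
    have h1 : ∀ᶠ y in 𝓝 p, ∀ k, ‖F k y - F k p - ρ k (y - p)‖ ≤ 1 * ‖y - p‖ :=
      (Filter.Tendsto.prodMk_nhds Filter.tendsto_id tendsto_const_nhds).eventually
        (hunif 1 one_pos)
    filter_upwards [h1, Metric.ball_mem_nhds p (show 0 < r / (C + 2) by positivity)] with y hy hyb k
    apply hball
    rw [mem_ball, dist_eq_norm] at hyb ⊢
    have h2 := hy k
    rw [hFp] at h2
    calc ‖F k y - p‖ = ‖(F k y - p - ρ k (y - p)) + ρ k (y - p)‖ := by rw [sub_add_cancel]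
      _ ≤ 1 * ‖y - p‖ + C * ‖y - p‖ := (norm_add_le _ _).trans
          (add_le_add h2 (((ρ k).le_opNorm _).trans (by gcongr; exact hC k)))
      _ ≤ (C + 2) * ‖y - p‖ := by nlinarith [norm_nonneg (y - p)]
      _ < (C + 2) * (r / (C + 2)) := by gcongr
      _ = r := by field_simp
  filter_upwards [hYc.eventually hequiv, hYc.eventually hclose, hYc.eventually hF1,
    L.open_target.mem_nhds h0t] with w he hc h1 ht hw k
  have hm1 : L.symm w ∈ L.source := L.map_target ht
  have h2 : L (F k (L.symm w)) = L (L.symm w) := by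
    rw [L.right_inv ht, hLe, he k, ← hLe, L.right_inv ht, hw]
  exact L.injOn (hc k) hm1 h2

variable [IsManifold I7 ∞ M] [T2Space M] [PreconnectedSpace M] {x : M} {v : LieT}

/-! ### Isotropy in charts -/

section Isotropy

lemma contMDiffAt_chart {x y : M} (hy : y ∈ (ch x).source) :
    ContMDiffAt I7 I7 ∞ (ch x) y :=
  contMDiffOn_chart.contMDiffAt ((ch x).open_source.mem_nhds hy)

lemma contMDiffAt_chart_symm {y : E7} (hy : y ∈ (ch x).target) :
    ContMDiffAt I7 I7 ∞ (ch x).symm y :=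
  contMDiffOn_chart_symm.contMDiffAt ((ch x).open_target.mem_nhds hy)

/-- The action of `k` in the chart at `x`. -/
def actChart (x : M) (k : T2SU2) (y : E7) : E7 := ch x (k • (ch x).symm y)

variable (hact : SmoothAction M)
include hact

lemma contDiffAt_actChart {E : Type*} [NormedAddCommGroup E] [NormedSpace ℝ E]
    {f : E → T2SU2} {g : E → E7} {z : E} (hf : ContMDiffAt 𝓘(ℝ, E) modelT2SU2 ∞ f z)
    (hg : ContDiffAt ℝ ∞ g z) (h1 : g z ∈ (ch x).target)
    (h2 : f z • (ch x).symm (g z) ∈ (ch x).source) :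
    ContDiffAt ℝ ∞ (fun z => actChart x (f z) (g z)) z := by
  rw [← contMDiffAt_iff_contDiffAt]
  have h3 : ContMDiffAt 𝓘(ℝ, E) I7 ∞ (fun z => (ch x).symm (g z)) z :=
    (contMDiffAt_chart_symm h1).comp z hg.contMDiffAt
  exact (contMDiffAt_chart h2).comp z (contMDiffAt_act hact hf h3)

lemma hasFDerivAt_actChart {k : T2SU2} (hk : k • x = x) :
    HasFDerivAt (actChart x k) (dact k x) (ch x x) := by
  have h : HasFDerivWithinAt (extChartAt I7 (k • x) ∘ (fun y => k • y) ∘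
      (extChartAt I7 x).symm) (dact k x) (range I7) (extChartAt I7 x x) :=
    (hasMFDerivAt_dact hact k x).2
  rw [hk] at h
  simp at h
  exact h

omit hact in
lemma actChart_self {k : T2SU2} (hk : k • x = x) :
    actChart x k (ch x x) = ch x x := by
  rw [actChart, (ch x).left_inv (mem_chart_source E7 x), hk]

lemma actChart_strict_local {k : T2SU2} (hk : k • x = x) {ε : ℝ} (hε : 0 < ε) :
    ∀ᶠ p : (E7 × E7) × T2SU2 in 𝓝 ((ch x x, ch x x), k),
      ‖actChart x p.2 p.1.1 - actChart x p.2 p.1.2 - dact k x (p.1.1 - p.1.2)‖ ≤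
        ε * ‖p.1.1 - p.1.2‖ := by
  set χ := extChartAt modelT2SU2 k
  set e := ch x
  have hex : e x ∈ e.target := mem_chart_target E7 x
  have hxs : x ∈ e.source := mem_chart_source E7 x
  have hk' : χ.symm (χ k) = k := extChartAt_to_inv k
  have hχ : ContMDiffAt 𝓘(ℝ, (EuclideanSpace ℝ (Fin 1) × EuclideanSpace ℝ (Fin 1)) ×
      E3) modelT2SU2 ∞ χ.symm (χ k) :=
    (contMDiffOn_extChartAt_symm k).contMDiffAt (extChartAt_target_mem_nhds k)
  have hG : ContDiffAt ℝ ∞ (fun z : ((EuclideanSpace ℝ (Fin 1) × EuclideanSpace ℝ (Fin 1)) ×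
      E3) × E7 => actChart x (χ.symm z.1) z.2) (χ k, e x) := by
    refine contDiffAt_actChart hact ?_ contDiffAt_snd hex ?_
    · exact ContMDiffAt.comp (x := (χ k, e x)) (f := fst) (g := χ.symm) hχ
        contDiff_fst.contMDiff.contMDiffAt
    · change χ.symm (χ k) • e.symm (e x) ∈ e.source
      rw [hk', e.left_inv hxs, hk]; exact hxs
  obtain ⟨L, hL⟩ : ∃ L, HasStrictFDerivAt (fun z : ((EuclideanSpace ℝ (Fin 1) ×
      EuclideanSpace ℝ (Fin 1)) × E3) × E7 =>
      actChart x (χ.symm z.1) z.2) L (χ k, e x) := ⟨_, hG.hasStrictFDerivAt (by simp)⟩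
  have hL2 : ∀ w, L (0, w) = dact k x w := by
    intro w
    have h1 : HasFDerivAt (fun y : E7 => actChart x (χ.symm (χ k)) y)
        (L.comp (ContinuousLinearMap.inr ℝ _ E7)) (e x) :=
      HasFDerivAt.comp (e x) hL.hasFDerivAt (hasFDerivAt_prodMk_right (χ k) (e x))
    rw [hk'] at h1
    exact DFunLike.congr_fun (h1.unique (hasFDerivAt_actChart hact hk)) w
  have h2 := hL.isLittleO.def hε
  have ht : Tendsto (fun p : (E7 × E7) × T2SU2 => ((χ p.2, p.1.1), (χ p.2, p.1.2)))
      (𝓝 ((e x, e x), k)) (𝓝 ((χ k, e x), (χ k, e x))) := by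
    have hc : Tendsto (fun p : (E7 × E7) × T2SU2 => χ p.2) (𝓝 ((e x, e x), k))
        (𝓝 (χ k)) := (continuousAt_extChartAt k).tendsto.comp
          (continuous_snd.tendsto ((e x, e x), k))
    have h1 := (continuous_fst.comp continuous_fst).tendsto (((e x, e x), k) : (E7 × E7) × T2SU2)
    have h2 := (continuous_snd.comp continuous_fst).tendsto (((e x, e x), k) : (E7 × E7) × T2SU2)
    exact (hc.prodMk_nhds h1).prodMk_nhds (hc.prodMk_nhds h2)
  have hsrc : ∀ᶠ p : (E7 × E7) × T2SU2 in 𝓝 ((e x, e x), k), p.2 ∈ χ.source :=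
    (continuous_snd.tendsto ((e x, e x), k)).eventually (extChartAt_source_mem_nhds k)
  filter_upwards [ht.eventually h2, hsrc] with p hp hps
  simp only [χ.left_inv hps, Prod.mk_sub_mk, sub_self, hL2] at hp
  refine hp.trans (le_of_eq ?_)
  congr 1
  rw [Prod.norm_mk, norm_zero, max_eq_right (norm_nonneg _)]

lemma norm_dact_sub_le {k : T2SU2} (hk : k • x = x) {ε : ℝ} (hε : 0 < ε) :
    ∀ᶠ g in 𝓝 k, g • x = x → ‖dact g x - dact k x‖ ≤ ε := by
  have h := actChart_strict_local hact hk hε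
  rw [nhds_prod_eq] at h
  have h2 := (Filter.eventually_swap_iff.1 h).curry
  filter_upwards [h2] with g hg hgx
  refine HasFDerivAt.le_of_lip' ((hasFDerivAt_actChart hact hgx).sub (dact k x).hasFDerivAt)
    hε.le ?_
  have h3 := (Filter.Tendsto.prodMk_nhds Filter.tendsto_id
    (tendsto_const_nhds (x := ch x x))).eventually hg
  filter_upwards [h3] with y hy
  refine le_trans (le_of_eq ?_) hy
  congr 1
  change actChart x g y - dact k x y - (actChart x g _ - dact k x _) =
    actChart x g y - actChart x g _ - dact k x (y - _)
  rw [map_sub]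
  abel

lemma continuousOn_dact (x : M) : ContinuousOn (fun k => dact k x) {k : T2SU2 | k • x = x} := by
  intro k hk
  rw [ContinuousWithinAt, Metric.tendsto_nhds]
  intro ε hε
  filter_upwards [nhdsWithin_le_nhds (norm_dact_sub_le hact hk (half_pos hε)),
    self_mem_nhdsWithin] with g hg hgx
  rw [dist_eq_norm]
  exact (hg hgx).trans_lt (half_lt_self hε)

lemma actChart_strict {K : Set T2SU2} (hK : IsCompact K) (hKx : ∀ k ∈ K, k • x = x)
    {ε : ℝ} (hε : 0 < ε) :
    ∀ᶠ q : E7 × E7 in 𝓝 (ch x x, ch x x), ∀ k ∈ K,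
      ‖actChart x k q.1 - actChart x k q.2 - dact k x (q.1 - q.2)‖ ≤ ε * ‖q.1 - q.2‖ := by
  have key := hK.eventually_forall_of_forall_eventually
    (x₀ := (ch x x, ch x x)) (P := fun q k => k • x = x →
      ‖actChart x k q.1 - actChart x k q.2 - dact k x (q.1 - q.2)‖ ≤ ε * ‖q.1 - q.2‖) ?_
  · filter_upwards [key] with q hq k hk
    exact hq k hk (hKx k hk)
  · intro k hk
    have h1 := actChart_strict_local hact (hKx k hk) (half_pos hε)
    have h2 := (continuous_snd.tendsto ((ch x x, ch x x), k)).eventually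
      (norm_dact_sub_le hact (hKx k hk) (half_pos hε))
    filter_upwards [h1, h2] with p hp hp2 hpx
    have h3 : actChart x p.2 p.1.1 - actChart x p.2 p.1.2 - dact p.2 x (p.1.1 - p.1.2) =
        (actChart x p.2 p.1.1 - actChart x p.2 p.1.2 - dact k x (p.1.1 - p.1.2)) -
          (dact p.2 x - dact k x) (p.1.1 - p.1.2) := by
      rw [sub_apply]; abel
    rw [h3]
    calc _ ≤ ε / 2 * ‖p.1.1 - p.1.2‖ + ε / 2 * ‖p.1.1 - p.1.2‖ :=
          (norm_sub_le _ _).trans (add_le_add hp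
            ((ContinuousLinearMap.le_opNorm _ _).trans (by gcongr; exact hp2 hpx)))
      _ = ε * ‖p.1.1 - p.1.2‖ := by ring

/-- In a chart, the elements of a compact set of isotropies keep points in the chart. -/
lemma eventually_mem_source {K : Set T2SU2} (hK : IsCompact K)
    (hKx : ∀ k ∈ K, k • x = x) {U : Set M} (hU : U ∈ 𝓝 x) :
    ∀ᶠ y in 𝓝 (ch x x), ∀ k ∈ K, k • (ch x).symm y ∈ U := by
  refine hK.eventually_forall_of_forall_eventually (P := fun y k =>
    k • (ch x).symm y ∈ U) fun k hk => ?_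
  have h1 : ContinuousAt (fun p : E7 × T2SU2 => p.2 • (ch x).symm p.1)
      (ch x x, k) := by
    refine hact.continuous.continuousAt.comp (f := fun p : E7 × T2SU2 => (p.2, (ch x).symm p.1)) ?_
    exact continuousAt_snd.prodMk (((ch x).continuousAt_symm
      (mem_chart_target E7 x)).comp (f := fst) continuousAt_fst)
  refine h1.eventually_mem ?_
  change U ∈ 𝓝 (k • (ch x).symm (ch x x))
  rw [(ch x).left_inv (mem_chart_source E7 x), hKx k hk]
  exact hU

lemma continuous_smul_left (x : M) : Continuous fun k : T2SU2 => k • x :=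
  hact.continuous.comp (Continuous.prodMk_left x)

lemma isClosed_stab (x : M) : IsClosed {k : T2SU2 | k • x = x} :=
  isClosed_eq (continuous_smul_left hact x) continuous_const

/-! ### Rigidity -/

lemma dact_pow {k : T2SU2} (hk : k • x = x)
    (h1 : dact k x = .id ℝ E7) (n : ℕ) :
    k ^ n • x = x ∧ dact (k ^ n) x = .id ℝ E7 := by
  induction n with
  | zero => rw [pow_zero]; exact ⟨one_smul _ x, dact_one x⟩
  | succ n ih =>
    rw [pow_succ]
    refine ⟨by rw [mul_smul (k ^ n) k x, hk, ih.1], ?_⟩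
    rw [dact_mul hact, hk, ih.2, h1]
    rfl

lemma eventually_smul_eq {k : T2SU2} (hk : k • x = x)
    (h1 : dact k x = .id ℝ E7) : ∀ᶠ y in 𝓝 x, k • y = y := by
  set e := ch x with he
  set K : Set T2SU2 := closure (range fun n : ℕ => k ^ n) with hK
  have hKc : IsCompact K := isClosed_closure.isCompact
  have hKx : ∀ g ∈ K, g • x = x := by
    refine closure_minimal ?_ (isClosed_stab hact x)
    rintro _ ⟨n, rfl⟩
    exact (dact_pow hact hk h1 n).1
  have hmem : ∀ n : ℕ, k ^ n ∈ K := fun n => subset_closure ⟨n, rfl⟩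
  have hs := actChart_strict hact hKc hKx (ε := 1 / 2) (by norm_num)
  have hsrc := eventually_mem_source hact hKc hKx
    (e.open_source.mem_nhds (mem_chart_source E7 x))
  have hex : e x ∈ e.target := mem_chart_target E7 x
  have hFc : Tendsto (actChart x k) (𝓝 (e x)) (𝓝 (e x)) := by
    have := (hasFDerivAt_actChart hact hk).continuousAt
    rwa [ContinuousAt, actChart_self hk] at this
  have hs1 := (Filter.tendsto_id.prodMk_nhds hFc).eventually hs
  have hs2 := (Filter.tendsto_id.prodMk_nhds (tendsto_const_nhds (x := e x))).eventually hs
  have key : ∀ᶠ y in 𝓝 (e x), k • e.symm y = e.symm y := by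
    filter_upwards [hs1, hs2, hsrc, e.open_target.mem_nhds hex] with y hy1 hy2 hy3 hyt
    set a : ℕ → E7 := fun n => actChart x (k ^ n) y with ha
    have ha0 : a 0 = y := by
      simp only [ha, actChart, pow_zero]
      rw [one_smul]; exact e.right_inv hyt
    have ha1 : a 1 = actChart x k y := by simp only [ha, pow_one]
    have hstep : ∀ n, actChart x (k ^ n) (actChart x k y) = a (n + 1) := by
      intro n
      have h := hy3 k (by simpa using hmem 1)
      simp only [ha, actChart, ← he]
      rw [e.left_inv h, smul_smul (k ^ n) k, pow_succ]
    have hd : ∀ n, ‖a n - a (n + 1) - (a 0 - a 1)‖ ≤ 1 / 2 * ‖a 0 - a 1‖ := by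
      intro n
      have h := hy1 (k ^ n) (hmem n)
      simp only [id, hstep, (dact_pow hact hk h1 n).2, ContinuousLinearMap.id_apply] at h
      rw [ha0, ha1]
      exact h
    have hsum : ∀ n : ℕ, ‖a 0 - a n - (n : ℝ) • (a 0 - a 1)‖ ≤ n * (1 / 2 * ‖a 0 - a 1‖) := by
      intro n
      induction n with
      | zero => simp
      | succ n ih =>
        have : a 0 - a (n + 1) - ((n + 1 : ℕ) : ℝ) • (a 0 - a 1) =
            (a 0 - a n - (n : ℝ) • (a 0 - a 1)) + (a n - a (n + 1) - (a 0 - a 1)) := by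
          push_cast; module
        rw [this]
        refine (norm_add_le _ _).trans ((add_le_add ih (hd n)).trans (le_of_eq ?_))
        push_cast; ring
    have hb : ∀ n, ‖a n - a 0‖ ≤ 1 / 2 * ‖y - e x‖ := by
      intro n
      have h := hy2 (k ^ n) (hmem n)
      simp only [id, (dact_pow hact hk h1 n).2, ContinuousLinearMap.id_apply] at h
      rw [actChart_self (dact_pow hact hk h1 n).1] at h
      refine le_trans (le_of_eq ?_) h
      congr 1
      rw [ha0]
      simp only [ha, ← he]; abel
    have hzero : ‖a 0 - a 1‖ = 0 := by
      by_contra hne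
      have hpos : 0 < ‖a 0 - a 1‖ := lt_of_le_of_ne (norm_nonneg _) (Ne.symm hne)
      obtain ⟨n, hn⟩ := exists_nat_gt (‖y - e x‖ / ‖a 0 - a 1‖)
      have h3 := hsum n
      have h4 := hb n
      have h5 : ‖(n : ℝ) • (a 0 - a 1)‖ ≤ n * (1 / 2 * ‖a 0 - a 1‖) + 1 / 2 * ‖y - e x‖ := by
        calc _ = ‖(a 0 - a n) - (a 0 - a n - (n : ℝ) • (a 0 - a 1))‖ := by
              congr 1; abel
          _ ≤ 1 / 2 * ‖y - e x‖ + n * (1 / 2 * ‖a 0 - a 1‖) :=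
              (norm_sub_le _ _).trans (add_le_add (by rw [norm_sub_rev]; exact h4) h3)
          _ = _ := by ring
      rw [norm_smul, Real.norm_natCast] at h5
      rw [div_lt_iff₀ hpos] at hn
      linarith
    rw [norm_eq_zero, sub_eq_zero, ha0, ha1] at hzero
    have h6 := hy3 k (by simpa using hmem 1)
    have h7 : e (k • e.symm y) = e (e.symm y) := by
      rw [e.right_inv hyt]; exact hzero.symm
    exact e.injOn h6 (e.map_target hyt) h7
  have h8 := (e.continuousAt (mem_chart_source E7 x)).eventually key
  filter_upwards [h8, e.open_source.mem_nhds (mem_chart_source E7 x)] with y hy hys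
  rwa [e.left_inv hys] at hy

/-- An isometry which fixes a point and has trivial differential there is the identity. -/
lemma smul_eq_of_dact_eq_id {k : T2SU2}
    (hk : k • x = x) (h1 : dact k x = .id ℝ E7) (y : M) : k • y = y := by
  set Z : Set M := interior {y | k • y = y} with hZ
  have hZo : IsOpen Z := isOpen_interior
  have hxZ : x ∈ Z := mem_interior_iff_mem_nhds.2 (eventually_smul_eq hact hk h1)
  have hZc : IsClosed Z := by
    refine isClosed_of_closure_subset fun z hz => ?_
    have hfix : k • z = z := by
      have : IsClosed {y : M | k • y = y} :=
        isClosed_eq (contMDiff_smul_const hact k).continuous continuous_id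
      exact (closure_minimal interior_subset this) hz
    refine mem_interior_iff_mem_nhds.2 (eventually_smul_eq hact hfix ?_)
    set e := ch z with he
    have hzs : z ∈ e.source := mem_chart_source E7 z
    have hC : ContDiffAt ℝ ∞ (actChart z k) (e z) := by
      refine contDiffAt_actChart (f := fun _ => k) (g := id) hact contMDiffAt_const contDiffAt_id
        (mem_chart_target E7 z) ?_
      change k • e.symm (e z) ∈ e.source
      rw [e.left_inv hzs, hfix]; exact hzs
    have hfd : ContinuousAt (fderiv ℝ (actChart z k)) (e z) :=
      (hC.fderiv_right (m := 0) (by simp)).continuousAt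
    have hfre : ∃ᶠ y in 𝓝 (e z), fderiv ℝ (actChart z k) y = .id ℝ E7 := by
      intro hev
      have h2 := (e.continuousAt hzs).eventually hev
      rw [mem_closure_iff_frequently] at hz
      refine hz ?_
      filter_upwards [h2, e.open_source.mem_nhds hzs] with y hy hys hyZ
      refine hy (HasFDerivAt.fderiv ?_)
      refine (hasFDerivAt_id (e y)).congr_of_eventuallyEq ?_
      have h3 : ∀ᶠ w in 𝓝 (e y), e.symm w ∈ Z := by
        have := e.continuousAt_symm (e.map_source hys)
        rw [ContinuousAt, e.left_inv hys] at this
        exact this (hZo.mem_nhds hyZ)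
      filter_upwards [h3, e.open_target.mem_nhds (e.map_source hys)] with w hw hwt
      have h4 : k • e.symm w = e.symm w := interior_subset (s := {y | k • y = y}) hw
      rw [actChart, h4]
      exact e.right_inv hwt
    have hcl : IsClosed {ContinuousLinearMap.id ℝ E7} := isClosed_singleton
    have h5 := hcl.mem_of_frequently_of_tendsto (hfre.mono fun y hy => hy) hfd.tendsto
    rw [mem_singleton_iff] at h5
    rw [← h5]
    exact (hasFDerivAt_actChart hact hfix).fderiv.symm
  have huniv : Z = univ := IsClopen.eq_univ ⟨hZc, hZo⟩ ⟨x, hxZ⟩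
  have : y ∈ Z := huniv ▸ mem_univ y
  exact interior_subset (s := {y | k • y = y}) this

end Isotropy

/-! ### The linearised isotropy -/

section Linearised

/-- The action in the chart at `x`, in exponential coordinates. -/
def psi (x : M) (p : LieT × E7) : E7 := actChart x (gexp p.1) p.2

/-- The generating vector fields in the chart at `x`. -/
def cI (x : M) (y : E7) : LieT →L[ℝ] E7 := (fderiv ℝ (psi x) (0, y)).comp (.inl ℝ LieT E7)

/-- The linearisation at `x` of the generating vector field `v`, in the chart at `x`. -/
def lin (x : M) (v : LieT) : L7 := (ContinuousLinearMap.apply ℝ E7 ((v, 0) : LieT × E7)).comp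
    ((fderiv ℝ (fderiv ℝ (psi x)) (0, ch x x)).comp (.inr ℝ LieT E7))

lemma lin_apply (x : M) (v : LieT) (w : E7) :
    lin x v w = fderiv ℝ (fderiv ℝ (psi x)) (0, ch x x) (0, w) (v, 0) := rfl

lemma lin_add (x : M) (v v' : LieT) : lin x (v + v') = lin x v + lin x v' := by
  ext1 w
  have : ((v + v', 0) : LieT × E7) = (v, 0) + (v', 0) := by simp
  rw [lin_apply, this, map_add]; rfl

lemma lin_smul (x : M) (c : ℝ) (v : LieT) : lin x (c • v) = c • lin x v := by
  ext1 w
  have : ((c • v, 0) : LieT × E7) = c • (v, 0) := by simp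
  rw [lin_apply, this, map_smul]; rfl

variable (hact : SmoothAction M)
include hact

lemma contDiffAt_psi (x : M) {y : E7} (hy : y ∈ (ch x).target) :
    ContDiffAt ℝ ∞ (psi x) (0, y) := by
  refine contDiffAt_actChart (f := fun p : LieT × E7 => gexp p.1) (g := snd) hact ?_
    contDiffAt_snd hy ?_
  · exact ContMDiffAt.comp (x := ((0, y) : LieT × E7)) (f := fst) (g := gexp)
      contMDiff_gexp.contMDiffAt contDiff_fst.contMDiff.contMDiffAt
  · change gexp 0 • (ch x).symm y ∈ _
    rw [gexp_zero, one_smul]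
    exact (ch x).map_target hy

lemma contDiffOn_cI (x : M) : ContDiffOn ℝ ∞ (cI x) (ch x).target := by
  intro y hy
  have h1 : ContDiffAt ℝ ∞ (fderiv ℝ (psi x)) (0, y) :=
    (contDiffAt_psi hact x hy).fderiv_right (by simp)
  have h2 : ContDiffAt ℝ ∞ (fun y : E7 => fderiv ℝ (psi x) (0, y)) y :=
    h1.comp (f := fun y : E7 => ((0 : LieT), y)) y (contDiffAt_const.prodMk contDiffAt_id)
  exact (h2.clm_comp contDiffAt_const).contDiffWithinAt

lemma hasFDerivAt_cI (x : M) (v : LieT) :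
    HasFDerivAt (fun y => cI x y v) (lin x v) (ch x x) := by
  have h1 : HasFDerivAt (fderiv ℝ (psi x)) (fderiv ℝ (fderiv ℝ (psi x)) (0, ch x x))
      (0, ch x x) :=
    (((contDiffAt_psi hact x (mem_chart_target E7 x)).fderiv_right (m := ∞)
      (by simp)).differentiableAt (by simp)).hasFDerivAt
  have h2 := h1.comp (ch x x) (hasFDerivAt_prodMk_right (0 : LieT) (ch x x))
  exact (ContinuousLinearMap.apply ℝ E7 ((v, 0) : LieT × E7)).hasFDerivAt.comp _ h2

lemma mfderiv_chart_infAct (x : M) {y : M} (hy : y ∈ (ch x).source) (v : LieT) :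
    (mfderiv I7 I7 (ch x) y : L7) (infAct y v) = cI x (ch x y) v := by
  have h1 := ((contMDiffAt_chart hy).mdifferentiableAt (by simp)).hasMFDerivAt
  have h0 : gexp (0 : LieT) • y = y := by rw [gexp_zero, one_smul]
  have h2 : HasMFDerivAt I7 I7 (ch x) (gexp (0 : LieT) • y)
      (mfderiv I7 I7 (ch x) y : L7) := by
    rw [h0]; exact h1
  obtain ⟨L, hL⟩ : ∃ L : L7, L = mfderiv I7 I7 (ch x) y := ⟨_, rfl⟩
  rw [← hL] at h2 ⊢
  have h3 : HasFDerivAt (fun v : LieT => ch x (gexp v • y)) (L.comp (infAct y)) 0 :=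
    (h2.comp (0 : LieT) (hasMFDerivAt_infAct hact y)).hasFDerivAt
  have h4 : HasFDerivAt (psi x) (fderiv ℝ (psi x) (0, ch x y)) (0, ch x y) :=
    ((contDiffAt_psi hact x ((ch x).map_source hy)).differentiableAt (by simp)).hasFDerivAt
  have h5 := HasFDerivAt.comp (g := psi x) (0 : LieT) h4 (hasFDerivAt_prodMk_left (𝕜 := ℝ) (0 : LieT) (ch x y))
  have e : (psi x ∘ fun v : LieT => (v, ch x y)) = fun v : LieT => ch x (gexp v • y) := by
    funext v
    simp only [Function.comp, psi, actChart]
    rw [(ch x).left_inv hy]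
  rw [e] at h5
  have h6 := h3.unique h5
  exact DFunLike.congr_fun h6 v

omit hact in
lemma mfderiv_chart_symm_comp (x : M) {y : M} (hy : y ∈ (ch x).source) (w : E7) :
    (mfderiv I7 I7 (ch x).symm (ch x y) : L7)
      ((mfderiv I7 I7 (ch x) y : L7) w) = w := by
  have h := (mdifferentiable_chart (I := I7) x).symm_comp_deriv hy
  exact DFunLike.congr_fun h w

omit hact in
lemma mfderiv_chart_injective (x : M) {y : M} (hy : y ∈ (ch x).source) :
    Injective (mfderiv I7 I7 (ch x) y : L7) :=
  Function.LeftInverse.injective (mfderiv_chart_symm_comp x hy)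

omit hact in
lemma mfderiv_chart_self (x : M) (w : E7) :
    (mfderiv I7 I7 (ch x) x : L7) w = w := by
  have h := mfderiv_chartAt_eq_tangentCoordChange (I := I7) (mem_chart_source E7 x)
  have h2 : (tangentCoordChange I7 x x x) w = w := tangentCoordChange_self (by simp)
  exact (DFunLike.congr_fun h w).trans h2

omit hact in
lemma mfderiv_chart_symm_self (x : M) (w : E7) :
    (mfderiv I7 I7 (ch x).symm (ch x x) : L7) w = w := by
  have h := mfderiv_chart_symm_comp x (mem_chart_source E7 x) w
  rwa [mfderiv_chart_self] at h

lemma cI_self (x : M) (v : LieT) : cI x (ch x x) v = infAct x v := by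
  rw [← mfderiv_chart_infAct hact x (mem_chart_source E7 x), mfderiv_chart_self]

lemma cI_eq_zero_iff (x : M) {y : M} (hy : y ∈ (ch x).source) (v : LieT) :
    cI x (ch x y) v = 0 ↔ infAct y v = 0 := by
  rw [← mfderiv_chart_infAct hact x hy]
  exact map_eq_zero_iff _ (mfderiv_chart_injective x hy)

lemma mfderiv_chart_symm_cI (x : M) {y : E7} (hy : y ∈ (ch x).target) (v : LieT) :
    (mfderiv I7 I7 (ch x).symm y : L7) (cI x y v) = infAct ((ch x).symm y) v := by
  have h1 := mfderiv_chart_infAct hact x ((ch x).map_target hy) v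
  have h2 := mfderiv_chart_symm_comp x ((ch x).map_target hy)
    (infAct ((ch x).symm y) v)
  rw [h1, (ch x).right_inv hy] at h2
  exact h2

/-! ### Isotropic one-parameter groups -/

omit hact in
lemma adj_gexp_self (t : ℝ) (v w : LieT)
    (h : Commute (imQ v.2) (imQ w.2)) : adj (gexp (t • v)) w = w := by
  have hcomm : Commute (gexp (t • v)).2.1 (imQ w.2) := by
    change Commute (NormedSpace.exp (imQ fun i => -((t • v).2 i / 2))) _
    have : (fun i => -((t • v).2 i / 2)) = (-(t / 2)) • v.2 := by
      ext i; simp; ring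
    rw [this, imQ_smul]
    let _ : NormedAlgebra ℚ ℍ := NormedAlgebra.restrictScalars ℚ ℝ ℍ
    exact (h.smul_left _).exp_left
  refine Prod.ext rfl ?_
  apply imQ_injective
  change imQ (rot (gexp (t • v)).2 w.2) = _
  rw [imQ_rot, hcomm.eq, mul_assoc, SU2.self_mul_star, mul_one]

lemma infAct_eq_zero_of_fixed (h : ∀ t : ℝ, gexp (t • v) • x = x) :
    infAct x v = 0 := by
  rw [← velocity_flow hact, velocity]
  have : (fun t : ℝ => gexp (t • v) • x) = fun _ => x := funext h
  rw [this, mfderiv_const]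
  rfl

/-- A zero of a generating vector field is fixed by its flow. -/
lemma gexp_smul_of_infAct_eq_zero (h : infAct x v = 0) (t : ℝ) :
    gexp (t • v) • x = x := by
  set e := ch x with he
  have hxs : x ∈ e.source := mem_chart_source E7 x
  have hz : ∀ t : ℝ, infAct (gexp (t • v) • x) v = 0 := by
    intro t
    have := dact_infAct hact (gexp (t • v)) x v
    rw [h, map_zero, adj_gexp_self t v v (Commute.refl _)] at this
    exact this.symm
  have hc : Continuous fun t : ℝ => gexp (t • v) • x :=
    continuous_iff_continuousAt.2 fun t => (hasMFDerivAt_flow hact x v t).continuousAt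
  have h0 : gexp ((0 : ℝ) • v) • x = x := by rw [zero_smul, gexp_zero, one_smul]
  have hsrc : ∀ᶠ t in 𝓝 (0 : ℝ), gexp (t • v) • x ∈ e.source := by
    refine hc.continuousAt.eventually_mem ?_
    rw [h0]; exact e.open_source.mem_nhds hxs
  obtain ⟨δ, hδ, hball⟩ := Metric.eventually_nhds_iff_ball.1 hsrc
  have hloc : ∀ t ∈ ball (0 : ℝ) δ, gexp (t • v) • x = x := by
    intro t ht
    have hd : ∀ s ∈ ball (0 : ℝ) δ,
        HasFDerivAt (fun t : ℝ => e (gexp (t • v) • x)) (0 : ℝ →L[ℝ] E7) s := by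
      intro s hs
      have h1 := ((contMDiffAt_chart (hball s hs)).mdifferentiableAt (by simp)).hasMFDerivAt
      have h2 := (h1.comp s (hasMFDerivAt_flow hact x v s))
      refine HasMFDerivAt.hasFDerivAt (h2.congr_mfderiv ?_)
      rw [hz s]
      ext
      have hL : ∀ L : L7, L ((1 : ℝ) • (0 : E7)) = 0 := fun L => by simp
      exact hL _
    have h3 : e (gexp (t • v) • x) = e (gexp ((0 : ℝ) • v) • x) :=
      Metric.isOpen_ball.is_const_of_fderiv_eq_zero (convex_ball (0 : ℝ) δ).isPreconnected
        (fun s hs => (hd s hs).differentiableAt.differentiableWithinAt)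
        (fun s hs => (hd s hs).fderiv) ht (Metric.mem_ball_self hδ)
    rw [h0] at h3
    exact e.injOn (hball t ht) hxs h3
  obtain ⟨n, hn⟩ := exists_nat_gt (|t| / δ)
  have hn0 : (0 : ℝ) < n := lt_of_le_of_lt (by positivity) hn
  have ht : t / n ∈ ball (0 : ℝ) δ := by
    rw [mem_ball_zero_iff, Real.norm_eq_abs, abs_div, Nat.abs_cast, div_lt_iff₀ hn0]
    rwa [div_lt_iff₀ hδ, mul_comm] at hn
  have hpow : ∀ m : ℕ, gexp ((m * (t / n)) • v) • x = x := by
    intro m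
    induction m with
    | zero => simpa using h0
    | succ m ih =>
      have : ((m + 1 : ℕ) : ℝ) * (t / n) = m * (t / n) + t / n := by push_cast; ring
      rw [this, gexp_add_smul, mul_smul (gexp ((m * (t / n)) • v)) _ x, hloc _ ht, ih]
  have := hpow n
  rwa [mul_div_cancel₀ _ hn0.ne'] at this

lemma hasDerivAt_dact (h : infAct x v = 0) (w : E7) :
    HasDerivAt (fun t : ℝ => dact (gexp (t • v)) x w) (lin x v w) 0 := by
  set p : LieT × E7 := (0, ch x x)
  have hfix := gexp_smul_of_infAct_eq_zero hact h
  have hψ := contDiffAt_psi hact x (mem_chart_target E7 x)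
  have hsymm : IsSymmSndFDerivAt ℝ (psi x) p := hψ.isSymmSndFDerivAt
    (by rw [minSmoothness_of_isRCLikeNormedField]; exact ENat.LEInfty.out)
  have h1 : HasFDerivAt (fderiv ℝ (psi x)) (fderiv ℝ (fderiv ℝ (psi x)) p) p :=
    ((hψ.fderiv_right (m := ∞) (by simp)).differentiableAt (by simp)).hasFDerivAt
  have hl : HasDerivAt (fun t : ℝ => (t • v, ch x x)) ((v, 0) : LieT × E7) 0 := by
    have : HasDerivAt (fun t : ℝ => t • v) ((1 : ℝ) • v) 0 := (hasDerivAt_id 0).smul_const v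
    rw [one_smul] at this
    exact this.prodMk (hasDerivAt_const _ _)
  have h1' : HasFDerivAt (fderiv ℝ (psi x)) (fderiv ℝ (fderiv ℝ (psi x)) p)
      ((fun t : ℝ => (t • v, ch x x)) 0) := by
    simpa [p] using h1
  have h2 := h1'.comp_hasDerivAt (0 : ℝ) hl
  have h3 := (ContinuousLinearMap.apply ℝ E7 ((0, w) : LieT × E7)).hasFDerivAt.comp_hasDerivAt
    (0 : ℝ) h2
  have e : lin x v w = (ContinuousLinearMap.apply ℝ E7 ((0, w) : LieT × E7))
      ((fderiv ℝ (fderiv ℝ (psi x)) p) (v, 0)) := by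
    rw [lin_apply]
    exact hsymm.eq _ _
  rw [e]
  refine h3.congr_of_eventuallyEq ?_
  have hd : ∀ᶠ t : ℝ in 𝓝 0, DifferentiableAt ℝ (psi x) (t • v, ch x x) := by
    have hev : ∀ᶠ q in 𝓝 p, DifferentiableAt ℝ (psi x) q :=
      ((hψ.of_le (m := 1) (by simp)).eventually (by simp)).mono
        fun q hq => hq.differentiableAt (by simp)
    have hc := hl.continuousAt
    rw [ContinuousAt, zero_smul] at hc
    exact hc.eventually hev
  filter_upwards [hd] with t ht
  have h4 := HasFDerivAt.comp (g := psi x) (ch x x) ht.hasFDerivAt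
    (hasFDerivAt_prodMk_right (t • v) (ch x x))
  have h5 := h4.unique (hasFDerivAt_actChart hact (hfix t))
  exact DFunLike.congr_fun h5.symm w

lemma hasDerivAt_dact' (h : infAct x v = 0) (w : E7) (t : ℝ) :
    HasDerivAt (fun t : ℝ => dact (gexp (t • v)) x w) (dact (gexp (t • v)) x (lin x v w)) t := by
  have hfix := gexp_smul_of_infAct_eq_zero hact h
  have h1 : HasDerivAt (fun s : ℝ => dact (gexp ((s - t) • v)) x w) (lin x v w) t := by
    have h2 : HasDerivAt (fun t : ℝ => dact (gexp (t • v)) x w) (lin x v w) (t - t) := by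
      rw [sub_self]; exact hasDerivAt_dact hact h w
    exact h2.comp_sub_const t t
  have h3 := (dact (gexp (t • v)) x).hasFDerivAt.comp_hasDerivAt t h1
  refine h3.congr_of_eventuallyEq (.of_forall fun s => ?_)
  have h4 := dact_mul hact (gexp (t • v)) (gexp ((s - t) • v)) x
  rw [← gexp_add_smul, hfix, add_sub_cancel] at h4
  exact DFunLike.congr_fun h4 w

lemma dact_eq_of_lin_eq_zero (h : infAct x v = 0) {w : E7}
    (hw : lin x v w = 0) (t : ℝ) : dact (gexp (t • v)) x w = w := by
  have h1 := is_const_of_deriv_eq_zero (fun t => (hasDerivAt_dact' hact h w t).differentiableAt)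
    (fun t => by rw [(hasDerivAt_dact' hact h w t).deriv, hw, map_zero]) t 0
  simpa [gexp_zero, dact_one] using h1

/-- The linearised isotropy representation is faithful. -/
lemma lin_ne_zero (h : infAct x v = 0)
    {y : M} (hy : infAct y v ≠ 0) : lin x v ≠ 0 := by
  intro h0
  refine hy (infAct_eq_zero_of_fixed hact fun t => ?_)
  refine smul_eq_of_dact_eq_id hact (gexp_smul_of_infAct_eq_zero hact h t) ?_ y
  ext1 w
  exact dact_eq_of_lin_eq_zero hact h (by rw [h0]; rfl) t

lemma lin_infAct_eq_zero {v w : LieT} (h : infAct x v = 0)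
    (hc : Commute (imQ v.2) (imQ w.2)) : lin x v (infAct x w) = 0 := by
  have h1 := hasDerivAt_dact hact h (infAct x w)
  have h2 : (fun t : ℝ => dact (gexp (t • v)) x (infAct x w)) = fun _ => infAct x w := by
    funext t
    rw [dact_infAct hact, gexp_smul_of_infAct_eq_zero hact h, adj_gexp_self t v w hc]
  rw [h2] at h1
  exact h1.unique (hasDerivAt_const _ _)

lemma lin_comm {v w : LieT} (hv : infAct x v = 0) (hw : infAct x w = 0)
    (hc : Commute (imQ v.2) (imQ w.2)) (z : E7) :
    lin x v (lin x w z) = lin x w (lin x v z) := by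
  have hfv := gexp_smul_of_infAct_eq_zero hact hv
  have hfw := gexp_smul_of_infAct_eq_zero hact hw
  have hgc : ∀ s t : ℝ, gexp (s • v) * gexp (t • w) = gexp (t • w) * gexp (s • v) := by
    intro s t
    have hc' : Commute (imQ (s • v).2) (imQ (t • w).2) := by
      simp only [Prod.smul_snd, imQ_smul]
      exact (hc.smul_left _).smul_right _
    rw [← gexp_add_of_commute hc', ← gexp_add_of_commute hc'.symm, add_comm]
  have h1 : ∀ (s t : ℝ) (z : E7), dact (gexp (s • v)) x (dact (gexp (t • w)) x z) =
      dact (gexp (t • w)) x (dact (gexp (s • v)) x z) := by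
    intro s t z
    have e1 := dact_mul hact (gexp (s • v)) (gexp (t • w)) x
    have e2 := dact_mul hact (gexp (t • w)) (gexp (s • v)) x
    rw [hfw] at e1
    rw [hfv, ← hgc, e1] at e2
    exact DFunLike.congr_fun e2 z
  have h2 : ∀ (t : ℝ) (z : E7), lin x v (dact (gexp (t • w)) x z) =
      dact (gexp (t • w)) x (lin x v z) := by
    intro t z
    have e1 := hasDerivAt_dact hact hv (dact (gexp (t • w)) x z)
    have e2 := (dact (gexp (t • w)) x).hasFDerivAt.comp_hasDerivAt (0 : ℝ)
      (hasDerivAt_dact hact hv z)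
    refine e1.unique (e2.congr_of_eventuallyEq (.of_forall fun s => ?_))
    exact h1 s t z
  have e1 := (lin x v).hasFDerivAt.comp_hasDerivAt (0 : ℝ) (hasDerivAt_dact hact hw z)
  have e2 := hasDerivAt_dact hact hw (lin x v z)
  refine e1.unique (e2.congr_of_eventuallyEq (.of_forall fun s => ?_))
  exact h2 s z

def linF (φ : G2Structure M) (x : M) (v : LieT) : E7 →ₗ[ℝ] E7 :=
  ((φ.fi x : L7).comp ((lin x v).comp ((φ.fi x).symm : L7)) : L7)

omit hact in
lemma linF_fi (φ : G2Structure M) (x : M) (v : LieT) (w : E7) :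
    linF φ x v (φ.fi x w) = φ.fi x (lin x v w) := by
  change φ.fi x (lin x v ((φ.fi x).symm (φ.fi x w))) = _
  rw [symm_apply_apply]

lemma isSkewDer_linF {φ : G2Structure M} (hpres : PreservesG2 φ)
    (h : infAct x v = 0) : IsSkewDer (linF φ x v) := by
  have hfix := gexp_smul_of_infAct_eq_zero hact h
  have hR : ∀ u, HasDerivAt (fun t : ℝ => φ.fi x (dact (gexp (t • v)) x ((φ.fi x).symm u)))
      (linF φ x v u) 0 := fun u =>
    (φ.fi x : L7).hasFDerivAt.comp_hasDerivAt (0 : ℝ)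
      (hasDerivAt_dact hact h ((φ.fi x).symm u))
  have hR0 : ∀ u, φ.fi x (dact (gexp ((0 : ℝ) • v)) x ((φ.fi x).symm u)) = u := fun u => by
    rw [zero_smul, gexp_zero, dact_one]; simp
  have hder : ∀ u w, linF φ x v (cross0 u w) =
      cross0 (linF φ x v u) w + cross0 u (linF φ x v w) := by
    intro u w
    have e1 := hR (cross0 u w)
    have hb : IsBoundedBilinearMap ℝ fun p : E7 × E7 => cross0 p.1 p.2 :=
      ((LinearMap.toContinuousLinearMap.toLinearMap.comp crossBilin :
        E7 →ₗ[ℝ] L7).toContinuousLinearMap).isBoundedBilinearMap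
    have e2 := (hb.hasFDerivAt (_, _)).comp_hasDerivAt (0 : ℝ) ((hR u).prodMk (hR w))
    have e3 := e1.unique (e2.congr_of_eventuallyEq (.of_forall fun t => ?_))
    · rw [e3, IsBoundedBilinearMap.deriv_apply, hR0, hR0]
      exact add_comm _ _
    · have := stab_cross (pres_phi0 hpres (gexp (t • v)) x) u w
      rw [hfix] at this
      exact this.symm
  refine ⟨fun u w => ?_, hder⟩
  have e2 := (hR u).inner ℝ (hR w)
  have e3 : (fun t : ℝ => inner ℝ (φ.fi x (dact (gexp (t • v)) x ((φ.fi x).symm u)))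
      (φ.fi x (dact (gexp (t • v)) x ((φ.fi x).symm w)))) = fun _ => inner ℝ u w := by
    funext t
    have := stab_isometry (pres_phi0 hpres (gexp (t • v)) x) u w
    rw [hfix] at this
    exact this
  rw [e3, hR0, hR0] at e2
  have e4 := e2.unique (hasDerivAt_const _ _)
  linarith

/-- Vectors annihilated by the linearisation of `v` are tangent to the zero set of `v`. -/
lemma exists_zeros_of_lin_eq_zero (h : infAct x v = 0) :
    ∃ Y : E7 → E7, HasStrictFDerivAt Y (.id ℝ E7) 0 ∧ Y 0 = ch x x ∧
      ∀ᶠ w in 𝓝 0, lin x v w = 0 → infAct ((ch x).symm (Y w)) v = 0 := by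
  have hfix := gexp_smul_of_infAct_eq_zero hact h
  let S : Subgroup T2SU2 :=
    { carrier := range fun t : ℝ => gexp (t • v)
      mul_mem' := by
        rintro _ _ ⟨s, rfl⟩ ⟨t, rfl⟩
        exact ⟨s + t, gexp_add_smul s t v⟩
      one_mem' := ⟨0, by simp [gexp_zero]⟩
      inv_mem' := by
        rintro _ ⟨s, rfl⟩
        exact ⟨-s, by simp only [neg_smul]; exact gexp_neg _⟩ }
  let K : Subgroup T2SU2 := S.topologicalClosure
  have hKc : IsCompact (K : Set T2SU2) := S.isClosed_topologicalClosure.isCompact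
  have : CompactSpace K := isCompact_iff_compactSpace.1 hKc
  have hKx : ∀ k ∈ (K : Set T2SU2), k • x = x := by
    refine closure_minimal ?_ (isClosed_stab hact x)
    rintro _ ⟨t, rfl⟩
    exact hfix t
  have hmem : ∀ t : ℝ, gexp (t • v) ∈ K := fun t => S.le_topologicalClosure ⟨t, rfl⟩
  set e := ch x with he
  have hex : e x ∈ e.target := mem_chart_target E7 x
  have hsrc := eventually_mem_source hact hKc hKx
    (e.open_source.mem_nhds (mem_chart_source E7 x))
  have hρ : Continuous fun k : K => dact (k : T2SU2) x :=
    (continuousOn_dact hact x).comp_continuous continuous_subtype_val fun k => hKx k k.2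
  obtain ⟨Y, hY, hY0, hYf⟩ := exists_fixed_of_linear_fixed (K := K) hρ
    (F := fun k y => actChart x (k : T2SU2) y) (p := e x)
    (fun k k' w => by
      have h1 := dact_mul hact (k : T2SU2) (k' : T2SU2) x
      rw [hKx k' k'.2] at h1
      exact DFunLike.congr_fun h1 w)
    (fun w => by
      change dact 1 x w = w
      rw [dact_one]; rfl)
    (fun k => actChart_self (hKx k k.2))
    (by
      filter_upwards [e.open_target.mem_nhds hex] with y hy
      change e ((1 : T2SU2) • e.symm y) = y
      rw [one_smul, e.right_inv hy])
    (by
      filter_upwards [hsrc] with y hy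
      exact e.continuousOn.comp_continuous
        ((continuous_smul_left hact (e.symm y)).comp continuous_subtype_val)
        fun k => hy k k.2)
    (by
      filter_upwards [hsrc] with y hy k k'
      change e (((k : T2SU2) * (k' : T2SU2)) • e.symm y) =
        e ((k : T2SU2) • e.symm (e ((k' : T2SU2) • e.symm y)))
      rw [e.left_inv (hy k' k'.2), smul_smul (k : T2SU2) (k' : T2SU2)])
    (fun ε hε => (actChart_strict hact hKc hKx hε).mono fun q hq k => hq k k.2)
  refine ⟨Y, hY, hY0, ?_⟩
  have hYc : Tendsto Y (𝓝 0) (𝓝 (e x)) := by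
    have := hY.continuousAt
    rwa [ContinuousAt, hY0] at this
  filter_upwards [hYf, hYc.eventually hsrc, hYc.eventually (e.open_target.mem_nhds hex)]
    with w h1 h2 h3 hw
  refine infAct_eq_zero_of_fixed hact fun t => ?_
  have hlin : ∀ k : K, dact (k : T2SU2) x w = w := by
    have hcl : IsClosed {k : K | dact (k : T2SU2) x w = w} :=
      isClosed_eq (hρ.clm_apply continuous_const) continuous_const
    have hd : Dense {k : K | ∃ t : ℝ, (k : T2SU2) = gexp (t • v)} := by
      rw [Subtype.dense_iff]
      intro k hk
      refine closure_mono ?_ hk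
      rintro _ ⟨t, rfl⟩
      exact ⟨⟨_, hmem t⟩, ⟨t, rfl⟩, rfl⟩
    intro k
    have : closure {k : K | ∃ t : ℝ, (k : T2SU2) = gexp (t • v)} ⊆
        {k : K | dact (k : T2SU2) x w = w} := by
      refine closure_minimal ?_ hcl
      rintro k ⟨t, ht⟩
      change dact (k : T2SU2) x w = w
      rw [ht]
      exact dact_eq_of_lin_eq_zero hact h hw t
    exact this (hd k)
  have h4 := h1 hlin ⟨_, hmem t⟩
  change e (gexp (t • v) • e.symm (Y w)) = Y w at h4
  have h5 := congrArg e.symm h4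
  rwa [e.left_inv (h2 _ (hmem t))] at h5

end Linearised

/-! ### The form `∗φ(U₁, U₂, ·, ·)` -/

/-- A `G₂` manifold with an action of `T² × SU(2)` of cohomogeneity two and its multi-moment
maps. -/
structure MultiMoment {M : Type*} [TopologicalSpace M] [ChartedSpace E7 M] [MulAction T2SU2 M]
    (φ : G2Structure M) (μ : M → E3) (ν : M → ℝ) : Prop where
  g2 : φ.IsG2Manifold
  act : SmoothAction M
  pres : PreservesG2 φ
  coh : IsCohomogeneityTwo M
  mu : IsMultimomentMu φ μ
  nu : IsMultimomentNu φ ν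

namespace G2Structure

variable (φ : G2Structure M)

/-- `∗φ(U₁, U₂, ·, ·)`. -/
def om (x : M) : E7 →ₗ[ℝ] E7 →ₗ[ℝ] ℝ := φ.stB x (infAct x (tv 0)) (infAct x (tv 1))

lemma om_apply (x : M) (w z : E7) :
    φ.om x w z = φ.st x (infAct x (tv 0)) (infAct x (tv 1)) w z := φ.stB_apply _ _ _ _ _

/-- The span of `U₁`, `U₂` and `U₁ × U₂`. -/
def Kd (x : M) : Submodule ℝ E7 := φ.asp x (infAct x (tv 0)) (infAct x (tv 1))

def Xf (x : M) : E7 := φ.cr x (infAct x (tv 0)) (infAct x (tv 1))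

lemma om_swap (x : M) (w z : E7) : φ.om x z w = -φ.om x w z := by
  rw [om_apply, om_apply, st_swap]

lemma tv_mem_Kd (x : M) (l : Fin 2) : infAct x (tv l) ∈ φ.Kd x := by
  fin_cases l
  exacts [φ.left_mem_asp _ _ _, φ.right_mem_asp _ _ _]

lemma Xf_mem_Kd (x : M) : φ.Xf x ∈ φ.Kd x := φ.cr_mem_asp _ _ _

lemma om_of_mem_Kd {w : E7} (hw : w ∈ φ.Kd x) (z : E7) : φ.om x w z = 0 := by
  have h := assocSpan_le_ker _ _ hw
  rw [om_apply, st, ← starBilin_apply]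
  exact DFunLike.congr_fun (mem_ker.1 h) _

lemma om_of_mem_Kd_right {w : E7} (hw : w ∈ φ.Kd x) (z : E7) : φ.om x z w = 0 := by
  rw [om_swap, φ.om_of_mem_Kd hw, neg_zero]

lemma mem_Kd_iff (h : Uind x) (w : E7) : w ∈ φ.Kd x ↔ ∀ z, φ.om x w z = 0 := by
  simp only [om_apply]
  exact φ.mem_asp_iff_st h w

lemma finrank_Kd (h : Uind x) : finrank ℝ (φ.Kd x) = 3 := φ.finrank_asp h

lemma exists_of_mem_Kd {w : E7} (hw : w ∈ φ.Kd x) :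
    ∃ a b c : ℝ, w = a • infAct x (tv 0) + b • infAct x (tv 1) + c • φ.Xf x := by
  have hw' : φ.fi x w ∈ assocSpan _ _ := hw
  rw [assocSpan, Submodule.mem_span_triple] at hw'
  obtain ⟨a, b, c, h⟩ := hw'
  refine ⟨a, b, c, (φ.fi x).injective ?_⟩
  rw [← h, map_add, map_add, map_smul, map_smul, map_smul, Xf, cr, apply_symm_apply]

lemma exists_of_mem_Kd_of_ph (h : Uind x) {w : E7} (hw : w ∈ φ.Kd x)
    (h0 : φ.ph x (infAct x (tv 0)) (infAct x (tv 1)) w = 0) :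
    ∃ θ : Fin 2 → ℝ, w = infAct x (θ, 0) := by
  obtain ⟨a, b, c, rfl⟩ := φ.exists_of_mem_Kd hw
  have hc : c = 0 := by
    rw [← phL_apply, map_add, map_add, map_smul, map_smul, map_smul, phL_apply, phL_apply,
      phL_apply, ph_left, ph_right] at h0
    simp only [smul_eq_mul, mul_zero, zero_add] at h0
    exact (mul_eq_zero.1 h0).resolve_right (φ.ph_cr_ne_zero h)
  refine ⟨![a, b], ?_⟩
  rw [hc, zero_smul, add_zero, lieT_eq (![a, b], 0)]
  simp only [sv, map_add, map_smul]
  rw [show ((0, 0) : LieT) = 0 from rfl, map_zero, add_zero]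
  rfl

end G2Structure

lemma Uind.eq_zero (h : Uind x) {θ : Fin 2 → ℝ} (h0 : infAct x (θ, 0) = 0) : θ = 0 := by
  rw [lieT_eq (θ, 0)] at h0
  simp only [map_add, map_smul, show sv (0 : R3) = 0 from rfl, add_zero] at h0
  rw [Uind, pair_iff] at h
  have := h _ _ h0
  ext j; fin_cases j
  exacts [this.1, this.2]

lemma uind_of_injective (h : Injective (infAct x)) : Uind x := by
  rw [Uind, pair_iff]
  intro s t hst
  rw [← map_smul, ← map_smul, ← map_add] at hst
  have h1 := h (hst.trans (map_zero _).symm)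
  have h2 := congrArg fst h1
  have e0 := congrFun h2 0
  have e1 := congrFun h2 1
  simp [tv] at e0 e1
  exact ⟨e0, e1⟩

lemma hasMFDerivAt_chart_symm (x : M) :
    HasMFDerivAt I7 I7 (ch x).symm (ch x x) (.id ℝ E7) := by
  refine ((contMDiffAt_chart_symm (mem_chart_target E7 x)).mdifferentiableAt
    (by simp)).hasMFDerivAt.congr_mfderiv ?_
  ext1 w; exact mfderiv_chart_symm_self _ w

lemma hasFDerivAt_mu_chart (hμ : IsMultimomentMu φ μ) (x : M) :
    HasFDerivAt (fun y => μ ((ch x).symm y)) (dmu μ x) (ch x x) :=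
  (HasMFDerivAt.comp (ch x x) (((ch x).left_inv (mem_chart_source E7 x)).symm ▸
    hasMFDerivAt_mu hμ x) (hasMFDerivAt_chart_symm x)).hasFDerivAt

lemma hasFDerivAt_nu_chart (hν : IsMultimomentNu φ ν) (x : M) :
    HasFDerivAt (fun y => ν ((ch x).symm y)) (dnu ν x) (ch x x) :=
  (HasMFDerivAt.comp (ch x x) (((ch x).left_inv (mem_chart_source E7 x)).symm ▸
    hasMFDerivAt_nu hν x) (hasMFDerivAt_chart_symm x)).hasFDerivAt

namespace MultiMoment

variable (S : MultiMoment φ μ ν)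
include S

lemma om_infAct_left (x : M) (v : LieT) (w : E7) :
    φ.om x (infAct x v) w = v.2 ⬝ᵥ (dmu μ x w).ofLp := by
  rw [dmu_apply S.act S.mu, ← φ.om_apply]
  conv_lhs => rw [lieT_eq v]
  simp only [map_add, map_smul, LinearMap.add_apply, LinearMap.smul_apply,
    φ.om_of_mem_Kd (φ.tv_mem_Kd x _), smul_zero, zero_add]

lemma om_infAct (x : M) (v w : LieT) :
    φ.om x (infAct x v) (infAct x w) = -((μ x).ofLp ⬝ᵥ crossProduct v.2 w.2) := by
  rw [← st_sv_sv S.act S.mu, ← φ.om_apply]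
  conv_lhs => rw [lieT_eq v, lieT_eq w]
  simp only [map_add, map_smul, LinearMap.add_apply, LinearMap.smul_apply,
    φ.om_of_mem_Kd (φ.tv_mem_Kd x _), φ.om_of_mem_Kd_right (φ.tv_mem_Kd x _), smul_zero, zero_add]

lemma dmu_infAct (x : M) (v : LieT) :
    (dmu μ x (infAct x v)).ofLp = crossProduct (μ x).ofLp v.2 := by
  have h : ∀ a : R3, a ⬝ᵥ (dmu μ x (infAct x v)).ofLp = a ⬝ᵥ crossProduct (μ x).ofLp v.2 := by
    intro a
    have h1 := S.om_infAct_left x (sv a) (infAct x v)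
    rw [S.om_infAct] at h1
    change _ = a ⬝ᵥ _ at h1
    rw [← h1]
    change -((μ x).ofLp ⬝ᵥ crossProduct a v.2) = _
    simp [dotProduct, Fin.sum_univ_three, cross_apply]
    ring
  ext i
  simpa using h (single i 1)

lemma dnu_infAct (x : M) (v : LieT) : dnu ν x (infAct x v) = 0 := by
  rw [dnu_apply S.act S.nu, ph_infAct S.pres S.act S.nu]

lemma dmu_of_mem_Kd {w : E7} (hw : w ∈ φ.Kd x) : dmu μ x w = 0 := by
  have h : ∀ a : R3, a ⬝ᵥ (dmu μ x w).ofLp = 0 := fun a => by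
    rw [dmu_apply S.act S.mu, ← φ.om_apply, φ.om_of_mem_Kd_right hw]
  ext i
  simpa using h (single i 1)

lemma dnu_Xf (h : Uind x) : dnu ν x (φ.Xf x) ≠ 0 := by
  rw [dnu_apply S.act S.nu]; exact φ.ph_cr_ne_zero h

/-- An element of `𝔰𝔲(2)` with `dμ(·) ⊥ a` moves along the torus. -/
lemma exists_isotropy_of_dot (h : Uind x) {a : R3}
    (ha : ∀ w, a ⬝ᵥ (dmu μ x w).ofLp = 0) : ∃ θ, infAct x (θ, a) = 0 := by
  have h1 : infAct x (sv a) ∈ φ.Kd x := by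
    rw [φ.mem_Kd_iff h]
    intro z
    rw [S.om_infAct_left]
    exact ha z
  obtain ⟨θ, hθ⟩ := φ.exists_of_mem_Kd_of_ph h h1 (ph_infAct S.pres S.act S.nu x _)
  refine ⟨-θ, ?_⟩
  have : ((-θ, a) : LieT) = sv a - (θ, 0) := by simp [sv]
  rw [this, map_sub, hθ, sub_self]

lemma dot_dmu_of_isotropy (hv : infAct x v = 0) (w : E7) :
    v.2 ⬝ᵥ (dmu μ x w).ofLp = 0 := by
  rw [← S.om_infAct_left, hv, map_zero, LinearMap.zero_apply]

lemma cross_mu_of_isotropy (hv : infAct x v = 0) :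
    crossProduct (μ x).ofLp v.2 = 0 := by
  rw [← S.dmu_infAct, hv, map_zero]; rfl

lemma dmu_surjective (h : Injective (infAct x)) :
    Surjective (dmu μ x) := by
  have hU := uind_of_injective h
  by_contra hns
  have hr : LinearMap.range (dmu μ x : E7 →ₗ[ℝ] E3) ≠ ⊤ := fun h1 =>
    hns (LinearMap.range_eq_top.1 h1)
  have hr2 := mt Submodule.orthogonal_eq_bot_iff.1 hr
  obtain ⟨a, ha, ha0⟩ := Submodule.exists_mem_ne_zero_of_ne_bot hr2
  obtain ⟨θ, hθ⟩ := S.exists_isotropy_of_dot hU (a := a.ofLp) fun w => by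
    have := (mem_orthogonal _ _).1 ha (dmu μ x w) ⟨w, rfl⟩
    rw [EuclideanSpace.inner_eq_star_dotProduct] at this
    simpa using this
  have := congrArg snd (h (hθ.trans (map_zero _).symm))
  exact ha0 (by ext i; exact congrFun this i)

lemma mu_ne_zero (h : Injective (infAct x)) : μ x ≠ 0 := by
  intro h0
  have h1 : LinearMap.range (infAct x : LieT →ₗ[ℝ] E7) ≤ ker (dmu μ x : E7 →ₗ[ℝ] E3) := by
    rintro _ ⟨v, rfl⟩
    rw [mem_ker]
    have := S.dmu_infAct x v
    rw [h0] at this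
    ext i
    have h2 := congrFun this i
    simpa using h2
  have h2 := Submodule.finrank_mono h1
  have h3 := LinearMap.finrank_range_add_finrank_ker
    (dmu μ x : E7 →ₗ[ℝ] E3)
  have h4 : LinearMap.range (dmu μ x : E7 →ₗ[ℝ] E3) = ⊤ :=
    LinearMap.range_eq_top.2 (S.dmu_surjective h)
  rw [h4, finrank_top, finrank_euclideanSpace_fin, finrank_euclideanSpace_fin] at h3
  have h5 : finrank ℝ (LinearMap.range (infAct x : LieT →ₗ[ℝ] E7)) = 5 := by
    rw [← orbitDim_eq S.act, orbitDim_eq_five_iff S.act]; exact h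
  omega

lemma exists_injective : ∃ x : M, Injective (infAct x) := by
  obtain ⟨x, hx⟩ := S.coh.1
  exact ⟨x, (orbitDim_eq_five_iff S.act x).1 hx⟩

lemma infAct_sv_mu_notMem (h : Injective (infAct x)) :
    infAct x (sv (μ x).ofLp) ∉ φ.Kd x := by
  intro hm
  obtain ⟨θ, hθ⟩ := φ.exists_of_mem_Kd_of_ph (uind_of_injective h) hm
    (ph_infAct S.pres S.act S.nu x _)
  have := congrArg snd (h hθ)
  exact S.mu_ne_zero h (by ext i; exact congrFun this i)

lemma dact_eq_id (h : Injective (infAct x)) {k : T2SU2} (hk : k • x = x) :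
    dact k x = .id ℝ E7 := by
  let T : Submodule ℝ E7 :=
    (ker ((dact k x : E7 →ₗ[ℝ] E7) - LinearMap.id)).map (φ.fi x : E7 →ₗ[ℝ] E7)
  have hT : ∀ w, φ.fi x w ∈ T ↔ dact k x w = w := by
    intro w
    constructor
    · rintro ⟨w', hw', he⟩
      have : w' = w := (φ.fi x).injective he
      subst this
      exact sub_eq_zero.1 hw'
    · intro hw
      exact ⟨w, sub_eq_zero.2 hw, rfl⟩
  have htv : ∀ l, dact k x (infAct x (tv l)) = infAct x (tv l) := fun l => by
    rw [dact_tv S.act, hk]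
  have hsv : dact k x (infAct x (sv (μ x).ofLp)) = infAct x (sv (μ x).ofLp) := by
    rw [dact_sv S.act, ← mu_smul S.pres S.act S.mu, hk]
  have htop : T = ⊤ := by
    refine eq_top_of_cross_closed ?_ ((hT _).2 (htv 0)) ((hT _).2 (htv 1)) ((hT _).2 hsv)
      (φ.linearIndependent_fi (uind_of_injective h)) (S.infAct_sv_mu_notMem h)
    rintro _ ⟨u, hu, rfl⟩ _ ⟨w, hw, rfl⟩
    have hu' : dact k x u = u := sub_eq_zero.1 hu
    have hw' : dact k x w = w := sub_eq_zero.1 hw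
    have h1 := pres_cr S.pres k x u w
    rw [hk, hu', hw'] at h1
    have h2 := (hT (φ.cr x u w)).2 h1.symm
    rwa [G2Structure.cr, apply_symm_apply] at h2
  ext1 w
  exact (hT w).1 (htop ▸ Submodule.mem_top)

/-- The stabilizer of a point with five-dimensional orbit acts trivially. -/
lemma smul_eq_of_injective (h : Injective (infAct x)) {k : T2SU2}
    (hk : k • x = x) (y : M) : k • y = y :=
  smul_eq_of_dact_eq_id S.act hk (S.dact_eq_id h hk) y

lemma mem_principalSet_iff (x : M) :
    x ∈ (principalSet : Set M) ↔ Injective (infAct x) := by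
  constructor
  · intro hx
    obtain ⟨y, hy⟩ := S.exists_injective
    obtain ⟨g, hg⟩ := hx y
    rw [injective_iff_map_eq_zero]
    intro v hv
    have h1 : ∀ t : ℝ, gexp (t • v) • (g • y) = g • y := fun t =>
      hg (gexp_smul_of_infAct_eq_zero S.act hv t)
    have h2 := infAct_eq_zero_of_fixed S.act h1
    exact injective_infAct_smul S.act hy (h2.trans (map_zero _).symm)
  · intro hx y
    exact ⟨1, fun k hk => S.smul_eq_of_injective hx hk _⟩

/-- A nonzero isotropy direction has nonzero linearisation. -/
lemma lin_ne_zero (hv : infAct x v = 0) (h0 : v ≠ 0) : lin x v ≠ 0 := by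
  obtain ⟨y, hy⟩ := S.exists_injective
  exact _root_.lin_ne_zero S.act hv (y := y) fun h => h0 (hy (h.trans (map_zero _).symm))

lemma linF_ne_zero (hv : infAct x v = 0) (h0 : v ≠ 0) : linF φ x v ≠ 0 := by
  intro h
  refine S.lin_ne_zero hv h0 ?_
  ext1 w
  apply (φ.fi x).injective
  rw [← linF_fi, h]
  simp

lemma lin_tv (hv : infAct x v = 0) (l : Fin 2) :
    lin x v (infAct x (tv l)) = 0 :=
  lin_infAct_eq_zero S.act hv (by simp only [tv]; rw [imQ_zero]; exact Commute.zero_right _)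

lemma lin_eq_zero_iff (h : Uind x) (hv : infAct x v = 0) (h0 : v ≠ 0)
    (w : E7) : lin x v w = 0 ↔ w ∈ φ.Kd x := by
  have h1 := (isSkewDer_linF S.act S.pres hv).ker_eq (S.linF_ne_zero hv h0)
    (u := φ.fi x (infAct x (tv 0))) (v := φ.fi x (infAct x (tv 1)))
    (by rw [linF_fi, S.lin_tv hv, map_zero]) (by rw [linF_fi, S.lin_tv hv, map_zero])
    (φ.linearIndependent_fi h)
  change _ ↔ φ.fi x w ∈ assocSpan _ _
  rw [← h1, mem_ker, linF_fi, map_eq_zero_iff _ (φ.fi x).injective]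

lemma lin_eq_zero_of_mem_Kd (h : Uind x) (hv : infAct x v = 0) (h0 : v ≠ 0)
    {w : E7} (hw : lin x v w ∈ φ.Kd x) : lin x v w = 0 := by
  have h1 := (S.lin_eq_zero_iff h hv h0 _).2 hw
  apply (φ.fi x).injective
  rw [map_zero, ← linF_fi]
  refine (isSkewDer_linF S.act S.pres hv).apply_eq_zero ?_
  rw [linF_fi, linF_fi, h1, map_zero]

lemma isOpen_injective : IsOpen {x : M | Injective (infAct x)} := by
  rw [isOpen_iff_mem_nhds]
  intro x hx
  have h1 : ∀ y ∈ (ch x).source, Injective (infAct y) ↔ Injective (cI x (ch x y)) := by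
    intro y hy
    rw [injective_iff_map_eq_zero, injective_iff_map_eq_zero]
    simp only [cI_eq_zero_iff S.act x hy]
  have hxs := mem_chart_source E7 x
  have h2 : ContinuousAt (fun y => cI x (ch x y)) x := ContinuousAt.comp (f := ch x) (g := cI x)
      (((contDiffOn_cI S.act x).continuousOn).continuousAt
        ((ch x).open_target.mem_nhds (mem_chart_target E7 x)))
      ((ch x).continuousAt hxs)
  have h3 : IsOpen {L : LieT →L[ℝ] E7 | Injective L} := ContinuousLinearMap.isOpen_injective
  filter_upwards [h2.eventually_mem (h3.mem_nhds ((h1 x hxs).1 hx)),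
    (ch x).open_source.mem_nhds hxs] with y hy hys
  exact (h1 y hys).2 hy

lemma isOpen_Uind : IsOpen {x : M | Uind x} := by
  rw [isOpen_iff_mem_nhds]
  intro x hx
  have h1 : ∀ y ∈ (ch x).source, (Uind y ↔ LinearIndependent ℝ
      ![cI x (ch x y) (tv 0), cI x (ch x y) (tv 1)]) := by
    intro y hy
    rw [Uind, pair_iff, pair_iff]
    simp only [← map_smul, ← map_add, cI_eq_zero_iff S.act x hy]
  have hxs := mem_chart_source E7 x
  have h2 : ContinuousAt (fun y => cI x (ch x y)) x := ContinuousAt.comp (f := ch x) (g := cI x)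
      (((contDiffOn_cI S.act x).continuousOn).continuousAt
        ((ch x).open_target.mem_nhds (mem_chart_target E7 x)))
      ((ch x).continuousAt hxs)
  have h4 : ContinuousAt (fun y => ![cI x (ch x y) (tv 0), cI x (ch x y) (tv 1)])
      x := by
    refine continuousAt_pi.2 fun i => ?_
    fin_cases i
    exacts [h2.clm_apply continuousAt_const, h2.clm_apply continuousAt_const]
  have h3 := isOpen_setOfPred_linearIndependent (𝕜 := ℝ) (ι := Fin 2) (E := E7)
  filter_upwards [h4.eventually_mem (h3.mem_nhds ((h1 x hxs).1 hx)),
    (ch x).open_source.mem_nhds hxs] with y hy hys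
  exact (h1 y hys).2 hy

/-- The kernel of the action projects into `{±1}`. -/
lemma rot_of_mem_gammaTwo {s : SU2} (hs : s ∈ gammaTwo M) (a : R3) : rot s a = a := by
  obtain ⟨⟨t, s⟩, hk, rfl⟩ := hs
  have hk' : ∀ y : M, ((t, s) : T2SU2) • y = y := fun y => congrArg (fun f : Equiv.Perm M => f y) hk
  obtain ⟨x, hx⟩ := S.exists_injective
  have h1 := dact_sv S.act (t, s) x a
  rw [hk', S.dact_eq_id hx (hk' x)] at h1
  exact (congrArg snd (hx h1)).symm

end MultiMoment

variable (S : MultiMoment φ μ ν)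

/-! ### The multi-moment map in charts -/

lemma exists_smul_of_cross_eq_zero {a n : R3} (hn : n ≠ 0)
    (h : crossProduct a n = 0) : ∃ c : ℝ, a = c • n := by
  have e0 := congrFun h 0
  have e1 := congrFun h 1
  have e2 := congrFun h 2
  simp [cross_apply] at e0 e1 e2
  obtain ⟨i, hi⟩ : ∃ i, n i ≠ 0 := by
    by_contra! hi; exact hn (funext hi)
  refine ⟨a i / n i, ?_⟩
  ext j
  simp only [Pi.smul_apply, smul_eq_mul]
  rw [div_mul_eq_mul_div, eq_div_iff hi]
  fin_cases i <;> fin_cases j <;> simp <;> linarith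

lemma contDiffAt_alternating_apply {E : Type*} [NormedAddCommGroup E] [NormedSpace ℝ E] {k : ℕ}
    {T : E → E7 [⋀^Fin k]→L[ℝ] ℝ} {m : E → Fin k → E7} {z : E} (hT : ContDiffAt ℝ ∞ T z)
    (hm : ContDiffAt ℝ ∞ m z) : ContDiffAt ℝ ∞ (fun z => T z (m z)) z := by
  let f : (E7 [⋀^Fin k]→L[ℝ] ℝ) →L[ℝ] ContinuousMultilinearMap ℝ (fun _ : Fin k => E7) ℝ :=
    ContinuousAlternatingMap.toContinuousMultilinearMapCLM ℝ
  have h : AnalyticAt ℝ (fun p : (E7 [⋀^Fin k]→L[ℝ] ℝ) × (Fin k → E7) => f p.1 p.2) (T z, m z) :=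
    f.analyticAt_uncurry_of_multilinear
  exact h.contDiffAt.comp (f := fun z => (T z, m z)) z (hT.prodMk hm)

def dsy (x : M) (y : E7) : L7 := mfderiv I7 I7 (ch x).symm y

def omC (φ : G2Structure M) (x : M) (y w z : E7) : ℝ :=
  (formInChart φ.star (ch x) y : E7 [⋀^Fin 4]→L[ℝ] ℝ)
    ![cI x y (tv 0), cI x y (tv 1), w, z]

lemma omC_eq (hact : SmoothAction M) (x : M) {y : E7} (hy : y ∈ (ch x).target)
    (w z : E7) : omC φ x y w z = φ.om ((ch x).symm y) (dsy x y w) (dsy x y z) := by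
  have h0 : dsy x y (cI x y (tv 0)) = infAct ((ch x).symm y) (tv 0) :=
    mfderiv_chart_symm_cI hact x hy (tv 0)
  have h1 : dsy x y (cI x y (tv 1)) = infAct ((ch x).symm y) (tv 1) :=
    mfderiv_chart_symm_cI hact x hy (tv 1)
  have h2 : omC φ x y w z = (φ.star ((ch x).symm y) : E7 [⋀^Fin 4]→L[ℝ] ℝ)
      (fun i => dsy x y ((![cI x y (tv 0), cI x y (tv 1), w, z] : Fin 4 → E7) i)) := rfl
  have h3 : (fun i => dsy x y ((![cI x y (tv 0), cI x y (tv 1), w, z] : Fin 4 → E7) i)) =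
      ![infAct ((ch x).symm y) (tv 0), infAct ((ch x).symm y) (tv 1), dsy x y w, dsy x y z] := by
    ext1 i
    fin_cases i
    exacts [h0, h1, rfl, rfl]
  rw [h2, h3, φ.om_apply]
  exact φ.star_eq _ _ _ _ _

namespace MultiMoment

include S

lemma contDiffAt_omC {E : Type*} [NormedAddCommGroup E] [NormedSpace ℝ E]
    {f g h : E → E7} {p : E} (hp : f p ∈ (ch x).target) (hf : ContDiffAt ℝ ∞ f p)
    (hg : ContDiffAt ℝ ∞ g p) (hh : ContDiffAt ℝ ∞ h p) :
    ContDiffAt ℝ ∞ (fun p => omC φ x (f p) (g p) (h p)) p := by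
  have hn := (ch x).open_target.mem_nhds hp
  have h1 := ((S.g2.2.1 x).contDiffAt hn).comp p hf
  have h2 := ((contDiffOn_cI S.act x).contDiffAt hn).comp p hf
  refine contDiffAt_alternating_apply h1 (contDiffAt_pi.2 fun i => ?_)
  fin_cases i
  · exact h2.clm_apply contDiffAt_const
  · exact h2.clm_apply contDiffAt_const
  · exact hg
  · exact hh

lemma contDiffOn_mu (x : M) :
    ContDiffOn ℝ ∞ (fun y => μ ((ch x).symm y)) (ch x).target := by
  rw [← contMDiffOn_iff_contDiffOn]
  exact S.mu.smooth.comp_contMDiffOn contMDiffOn_chart_symm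

lemma fderiv_mu (x : M) {y : E7} (hy : y ∈ (ch x).target) (z : E7) :
    fderiv ℝ (fun y => μ ((ch x).symm y)) y z = dmu μ ((ch x).symm y) (dsy x y z) := by
  have h1 := ((contMDiffAt_chart_symm hy).mdifferentiableAt (by simp)).hasMFDerivAt
  have h2 : HasFDerivAt (fun y => μ ((ch x).symm y))
      ((dmu μ ((ch x).symm y)).comp (dsy x y)) y :=
    ((hasMFDerivAt_mu S.mu ((ch x).symm y)).comp y h1).hasFDerivAt
  exact DFunLike.congr_fun h2.fderiv z

lemma dot_fderiv_mu (x : M) {y : E7} (hy : y ∈ (ch x).target) (v : LieT) (z : E7) :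
    v.2 ⬝ᵥ (fderiv ℝ (fun y => μ ((ch x).symm y)) y z).ofLp = omC φ x y (cI x y v) z := by
  rw [S.fderiv_mu x hy, omC_eq S.act x hy, ← S.om_infAct_left]
  rw [← mfderiv_chart_symm_cI S.act x hy]
  rfl

omit S in
lemma contDiffAt_dot {E : Type*} [NormedAddCommGroup E] [NormedSpace ℝ E] {p : E}
    {a : E → E3} (n : R3) (ha : ContDiffAt ℝ ∞ a p) :
    ContDiffAt ℝ ∞ (fun p => n ⬝ᵥ (a p).ofLp) p := by
  have : (fun p => n ⬝ᵥ (a p).ofLp) = fun p => inner ℝ (WithLp.toLp 2 n) (a p) := by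
    funext p
    rw [EuclideanSpace.inner_eq_star_dotProduct]
    simp [dotProduct_comm]
  rw [this]
  exact contDiffAt_const.inner ℝ ha

lemma contDiffAt_dot_fderiv_mu (x : M) {y : E7} (hy : y ∈ (ch x).target)
    (n : R3) (z : E7) : ContDiffAt ℝ ∞
      (fun y => n ⬝ᵥ (fderiv ℝ (fun y => μ ((ch x).symm y)) y z).ofLp) y :=
  contDiffAt_dot n ((((S.contDiffOn_mu x).contDiffAt
    ((ch x).open_target.mem_nhds hy)).fderiv_right (m := ∞) (by simp)).clm_apply
      contDiffAt_const)

omit S in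
lemma omC_zero (φ : G2Structure M) (x : M) (y z : E7) : omC φ x y 0 z = 0 :=
  (formInChart φ.star (ch x) y : E7 [⋀^Fin 4]→L[ℝ] ℝ).map_coord_zero 2 rfl

omit S in
lemma omC_self (hact : SmoothAction M) (x : M) (w z : E7) :
    omC φ x (ch x x) w z = φ.om x w z := by
  rw [omC_eq hact x (mem_chart_target E7 x), (ch x).left_inv (mem_chart_source E7 x)]
  have h := mfderiv_chart_symm_self x
  have h' : ∀ w, dsy x (ch x x) w = w := h
  rw [h', h']

/-- The Hessian of `n · μ` in a chart at a point where `V_n` is tangent to the torus. -/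
lemma hasFDerivAt_dot_fderiv_mu (hv : infAct x v = 0) (z : E7) :
    HasFDerivAt (fun y => v.2 ⬝ᵥ (fderiv ℝ (fun y => μ ((ch x).symm y)) y z).ofLp)
      ((toContinuousLinearMap ((φ.om x).flip z)).comp (lin x v)) (ch x x) := by
  set e := ch x
  have hex : e x ∈ e.target := mem_chart_target E7 x
  have hP : ContDiffAt ℝ ∞ (fun p : E7 × E7 => omC φ x p.1 p.2 z) (e x, 0) :=
    S.contDiffAt_omC (f := fst) hex contDiffAt_fst contDiffAt_snd contDiffAt_const
  have hP' := (hP.differentiableAt (by simp)).hasFDerivAt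
  set P' := fderiv ℝ (fun p : E7 × E7 => omC φ x p.1 p.2 z) (e x, 0)
  have h1 : ∀ w, P' (w, 0) = 0 := by
    intro w
    have a1 := HasFDerivAt.comp (g := fun p : E7 × E7 => omC φ x p.1 p.2 z) (e x) hP'
      (hasFDerivAt_prodMk_left (𝕜 := ℝ) (e x) (0 : E7))
    have a2 : ((fun p : E7 × E7 => omC φ x p.1 p.2 z) ∘ fun y => (y, (0 : E7))) = fun _ => 0 := by
      funext y; exact omC_zero φ x y z
    rw [a2] at a1
    exact DFunLike.congr_fun (a1.unique (hasFDerivAt_const _ _)) w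
  have h2 : ∀ w, P' (0, w) = φ.om x w z := by
    intro w
    have a1 := HasFDerivAt.comp (g := fun p : E7 × E7 => omC φ x p.1 p.2 z) (0 : E7) hP'
      (hasFDerivAt_prodMk_right (𝕜 := ℝ) (e x) (0 : E7))
    have a2 : ((fun p : E7 × E7 => omC φ x p.1 p.2 z) ∘ fun w => (e x, w)) =
        toContinuousLinearMap ((φ.om x).flip z) := by
      funext w; exact omC_self S.act x w z
    rw [a2] at a1
    exact DFunLike.congr_fun (a1.unique (ContinuousLinearMap.hasFDerivAt _)) w
  have hc := hasFDerivAt_cI S.act x v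
  have hc0 : cI x (e x) v = 0 := by rw [cI_self S.act, hv]
  have hP2 : HasFDerivAt (fun p : E7 × E7 => omC φ x p.1 p.2 z) P' (e x, cI x (e x) v) := by
    rw [hc0]; exact hP'
  have h3 := HasFDerivAt.comp (g := fun p : E7 × E7 => omC φ x p.1 p.2 z) (e x) hP2
    ((hasFDerivAt_id (e x)).prodMk hc)
  have h4 : P'.comp ((ContinuousLinearMap.id ℝ E7).prod (lin x v)) =
      (toContinuousLinearMap ((φ.om x).flip z)).comp (lin x v) := by
    ext1 w
    change P' (w, lin x v w) = φ.om x (lin x v w) z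
    rw [← h2]
    have : ((w, lin x v w) : E7 × E7) = (w, 0) + (0, lin x v w) := by simp
    rw [this, map_add, h1, zero_add]
  rw [h4] at h3
  refine h3.congr_of_eventuallyEq ?_
  filter_upwards [e.open_target.mem_nhds hex] with y hy
  exact S.dot_fderiv_mu x hy v z

/-! ### Density of the points with five-dimensional orbit -/

lemma om_lin_eq_zero (h : Uind x) (hv : infAct x v = 0) (h0 : v ≠ 0)
    {w : E7} (hw : ∀ z, φ.om x (lin x v w) z = 0) : w ∈ φ.Kd x := by
  rw [← S.lin_eq_zero_iff h hv h0]
  exact S.lin_eq_zero_of_mem_Kd h hv h0 ((φ.mem_Kd_iff h _).2 hw)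

omit S in
lemma exists_isotropy (h : Uind x) (hs : ¬ Injective (infAct x)) :
    ∃ v : LieT, infAct x v = 0 ∧ v.2 ≠ 0 := by
  rw [injective_iff_map_eq_zero] at hs
  push Not at hs
  obtain ⟨v, hv, hv0⟩ := hs
  refine ⟨v, hv, fun h2 => hv0 ?_⟩
  have : v = (v.1, 0) := Prod.ext rfl h2
  rw [this] at hv ⊢
  rw [h.eq_zero hv]; rfl

/-- The isotropy at a singular point with independent `U`'s is spanned by the direction of `μ`. -/
lemma exists_isotropy_mu (h : Uind x) (hs : ¬ Injective (infAct x)) :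
    ∃ θ, infAct x (θ, (μ x).ofLp) = 0 := by
  obtain ⟨v, hv, hv0⟩ := exists_isotropy h hs
  have h1 := S.cross_mu_of_isotropy hv
  refine S.exists_isotropy_of_dot h fun w => ?_
  have h2 := S.dot_dmu_of_isotropy hv w
  obtain ⟨c, hc⟩ := exists_smul_of_cross_eq_zero hv0 h1
  rw [hc, smul_dotProduct, h2, smul_zero]

lemma exists_injective_of_Uind {O : Set M} (hO : IsOpen O) (hx : x ∈ O) (hU : Uind x) :
    ∃ y ∈ O, Injective (infAct y) := by
  by_contra! hns
  -- shrink to the locus of independent `U`'s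
  set O₁ := O ∩ {y | Uind y} with hO₁
  have hO₁o : IsOpen O₁ := hO.inter S.isOpen_Uind
  by_cases hμ : ∃ y ∈ O₁, μ y ≠ 0
  · obtain ⟨y, ⟨hyO, hyU⟩, hyμ⟩ := hμ
    set e := ch y
    have hye : e y ∈ e.target := mem_chart_target E7 y
    have hys : y ∈ e.source := mem_chart_source E7 y
    set F : E7 → E3 := fun q => μ (e.symm q) with hF
    have hFy : F (e y) = μ y := by simp only [hF]; rw [e.left_inv hys]
    have hev : ∀ᶠ q in 𝓝 (e y), q ∈ e.target ∧ e.symm q ∈ O₁ ∧ μ (e.symm q) ≠ 0 := by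
      have hc : Tendsto e.symm (𝓝 (e y)) (𝓝 y) := by
        have := e.continuousAt_symm hye
        rwa [ContinuousAt, e.left_inv hys] at this
      have hμo : IsOpen {y | μ y ≠ 0} := isOpen_ne_fun S.mu.smooth.continuous continuous_const
      filter_upwards [e.open_target.mem_nhds hye, hc.eventually (hO₁o.mem_nhds ⟨hyO, hyU⟩),
        hc.eventually (hμo.mem_nhds hyμ)] with q h1 h2 h3
      exact ⟨h1, h2, h3⟩
    have hzero : ∀ z, ∀ᶠ q in 𝓝 (e y), inner ℝ (F q) (fderiv ℝ F q z) = (0 : ℝ) := by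
      intro z
      filter_upwards [hev] with q hq
      obtain ⟨θ, hθ⟩ := S.exists_isotropy_mu hq.2.1.2 (hns _ hq.2.1.1)
      rw [S.fderiv_mu y hq.1]
      have := S.dot_dmu_of_isotropy hθ (dsy y q z)
      rw [EuclideanSpace.inner_eq_star_dotProduct]
      simpa [dotProduct_comm] using this
    obtain ⟨θ, hθ⟩ := S.exists_isotropy_mu hyU (hns _ hyO)
    have hv0 : ((θ, (μ y).ofLp) : LieT) ≠ 0 := by
      intro h
      have := congrArg snd h
      exact hyμ (by ext i; exact congrFun this i)
    have hle : ker (dmu μ y : E7 →ₗ[ℝ] E3) ≤ φ.Kd y := by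
      intro w hw
      refine S.om_lin_eq_zero hyU hθ hv0 fun z => ?_
      have hFd : ContDiffAt ℝ ∞ F (e y) :=
        (S.contDiffOn_mu y).contDiffAt (e.open_target.mem_nhds hye)
      have a1 : HasFDerivAt F (fderiv ℝ F (e y)) (e y) :=
        (hFd.differentiableAt (by simp)).hasFDerivAt
      have a2 : DifferentiableAt ℝ (fun q => fderiv ℝ F q z) (e y) :=
        ((hFd.fderiv_right (m := ∞) (by simp)).clm_apply contDiffAt_const).differentiableAt
          (by simp)
      have a3 := a1.inner ℝ a2.hasFDerivAt
      have a4 := (a3.congr_of_eventuallyEq (f₁ := fun _ => (0 : ℝ))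
        ((hzero z).mono fun q hq => hq.symm)).unique (hasFDerivAt_const _ _)
      have a5 := DFunLike.congr_fun a4 w
      have a6 : fderiv ℝ F (e y) w = 0 := by
        rw [S.fderiv_mu y hye]
        have e1 : dsy y (e y) w = w := mfderiv_chart_symm_self y w
        rw [e1, e.left_inv hys]
        exact hw
      have a7 : inner ℝ (F (e y)) (fderiv ℝ (fun q => fderiv ℝ F q z) (e y) w) = (0 : ℝ) := by
        simpa [fderivInnerCLM_apply, a6] using a5
      have a8 := S.hasFDerivAt_dot_fderiv_mu hθ z
      have a9 : (fun q => ((μ y).ofLp) ⬝ᵥ (fderiv ℝ F q z).ofLp) =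
          fun q => inner ℝ (μ y) (fderiv ℝ F q z) := by
        funext q
        rw [EuclideanSpace.inner_eq_star_dotProduct]
        simp [dotProduct_comm]
      have a10 := (hasFDerivAt_const (μ y) (e y)).inner ℝ a2.hasFDerivAt
      have a11 := a8.unique (by
        change HasFDerivAt (fun q => ((μ y).ofLp) ⬝ᵥ (fderiv ℝ F q z).ofLp) _ _
        rw [a9]; exact a10)
      have a12 := DFunLike.congr_fun a11 w
      rw [hFy] at a7
      simpa [fderivInnerCLM_apply, a7] using a12
    have hd1 := Submodule.finrank_mono hle
    have hd2 := LinearMap.finrank_range_add_finrank_ker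
      (dmu μ y : E7 →ₗ[ℝ] E3)
    have hd3 := Submodule.finrank_le
      (LinearMap.range (dmu μ y : E7 →ₗ[ℝ] E3))
    rw [φ.finrank_Kd hyU] at hd1
    rw [finrank_euclideanSpace_fin] at hd2 hd3
    omega
  · push Not at hμ
    have hx₁ : x ∈ O₁ := ⟨hx, hU⟩
    obtain ⟨v, hv, hv2⟩ := exists_isotropy hU (hns x hx)
    have hv0 : v ≠ 0 := fun h => hv2 (by rw [h]; rfl)
    set e := ch x
    have hxe : e x ∈ e.target := mem_chart_target E7 x
    have hxs : x ∈ e.source := mem_chart_source E7 x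
    have hev : ∀ᶠ q in 𝓝 (e x), μ (e.symm q) = 0 := by
      have hc : Tendsto e.symm (𝓝 (e x)) (𝓝 x) := by
        have := e.continuousAt_symm hxe
        rwa [ContinuousAt, e.left_inv hxs] at this
      filter_upwards [hc.eventually (hO₁o.mem_nhds hx₁)] with q hq
      exact hμ _ hq
    have hle : (⊤ : Submodule ℝ E7) ≤ φ.Kd x := by
      intro w _
      refine S.om_lin_eq_zero hU hv hv0 fun z => ?_
      have a1 := S.hasFDerivAt_dot_fderiv_mu hv z
      have a2 : ∀ᶠ q in 𝓝 (e x), v.2 ⬝ᵥ (fderiv ℝ (fun y => μ (e.symm y)) q z).ofLp = 0 := by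
        filter_upwards [hev.eventually_nhds] with q hq
        have : fderiv ℝ (fun y => μ (e.symm y)) q = 0 := by
          rw [Filter.EventuallyEq.fderiv_eq (f := fun _ => 0) hq]
          simp
        rw [this]; simp
      have a3 := (a1.congr_of_eventuallyEq (f₁ := fun _ => (0 : ℝ))
        (a2.mono fun q hq => hq.symm)).unique (hasFDerivAt_const _ _)
      exact DFunLike.congr_fun a3 w
    have hd1 := Submodule.finrank_mono hle
    rw [φ.finrank_Kd hU, finrank_top, finrank_euclideanSpace_fin] at hd1
    omega

end MultiMoment

/-! ### Points where the torus generators are dependent -/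

lemma commute_of_left {v w : LieT} (h : v.2 = 0) :
    Commute (imQ v.2) (imQ w.2) := by
  rw [h, imQ_zero]; exact Commute.zero_left _

lemma exists_torus_isotropy (h : ¬ Uind x) :
    ∃ ξ : LieT, ξ.2 = 0 ∧ ξ ≠ 0 ∧ infAct x ξ = 0 := by
  rw [Uind, pair_iff] at h
  push Not at h
  obtain ⟨s, t, h1, h2⟩ := h
  refine ⟨s • tv 0 + t • tv 1, by simp [tv], fun h0 => ?_, by simpa using h1⟩
  have e := congrArg fst h0
  have e0 := congrFun e 0
  have e1 := congrFun e 1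
  simp [tv] at e0 e1
  exact h2 e0 e1

/-- The subspace of vectors annihilated by a nonzero derivation has dimension at most three. -/
lemma IsSkewDer.finrank_ker_le {A : E7 →ₗ[ℝ] E7} (hA : IsSkewDer A) (h0 : A ≠ 0) :
    finrank ℝ (ker A) ≤ 3 := by
  by_contra! h
  have h1 : 1 < finrank ℝ (ker A) := by omega
  obtain ⟨u, hu⟩ : ∃ u : ker A, u ≠ 0 := by
    have : Nontrivial (ker A) := Module.nontrivial_of_finrank_pos (R := ℝ) (by omega)
    exact exists_ne 0
  obtain ⟨v, hv⟩ := exists_linearIndependent_pair_of_one_lt_finrank h1 hu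
  have hi : LinearIndependent ℝ ![(u : E7), (v : E7)] := by
    rw [pair_iff] at hv ⊢
    intro s t hst
    exact hv s t (Subtype.ext hst)
  have h2 := hA.ker_eq h0 u.2 v.2 hi
  rw [h2, finrank_assocSpan hi] at h
  omega

namespace MultiMoment

include S

lemma linF_add (φ : G2Structure M) (x : M) (v w : LieT) :
    linF φ x (v + w) = linF φ x v + linF φ x w := by
  ext1 z
  change φ.fi x (lin x (v + w) _) = φ.fi x (lin x v _) + φ.fi x (lin x w _)
  rw [lin_add, ← map_add]; rfl

lemma linF_smul (φ : G2Structure M) (x : M) (c : ℝ) (v : LieT) :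
    linF φ x (c • v) = c • linF φ x v := by
  ext1 z
  change φ.fi x (lin x (c • v) _) = c • φ.fi x (lin x v _)
  rw [lin_smul, ← map_smul]; rfl

lemma linF_comm {v w : LieT} (hv : infAct x v = 0) (hw : infAct x w = 0)
    (hc : Commute (imQ v.2) (imQ w.2)) (z : E7) :
    linF φ x v (linF φ x w z) = linF φ x w (linF φ x v z) := by
  obtain ⟨z, rfl⟩ := (φ.fi x).surjective z
  rw [linF_fi, linF_fi, linF_fi, linF_fi, lin_comm S.act hv hw hc]

lemma linF_infAct {v w : LieT} (hv : infAct x v = 0)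
    (hc : Commute (imQ v.2) (imQ w.2)) :
    linF φ x v (φ.fi x (infAct x w)) = 0 := by
  rw [linF_fi, lin_infAct_eq_zero S.act hv hc, map_zero]

lemma eq_zero_of_linF (hv : infAct x v = 0) (h : linF φ x v = 0) : v = 0 := by
  by_contra h0
  exact S.linF_ne_zero hv h0 h

lemma exists_tv_ne_zero (x : M) : ∃ l, infAct x (tv l) ≠ 0 := by
  by_contra! h
  have hc : ∀ (l : Fin 2) (w : LieT), Commute (imQ (tv l).2) (imQ w.2) :=
    fun l w => commute_of_left rfl
  have hd0 := isSkewDer_linF S.act S.pres (h 0)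
  have hd1 := isSkewDer_linF S.act S.pres (h 1)
  have hcomm := S.linF_comm (h 0) (h 1) (hc 0 _)
  have htv : ∀ a b : ℝ, a • tv 0 + b • tv 1 = 0 → a = 0 ∧ b = 0 := by
    intro a b hab
    have e := congrArg fst hab
    have e0 := congrFun e 0
    have e1 := congrFun e 1
    simp [tv] at e0 e1
    exact ⟨e0, e1⟩
  by_cases hV : ∃ a : R3, a ≠ 0 ∧ infAct x (sv a) = 0
  · obtain ⟨a, ha, hV⟩ := hV
    obtain ⟨p, q, r, hne, hsum⟩ := hd0.dependent_three hd1 (isSkewDer_linF S.act S.pres hV) hcomm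
      (S.linF_comm (h 0) hV (hc 0 _)) (S.linF_comm (h 1) hV (hc 1 _))
    have h1 : p • tv 0 + q • tv 1 + r • sv a = 0 := by
      refine S.eq_zero_of_linF (x := x) (by simp [h, hV]) ?_
      rw [S.linF_add, S.linF_add, S.linF_smul, S.linF_smul, S.linF_smul, hsum]
    have h2 : r • a = 0 := by simpa [tv, sv] using congrArg snd h1
    have hr : r = 0 := (smul_eq_zero.1 h2).resolve_right ha
    rw [hr, zero_smul, add_zero] at h1
    obtain ⟨hp, hq⟩ := htv _ _ h1
    exact hne (by simp [hp, hq, hr])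
  · push Not at hV
    have hi : LinearIndependent ℝ ![infAct x (sv (single 0 1)), infAct x (sv (single 1 1))] := by
      rw [pair_iff]
      intro s t hst
      have h1 : infAct x (sv (s • single 0 1 + t • single 1 1)) = 0 := by
        rw [sv_add, sv_smul, sv_smul, map_add, map_smul, map_smul, hst]
      have h2 : s • (single 0 1 : R3) + t • single 1 1 = 0 := by
        by_contra h3
        exact hV _ h3 h1
      have e0 := congrFun h2 0
      have e1 := congrFun h2 1
      simp at e0 e1
      exact ⟨e0, e1⟩
    rcases hd0.dependent_of_ker hd1 hcomm (S.linF_infAct (h 0) (hc 0 _))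
      (S.linF_infAct (h 0) (hc 0 _)) (S.linF_infAct (h 1) (hc 1 _))
      (S.linF_infAct (h 1) (hc 1 _)) (φ.linearIndependent_fi hi) with h1 | ⟨t, h1⟩
    · have h2 := S.eq_zero_of_linF (h 0) h1
      have := congrFun (congrArg fst h2) 0
      simp [tv] at this
    · have h2 : (-t) • tv 0 + (1 : ℝ) • tv 1 = 0 := by
        refine S.eq_zero_of_linF (x := x) (by simp [h]) ?_
        rw [S.linF_add, S.linF_smul, S.linF_smul, h1]; simp
      exact one_ne_zero (htv _ _ h2).2

lemma linearIndependent_lin (hv : infAct x v = 0) {w u : E7}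
    (hw : lin x v w ≠ 0) (hu : u ≠ 0) (hvu : lin x v u = 0) :
    LinearIndependent ℝ ![lin x v w, u] := by
  have hd := isSkewDer_linF S.act S.pres hv
  have h1 : inner ℝ (φ.fi x (lin x v w)) (φ.fi x u) = (0 : ℝ) := by
    rw [← linF_fi, hd.skew, linF_fi, hvu, map_zero, inner_zero_right, neg_zero]
  rw [pair_iff]
  intro s t hst
  have h2 := congrArg (φ.fi x) hst
  rw [map_add, map_smul, map_smul, map_zero] at h2
  have h3 : inner ℝ (φ.fi x (lin x v w)) (s • φ.fi x (lin x v w) + t • φ.fi x u) = (0 : ℝ) := by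
    rw [h2, inner_zero_right]
  have h4 : inner ℝ (φ.fi x u) (s • φ.fi x (lin x v w) + t • φ.fi x u) = (0 : ℝ) := by
    rw [h2, inner_zero_right]
  rw [inner_add_right, inner_smul_right, inner_smul_right, h1, mul_zero, add_zero] at h3
  rw [inner_add_right, inner_smul_right, inner_smul_right, real_inner_comm, h1, mul_zero,
    zero_add] at h4
  constructor
  · refine (mul_eq_zero.1 h3).resolve_right fun h => hw ?_
    exact (φ.fi x).injective ((inner_self_eq_zero.1 h).trans (map_zero _).symm)
  · refine (mul_eq_zero.1 h4).resolve_right fun h => hu ?_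
    exact (φ.fi x).injective ((inner_self_eq_zero.1 h).trans (map_zero _).symm)

/-- At a point with dependent torus generators there is an isotropy direction which is not
tangent to the torus. -/
lemma exists_isotropy_of_not_Uind (h : ¬ Uind x) :
    ∃ η : LieT, infAct x η = 0 ∧ η.2 ≠ 0 := by
  obtain ⟨ξ, hξ2, hξ0, hξ⟩ := exists_torus_isotropy h
  obtain ⟨l, hl⟩ := S.exists_tv_ne_zero x
  have hd := isSkewDer_linF S.act S.pres hξ
  have hk := hd.finrank_ker_le (S.linF_ne_zero hξ hξ0)
  let L : ℝ × R3 →ₗ[ℝ] ker (linF φ x ξ) :=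
    { toFun := fun p => ⟨φ.fi x (infAct x (p.1 • tv l + sv p.2)),
        S.linF_infAct hξ (commute_of_left hξ2)⟩
      map_add' := fun p q => by
        apply Subtype.ext
        simp only [Submodule.coe_add, ← map_add]
        congr 2
        rw [Prod.fst_add, Prod.snd_add, sv_add, add_smul]; abel
      map_smul' := fun c p => by
        apply Subtype.ext
        simp only [Submodule.coe_smul, ← map_smul, RingHom.id_apply]
        congr 2
        rw [Prod.smul_fst, Prod.smul_snd, sv_smul, smul_add, smul_smul, smul_eq_mul] }
  have hL : ¬ Injective L := fun hi => by
    have := LinearMap.finrank_le_finrank_of_injective hi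
    simp at this
    omega
  rw [injective_iff_map_eq_zero] at hL
  push Not at hL
  obtain ⟨⟨c, a⟩, hp, hp0⟩ := hL
  have h1 : infAct x (c • tv l + sv a) = 0 := by
    have := congrArg Subtype.val hp
    exact (φ.fi x).injective (this.trans (map_zero _).symm)
  refine ⟨_, h1, fun ha => ?_⟩
  have ha' : a = 0 := by simpa [tv, sv] using ha
  subst ha'
  rw [show sv (0 : R3) = 0 from rfl, add_zero, map_smul] at h1
  exact hp0 (by rw [(smul_eq_zero.1 h1).resolve_right hl]; rfl)

/-- Points with dependent torus generators are limits of singular points with independent ones. -/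
lemma mem_closure_of_not_Uind (h : ¬ Uind x) {η : LieT} (hη : infAct x η = 0)
    (hη2 : η.2 ≠ 0) : ∃ ζ : LieT, infAct x ζ = 0 ∧ ζ.2 = η.2 ∧
      x ∈ closure {y | Uind y ∧ infAct y ζ = 0} := by
  obtain ⟨ξ, hξ2, hξ0, hξ⟩ := exists_torus_isotropy h
  obtain ⟨l, hl⟩ := S.exists_tv_ne_zero x
  have hdξ := isSkewDer_linF S.act S.pres hξ
  have hdη := isSkewDer_linF S.act S.pres hη
  have hcc : ∀ w : LieT, Commute (imQ ξ.2) (imQ w.2) := fun w => commute_of_left hξ2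
  have hAne : ∃ z, linF φ x ξ z ≠ 0 := by
    by_contra! h0
    exact S.linF_ne_zero hξ hξ0 (LinearMap.ext h0)
  obtain ⟨z, hz⟩ := hAne
  obtain ⟨w', -, hw', t, ht⟩ := hdξ.exists_pencil hdη (S.linF_comm hξ hη (hcc η)) ⊤
    (by simp) (by simp) ⟨z, by simp, hz⟩
  obtain ⟨w, rfl⟩ := (φ.fi x).surjective w'
  set ζ : LieT := η + (-t) • ξ with hζ
  have hζ0 : infAct x ζ = 0 := by simp [hζ, hη, hξ]
  have hζ2 : ζ.2 = η.2 := by simp [hζ, hξ2]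
  have hζw : lin x ζ w = 0 := by
    apply (φ.fi x).injective
    rw [← linF_fi, hζ, S.linF_add, S.linF_smul, LinearMap.add_apply, LinearMap.smul_apply, ht]
    simp
  have hξw : lin x ξ w ≠ 0 := fun h0 => hw' (by rw [linF_fi, h0, map_zero])
  refine ⟨ζ, hζ0, hζ2, ?_⟩
  obtain ⟨Y, hY, hY0, hYz⟩ := exists_zeros_of_lin_eq_zero S.act hζ0
  set e := ch x
  have hex : e x ∈ e.target := mem_chart_target E7 x
  have hxs : x ∈ e.source := mem_chart_source E7 x
  have hsw : HasDerivAt (fun s : ℝ => s • w) w 0 := by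
    have : HasDerivAt (fun s : ℝ => s • w) ((1 : ℝ) • w) 0 := (hasDerivAt_id 0).smul_const w
    rwa [one_smul] at this
  have hYd : HasDerivAt (fun s : ℝ => Y (s • w)) w 0 := by
    have h1 : HasFDerivAt Y (.id ℝ E7) ((0 : ℝ) • w) := by
      rw [zero_smul]; exact hY.hasFDerivAt
    exact h1.comp_hasDerivAt (0 : ℝ) hsw
  have hYs0 : Y ((0 : ℝ) • w) = e x := by rw [zero_smul, hY0]
  have hYc : Tendsto (fun s : ℝ => Y (s • w)) (𝓝 0) (𝓝 (e x)) := by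
    have := hYd.continuousAt
    rwa [ContinuousAt, hYs0] at this
  -- the torus generators at the nearby zeros of `ζ`
  have hfξ : HasDerivAt (fun s : ℝ => cI x (Y (s • w)) ξ) (lin x ξ w) 0 := by
    have h1 : HasFDerivAt (fun y => cI x y ξ) (lin x ξ) (Y ((0 : ℝ) • w)) := by
      rw [hYs0]; exact hasFDerivAt_cI S.act x ξ
    exact h1.comp_hasDerivAt (0 : ℝ) hYd
  have hslope : Tendsto (fun s : ℝ => s⁻¹ • cI x (Y (s • w)) ξ) (𝓝[≠] 0)
      (𝓝 (lin x ξ w)) := by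
    have h1 := hfξ.tendsto_slope
    refine h1.congr' ?_
    filter_upwards with s
    rw [slope_def_module, hYs0, cI_self S.act, hξ, sub_zero, sub_zero]
  have hfl : Tendsto (fun s : ℝ => cI x (Y (s • w)) (tv l)) (𝓝[≠] 0)
      (𝓝 (infAct x (tv l))) := by
    have h1 : ContinuousAt (fun y => cI x y (tv l)) (e x) :=
      (hasFDerivAt_cI S.act x (tv l)).continuousAt
    have h2 := h1.tendsto.comp hYc
    rw [cI_self S.act] at h2
    exact h2.mono_left nhdsWithin_le_nhds
  have hli := S.linearIndependent_lin hξ hξw hl (lin_infAct_eq_zero S.act hξ (hcc _))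
  have hpair : Tendsto (fun s : ℝ => ![s⁻¹ • cI x (Y (s • w)) ξ, cI x (Y (s • w)) (tv l)])
      (𝓝[≠] 0) (𝓝 ![lin x ξ w, infAct x (tv l)]) := by
    refine tendsto_pi_nhds.2 fun i => ?_
    fin_cases i
    exacts [hslope, hfl]
  have hev := hpair.eventually (isOpen_setOfPred_linearIndependent.mem_nhds hli)
  have hz0 : ∀ᶠ s in 𝓝[≠] (0 : ℝ), infAct (e.symm (Y (s • w))) ζ = 0 := by
    have h1 : Tendsto (fun s : ℝ => s • w) (𝓝[≠] 0) (𝓝 0) := by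
      have := hsw.continuousAt
      rw [ContinuousAt, zero_smul] at this
      exact this.mono_left nhdsWithin_le_nhds
    filter_upwards [h1.eventually hYz] with s hs
    exact hs (by rw [map_smul, hζw, smul_zero])
  have htar : ∀ᶠ s in 𝓝[≠] (0 : ℝ), Y (s • w) ∈ e.target :=
    (hYc.mono_left nhdsWithin_le_nhds).eventually (e.open_target.mem_nhds hex)
  have hlim : Tendsto (fun s : ℝ => e.symm (Y (s • w))) (𝓝[≠] 0) (𝓝 x) := by
    have h1 := e.continuousAt_symm hex
    rw [ContinuousAt, e.left_inv hxs] at h1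
    exact h1.comp (hYc.mono_left nhdsWithin_le_nhds)
  refine mem_closure_of_tendsto hlim ?_
  filter_upwards [hev, hz0, htar] with s h1 h2 h3
  refine ⟨?_, h2⟩
  by_contra hU
  obtain ⟨ξ', hξ'2, hξ'0, hξ'⟩ := exists_torus_isotropy hU
  -- `ξ'` is a combination of `ξ` and `tv l`
  have hind : ∀ a b : ℝ, a • ξ + b • tv l = 0 → a = 0 ∧ b = 0 := by
    intro a b hab
    have h4 : b • infAct x (tv l) = 0 := by
      have := congrArg (infAct x) hab
      rwa [map_add, map_smul, map_smul, hξ, smul_zero, zero_add, map_zero] at this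
    have hb := (smul_eq_zero.1 h4).resolve_right hl
    rw [hb, zero_smul, add_zero] at hab
    exact ⟨(smul_eq_zero.1 hab).resolve_right hξ0, hb⟩
  obtain ⟨a, b, hab⟩ : ∃ a b : ℝ, a • ξ + b • tv l = ξ' := by
    let T : R2 →ₗ[ℝ] (Fin 2 → ℝ) :=
      { toFun := fun p => p.1 • ξ.1 + p.2 • (tv l).1
        map_add' := fun p q => by simp only [Prod.fst_add, Prod.snd_add]; module
        map_smul' := fun c p => by
          simp only [Prod.smul_fst, Prod.smul_snd, RingHom.id_apply, smul_eq_mul]; module }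
    have hTi : Injective T := by
      rw [injective_iff_map_eq_zero]
      rintro ⟨p, q⟩ hpq
      obtain ⟨h5, h6⟩ := hind p q (Prod.ext hpq (by simp [hξ2, tv]))
      rw [h5, h6]; rfl
    have hTs := (LinearMap.injective_iff_surjective_of_finrank_eq_finrank
      (by simp : finrank ℝ R2 = finrank ℝ (Fin 2 → ℝ))).1 hTi
    obtain ⟨⟨a, b⟩, hab⟩ := hTs ξ'.1
    exact ⟨a, b, Prod.ext hab (by simp [hξ2, hξ'2, tv])⟩
  have hc0 : cI x (Y (s • w)) ξ' = 0 := by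
    have := (cI_eq_zero_iff S.act x (e.map_target h3) ξ').2 hξ'
    rwa [e.right_inv h3] at this
  by_cases hs : s = 0
  · subst hs
    have : LinearIndependent ℝ ![(0 : ℝ)⁻¹ • cI x (Y ((0 : ℝ) • w)) ξ, cI x (Y ((0 : ℝ) • w)) (tv l)] := h1
    have h6 := this.ne_zero 0
    simp at h6
  · have h4 : (a * s) • (s⁻¹ • cI x (Y (s • w)) ξ) + b • cI x (Y (s • w)) (tv l) = 0 := by
      rw [smul_smul, mul_assoc, mul_inv_cancel₀ hs, mul_one, ← map_smul, ← map_smul, ← map_add,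
        hab, hc0]
    have h5 := pair_iff.1 h1 _ _ h4
    have ha : a = 0 := (mul_eq_zero.1 h5.1).resolve_right hs
    rw [ha, h5.2] at hab
    exact hξ'0 (by rw [← hab]; simp)

lemma dense_injective : Dense {x : M | Injective (infAct x)} := by
  intro x
  rw [mem_closure_iff]
  intro O hO hx
  by_cases hU : Uind x
  · obtain ⟨y, hyO, hy⟩ := S.exists_injective_of_Uind hO hx hU
    exact ⟨y, hyO, hy⟩
  · obtain ⟨η, hη, hη2⟩ := S.exists_isotropy_of_not_Uind hU
    obtain ⟨ζ, -, -, hcl⟩ := S.mem_closure_of_not_Uind hU hη hη2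
    obtain ⟨y, hyO, hyU, -⟩ := mem_closure_iff.1 hcl O hO hx
    obtain ⟨z, hzO, hz⟩ := S.exists_injective_of_Uind hO hyO hyU
    exact ⟨z, hzO, hz⟩

end MultiMoment

/-! ### The exceptional set has measure zero -/

/-- If the derivative of `G` is injective on the kernel of a linear form, the zeros of `G` are
locally contained in a Lipschitz curve. -/
lemma exists_hausdorffMeasure_zeros_eq_zero {H : Type*} [NormedAddCommGroup H]
    [NormedSpace ℝ H] {G : E7 → H} {G' : E7 →L[ℝ] H} {p : E7} (hG : HasStrictFDerivAt G G' p)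
    (l : E7 →L[ℝ] ℝ) (hl : ∀ w, G' w = 0 → l w = 0 → w = 0) :
    ∃ O ∈ 𝓝 p, ∀ T ⊆ O, (∀ y ∈ T, G y = 0) →
      MeasureTheory.Measure.hausdorffMeasure (3 : ℝ) T = 0 := by
  have hF := l.hasStrictFDerivAt (x := p) |>.prodMk hG
  have hker : ker ((l.prod G' : E7 →L[ℝ] ℝ × H) : E7 →ₗ[ℝ] ℝ × H) = ⊥ := by
    rw [LinearMap.ker_eq_bot']
    intro w hw
    have hw' : ((l.prod G' : E7 →L[ℝ] ℝ × H) w) = 0 := hw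
    rw [ContinuousLinearMap.prod_apply, Prod.mk_eq_zero] at hw'
    exact hl w hw'.2 hw'.1
  obtain ⟨K, hK, hanti⟩ := LinearMap.exists_antilipschitzWith _ hker
  have hK' : (0 : ℝ) < K := hK
  have h1 := (hasStrictFDerivAt_iff_isLittleO.1 hF).def (c := 1 / (2 * K)) (by positivity)
  rw [nhds_prod_eq] at h1
  obtain ⟨O, hO, hsub⟩ := Filter.mem_prod_same_iff.1 h1
  refine ⟨O, hO, fun T hT hT0 => ?_⟩
  have h2 : ∀ y ∈ T, ∀ z ∈ T, ‖y - z‖ ≤ 2 * K * ‖l y - l z‖ := by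
    intro y hy z hz
    have h3 : ‖(l y, G y) - (l z, G z) - (l.prod G') (y - z)‖ ≤ 1 / (2 * K) * ‖y - z‖ :=
      hsub (mk_mem_prod (hT hy) (hT hz))
    have h4 : ‖y - z‖ ≤ K * ‖(l.prod G' : E7 →L[ℝ] ℝ × H) (y - z)‖ := by
      have := hanti.le_mul_dist (y - z) 0
      simpa [dist_eq_norm] using this
    have h5 : (l y, G y) - (l z, G z) = (l y - l z, 0) := by
      rw [hT0 y hy, hT0 z hz]; simp
    simp only [h5] at h3
    have h6 : ‖((l y - l z, 0) : ℝ × H)‖ = ‖l y - l z‖ := by simp [Prod.norm_def]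
    have h7 := norm_sub_norm_le ((l.prod G' : E7 →L[ℝ] ℝ × H) (y - z)) ((l y - l z, 0) : ℝ × H)
    rw [norm_sub_rev] at h7
    rw [h6] at h7
    have h8 : K * (1 / (2 * K) * ‖y - z‖) = ‖y - z‖ / 2 := by field_simp
    have h9 : ‖(l.prod G' : E7 →L[ℝ] ℝ × H) (y - z)‖ ≤
        ‖l y - l z‖ + 1 / (2 * K) * ‖y - z‖ := by linarith
    have h10 := mul_le_mul_of_nonneg_left h9 hK'.le
    rw [mul_add, h8] at h10
    linarith
  have hinj : InjOn l T := fun y hy z hz hyz => by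
    have := h2 y hy z hz
    rw [hyz, sub_self, norm_zero, mul_zero] at this
    exact sub_eq_zero.1 (norm_le_zero_iff.1 this)
  have hlip : LipschitzOnWith (2 * K) (Function.invFunOn l T) (l '' T) := by
    refine LipschitzOnWith.of_dist_le_mul ?_
    rintro _ ⟨y, hy, rfl⟩ _ ⟨z, hz, rfl⟩
    rw [hinj.leftInvOn_invFunOn hy, hinj.leftInvOn_invFunOn hz, dist_eq_norm, dist_eq_norm]
    simpa using h2 y hy z hz
  have himg : Function.invFunOn l T '' (l '' T) = T := hinj.leftInvOn_invFunOn.image_image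
  have h3 := hlip.hausdorffMeasure_image_le (d := 3) (by norm_num)
  rw [himg] at h3
  have h4 : MeasureTheory.Measure.hausdorffMeasure (3 : ℝ) (l '' T) = 0 := by
    refine hausdorffMeasure_of_dimH_lt (d := 3) ?_
    refine (dimH_mono (subset_univ _)).trans_lt ?_
    rw [Real.dimH_univ]
    norm_num
  rw [h4, mul_zero] at h3
  exact le_antisymm h3 zero_le

lemma exists_hausdorffMeasure_image_eq_zero {f : E7 → E7} {p : E7} (hf : ContDiffAt ℝ 1 f p) :
    ∃ O ∈ 𝓝 p, ∀ T ⊆ O, MeasureTheory.Measure.hausdorffMeasure (3 : ℝ) T = 0 →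
      MeasureTheory.Measure.hausdorffMeasure (3 : ℝ) (f '' T) = 0 := by
  obtain ⟨K, O, hO, hK⟩ := hf.exists_lipschitzOnWith
  refine ⟨O, hO, fun T hT h0 => le_antisymm ?_ zero_le⟩
  refine ((hK.mono hT).hausdorffMeasure_image_le (d := 3) (by norm_num)).trans ?_
  rw [h0, mul_zero]

lemma exists_smul_of_not_Uind (h : ¬ Uind x) {l : Fin 2} (hl : infAct x (tv l) ≠ 0)
    (hv : v.2 = 0) : ∃ c : ℝ, infAct x v = c • infAct x (tv l) := by
  have hpair : ∃ j : Fin 2, ∀ v : LieT, v.2 = 0 → v = v.1 l • tv l + v.1 j • tv j := by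
    refine ⟨1 - l, fun v hv => ?_⟩
    refine (lieT_eq v).trans ?_
    rw [hv]
    fin_cases l
    · simp [sv]
    · simp [sv, add_comm]
  obtain ⟨j, hj⟩ := hpair
  obtain ⟨ξ, hξ2, hξ0, hξ⟩ := exists_torus_isotropy h
  have e := hj ξ hξ2
  by_cases hc : ξ.1 j = 0
  · rw [hc, zero_smul, add_zero] at e
    rw [e, map_smul] at hξ
    rcases smul_eq_zero.1 hξ with h1 | h1
    · rw [h1, zero_smul] at e; exact absurd e hξ0
    · exact absurd h1 hl
  · rw [e, map_add, map_smul, map_smul] at hξ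
    have h1 : infAct x (tv j) = (-(ξ.1 j)⁻¹ * ξ.1 l) • infAct x (tv l) := by
      rw [neg_mul, neg_smul, mul_smul, eq_neg_of_add_eq_zero_left hξ, smul_neg, neg_neg, smul_smul,
        inv_mul_cancel₀ hc, one_smul]
    refine ⟨v.1 l + v.1 j * (-(ξ.1 j)⁻¹ * ξ.1 l), ?_⟩
    rw [add_smul, mul_smul, ← h1, hj v hv]
    simp only [map_add, map_smul]
    rw [← hj v hv]

/-- `|a|²` times the component of `b` orthogonal to `a`. -/
def rejection (a b : E7) : E7 := (inner ℝ a a : ℝ) • b - (inner ℝ a b : ℝ) • a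

lemma rejection_smul (a : E7) (c : ℝ) : rejection a (c • a) = 0 := by
  rw [rejection, inner_smul_right, smul_smul, mul_comm, sub_self]

lemma hasFDerivAt_rejection {f g : E7 → E7} {f' g' : L7} {p : E7}
    (hf : HasFDerivAt f f' p) (hg : HasFDerivAt g g' p) (h0 : g p = 0) :
    ∃ L : L7, HasFDerivAt (fun y => rejection (f y) (g y)) L p ∧
      ∀ w, L w = rejection (f p) (g' w) := by
  refine ⟨_, ((hf.inner ℝ hf).smul hg).sub ((hf.inner ℝ hg).smul hf), fun w => ?_⟩
  simp [rejection, h0]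

lemma contDiffAt_rejection {f g : E7 → E7} {p : E7}
    (hf : ContDiffAt ℝ ∞ f p) (hg : ContDiffAt ℝ ∞ g p) :
    ContDiffAt ℝ ∞ (fun y => rejection (f y) (g y)) p :=
  ((hf.inner ℝ hf).smul hg).sub ((hf.inner ℝ hg).smul hf)

namespace MultiMoment

include S

lemma contDiffAt_cI (x : M) {y : E7} (hy : y ∈ (ch x).target) (v : LieT) :
    ContDiffAt ℝ ∞ (fun y => cI x y v) y :=
  ((contDiffOn_cI S.act x).contDiffAt ((ch x).open_target.mem_nhds hy)).clm_apply
    contDiffAt_const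

lemma exists_null_nhds (z : M) (hz : ¬ Uind z) {n : R3} (hn : n ≠ 0) {θ : Fin 2 → ℝ}
    (hη : infAct z (θ, n) = 0) : ∃ O ∈ 𝓝 (ch z z), O ⊆ (ch z).target ∧
      ∀ T ⊆ O, (∀ y ∈ T, ¬ Uind ((ch z).symm y) ∧ ∃ θ, infAct ((ch z).symm y) (θ, n) = 0) →
        MeasureTheory.Measure.hausdorffMeasure (3 : ℝ) T = 0 := by
  set e := ch z with he
  obtain ⟨ξ, hξ2, hξ0, hξ⟩ := exists_torus_isotropy hz
  obtain ⟨l, hl⟩ := S.exists_tv_ne_zero z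
  have hzt : e z ∈ e.target := e.map_source (mem_chart_source _ _)
  have hcξ : ∀ w : LieT, Commute (imQ ξ.2) (imQ w.2) := fun w => commute_of_left hξ2
  set a : E7 → E7 := fun y => cI z y (tv l)
  set G : E7 → E7 × E7 := fun y =>
    (rejection (a y) (cI z y ξ), rejection (a y) (cI z y (θ, n))) with hG
  have hz0 : ∀ v : LieT, infAct z v = 0 → cI z (e z) v = 0 := fun v hv => by
    rw [he, cI_self S.act, hv]
  have ha0 : a (e z) = infAct z (tv l) := cI_self S.act z _
  obtain ⟨L₁, hL₁, hL₁'⟩ := hasFDerivAt_rejection (hasFDerivAt_cI S.act z (tv l))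
    (hasFDerivAt_cI S.act z ξ) (hz0 _ hξ)
  obtain ⟨L₂, hL₂, hL₂'⟩ := hasFDerivAt_rejection (hasFDerivAt_cI S.act z (tv l))
    (hasFDerivAt_cI S.act z (θ, n)) (hz0 _ hη)
  have hGc : ContDiffAt ℝ ∞ G (e z) :=
    (contDiffAt_rejection (S.contDiffAt_cI z hzt _) (S.contDiffAt_cI z hzt _)).prodMk
      (contDiffAt_rejection (S.contDiffAt_cI z hzt _) (S.contDiffAt_cI z hzt _))
  have hGs : HasStrictFDerivAt G (L₁.prod L₂) (e z) :=
    hGc.hasStrictFDerivAt' (hL₁.prodMk hL₂) (by simp)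
  have hrej : ∀ {v : LieT}, infAct z v = 0 → lin z v (infAct z (tv l)) = 0 → ∀ w,
      rejection (a (e z)) (lin z v w) = 0 → lin z v w = 0 := by
    intro v hv hvl w hw
    by_contra h0
    have h1 := S.linearIndependent_lin hv h0 hl hvl
    rw [pair_iff] at h1
    rw [ha0, rejection, sub_eq_add_neg, ← neg_smul] at hw
    exact hl (inner_self_eq_zero.1 (h1 _ _ hw).1)
  have hlξ : lin z ξ (infAct z (tv l)) = 0 := lin_infAct_eq_zero S.act hξ (hcξ _)
  have hlη : lin z (θ, n) (infAct z (tv l)) = 0 :=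
    lin_infAct_eq_zero S.act hη (commute_of_left rfl).symm
  have hinj : ∀ w, (L₁.prod L₂) w = 0 → innerSL ℝ (infAct z (tv l)) w = 0 → w = 0 := by
    intro w hw hw2
    rw [ContinuousLinearMap.prod_apply, Prod.mk_eq_zero, hL₁', hL₂'] at hw
    have h1 := hrej hξ hlξ w hw.1
    have h2 := hrej hη hlη w hw.2
    by_contra hw0
    have hi : LinearIndependent ℝ ![w, infAct z (tv l)] := by
      rw [pair_iff]
      intro s t hst
      have h3 := congrArg (innerSL ℝ (infAct z (tv l))) hst
      rw [map_add, map_smul, map_smul, hw2, smul_zero, zero_add, map_zero] at h3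
      have ht : t = 0 := (smul_eq_zero.1 h3).resolve_right fun h => hl (inner_self_eq_zero.1 h)
      rw [ht, zero_smul, add_zero] at hst
      exact ⟨(smul_eq_zero.1 hst).resolve_right hw0, ht⟩
    have hz : ∀ {v : LieT} {u : E7}, lin z v u = 0 → linF φ z v (φ.fi z u) = 0 := fun h => by
      rw [linF_fi, h, map_zero]
    rcases (isSkewDer_linF S.act S.pres hξ).dependent_of_ker (isSkewDer_linF S.act S.pres hη)
      (S.linF_comm hξ hη (hcξ _)) (hz h1) (hz hlξ) (hz h2) (hz hlη) (φ.linearIndependent_fi hi)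
      with h3 | ⟨t, h3⟩
    · exact hξ0 (S.eq_zero_of_linF hξ h3)
    · have h4 : (-t) • ξ + (1 : ℝ) • ((θ, n) : LieT) = 0 := by
        refine S.eq_zero_of_linF (x := z) (by simp [hξ, hη]) ?_
        rw [S.linF_add, S.linF_smul, S.linF_smul, h3]; simp
      have h5 := congrArg snd h4
      simp [hξ2] at h5
      exact hn h5
  obtain ⟨O, hO, hnull⟩ := exists_hausdorffMeasure_zeros_eq_zero hGs _ hinj
  have hne : ∀ᶠ y in 𝓝 (e z), a y ≠ 0 :=
    (S.contDiffAt_cI z hzt (tv l)).continuousAt.eventually_ne (by rw [he, cI_self S.act]; exact hl)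
  refine ⟨O ∩ {y | a y ≠ 0} ∩ e.target, inter_mem (inter_mem hO hne)
    (e.open_target.mem_nhds hzt), inter_subset_right, fun T hT hT2 =>
    hnull T (fun y hy => (hT hy).1.1) fun y hy => ?_⟩
  obtain ⟨⟨-, hay⟩, hyt⟩ := hT hy
  obtain ⟨hnU, θ', hθ'⟩ := hT2 y hy
  have hys := e.map_target hyt
  have hzero : ∀ v : LieT, cI z y v = 0 ↔ infAct (e.symm y) v = 0 := fun v => by
    rw [← cI_eq_zero_iff S.act z hys, ← he, e.right_inv hyt]
  have hl' : infAct (e.symm y) (tv l) ≠ 0 := fun h => hay ((hzero _).2 h)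
  have key : ∀ v : LieT, (∃ θ₀ : Fin 2 → ℝ, infAct (e.symm y) (v - (θ₀, 0)) = 0) →
      rejection (a y) (cI z y v) = 0 := by
    rintro v ⟨θ₀, h0⟩
    obtain ⟨c, hc⟩ := exists_smul_of_not_Uind hnU hl' (v := (θ₀, 0)) rfl
    rw [map_sub, hc, ← map_smul, ← map_sub, ← hzero, map_sub, map_smul, sub_eq_zero] at h0
    rw [h0, rejection_smul]
  rw [hG, Prod.mk_eq_zero]
  refine ⟨key ξ ⟨ξ.1, ?_⟩, key (θ, n) ⟨θ - θ', ?_⟩⟩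
  · rw [show ξ - (ξ.1, 0) = 0 from Prod.ext (by simp) (by simp [hξ2]), map_zero]
  · rw [show ((θ, n) : LieT) - (θ - θ', 0) = (θ', n) from Prod.ext (by simp) (by simp)]
    exact hθ'

lemma hausdorffMeasure_not_Uind {n : R3} (hn : n ≠ 0) (x : M) :
    MeasureTheory.Measure.hausdorffMeasure (3 : ℝ) (ch x ''
      ((ch x).source ∩ {y | ¬ Uind y ∧ ∃ θ, infAct y (θ, n) = 0})) = 0 := by
  refine MeasureTheory.measure_null_of_locally_null _ ?_
  rintro _ ⟨z, ⟨hzx, hzU, θ, hθ⟩, rfl⟩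
  obtain ⟨O, hO, hOt, hnull⟩ := S.exists_null_nhds z hzU hn hθ
  set f : E7 → E7 := fun y => ch x ((ch z).symm y)
  have hzt : ch z z ∈ (ch z).target := (ch z).map_source (mem_chart_source _ _)
  have hf : ContDiffAt ℝ ∞ f (ch z z) := by
    refine ContMDiffAt.contDiffAt (ContMDiffAt.comp _ (contMDiffAt_chart ?_)
      (contMDiffAt_chart_symm hzt))
    rwa [(ch z).left_inv (mem_chart_source _ _)]
  obtain ⟨O', hO', himg⟩ := exists_hausdorffMeasure_image_eq_zero (hf.of_le (by simp))
  set T := O ∩ O' ∩ {y | ¬ Uind ((ch z).symm y) ∧ ∃ θ, infAct ((ch z).symm y) (θ, n) = 0}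
  refine ⟨f '' T, ?_, himg T (fun y hy => hy.1.2) (hnull T (fun y hy => hy.1.1)
    fun y hy => hy.2)⟩
  have hN : (ch z).source ∩ ch z ⁻¹' (O ∩ O') ∈ 𝓝 z := inter_mem (chart_source_mem_nhds _ _)
      (((ch z).continuousAt (mem_chart_source _ _)).preimage_mem_nhds
        (inter_mem hO hO'))
  have hN2 : (ch x).target ∩ (ch x).symm ⁻¹'
      ((ch z).source ∩ ch z ⁻¹' (O ∩ O')) ∈ 𝓝 (ch x z) := by
    refine inter_mem ((ch x).open_target.mem_nhds ((ch x).map_source hzx)) ?_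
    refine ((ch x).symm.continuousAt
      ((ch x).map_source hzx)).preimage_mem_nhds ?_
    rwa [(ch x).left_inv hzx]
  refine mem_nhdsWithin_iff_exists_mem_nhds_inter.2 ⟨_, hN2, ?_⟩
  rintro _ ⟨⟨-, h1, h2⟩, y, ⟨hyx, hy⟩, rfl⟩
  rw [(ch x).left_inv hyx] at h1 h2
  have h3 : (ch z).symm (ch z y) = y := (ch z).left_inv h1
  refine ⟨ch z y, ⟨h2, ?_⟩, ?_⟩
  · rw [mem_ofPred_eq, h3]; exact hy
  · change ch x ((ch z).symm (ch z y)) = _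
    rw [h3]

end MultiMoment

/-! ### Level sets as submanifolds -/

section InverseFunction

variable {E F : Type*} [NormedAddCommGroup E] [NormedSpace ℝ E] [CompleteSpace E]
  [NormedAddCommGroup F] [NormedSpace ℝ F]

/-- The inverse function theorem, with an inverse that is smooth on an open set. -/
lemma exists_smooth_localInverse {f : E → F} {W : Set E} (hW : IsOpen W)
    (hf : ContDiffOn ℝ ∞ f W) {p : E} (hp : p ∈ W) {f' : E ≃L[ℝ] F}
    (hf' : HasFDerivAt f (f' : E →L[ℝ] F) p) :
    ∃ h : OpenPartialHomeomorph E F, p ∈ h.source ∧ h.source ⊆ W ∧ (h : E → F) = f ∧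
      ContDiffOn ℝ ∞ h.symm h.target := by
  have hfa : ContDiffAt ℝ ∞ f p := hf.contDiffAt (hW.mem_nhds hp)
  set h₀ := hfa.toOpenPartialHomeomorph f hf' (by simp)
  have hh₀ : (h₀ : E → F) = f := rfl
  set s : Set E := W ∩ fderiv ℝ f ⁻¹' (range ((↑) : (E ≃L[ℝ] F) → E →L[ℝ] F))
  have hs : IsOpen s := ((hf.continuousOn_fderiv_of_isOpen hW (by simp)).isOpen_inter_preimage hW
    ContinuousLinearEquiv.isOpen)
  refine ⟨h₀.restrOpen s hs, ?_, ?_, ?_, ?_⟩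
  · rw [OpenPartialHomeomorph.restrOpen_source]
    exact ⟨hfa.mem_toOpenPartialHomeomorph_source hf' _, hp, f', hf'.fderiv.symm⟩
  · rw [OpenPartialHomeomorph.restrOpen_source]
    exact fun y hy => hy.2.1
  · exact hh₀
  · intro y hy
    have hyt := (h₀.restrOpen s hs).map_target hy
    rw [OpenPartialHomeomorph.restrOpen_source] at hyt
    obtain ⟨-, hyW, f₁, hf₁⟩ := hyt
    refine ContDiffAt.contDiffWithinAt ((h₀.restrOpen s hs).contDiffAt_symm (f₀' := f₁) hy ?_ ?_)
    · rw [hf₁]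
      exact ((hf.contDiffAt (hW.mem_nhds hyW)).differentiableAt (by simp)).hasFDerivAt
    · exact hf.contDiffAt (hW.mem_nhds hyW)

lemma mem_contDiffGroupoid_of_contDiffOn {h : OpenPartialHomeomorph E E}
    (h1 : ContDiffOn ℝ ∞ h h.source) (h2 : ContDiffOn ℝ ∞ h.symm h.target) :
    h ∈ contDiffGroupoid ∞ 𝓘(ℝ, E) := by
  rw [contDiffGroupoid, mem_groupoid_of_pregroupoid]
  simpa [contDiffPregroupoid] using ⟨h1, h2⟩

end InverseFunction

/-- The vector of `ℝ⁷` with given first three and last four coordinates. -/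
def joinE7 : (R3 × (Fin 4 → ℝ)) →L[ℝ] E7 := toContinuousLinearMap
    { toFun := fun p => !₂[p.1 0, p.1 1, p.1 2, p.2 0, p.2 1, p.2 2, p.2 3]
      map_add' := fun p q => by ext i; fin_cases i <;> simp
      map_smul' := fun c p => by ext i; fin_cases i <;> simp }

lemma joinE7_apply (p : R3 × (Fin 4 → ℝ)) :
    joinE7 p = !₂[p.1 0, p.1 1, p.1 2, p.2 0, p.2 1, p.2 2, p.2 3] := rfl

lemma joinE7_eq_zero_iff (p : R3 × (Fin 4 → ℝ)) :
    (∀ i : Fin 7, 3 ≤ (i : ℕ) → joinE7 p i = 0) ↔ p.2 = 0 := by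
  rw [joinE7_apply]
  constructor
  · intro h
    ext j
    fin_cases j
    exacts [h 3 (by decide), h 4 (by decide), h 5 (by decide), h 6 (by decide)]
  · intro h i hi
    fin_cases i <;> first | (simp at hi; done) | simp [h]

lemma joinE7_injective : Injective joinE7 := by
  intro p q h
  rw [joinE7_apply, joinE7_apply] at h
  have h' := fun i : Fin 7 => congrArg (fun v : E7 => v i) h
  ext j <;> fin_cases j
  exacts [h' 0, h' 1, h' 2, h' 3, h' 4, h' 5, h' 6]

/-- A set which near `x` is the regular zero set of four functions, with an associative plane as
tangent space, is near `x` an associative submanifold. -/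
lemma G2Structure.exists_adapted_chart (φ : G2Structure M) {L : Set M} {u v : E7}
    (huv : LinearIndependent ℝ ![u, v]) {F : E7 → Fin 4 → ℝ} {W : Set E7} (hW : IsOpen W)
    (hxW : ch x x ∈ W) (hF : ContDiffOn ℝ ∞ F W)
    (hk : ∀ w, fderiv ℝ F (ch x x) w = 0 ↔ w ∈ φ.asp x u v)
    (hL : ∀ y ∈ (ch x).source, ch x y ∈ W → (y ∈ L ↔ F (ch x y) = 0)) :
    ∃ e ∈ IsManifold.maximalAtlas I7 ∞ M, x ∈ e.source ∧
      (∀ y ∈ e.source, y ∈ L ↔ ∀ i : Fin 7, 3 ≤ (i : ℕ) → (e y : E7) i = 0) ∧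
      ∃ v : Fin 3 → TangentSpace I7 x, (∀ i j, φ.metric x (v i) (v j) = if i = j then 1 else 0) ∧
        φ.form x v = 1 ∧
        ∀ u : TangentSpace I7 x, u ∈ span ℝ (range v) ↔
          ∀ i : Fin 7, 3 ≤ (i : ℕ) → tangentCoord (mfderiv I7 I7 e x u) i = 0 := by
  set e₀ := ch x with he₀
  have hdim : finrank ℝ (φ.asp x u v) = finrank ℝ R3 := by
    rw [φ.finrank_asp huv]; simp
  set q : φ.asp x u v ≃ₗ[ℝ] R3 := LinearEquiv.ofFinrankEq _ _ hdim
  obtain ⟨π₀, hπ₀⟩ := (q : φ.asp x u v →ₗ[ℝ] R3).exists_extend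
  set π : E7 →L[ℝ] R3 := toContinuousLinearMap π₀
  have hπ : ∀ w ∈ φ.asp x u v, π w = 0 → w = 0 := by
    intro w hw h0
    have h1 : π₀ w = q ⟨w, hw⟩ := congrArg (fun L => L ⟨w, hw⟩) hπ₀
    have h2 : q ⟨w, hw⟩ = 0 := h1.symm.trans h0
    rw [LinearEquiv.map_eq_zero_iff] at h2
    exact congrArg Subtype.val h2
  set f : E7 → E7 := fun y => joinE7 (π y, F y) with hf
  have hfW : ContDiffOn ℝ ∞ f W := joinE7.contDiff.comp_contDiffOn (π.contDiff.contDiffOn.prodMk hF)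
  have hFd : HasFDerivAt F (fderiv ℝ F (e₀ x)) (e₀ x) :=
    ((hF.contDiffAt (hW.mem_nhds hxW)).differentiableAt (by simp)).hasFDerivAt
  set f₁ : L7 := joinE7.comp (π.prod (fderiv ℝ F (e₀ x))) with hf₁
  have hfd : HasFDerivAt f f₁ (e₀ x) := joinE7.hasFDerivAt.comp _ (π.hasFDerivAt.prodMk hFd)
  have hinj : Injective (f₁ : E7 →ₗ[ℝ] E7) := by
    rw [injective_iff_map_eq_zero]
    intro w hw
    have h1 : (π w, fderiv ℝ F (e₀ x) w) = 0 :=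
      joinE7_injective ((show joinE7 (π w, fderiv ℝ F (e₀ x) w) = 0 from hw).trans
        (map_zero _).symm)
    rw [Prod.mk_eq_zero] at h1
    exact hπ w ((hk w).1 h1.2) h1.1
  set f₂ : E7 ≃L[ℝ] E7 := (LinearEquiv.ofInjectiveEndo _ hinj).toContinuousLinearEquiv
  have hf₂ : (f₂ : L7) = f₁ := by
    ext1 w; rfl
  obtain ⟨h, hh1, hh2, hh3, hh4⟩ := exists_smooth_localInverse hW hfW hxW (f' := f₂)
    (by rw [hf₂]; exact hfd)
  have hG : h ∈ contDiffGroupoid ∞ I7 :=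
    mem_contDiffGroupoid_of_contDiffOn (by rw [hh3]; exact hfW.mono hh2) hh4
  set e := e₀ ≫ₕ h with he
  have hxe : x ∈ e.source := by
    rw [he, OpenPartialHomeomorph.trans_source]
    exact ⟨mem_chart_source _ _, hh1⟩
  have hev : ∀ y, e y = joinE7 (π (e₀ y), F (e₀ y)) := fun y => by
    rw [he, OpenPartialHomeomorph.coe_trans, Function.comp_apply, hh3]
  have hem : e ∈ IsManifold.maximalAtlas I7 ∞ M := by
    intro e' he'
    constructor
    · rw [he, OpenPartialHomeomorph.trans_symm_eq_symm_trans_symm,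
        OpenPartialHomeomorph.trans_assoc]
      exact (contDiffGroupoid ∞ I7).trans ((contDiffGroupoid ∞ I7).symm hG)
        ((contDiffGroupoid ∞ I7).compatible (chart_mem_atlas _ _) he')
    · rw [he, ← OpenPartialHomeomorph.trans_assoc]
      exact (contDiffGroupoid ∞ I7).trans
        ((contDiffGroupoid ∞ I7).compatible he' (chart_mem_atlas _ _)) hG
  have hde : ∀ w : E7, (mfderiv I7 I7 e x : L7) w = f₁ w := by
    have h1 : HasMFDerivAt I7 I7 e₀ x (mfderiv I7 I7 e₀ x) :=
      ((contMDiffAt_chart (mem_chart_source E7 x)).mdifferentiableAt (by simp)).hasMFDerivAt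
    have h2 : HasMFDerivAt I7 I7 f (e₀ x) f₁ := hfd.hasMFDerivAt
    have h3 := h2.comp x h1
    have h4 : f ∘ e₀ = e := funext fun y => (hev y).symm
    rw [h4] at h3
    intro w
    rw [h3.mfderiv]
    change f₁ ((mfderiv I7 I7 e₀ x : L7) w) = _
    rw [he₀, mfderiv_chart_self]
  refine ⟨e, hem, hxe, fun y hy => ?_, ?_⟩
  · rw [he, OpenPartialHomeomorph.trans_source] at hy
    rw [hL y hy.1 (hh2 hy.2), hev, joinE7_eq_zero_iff]
  · obtain ⟨g, hg1, hg2, hg3⟩ := exists_orthonormal_assocSpan (φ.linearIndependent_fi (x := x) huv)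
    refine ⟨fun i => φ.frame x (g i), fun i j => ?_, ?_, fun u' => ?_⟩
    · rw [G2Structure.metric, symm_apply_apply, symm_apply_apply]
      exact hg1 i j
    · rw [φ.frame_spec]; exact hg2
    · have h1 : tangentCoord (mfderiv I7 I7 e x u') = f₁ u' := hde u'
      rw [h1]
      refine Iff.trans ?_ ((joinE7_eq_zero_iff (π u', fderiv ℝ F (e₀ x) u')).trans (hk u')).symm
      refine Iff.trans ?_ (φ.mem_asp (w := u')).symm
      rw [← hg3]
      have h3 : range (fun i => φ.frame x (g i)) = (φ.frame x).toLinearEquiv '' range g := by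
        rw [← range_comp]; rfl
      rw [h3]
      have h4 := Submodule.map_span ((φ.frame x).toLinearEquiv : E7 →ₗ[ℝ] TangentSpace I7 x)
        (range g)
      have h5 : span ℝ ((φ.frame x).toLinearEquiv '' range g) =
        Submodule.map ((φ.frame x).toLinearEquiv : E7 →ₗ[ℝ] TangentSpace I7 x)
          (span ℝ (range g)) := h4.symm
      rw [h5, Submodule.mem_map_equiv]
      exact Iff.rfl

/-! ### Rotations fixing or aligning vectors -/

lemma imQ_parts (a : R3) : (imQ a).re = 0 ∧
    (imQ a).imI = a 0 ∧ (imQ a).imJ = a 1 ∧ (imQ a).imK = a 2 :=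
  ⟨rfl, rfl, rfl, rfl⟩

lemma rot_eq_of_mul_eq {s : SU2} {a b : R3}
    (h : (s : ℍ) * imQ a = imQ b * s) : rot s a = b := by
  apply imQ_injective
  rw [imQ_rot, h, mul_assoc, SU2.self_mul_star, mul_one]

lemma mul_eq_of_rot_eq {s : SU2} {a b : R3} (h : rot s a = b) :
    (s : ℍ) * imQ a = imQ b * s := by
  rw [← h, imQ_rot, mul_assoc, SU2.star_mul_self, mul_one]

open Classical in
def normalizeSU2 (q : ℍ) : SU2 := if h : q = 0 then 1 else ⟨‖q‖⁻¹ • q, by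
    rw [mem_sphere_zero_iff_norm, norm_smul, norm_inv, norm_norm,
      inv_mul_cancel₀ (norm_ne_zero_iff.2 h)]⟩

lemma coe_normalizeSU2 {q : ℍ} (h : q ≠ 0) : (normalizeSU2 q : ℍ) = ‖q‖⁻¹ • q := by
  rw [normalizeSU2, dif_neg h]

/-- The quaternion `|n| - i n`, which conjugates `n` to `|n| i`. -/
def alignQ (n : E3) : ℍ := (‖n‖ : ℝ) • (1 : ℍ) - imQ (single 0 1) * imQ n.ofLp

lemma sq_norm_eq (n : E3) : ‖n‖ ^ 2 = n 0 ^ 2 + n 1 ^ 2 + n 2 ^ 2 := by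
  rw [EuclideanSpace.norm_sq_eq, Fin.sum_univ_three]; simp

lemma alignQ_parts (n : E3) : (alignQ n).re = ‖n‖ + n 0 ∧
    (alignQ n).imI = 0 ∧ (alignQ n).imJ = n 2 ∧ (alignQ n).imK = -n 1 := by
  refine ⟨?_, ?_, ?_, ?_⟩ <;>
  simp [alignQ, imQ_parts, re_mul, imI_mul, imJ_mul, imK_mul]

lemma alignQ_mul (n : E3) :
    alignQ n * imQ n.ofLp = imQ (‖n‖ • single 0 1) * alignQ n := by
  have h := sq_norm_eq n
  refine Quaternion.ext _ _ ?_ ?_ ?_ ?_ <;>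
  simp [alignQ_parts, imQ_parts, re_mul, imI_mul, imJ_mul, imK_mul] <;> nlinarith

lemma rot_normalizeSU2 {n : E3} (h : alignQ n ≠ 0) :
    rot (normalizeSU2 (alignQ n)) n.ofLp = ‖n‖ • single 0 1 := by
  apply rot_eq_of_mul_eq
  rw [coe_normalizeSU2 h, smul_mul_assoc, mul_smul_comm, alignQ_mul]

lemma alignQ_ne_zero {n : E3} (h : ‖n‖ + n 0 ≠ 0) : alignQ n ≠ 0 := by
  intro h0
  have h1 := (alignQ_parts n).1
  rw [h0] at h1
  exact h h1.symm

lemma exists_rot_eq (n : E3) :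
    ∃ s : SU2, rot s n.ofLp = ‖n‖ • single 0 1 := by
  by_cases h : ‖n‖ + n 0 = 0
  · have h1 := sq_norm_eq n
    have h0 : ‖n‖ ^ 2 = n 0 ^ 2 := by rw [eq_neg_of_add_eq_zero_left h, neg_sq]
    have h2 : n 1 = 0 := pow_eq_zero_iff two_ne_zero |>.1
      (le_antisymm (by linarith [sq_nonneg (n 2)]) (sq_nonneg _))
    have h3 : n 2 = 0 := pow_eq_zero_iff two_ne_zero |>.1
      (le_antisymm (by linarith [sq_nonneg (n 1)]) (sq_nonneg _))
    refine ⟨⟨imQ (single 1 1), ?_⟩, rot_eq_of_mul_eq ?_⟩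
    · rw [mem_sphere_zero_iff_norm, ← sq_eq_sq₀ (norm_nonneg _) zero_le_one, sq,
        ← normSq_eq_norm_mul_self, normSq_def']
      simp [imQ_parts]
    · refine Quaternion.ext _ _ ?_ ?_ ?_ ?_ <;>
      simp [imQ_parts, re_mul, imI_mul, imJ_mul, imK_mul, h2, h3]
      linarith
  · exact ⟨_, rot_normalizeSU2 (alignQ_ne_zero h)⟩

/-- Vectors commuting with an element of `SU(2)` that is not too far from `1`. -/
lemma crossProduct_eq_zero_of_rot {a b : R3} (h : rot (su2Exp a) b = b)
    (ha : ‖imQ a‖ < Real.pi) : crossProduct a b = 0 := by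
  rcases eq_or_ne a 0 with rfl | ha0
  · simp
  have h1 := mul_eq_of_rot_eq h
  have ha1 : 0 < ‖imQ a‖ := norm_pos_iff.2 fun h => ha0 (by
    rw [← imQ_zero] at h; exact imQ_injective h)
  rw [coe_su2Exp, Quaternion.exp_of_re_eq_zero _ rfl, add_mul, mul_add, smul_mul_assoc,
    mul_smul_comm, (Quaternion.coe_commutes _ _).symm, add_right_inj, ← sub_eq_zero,
    ← smul_sub] at h1
  have h2 := (smul_eq_zero.1 h1).resolve_left
    (div_pos (Real.sin_pos_of_pos_of_lt_pi ha1 ha) ha1).ne'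
  apply imQ_injective
  rw [imQ_cross, h2, smul_zero, imQ_zero]

lemma exists_smul_single_of_cross {a : R3}
    (h : crossProduct a (single 0 1) = 0) : a = a 0 • single 0 1 := by
  rw [cross_apply] at h
  have h1 := congrFun h 1
  have h2 := congrFun h 2
  simp at h1 h2
  ext i; fin_cases i <;> simp [h1, h2]

lemma exists_su2Exp_of_rot {s : SU2} (h : rot s (single 0 1) = single 0 1) :
    ∃ c : ℝ, s = su2Exp (c • single 0 1) := by
  have h1 := mul_eq_of_rot_eq h
  have e2 := congrArg QuaternionAlgebra.imJ h1
  have e3 := congrArg QuaternionAlgebra.imK h1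
  simp [imQ_parts, imJ_mul, imK_mul] at e2 e3
  have h2 : (s : ℍ).imJ = 0 := by linarith
  have h3 : (s : ℍ).imK = 0 := by linarith
  have hs : (s : ℍ).re ^ 2 + (s : ℍ).imI ^ 2 = 1 := by
    have h1 : ‖(s : ℍ)‖ * ‖(s : ℍ)‖ = 1 := by rw [norm_eq_of_mem_sphere]; simp
    rw [← normSq_eq_norm_mul_self, normSq_def', h2, h3] at h1
    linarith
  obtain ⟨c, hc1, hc2⟩ : ∃ c : ℝ, Real.cos c = (s : ℍ).re ∧ Real.sin c = (s : ℍ).imI := by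
    set z : ℂ := ⟨(s : ℍ).re, (s : ℍ).imI⟩
    have hz : ‖z‖ = 1 := by
      rw [← sq_eq_sq₀ (norm_nonneg _) zero_le_one, Complex.sq_norm, Complex.normSq_apply]
      change (s : ℍ).re * (s : ℍ).re + (s : ℍ).imI * (s : ℍ).imI = 1 ^ 2
      linarith
    have hz0 : z ≠ 0 := norm_ne_zero_iff.1 (by rw [hz]; exact one_ne_zero)
    exact ⟨Complex.arg z, by rw [Complex.cos_arg hz0, hz, div_one],
      by rw [Complex.sin_arg, hz, div_one]⟩
  refine ⟨c, Subtype.ext ?_⟩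
  have hn : ‖imQ (c • single 0 1)‖ = |c| := by
    rw [← abs_norm, ← sq_eq_sq_iff_abs_eq_abs, sq, ← normSq_eq_norm_mul_self, normSq_def']
    simp [imQ_parts]
  rw [coe_su2Exp, Quaternion.exp_of_re_eq_zero _ rfl, hn, Real.cos_abs, hc1]
  have h4 : Real.sin |c| / |c| * c = (s : ℍ).imI := by
    rcases eq_or_ne c 0 with rfl | hc0
    · rw [← hc2]; simp
    · rw [← hc2]
      rcases abs_cases c with ⟨h, -⟩ | ⟨h, -⟩ <;> rw [h] <;> field_simp <;> simp
  refine Quaternion.ext _ _ ?_ ?_ ?_ ?_ <;> simp [imQ_parts, h2, h3, h4]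

/-- The abelian subalgebra of elements `(θ, a e₁)`. -/
def cartan : ((Fin 2 → ℝ) × ℝ) →L[ℝ] LieT := (ContinuousLinearMap.id ℝ (Fin 2 → ℝ)).prodMap
    (toSpanSingleton ℝ (single 0 1 : R3))

lemma cartan_apply (u : (Fin 2 → ℝ) × ℝ) : cartan u = (u.1, u.2 • single 0 1) := rfl

lemma commute_cartan (u v : (Fin 2 → ℝ) × ℝ) :
    Commute (imQ (cartan u).2) (imQ (cartan v).2) := by
  rw [cartan_apply, cartan_apply, imQ_smul, imQ_smul]
  exact ((Commute.refl _).smul_left _).smul_right _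

lemma gexp_cartan_add (u v : (Fin 2 → ℝ) × ℝ) :
    gexp (cartan (u + v)) = gexp (cartan u) * gexp (cartan v) := by
  rw [map_add, gexp_add_of_commute (commute_cartan u v)]

lemma rot_gexp_cartan (u : (Fin 2 → ℝ) × ℝ) :
    rot (gexp (cartan u)).2 (single 0 1) = single 0 1 := by
  have h := adj_gexp_self 1 (cartan u) (cartan (0, 1)) (commute_cartan _ _)
  rw [adj_apply, one_smul] at h
  simpa [cartan_apply] using congrArg snd h

lemma exists_gexp_cartan {k : T2SU2} (h : rot k.2 (single 0 1) = single 0 1) :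
    ∃ u, k = gexp (cartan u) := by
  obtain ⟨v, hv⟩ := gexp_surjective (k.1, 1)
  obtain ⟨c, hc⟩ := exists_su2Exp_of_rot h
  refine ⟨(v.1, -(2 * c)), Prod.ext ?_ ?_⟩
  · exact (congrArg fst hv).symm
  · rw [hc]
    change _ = su2Exp _
    congr 1
    ext i
    simp only [cartan_apply, Pi.smul_apply, smul_eq_mul]
    ring

lemma eventually_norm_lt_pi : ∀ᶠ v : LieT in 𝓝 0, ‖imQ fun i => -(v.2 i / 2)‖ < Real.pi := by
  have hc : Continuous fun v : LieT => ‖imQ fun i => -(v.2 i / 2)‖ :=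
    (contDiff_imQ.continuous.comp (by fun_prop)).norm
  have h0 : ‖imQ fun i => -((0 : LieT).2 i / 2)‖ < Real.pi := by
    have : (fun i => -((0 : LieT).2 i / 2)) = 0 := by ext i; simp
    rw [this, imQ_zero, norm_zero]; exact Real.pi_pos
  exact hc.continuousAt.eventually_lt continuousAt_const h0

/-- Near `0`, only the elements of the abelian subalgebra exponentiate to stabilizers of `e₁`. -/
lemma eventually_cartan : ∀ᶠ v : LieT in 𝓝 0,
    rot (gexp v).2 (single 0 1) = single 0 1 → v = cartan (v.1, v.2 0) := by
  filter_upwards [eventually_norm_lt_pi] with v hv h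
  have h1 := exists_smul_single_of_cross (crossProduct_eq_zero_of_rot h hv)
  refine Prod.ext rfl ?_
  rw [cartan_apply]
  ext i
  have := congrFun h1 i
  simp only [Pi.smul_apply, smul_eq_mul] at this ⊢
  linarith

lemma eventually_snd_eq_zero : ∀ᶠ v : LieT in 𝓝 0, (∀ a, rot (gexp v).2 a = a) → v.2 = 0 := by
  filter_upwards [eventually_norm_lt_pi] with v hv h
  have h1 := exists_smul_single_of_cross (crossProduct_eq_zero_of_rot (h _) hv)
  have h2 := crossProduct_eq_zero_of_rot (h (single 1 1)) hv
  rw [cross_apply] at h2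
  have e1 := congrFun h1 1
  have e2 := congrFun h1 2
  have e0 := congrFun h2 2
  simp at e0 e1 e2
  ext i; fin_cases i
  exacts [e0, e1, e2]

variable {A : Set M} {D W : Set R2} {σ : R2 → M} {d : R2}

/-! ### Slices of the principal part -/

/-- `σ` is a smooth section over `W` of `(|μ|, ν)`, with values in `A` and in the set where `μ` is
a positive multiple of the first basis vector. -/
structure IsSlice (μ : M → E3) (ν : M → ℝ) (A : Set M) (W : Set R2)
    (σ : R2 → M) : Prop where
  smooth : ContMDiffOn 𝓘(ℝ, R2) I7 ∞ σ W
  mem : ∀ d ∈ W, σ d ∈ A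
  mu : ∀ d ∈ W, (μ (σ d)).ofLp = d.1 • single 0 1
  pos : ∀ d ∈ W, 0 < d.1
  nu : ∀ d ∈ W, ν (σ d) = d.2

namespace IsSlice

lemma mono (h : IsSlice μ ν A W σ) {W' : Set R2} (hW : W' ⊆ W) : IsSlice μ ν A W' σ :=
  ⟨h.smooth.mono hW, fun d hd => h.mem d (hW hd), fun d hd => h.mu d (hW hd),
    fun d hd => h.pos d (hW hd), fun d hd => h.nu d (hW hd)⟩

lemma norm_mu (h : IsSlice μ ν A W σ) (hd : d ∈ W) : ‖μ (σ d)‖ = d.1 := by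
  have h1 : μ (σ d) = d.1 • EuclideanSpace.single 0 1 := by
    ext i
    have := congrFun (h.mu d hd) i
    rw [this]; fin_cases i <;> simp
  rw [h1, norm_smul, Real.norm_of_nonneg (h.pos d hd).le]; simp

end IsSlice

variable (σ) in
def dslice (d : R2) : R2 →L[ℝ] E7 := mfderiv 𝓘(ℝ, R2) I7 σ d

namespace MultiMoment

variable (hW : IsOpen W) (hσ : IsSlice μ ν A W σ)
include hW hσ

lemma hasMFDerivAt_slice (hd : d ∈ W) :
    HasMFDerivAt 𝓘(ℝ, R2) I7 σ d (dslice σ d) :=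
  ((hσ.smooth.contMDiffAt (hW.mem_nhds hd)).mdifferentiableAt (by simp)).hasMFDerivAt

include S

lemma dmu_dslice (hd : d ∈ W) (w : R2) :
    (dmu μ (σ d) (dslice σ d w)).ofLp = w.1 • single 0 1 := by
  have h1 := (hasMFDerivAt_mu S.mu (σ d)).comp d (hasMFDerivAt_slice hW hσ hd)
  have h2 : HasFDerivAt (fun d => μ (σ d)) ((dmu μ (σ d)).comp (dslice σ d)) d := h1.hasFDerivAt
  have h3 : HasFDerivAt (fun d : R2 => d.1 • (EuclideanSpace.single 0 1 : E3))
      ((ContinuousLinearMap.fst ℝ ℝ ℝ).smulRight (EuclideanSpace.single 0 1)) d :=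
    (ContinuousLinearMap.fst ℝ ℝ ℝ).hasFDerivAt.smul_const _
  have h4 : (fun d => μ (σ d)) =ᶠ[𝓝 d] fun d => d.1 • EuclideanSpace.single 0 1 := by
    filter_upwards [hW.mem_nhds hd] with d hd
    ext i
    rw [hσ.mu d hd]; fin_cases i <;> simp
  have h5 := congrArg (fun L : R2 →L[ℝ] E3 => (L w).ofLp)
    (h2.unique (h3.congr_of_eventuallyEq h4))
  refine h5.trans ?_
  ext i
  fin_cases i <;> simp

lemma dnu_dslice (hd : d ∈ W) (w : R2) :
    dnu ν (σ d) (dslice σ d w) = w.2 := by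
  have h1 := (hasMFDerivAt_nu S.nu (σ d)).comp d (hasMFDerivAt_slice hW hσ hd)
  have h2 : HasFDerivAt (fun d => ν (σ d)) ((dnu ν (σ d)).comp (dslice σ d)) d := h1.hasFDerivAt
  have h4 : (fun d => ν (σ d)) =ᶠ[𝓝 d] snd := by
    filter_upwards [hW.mem_nhds hd] with d hd using hσ.nu d hd
  exact DFunLike.congr_fun (h2.unique (hasFDerivAt_snd.congr_of_eventuallyEq h4)) w

lemma slice_transversal (hd : d ∈ W) {w : R2}
    (h : infAct (σ d) v + dslice σ d w = 0) : w = 0 := by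
  have h1 := congrArg (dmu μ (σ d)) h
  have h2 := congrArg (dnu ν (σ d)) h
  rw [map_add, map_zero] at h1 h2
  rw [S.dnu_infAct, zero_add, S.dnu_dslice hW hσ hd] at h2
  have h3 := congrArg (fun z : E3 => z.ofLp 0) h1
  have h4 : (dmu μ (σ d) (infAct (σ d) v)).ofLp 0 + (dmu μ (σ d) (dslice σ d w)).ofLp 0 = 0 := h3
  rw [S.dmu_infAct, S.dmu_dslice hW hσ hd, hσ.mu d hd, cross_apply] at h4
  simp at h4
  exact Prod.ext h4 h2

omit hW in
lemma contMDiffOn_slice_act :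
    ContMDiffOn 𝓘(ℝ, LR) I7 ∞
      (fun p : LR => gexp p.1 • σ p.2) (snd ⁻¹' W) := by
  have h1 : ContMDiffOn 𝓘(ℝ, LR) modelT2SU2 ∞
      (fun p : LR => gexp p.1) (snd ⁻¹' W) :=
    (contMDiff_gexp.comp contDiff_fst.contMDiff).contMDiffOn
  have h2 : ContMDiffOn 𝓘(ℝ, LR) I7 ∞
      (fun p : LR => σ p.2) (snd ⁻¹' W) :=
    hσ.smooth.comp (t := W) contDiff_snd.contMDiff.contMDiffOn fun _ h => h
  exact ContMDiff.comp_contMDiffOn S.act (h1.prodMk h2)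

/-- Near a slice, points are uniquely `gexp v • σ d` with small `v`. -/
lemma exists_slice_inverse (hd : d ∈ W) (hinj : Injective (infAct (σ d))) :
    ∃ (P : M → LR) (O : Set M), IsOpen O ∧ σ d ∈ O ∧
      ContMDiffOn I7 𝓘(ℝ, LR) ∞ P O ∧ P (σ d) = (0, d) ∧
      (∀ y ∈ O, (P y).2 ∈ W ∧ gexp (P y).1 • σ (P y).2 = y) ∧
      ∀ᶠ q in 𝓝 ((0, d) : LR), gexp q.1 • σ q.2 ∈ O ∧ P (gexp q.1 • σ q.2) = q := by
  set e := ch (σ d) with he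
  set g : LR → M := fun p => gexp p.1 • σ p.2 with hg
  have hgs := S.contMDiffOn_slice_act hσ
  have hV : IsOpen (snd ⁻¹' W : Set LR) := hW.preimage continuous_snd
  set W' : Set LR := snd ⁻¹' W ∩ g ⁻¹' e.source
  have hW' : IsOpen W' := hgs.continuousOn.isOpen_inter_preimage hV e.open_source
  have hg0 : g (0, d) = σ d := by rw [hg]; change gexp 0 • σ d = _; rw [gexp_zero, one_smul]
  have h0W' : ((0, d) : LR) ∈ W' := ⟨hd, by rw [mem_preimage, hg0]; exact mem_chart_source _ _⟩
  set f : LR → E7 := fun p => e (g p) with hf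
  have hfs : ContDiffOn ℝ ∞ f W' := by
    intro p hp
    have h1 := (hgs.mono inter_subset_left).contMDiffAt (hW'.mem_nhds hp)
    exact (ContMDiffAt.comp p (contMDiffAt_chart hp.2) h1).contDiffAt.contDiffWithinAt
  have hfd : HasFDerivAt f (fderiv ℝ f (0, d)) (0, d) :=
    ((hfs.contDiffAt (hW'.mem_nhds h0W')).differentiableAt (by simp)).hasFDerivAt
  have hchart : HasMFDerivAt I7 I7 e (σ d) (.id ℝ E7) := by
    refine ((contMDiffAt_chart (mem_chart_source E7 _)).mdifferentiableAt
      (by simp)).hasMFDerivAt.congr_mfderiv ?_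
    ext1 w; exact mfderiv_chart_self _ w
  have hL1 : ∀ v, fderiv ℝ f (0, d) (v, 0) = infAct (σ d) v := by
    have h1 := hfd.comp (0 : LieT) (hasFDerivAt_prodMk_left (𝕜 := ℝ) (0 : LieT) d)
    have h2 := HasMFDerivAt.comp (0 : LieT) (g := e) (f := fun v : LieT => gexp v • σ d)
      (by rw [gexp_zero, one_smul]; exact hchart) (hasMFDerivAt_infAct S.act (σ d))
    have h3 : HasFDerivAt (fun v : LieT => f (v, d)) (infAct (σ d)) 0 := h2.hasFDerivAt
    exact fun v => DFunLike.congr_fun (h1.unique h3) v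
  have hL2 : ∀ w, fderiv ℝ f (0, d) (0, w) = dslice σ d w := by
    have h1 := hfd.comp d (hasFDerivAt_prodMk_right (𝕜 := ℝ) (0 : LieT) d)
    have h2 := hchart.comp d (hasMFDerivAt_slice hW hσ hd)
    have h3 : HasFDerivAt (fun d => e (σ d)) (dslice σ d) d := h2.hasFDerivAt
    have h4 : (fun d => f ((0 : LieT), d)) = fun d => e (σ d) := funext fun d => by
      rw [hf]; change e (gexp 0 • σ d) = _; rw [gexp_zero, one_smul]
    exact fun v => DFunLike.congr_fun (h1.unique
      (h3.congr_of_eventuallyEq (.of_forall fun d => congrFun h4 d))) v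
  have hker : ∀ p, fderiv ℝ f (0, d) p = 0 → p = 0 := by
    intro p hp
    have h1 : p = (p.1, 0) + (0, p.2) := by simp
    rw [h1, map_add, hL1, hL2] at hp
    have h2 := S.slice_transversal hW hσ hd hp
    rw [h2, map_zero, add_zero] at hp
    exact Prod.ext (hinj (hp.trans (map_zero _).symm)) h2
  have hinj' : Injective (fderiv ℝ f (0, d) : LR →ₗ[ℝ] E7) := (injective_iff_map_eq_zero _).2 hker
  have hdim : finrank ℝ LR = finrank ℝ E7 := by simp
  obtain ⟨h, hh1, hh2, hh3, hh4⟩ := exists_smooth_localInverse hW' hfs h0W'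
    (f' := (LinearEquiv.ofInjectiveOfFinrankEq _ hinj' hdim).toContinuousLinearEquiv)
    (hfd.congr_fderiv (ContinuousLinearMap.ext fun p => rfl))
  have hP0 : h.symm (e (σ d)) = (0, d) := by
    rw [← hg0, show e (g (0, d)) = h (0, d) by rw [hh3], h.left_inv hh1]
  have hsub : ∀ y ∈ e.source ∩ e ⁻¹' h.target, h.symm (e y) ∈ W' ∧ g (h.symm (e y)) = y := by
    intro y hy
    have h1 := hh2 (h.map_target hy.2)
    refine ⟨h1, e.injOn h1.2 hy.1 ?_⟩
    have h2 := h.right_inv hy.2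
    rwa [hh3] at h2
  have hev : ∀ p ∈ h.source, g p ∈ e.source ∩ e ⁻¹' h.target ∧ h.symm (e (g p)) = p := by
    intro p hp
    have h1 : e (g p) = h p := by rw [hh3]
    refine ⟨⟨(hh2 hp).2, ?_⟩, by rw [h1, h.left_inv hp]⟩
    rw [mem_preimage, h1]
    exact h.map_source hp
  refine ⟨fun y => h.symm (e y), e.source ∩ e ⁻¹' h.target,
    e.isOpen_inter_preimage h.open_target, ?_, ?_, hP0, fun y hy => ⟨(hsub y hy).1.1, (hsub y hy).2⟩,
    ?_⟩
  · have := (hev _ hh1).1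
    rwa [hg0] at this
  · exact hh4.contMDiffOn.comp
      (fun y hy => (contMDiffAt_chart hy.1).contMDiffWithinAt) fun y hy => hy.2
  · filter_upwards [h.open_source.mem_nhds hh1] with p hp using hev p hp

end MultiMoment

/-! ### Comparison of slices -/

section Compare

/-- The elements `u` of the abelian subalgebra for which `gexp u` acts trivially. -/
def cartanLattice (M : Type*) [MulAction T2SU2 M] : AddSubgroup ((Fin 2 → ℝ) × ℝ) where
  carrier := {u | ∀ x : M, gexp (cartan u) • x = x}
  add_mem' {u v} hu hv x := by
    rw [gexp_cartan_add, mul_smul (gexp (cartan u)) (gexp (cartan v)) x, hv, hu]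
  zero_mem' x := by rw [map_zero, gexp_zero, one_smul]
  neg_mem' {u} hu x := by
    have h := hu (gexp (cartan (-u)) • x)
    rw [smul_smul (gexp (cartan u)) (gexp (cartan (-u))) x, ← gexp_cartan_add, add_neg_cancel,
      map_zero, gexp_zero, one_smul] at h
    exact h.symm

lemma mem_cartanLattice {u : (Fin 2 → ℝ) × ℝ} :
    u ∈ cartanLattice M ↔ ∀ x : M, gexp (cartan u) • x = x := Iff.rfl

lemma gexp_cartan_sub_smul (u v : (Fin 2 → ℝ) × ℝ) (x : M) :
    gexp (cartan (u - v)) • gexp (cartan v) • x = gexp (cartan u) • x := by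
  rw [smul_smul (gexp (cartan (u - v))) (gexp (cartan v)) x, ← gexp_cartan_add, sub_add_cancel]

lemma cartan_injective : Injective cartan := by
  intro u v h
  rw [cartan_apply, cartan_apply, Prod.mk.injEq] at h
  refine Prod.ext h.1 ?_
  simpa using congrFun h.2 0

/-- The union of the orbits over an open set of principal orbits separated by `(|μ|, ν)`. -/
structure IsSeparated (μ : M → E3) (ν : M → ℝ) (A : Set M) : Prop where
  inj : ∀ x ∈ A, Injective (infAct x)
  smul : ∀ (k : T2SU2), ∀ x ∈ A, k • x ∈ A
  sep : ∀ x ∈ A, ∀ y ∈ A, ‖μ x‖ = ‖μ y‖ → ν x = ν y → ∃ k : T2SU2, y = k • x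

variable {W W₁ W₂ : Set R2} {σ σ₁ σ₂ : R2 → M}

namespace MultiMoment

variable (hA : IsSeparated μ ν A)
include S

/-- Acting on a slice by the abelian subgroup gives a slice. -/
lemma isSlice_smul (hA : IsSeparated μ ν A) (hW : IsOpen W) (hσ : IsSlice μ ν A W σ)
    {w : R2 → (Fin 2 → ℝ) × ℝ}
    (hw : ContDiffOn ℝ ∞ w W) : IsSlice μ ν A W fun d => gexp (cartan (w d)) • σ d where
  smooth d hd := by
    refine ContMDiffAt.contMDiffWithinAt (contMDiffAt_act S.act ?_
      (hσ.smooth.contMDiffAt (hW.mem_nhds hd)))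
    exact ContMDiffAt.comp d (g := fun u => gexp (cartan u)) (f := w)
      (contMDiff_gexp.comp cartan.contDiff.contMDiff).contMDiffAt
      (hw.contDiffAt (hW.mem_nhds hd)).contMDiffAt
  mem d hd := hA.smul _ _ (hσ.mem d hd)
  mu d hd := by rw [mu_smul S.pres S.act S.mu, hσ.mu d hd, rot_smul, rot_gexp_cartan]
  pos := hσ.pos
  nu d hd := by rw [nu_smul S.pres S.act S.nu, hσ.nu d hd]

include hA in
lemma exists_cartan_smul_eq (h₁ : IsSlice μ ν A W₁ σ₁) (h₂ : IsSlice μ ν A W₂ σ₂)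
    (hd₁ : d ∈ W₁) (hd₂ : d ∈ W₂) : ∃ u, gexp (cartan u) • σ₁ d = σ₂ d := by
  obtain ⟨k, hk⟩ := hA.sep _ (h₁.mem d hd₁) _ (h₂.mem d hd₂)
    (by rw [h₁.norm_mu hd₁, h₂.norm_mu hd₂]) (by rw [h₁.nu d hd₁, h₂.nu d hd₂])
  have h1 := h₂.mu d hd₂
  rw [hk, mu_smul S.pres S.act S.mu, h₁.mu d hd₁, rot_smul] at h1
  obtain ⟨u, hu⟩ := exists_gexp_cartan (smul_right_injective _ (h₁.pos d hd₁).ne' h1)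
  exact ⟨u, by rw [hk, hu]⟩

include hA in
lemma eventually_lattice_eq_zero (hW : IsOpen W) (hσ : IsSlice μ ν A W σ)
    (hd : d ∈ W) : ∀ᶠ u in 𝓝 0, u ∈ cartanLattice M → u = 0 := by
  obtain ⟨P, O, -, -, -, hP0, -, hP⟩ := S.exists_slice_inverse hW hσ hd (hA.inj _ (hσ.mem d hd))
  have hc : ContinuousAt (fun u => ((cartan u, d) : LR)) 0 :=
    (cartan.continuous.prodMk continuous_const).continuousAt
  have h0 : ((cartan 0, d) : LR) = (0, d) := by rw [map_zero]
  have h1 := (hc.tendsto.eventually (h0 ▸ hP))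
  filter_upwards [h1] with u hu hl
  have h2 := hu.2
  rw [hl (σ d), hP0] at h2
  exact cartan_injective (((congrArg fst h2).symm).trans (map_zero _).symm)

lemma exists_local_difference (h₁ : IsSlice μ ν A W₁ σ₁) (h₂ : IsSlice μ ν A W₂ σ₂)
    (hA : IsSeparated μ ν A) (hW₁ : IsOpen W₁) (hW₂ : IsOpen W₂)
    {d₀ : R2} (hd₁ : d₀ ∈ W₁) (hd₂ : d₀ ∈ W₂) {u₀ : (Fin 2 → ℝ) × ℝ}
    (hu₀ : gexp (cartan u₀) • σ₁ d₀ = σ₂ d₀) :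
    ∃ (N : Set R2) (w : R2 → (Fin 2 → ℝ) × ℝ), IsOpen N ∧ d₀ ∈ N ∧
      ContDiffOn ℝ ∞ w N ∧ w d₀ = u₀ ∧ ∀ d ∈ N, gexp (cartan (w d)) • σ₁ d = σ₂ d := by
  obtain ⟨P, O, hO, hdO, hP, hP0, hPO, -⟩ :=
    S.exists_slice_inverse hW₁ h₁ hd₁ (hA.inj _ (h₁.mem d₀ hd₁))
  set y : R2 → M := fun d => gexp (cartan (-u₀)) • σ₂ d with hy
  have hys : IsSlice μ ν A W₂ y := S.isSlice_smul hA hW₂ h₂ (w := fun _ => -u₀) contDiffOn_const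
  have hy0 : y d₀ = σ₁ d₀ := by
    change gexp (cartan (-u₀)) • σ₂ d₀ = _
    rw [← hu₀]
    rw [smul_smul (gexp (cartan (-u₀))) (gexp (cartan u₀)) (σ₁ d₀), ← gexp_cartan_add,
      neg_add_cancel, map_zero, gexp_zero, one_smul]
  set N₁ := W₂ ∩ y ⁻¹' O
  have hN₁ : IsOpen N₁ := hys.smooth.continuousOn.isOpen_inter_preimage hW₂ hO
  have hdN₁ : d₀ ∈ N₁ := ⟨hd₂, by rwa [mem_preimage, hy0]⟩
  have hPy : ContDiffOn ℝ ∞ (fun d => (P (y d)).1) N₁ := contDiff_fst.comp_contDiffOn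
      ((hP.comp (hys.smooth.mono inter_subset_left) fun d hd => hd.2).contDiffOn)
  have h0 : (P (y d₀)).1 = 0 := by rw [hy0, hP0]
  have hev := (hPy.continuousOn.continuousAt (hN₁.mem_nhds hdN₁)).eventually
    (h0 ▸ eventually_cartan)
  obtain ⟨N₂, hN₂, hN₂o, hdN₂⟩ := eventually_nhds_iff.1 hev
  refine ⟨N₁ ∩ N₂, fun d => u₀ + ((P (y d)).1.1, (P (y d)).1.2 0), hN₁.inter hN₂o,
    ⟨hdN₁, hdN₂⟩, ?_, ?_, ?_⟩
  · refine contDiffOn_const.add ?_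
    have h2 := hPy.mono (t := N₁ ∩ N₂) inter_subset_left
    exact h2.fst.prodMk (contDiffOn_pi.1 h2.snd 0)
  · change u₀ + ((P (y d₀)).1.1, (P (y d₀)).1.2 0) = u₀
    rw [h0]; simp
  · intro d hd
    obtain ⟨hw, hq⟩ := hPO (y d) hd.1.2
    have hdd : (P (y d)).2 = d := by
      refine Prod.ext ?_ ?_
      · rw [← h₁.norm_mu hw, ← norm_mu_smul S.pres S.act S.mu, hq, hys.norm_mu hd.1.1]
      · rw [← h₁.nu _ hw, ← nu_smul S.pres S.act S.nu (gexp (P (y d)).1), hq, hys.nu d hd.1.1]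
    rw [hdd] at hq
    have h3 := hys.mu d hd.1.1
    rw [← hq, mu_smul S.pres S.act S.mu, h₁.mu d (hdd ▸ hw), rot_smul] at h3
    have h4 := hN₂ d hd.2 (smul_right_injective _ (h₁.pos d (hdd ▸ hw)).ne' h3)
    have h5 : gexp (cartan ((P (y d)).1.1, (P (y d)).1.2 0)) • σ₁ d = y d :=
      (congrArg (fun v => gexp v • σ₁ d) h4.symm).trans hq
    rw [gexp_cartan_add, mul_smul (gexp (cartan u₀)) _ (σ₁ d), h5, hy]
    change gexp (cartan u₀) • gexp (cartan (-u₀)) • σ₂ d = _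
    rw [smul_smul (gexp (cartan u₀)) (gexp (cartan (-u₀))) (σ₂ d), ← gexp_cartan_add,
      add_neg_cancel, map_zero, gexp_zero, one_smul]

include hA in
lemma sub_mem_cartanLattice (hx : x ∈ A) {u v : (Fin 2 → ℝ) × ℝ}
    (h : gexp (cartan u) • x = gexp (cartan v) • x) : u - v ∈ cartanLattice M := by
  have h1 := gexp_cartan_sub_smul (u - v) u x
  rw [h, sub_sub_cancel_left] at h1
  have h2 := gexp_cartan_sub_smul 0 v x
  rw [zero_sub, map_zero, gexp_zero, one_smul] at h2
  exact fun y => S.smul_eq_of_injective (hA.inj x hx) (h1.symm.trans h2) y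

/-- Two slices over a convex open set differ by a smooth function. -/
lemma exists_difference (h₁ : IsSlice μ ν A W σ₁) (h₂ : IsSlice μ ν A W σ₂)
    (hA : IsSeparated μ ν A) (hW : IsOpen W) (hc : Convex ℝ W) :
    ∃ w : R2 → (Fin 2 → ℝ) × ℝ, ContDiffOn ℝ ∞ w W ∧
      ∀ d ∈ W, gexp (cartan (w d)) • σ₁ d = σ₂ d := by
  rcases W.eq_empty_or_nonempty with rfl | ⟨d₀, hd₀⟩
  · exact ⟨0, by simp, by simp⟩
  set Λ := cartanLattice M with hΛ
  have hz := S.eventually_lattice_eq_zero hA hW h₁ hd₀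
  have hdisc : IsDiscrete (Λ : Set ((Fin 2 → ℝ) × ℝ)) := by
    have : DiscreteTopology Λ := by
      rw [discreteTopology_iff_isOpen_singleton_zero]
      obtain ⟨O, hO, hOo, h0⟩ := eventually_nhds_iff.1 hz
      have : ({0} : Set Λ) = Subtype.val ⁻¹' O := by
        ext u
        constructor
        · rintro rfl; exact h0
        · exact fun hu => Subtype.ext (hO u hu u.2)
      rw [this]
      exact hOo.preimage continuous_subtype_val
    exact ⟨this⟩
  have hcov := (AddSubgroup.isAddQuotientCoveringMap_of_comm Λ hdisc).isCoveringMap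
  choose! u hu using fun d (hd : d ∈ W) => S.exists_cartan_smul_eq hA h₁ h₂ hd hd
  have hmk : ∀ d ∈ W, ∀ v, gexp (cartan v) • σ₁ d = σ₂ d →
      (QuotientAddGroup.mk v : _ ⧸ Λ) = QuotientAddGroup.mk (u d) := by
    intro d hd v hv
    rw [QuotientAddGroup.eq, neg_add_eq_sub]
    exact S.sub_mem_cartanLattice hA (h₁.mem d hd) ((hu d hd).trans hv.symm)
  have hfc : ContinuousOn (fun d => (QuotientAddGroup.mk (u d) : _ ⧸ Λ)) W := by
    intro d hd
    obtain ⟨N, w, hN, hdN, hw, -, hwN⟩ := S.exists_local_difference h₁ h₂ hA hW hW hd hd (hu d hd)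
    refine ContinuousAt.continuousWithinAt ?_
    have h3 : ContinuousAt (fun d => (QuotientAddGroup.mk (w d) : _ ⧸ Λ)) d :=
      (hcov.continuous.continuousAt).comp (hw.continuousOn.continuousAt (hN.mem_nhds hdN))
    refine h3.congr ?_
    filter_upwards [hN.mem_nhds hdN, hW.mem_nhds hd] with d' h1 h2 using hmk d' h2 _ (hwN d' h1)
  have : ContractibleSpace W := hc.contractibleSpace ⟨d₀, hd₀⟩
  have : LocallyPathConnectedSpace W := hW.locallyPathConnectedSpace
  obtain ⟨F, ⟨-, hF⟩, -⟩ := hcov.existsUnique_continuousMap_lifts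
    (⟨_, hfc.domRestrict⟩ : C(W, _ ⧸ Λ)) ⟨d₀, hd₀⟩ (u d₀) rfl
  have hF' : ∀ d : W, gexp (cartan (F d)) • σ₁ d = σ₂ d := by
    intro d
    have h3 : (QuotientAddGroup.mk (F d) : _ ⧸ Λ) = QuotientAddGroup.mk (u d) := congrFun hF d
    rw [QuotientAddGroup.eq] at h3
    have h4 := h3 (gexp (cartan (F d)) • σ₁ d)
    rw [neg_add_eq_sub, gexp_cartan_sub_smul, hu d d.2] at h4
    exact h4.symm
  have hFe : ∀ d (hd : d ∈ W), Function.extend Subtype.val F 0 d = F ⟨d, hd⟩ := fun d hd =>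
    Subtype.val_injective.extend_apply F 0 ⟨d, hd⟩
  have hFc : ContinuousOn (Function.extend Subtype.val F 0) W := by
    rw [continuousOn_iff_continuous_domRestrict]
    exact F.continuous.congr fun d => (hFe d d.2).symm
  refine ⟨Function.extend Subtype.val F 0, fun d hd => ?_,
    fun d hd => by rw [hFe d hd]; exact hF' ⟨d, hd⟩⟩
  obtain ⟨N, w, hN, hdN, hw, hw0, hwN⟩ :=
      S.exists_local_difference h₁ h₂ hA hW hW hd hd (hF' ⟨d, hd⟩)
  refine ContDiffAt.contDiffWithinAt ?_
  refine (hw.contDiffAt (hN.mem_nhds hdN)).congr_of_eventuallyEq ?_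
  have hsub : ContinuousAt (fun d => Function.extend Subtype.val F 0 d - w d) d :=
    (hFc.continuousAt (hW.mem_nhds hd)).sub (hw.continuousOn.continuousAt (hN.mem_nhds hdN))
  have h0 : Function.extend Subtype.val F 0 d - w d = 0 := by rw [hFe d hd, hw0, sub_self]
  have hz' : ∀ᶠ u in 𝓝 (Function.extend Subtype.val F 0 d - w d), u ∈ Λ → u = 0 := by
    rw [h0]; exact hz
  have hev := hsub.eventually hz'
  filter_upwards [hev, hN.mem_nhds hdN, hW.mem_nhds hd] with d' h1 h2 h3
  refine sub_eq_zero.1 (h1 (S.sub_mem_cartanLattice hA (h₁.mem d' h3) ?_))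
  rw [hwN d' h2, hFe d' h3, hF' ⟨d', h3⟩]

end MultiMoment

end Compare

/-! ### Gluing slices -/

lemma Convex.setOf_ball_subset {D : Set R2} (hD : Convex ℝ D) (ε : ℝ) :
    Convex ℝ {d | ball d ε ⊆ D} := by
  intro x hx y hy a b ha hb hab z hz
  have h : ∀ p : R2, p + (z - (a • x + b • y)) ∈ ball p ε := fun p => by
    rw [mem_ball, dist_eq_norm, add_sub_cancel_left, ← dist_eq_norm]
    exact hz
  have h1 := hD (hx (h x)) (hy (h y)) ha hb hab
  have h2 : a • (x + (z - (a • x + b • y))) + b • (y + (z - (a • x + b • y))) = z := by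
    have : z - (a • x + b • y) = (a + b) • (z - (a • x + b • y)) := by rw [hab, one_smul]
    rw [smul_add, smul_add, add_add_add_comm, ← add_smul, ← this]
    abel
  rwa [h2] at h1

lemma isClosed_setOf_ball_subset (D : Set R2) (ε : ℝ) :
    IsClosed {d : R2 | ball d ε ⊆ D} := by
  rw [← isOpen_compl_iff, isOpen_iff_mem_nhds]
  intro d hd
  simp only [mem_compl_iff, mem_ofPred_eq, not_subset] at hd
  obtain ⟨z, hz, hzD⟩ := hd
  have h1 : ∀ᶠ d' in 𝓝 d, z ∈ ball d' ε := by
    have : ContinuousAt (fun d' => dist z d') d := by fun_prop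
    exact this.eventually_lt continuousAt_const hz
  filter_upwards [h1] with d' h1 h2 using hzD (h2 h1)

/-- A compact convex exhaustion of a convex open set. -/
def exhaustion (D : Set R2) (n : ℕ) : Set R2 :=
  {d | ball d (1 / (n + 1)) ⊆ D} ∩ Metric.closedBall 0 n

lemma isCompact_exhaustion (D : Set R2) (n : ℕ) : IsCompact (exhaustion D n) :=
  (isCompact_closedBall _ _).inter_left (isClosed_setOf_ball_subset D _)

lemma convex_exhaustion (hD : Convex ℝ D) (n : ℕ) : Convex ℝ (exhaustion D n) :=
  (hD.setOf_ball_subset _).inter (convex_closedBall _ _)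

lemma exhaustion_subset (D : Set R2) (n : ℕ) : exhaustion D n ⊆ D :=
  fun d hd => hd.1 (Metric.mem_ball_self (by positivity))

lemma exhaustion_subset_interior (D : Set R2) (n : ℕ) :
    exhaustion D n ⊆ interior (exhaustion D (n + 1)) := by
  intro d hd
  rw [mem_interior_iff_mem_nhds]
  set δ : ℝ := 1 / (n + 1) - 1 / (n + 1 + 1) with hδ
  have hδ0 : 0 < δ := by
    rw [hδ, sub_pos]
    exact one_div_lt_one_div_of_lt (by positivity) (by linarith)
  have hδ1 : δ ≤ 1 := by
    have h1 : (1 : ℝ) / (n + 1) ≤ 1 := by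
      rw [div_le_one (by positivity)]; linarith [n.cast_nonneg (α := ℝ)]
    have h2 : (0 : ℝ) ≤ 1 / (n + 1 + 1) := by positivity
    linarith
  refine Filter.mem_of_superset (Metric.ball_mem_nhds d hδ0) fun d' hd' => ⟨?_, ?_⟩
  · refine Subset.trans (Metric.ball_subset_ball' ?_) hd.1
    rw [mem_ball] at hd'
    push_cast
    linarith
  · have h1 := hd.2
    rw [Metric.mem_closedBall] at h1 ⊢
    rw [mem_ball] at hd'
    push_cast
    linarith [dist_triangle d' d 0]

lemma exhaustion_mono (D : Set R2) : Monotone (exhaustion D) :=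
  monotone_nat_of_le_succ fun n => (exhaustion_subset_interior D n).trans interior_subset

lemma exists_mem_exhaustion (hD : IsOpen D) (hd : d ∈ D) :
    ∃ n, d ∈ exhaustion D n := by
  obtain ⟨ε, hε, hb⟩ := Metric.isOpen_iff.1 hD d hd
  obtain ⟨n, hn⟩ := exists_nat_one_div_lt hε
  obtain ⟨m, hm⟩ := exists_nat_ge (dist d 0)
  refine ⟨max n m, ?_, ?_⟩
  · refine Subset.trans (Metric.ball_subset_ball ?_) hb
    refine le_trans (one_div_le_one_div_of_le (by positivity) ?_) hn.le
    have : (n : ℝ) ≤ (max n m : ℕ) := by exact_mod_cast le_max_left n m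
    linarith
  · have : (m : ℝ) ≤ (max n m : ℕ) := by exact_mod_cast le_max_right n m
    exact hm.trans this

lemma IsCompact.exists_pos_lt_abs {K : Set R2} (hK : IsCompact K) (f : R2 →L[ℝ] ℝ)
    {c : ℝ} (h : ∀ d ∈ K, f d ≠ c) : ∃ ε > 0, ∀ d ∈ K, ε < |f d - c| := by
  rcases K.eq_empty_or_nonempty with rfl | hne
  · exact ⟨1, one_pos, by simp⟩
  obtain ⟨d, hd, hmin⟩ := hK.exists_isMinOn (f := fun d => |f d - c|) hne
    (f.continuous.sub continuous_const).abs.continuousOn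
  have hpos : 0 < |f d - c| := abs_pos.2 (sub_ne_zero.2 (h d hd))
  exact ⟨|f d - c| / 2, half_pos hpos, fun d' hd' => (half_lt_self hpos).trans_le (hmin hd')⟩

section Glue

variable {W U : Set R2}

lemma IsSlice.of_locally (h : ∀ d ∈ U, ∃ V, IsOpen V ∧ d ∈ V ∧ ∃ σ', IsSlice μ ν A V σ' ∧
    EqOn σ σ' V) : IsSlice μ ν A U σ where
  smooth d hd := by
    obtain ⟨V, hV, hdV, σ', h1, h2⟩ := h d hd
    refine ContMDiffAt.contMDiffWithinAt ?_
    exact (h1.smooth.contMDiffAt (hV.mem_nhds hdV)).congr_of_eventuallyEq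
      (h2.eventuallyEq_of_mem (hV.mem_nhds hdV))
  mem d hd := by obtain ⟨V, hV, hdV, σ', h1, h2⟩ := h d hd; rw [h2 hdV]; exact h1.mem d hdV
  mu d hd := by obtain ⟨V, hV, hdV, σ', h1, h2⟩ := h d hd; rw [h2 hdV]; exact h1.mu d hdV
  pos d hd := by obtain ⟨V, hV, hdV, σ', h1, h2⟩ := h d hd; exact h1.pos d hdV
  nu d hd := by obtain ⟨V, hV, hdV, σ', h1, h2⟩ := h d hd; rw [h2 hdV]; exact h1.nu d hdV

def HasSlice (μ : M → E3) (ν : M → ℝ) (A : Set M) (K : Set R2) : Prop :=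
  ∃ U, IsOpen U ∧ K ⊆ U ∧ ∃ σ, IsSlice μ ν A U σ

lemma HasSlice.mono {K K' : Set R2} (h : HasSlice μ ν A K) (hK : K' ⊆ K) :
    HasSlice μ ν A K' := by
  obtain ⟨U, hU, hKU, σ, hσ⟩ := h
  exact ⟨U, hU, hK.trans hKU, σ, hσ⟩

lemma hasSlice_empty [Nonempty M] : HasSlice μ ν A ∅ :=
  ⟨∅, isOpen_empty, subset_rfl, fun _ => Classical.arbitrary M,
    ⟨by simp, by simp, by simp, by simp, by simp⟩⟩

namespace MultiMoment

variable (hA : IsSeparated μ ν A)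
include S hA

lemma hasSlice_of_halves {K : Set R2} (hK : IsCompact K) (hKc : Convex ℝ K)
    (f : R2 →L[ℝ] ℝ) (c : ℝ) (h₁ : HasSlice μ ν A (K ∩ {d | f d ≤ c}))
    (h₂ : HasSlice μ ν A (K ∩ {d | c ≤ f d})) : HasSlice μ ν A K := by
  obtain ⟨U₁, hU₁, hKU₁, σ₁, hσ₁⟩ := h₁
  obtain ⟨U₂, hU₂, hKU₂, σ₂, hσ₂⟩ := h₂
  have hcl : IsClosed {d | f d = c} := isClosed_eq f.continuous continuous_const
  have hK₀c : Convex ℝ (K ∩ {d | f d = c}) := hKc.inter (convex_hyperplane f.isLinear c)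
  obtain ⟨δ, hδ, hsub⟩ := (hK.inter_right hcl).exists_thickening_subset_open (hU₁.inter hU₂)
    fun d hd => ⟨hKU₁ ⟨hd.1, le_of_eq hd.2⟩, hKU₂ ⟨hd.1, ge_of_eq hd.2⟩⟩
  set W := Metric.thickening δ (K ∩ {d | f d = c}) with hWdef
  have hW : IsOpen W := Metric.isOpen_thickening
  obtain ⟨w, hw, hw₂⟩ := S.exists_difference (hσ₁.mono fun d hd => (hsub hd).1)
    (hσ₂.mono fun d hd => (hsub hd).2) hA hW (hK₀c.thickening δ)
  obtain ⟨ε, hε, hεK⟩ := (hK.diff hW).exists_pos_lt_abs f (c := c) fun d hd h =>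
    hd.2 (Metric.self_subset_thickening hδ _ ⟨hd.1, h⟩)
  set χ : R2 → ℝ := fun d => Real.smoothTransition ((f d - (c - ε)) / (2 * ε)) with hχ
  have hχs : ContDiff ℝ ∞ χ :=
    Real.smoothTransition.contDiff.comp ((f.contDiff.sub contDiff_const).div_const _)
  have hχ0 : ∀ d, f d ≤ c - ε → χ d = 0 := fun d hd =>
    Real.smoothTransition.zero_of_nonpos (div_nonpos_of_nonpos_of_nonneg (by linarith)
      (by positivity))
  have hχ1 : ∀ d, c + ε ≤ f d → χ d = 1 := fun d hd =>
    Real.smoothTransition.one_of_one_le ((one_le_div (by positivity)).2 (by linarith))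
  classical
  set σ : R2 → M := fun d => if f d < c - ε then σ₁ d else if c + ε < f d then σ₂ d else
    gexp (cartan (χ d • w d)) • σ₁ d with hσ
  have hO₁ : IsOpen (U₁ ∩ {d | f d < c - ε}) := hU₁.inter (isOpen_lt f.continuous continuous_const)
  have hO₂ : IsOpen (U₂ ∩ {d | c + ε < f d}) := hU₂.inter (isOpen_lt continuous_const f.continuous)
  refine ⟨(U₁ ∩ {d | f d < c - ε}) ∪ W ∪ (U₂ ∩ {d | c + ε < f d}), (hO₁.union hW).union hO₂,
    fun d hd => ?_, σ, IsSlice.of_locally ?_⟩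
  · by_cases hdW : d ∈ W
    · exact Or.inl (Or.inr hdW)
    rcases lt_abs.1 (hεK d ⟨hd, hdW⟩) with h | h
    · exact Or.inr ⟨hKU₂ ⟨hd, show c ≤ f d by linarith⟩, show c + ε < f d by linarith⟩
    · exact Or.inl (Or.inl ⟨hKU₁ ⟨hd, show f d ≤ c by linarith⟩, show f d < c - ε by linarith⟩)
  · rintro d ((hd | hd) | hd)
    · refine ⟨_, hO₁, hd, σ₁, hσ₁.mono inter_subset_left, fun d' hd' => if_pos hd'.2⟩
    · refine ⟨W, hW, hd, _, S.isSlice_smul hA hW (hσ₁.mono fun d hd => (hsub hd).1)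
        (hχs.contDiffOn.smul hw), fun d' hd' => ?_⟩
      rw [hσ]
      dsimp only
      split_ifs with h1 h2
      · change _ = gexp (cartan (χ d' • w d')) • σ₁ d'
        rw [hχ0 d' h1.le, zero_smul, map_zero, gexp_zero, one_smul]
      · change _ = gexp (cartan (χ d' • w d')) • σ₁ d'
        rw [hχ1 d' h2.le, one_smul, hw₂ d' hd']
      · rfl
    · refine ⟨_, hO₂, hd, σ₂, hσ₂.mono inter_subset_left, fun d' hd' => ?_⟩
      have h1 : c + ε < f d' := hd'.2
      rw [hσ]
      dsimp only
      rw [if_neg (by linarith), if_pos h1]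

lemma hasSlice_of_fibers [Nonempty M] {K : Set R2} (hK : IsCompact K) (hKc : Convex ℝ K)
    (f : R2 →L[ℝ] ℝ) (h : ∀ t, HasSlice μ ν A (K ∩ {d | f d = t})) : HasSlice μ ν A K := by
  set T : Set ℝ := {t | HasSlice μ ν A (K ∩ {d | f d ≤ t})} with hT
  have key : ∀ t, ∃ ε > 0, ∀ s s', |s - t| < ε → |s' - t| < ε → s ∈ T → s' ∈ T := by
    intro t
    obtain ⟨U, hU, hKU, σ, hσ⟩ := h t
    obtain ⟨ε, hε, hεK⟩ := (hK.diff hU).exists_pos_lt_abs f (c := t) fun d hd h =>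
      hd.2 (hKU ⟨hd.1, h⟩)
    refine ⟨ε, hε, fun s s' hs hs' hsT => ?_⟩
    have hcl : IsClosed {d | f d ≤ s'} := isClosed_le f.continuous continuous_const
    refine S.hasSlice_of_halves hA (hK.inter_right hcl)
      (hKc.inter (convex_halfSpace_le f.isLinear s')) f s ?_ ?_
    · exact hsT.mono fun d hd => ⟨hd.1.1, hd.2⟩
    · refine ⟨U, hU, fun d hd => ?_, σ, hσ⟩
      by_contra hdU
      have h1 := hεK d ⟨hd.1.1, hdU⟩
      have h2 : f d ≤ s' := hd.1.2
      have h3 : s ≤ f d := hd.2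
      rw [abs_lt] at hs hs'
      exact absurd h1 (not_lt.2 (abs_le.2 ⟨by linarith, by linarith⟩))
  have hclopen : IsClopen T := by
    refine ⟨⟨isOpen_iff_mem_nhds.2 fun t ht => ?_⟩, isOpen_iff_mem_nhds.2 fun t ht => ?_⟩
    · obtain ⟨ε, hε, h1⟩ := key t
      filter_upwards [Metric.ball_mem_nhds t hε] with s hs hsT
      exact ht (h1 s t (by rwa [mem_ball, Real.dist_eq] at hs) (by simpa using hε) hsT)
    · obtain ⟨ε, hε, h1⟩ := key t
      filter_upwards [Metric.ball_mem_nhds t hε] with s hs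
      exact h1 t s (by simpa using hε) (by rwa [mem_ball, Real.dist_eq] at hs) ht
  obtain ⟨R, hR⟩ := hK.exists_bound_of_continuousOn f.continuous.continuousOn
  have hne : T.Nonempty := by
    refine ⟨-R - 1, hasSlice_empty.mono fun d hd => ?_⟩
    have h1 := hR d hd.1
    have h2 : f d ≤ -R - 1 := hd.2
    rw [Real.norm_eq_abs, abs_le] at h1
    linarith [h1.1]
  have h1 : R ∈ T := by rw [hclopen.eq_univ hne]; exact mem_univ _
  refine HasSlice.mono h1 fun d hd => ⟨hd, ?_⟩
  have h2 := hR d hd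
  rw [Real.norm_eq_abs, abs_le] at h2
  exact h2.2

variable (hloc : ∀ d ∈ D, HasSlice μ ν A {d})
include hloc

lemma hasSlice_of_isCompact [Nonempty M] {K : Set R2} (hK : IsCompact K)
    (hKc : Convex ℝ K) (hKD : K ⊆ D) : HasSlice μ ν A K := by
  refine S.hasSlice_of_fibers hA hK hKc (.fst ℝ ℝ ℝ) fun t => ?_
  refine S.hasSlice_of_fibers hA
    (hK.inter_right (isClosed_eq (ContinuousLinearMap.fst ℝ ℝ ℝ).continuous continuous_const))
    (hKc.inter (convex_hyperplane (ContinuousLinearMap.fst ℝ ℝ ℝ).isLinear t)) (.snd ℝ ℝ ℝ)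
    fun u => ?_
  by_cases h : (t, u) ∈ D
  · exact (hloc _ h).mono fun d hd => Prod.ext hd.1.2 hd.2
  · refine hasSlice_empty.mono fun d hd => h ?_
    have : d = (t, u) := Prod.ext hd.1.2 hd.2
    exact this ▸ hKD hd.1.1

/-- A slice can be changed so as to extend, without changing it on a smaller set. -/
lemma exists_slice_extend [Nonempty M] (hDc : Convex ℝ D) (n : ℕ) {U : Set R2}
    {σ : R2 → M} (hKU : exhaustion D (n + 2) ⊆ U) (hσ : IsSlice μ ν A U σ) :
    ∃ U' σ', IsOpen U' ∧ exhaustion D (n + 3) ⊆ U' ∧ IsSlice μ ν A U' σ' ∧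
      EqOn σ' σ (exhaustion D n) := by
  obtain ⟨U', hU', hKU', τ, hτ⟩ := S.hasSlice_of_isCompact hA hloc
    (isCompact_exhaustion D (n + 3)) (convex_exhaustion hDc _) (exhaustion_subset D _)
  set W := interior (exhaustion D (n + 2)) with hWdef
  have hWU' : W ⊆ U' := interior_subset.trans ((exhaustion_mono D (Nat.le_succ _)).trans hKU')
  obtain ⟨w, hw, hw₂⟩ := S.exists_difference (hτ.mono hWU') (hσ.mono (interior_subset.trans hKU))
    hA isOpen_interior (convex_exhaustion hDc _).interior
  obtain ⟨χ, hχ0, hχ1, -⟩ := exists_contMDiffMap_zero_one_of_isClosed (n := ⊤) 𝓘(ℝ, R2)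
    (s := (interior (exhaustion D (n + 1)))ᶜ) (t := exhaustion D n)
    isOpen_interior.isClosed_compl (isCompact_exhaustion D n).isClosed
    (disjoint_compl_left_iff_subset.2 (exhaustion_subset_interior D n))
  have hχs : ContDiff ℝ ∞ χ := χ.contMDiff.contDiff
  refine ⟨U', fun d => gexp (cartan (χ d • w d)) • τ d, hU', hKU', IsSlice.of_locally fun d hd => ?_,
    fun d hd => ?_⟩
  · by_cases hdW : d ∈ W
    · exact ⟨W, isOpen_interior, hdW, _, S.isSlice_smul hA isOpen_interior (hτ.mono hWU')
        (hχs.contDiffOn.smul hw), fun _ _ => rfl⟩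
    · refine ⟨U' ∩ (exhaustion D (n + 1))ᶜ, hU'.inter
        (isCompact_exhaustion D _).isClosed.isOpen_compl,
        ⟨hd, fun h => hdW (exhaustion_subset_interior D _ h)⟩, τ, hτ.mono inter_subset_left,
        fun d' hd' => ?_⟩
      have : χ d' = 0 := hχ0 fun h => hd'.2 (interior_subset h)
      dsimp only
      rw [this, zero_smul, map_zero, gexp_zero, one_smul]
  · have h1 : χ d = 1 := hχ1 hd
    have h2 : d ∈ W := interior_mono (exhaustion_mono D (Nat.le_succ _))
      (exhaustion_subset_interior D n hd)
    dsimp only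
    rw [h1, one_smul, hw₂ d h2]

lemma exists_slice [Nonempty M] (hD : IsOpen D) (hDc : Convex ℝ D) :
    ∃ σ, IsSlice μ ν A D σ := by
  let X : ℕ → Type _ := fun n => {σ : R2 → M // ∃ U, exhaustion D (n + 2) ⊆ U ∧ IsSlice μ ν A U σ}
  have hstep : ∀ n (σ : X n), ∃ σ' : X (n + 1), EqOn σ'.1 σ.1 (exhaustion D n) := by
    rintro n ⟨σ, U, hKU, hσ⟩
    obtain ⟨U', σ', -, h1, h2, h3⟩ := S.exists_slice_extend hA hloc hDc n hKU hσ
    exact ⟨⟨σ', U', h1, h2⟩, h3⟩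
  choose F hF using hstep
  obtain ⟨U₀, -, hKU₀, σ₀, hσ₀⟩ := S.hasSlice_of_isCompact hA hloc
    (isCompact_exhaustion D 2) (convex_exhaustion hDc _) (exhaustion_subset D _)
  let τ : ∀ n, X n := Nat.rec ⟨σ₀, U₀, hKU₀, hσ₀⟩ F
  have hτ : ∀ n m, n ≤ m → EqOn (τ m).1 (τ n).1 (exhaustion D n) := by
    intro n m hnm
    induction m, hnm using Nat.le_induction with
    | base => exact fun _ _ => rfl
    | succ m hnm ih => exact fun d hd => (hF m (τ m) (exhaustion_mono D hnm hd)).trans (ih hd)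
  classical
  set σ : R2 → M := fun d => if h : ∃ n, d ∈ exhaustion D n then (τ (Nat.find h)).1 d else
    Classical.arbitrary M
  have hσ : ∀ n, EqOn σ (τ n).1 (exhaustion D n) := by
    intro n d hd
    have h : ∃ n, d ∈ exhaustion D n := ⟨n, hd⟩
    have h1 : σ d = (τ (Nat.find h)).1 d := dif_pos h
    rw [h1, hτ _ n (Nat.find_min' h hd) (Nat.find_spec h)]
  refine ⟨σ, IsSlice.of_locally fun d hd => ?_⟩
  obtain ⟨n, hn⟩ := exists_mem_exhaustion hD hd
  obtain ⟨U, hU, hs⟩ := (τ (n + 1)).2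
  refine ⟨_, isOpen_interior, exhaustion_subset_interior D n hn, (τ (n + 1)).1,
    hs.mono (interior_subset.trans ((exhaustion_mono D (by omega)).trans hU)),
    fun d' hd' => hσ _ (interior_subset hd')⟩

end MultiMoment

end Glue

section Primitive

open MeasureTheory

lemma contDiffOn_integral_unitInterval {E : Type*} [NormedAddCommGroup E] [NormedSpace ℝ E]
    {h : E × ℝ → ℝ} {W : Set (E × ℝ)} (hW : IsOpen W) (hh : ContDiffOn ℝ ∞ h W) {x₀ : E}
    (hK : ∀ u ∈ Icc (0 : ℝ) 1, (x₀, u) ∈ W) :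
    ContDiffAt ℝ ∞ (fun x => ∫ u in (0 : ℝ)..1, h (x, u)) x₀ := by
  obtain ⟨V, O, hV, hO, hxV, hKO, hVO⟩ := generalized_tube_lemma (s := {x₀})
    isCompact_singleton (t := Icc (0 : ℝ) 1) isCompact_Icc hW
    (by rintro ⟨x, u⟩ ⟨rfl, hu⟩; exact hK u hu)
  obtain ⟨O', hO', hKO', hO'O, hO'c⟩ := exists_open_between_and_isCompact_closure isCompact_Icc
    hO hKO
  obtain ⟨χ, hχ0, hχ1, -⟩ := exists_contMDiffMap_zero_one_of_isClosed (n := ⊤) 𝓘(ℝ, ℝ)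
    (s := O'ᶜ) (t := Icc (0 : ℝ) 1) hO'.isClosed_compl isClosed_Icc
    (disjoint_compl_left_iff_subset.2 hKO')
  have hχs : ContDiff ℝ ∞ χ := χ.contMDiff.contDiff
  set g : E → ℝ → ℝ := fun x t => χ (-t) * h (x, -t) with hg
  have hgs : ContDiffOn ℝ ∞ (fun p : E × ℝ => g p.1 p.2) (V ×ˢ univ) := by
    rintro ⟨x, t⟩ ⟨hx, -⟩
    refine ContDiffAt.contDiffWithinAt ?_
    have hneg : ContDiff ℝ ∞ fun p : E × ℝ => -p.2 := contDiff_snd.neg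
    by_cases ht : -t ∈ O
    · have h1 : ContDiffAt ℝ ∞ h (x, -t) := hh.contDiffAt (hW.mem_nhds (hVO ⟨hx, ht⟩))
      have h2 : ContDiffAt ℝ ∞ (fun p : E × ℝ => h (p.1, -p.2)) (x, t) :=
        ContDiffAt.comp (x, t) (f := fun p : E × ℝ => (p.1, -p.2)) h1
          (contDiffAt_fst.prodMk hneg.contDiffAt)
      exact (hχs.comp hneg).contDiffAt.mul h2
    · have h1 : ∀ᶠ p : E × ℝ in 𝓝 (x, t), -p.2 ∈ (closure O')ᶜ :=
        hneg.continuous.continuousAt.eventually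
          (isClosed_closure.isOpen_compl.mem_nhds fun h => ht (hO'O h))
      refine (contDiffAt_const (c := (0 : ℝ))).congr_of_eventuallyEq ?_
      filter_upwards [h1] with p hp
      have h2 : χ (-p.2) = 0 := hχ0 fun h => hp (subset_closure h)
      rw [hg]
      dsimp only
      rw [h2, zero_mul]
  have hgk : ∀ x t, x ∈ V → t ∉ Neg.neg ⁻¹' closure O' → g x t = 0 := by
    intro x t _ ht
    have h2 : χ (-t) = 0 := hχ0 fun h => ht (subset_closure h)
    rw [hg]
    dsimp only
    rw [h2, zero_mul]
  have hk : IsCompact (Neg.neg ⁻¹' closure O') := (Homeomorph.neg ℝ).isCompact_preimage.2 hO'c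
  have hf : LocallyIntegrable ((Icc (0 : ℝ) 1).indicator fun _ => (1 : ℝ)) :=
    (locallyIntegrable_const 1).indicator measurableSet_Icc
  have key := contDiffOn_convolution_right_with_param_comp (n := ⊤) (μ := volume)
    (ContinuousLinearMap.mul ℝ ℝ) (v := fun _ : E => (0 : ℝ)) contDiffOn_const hV hk hgk hf hgs
  refine (key.contDiffAt (hV.mem_nhds (hxV rfl))).congr_of_eventuallyEq
    (.of_forall fun x => ?_)
  dsimp only
  rw [convolution_mul, intervalIntegral.integral_of_le zero_le_one, ← integral_Icc_eq_integral_Ioc,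
    ← integral_indicator measurableSet_Icc]
  refine integral_congr_ae (.of_forall fun t => ?_)
  dsimp only
  by_cases ht : t ∈ Icc (0 : ℝ) 1
  · have h1 : χ t = 1 := hχ1 ht
    rw [indicator_of_mem ht, indicator_of_mem ht, hg]
    dsimp only
    rw [zero_sub, neg_neg, h1, one_mul, one_mul]
  · rw [indicator_of_notMem ht, indicator_of_notMem ht, zero_mul]

variable (hD : IsOpen D) (hDc : Convex ℝ D) {w : R2 → ℝ}
  (hw : ContDiffOn ℝ ∞ w D)
include hD hDc hw

omit hD hw in
lemma mk_mem_of_mem_uIcc {r a b t : ℝ} (ha : (r, a) ∈ D) (hb : (r, b) ∈ D)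
    (ht : t ∈ uIcc a b) : (r, t) ∈ D := by
  rw [← segment_eq_uIcc] at ht
  obtain ⟨x, y, hx, hy, hxy, rfl⟩ := ht
  have h1 := hDc ha hb hx hy hxy
  simpa [← add_mul, hxy] using h1

lemma contDiffOn_primitive {I : Set ℝ} (hI : IsOpen I) {s : ℝ → ℝ} (hs : ContDiffOn ℝ ∞ s I)
    (hsD : ∀ r ∈ I, (r, s r) ∈ D) :
    ContDiffOn ℝ ∞ (fun d : R2 => ∫ t in s d.1..d.2, w (d.1, t)) (D ∩ fst ⁻¹' I) := by
  intro d₀ hd₀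
  refine ContDiffAt.contDiffWithinAt ?_
  set q : R2 × ℝ → R2 := fun p => (p.1.1, s p.1.1 + (p.1.2 - s p.1.1) * p.2) with hq
  set Q : Set (R2 × ℝ) := {p | p.1.1 ∈ I} with hQ
  have hQo : IsOpen Q := hI.preimage (continuous_fst.comp continuous_fst)
  have hs1 : ContDiffOn ℝ ∞ (fun p : R2 × ℝ => s p.1.1) Q :=
    hs.comp (contDiff_fst.comp contDiff_fst).contDiffOn fun p hp => hp
  have hqs : ContDiffOn ℝ ∞ q Q := (contDiff_fst.comp contDiff_fst).contDiffOn.prodMk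
      (hs1.add (((contDiff_snd.comp contDiff_fst).contDiffOn.sub hs1).mul contDiff_snd.contDiffOn))
  have hWo : IsOpen (Q ∩ q ⁻¹' D) := hqs.continuousOn.isOpen_inter_preimage hQo hD
  have h1 := contDiffOn_integral_unitInterval (h := fun p => w (q p)) hWo
    (hw.comp (hqs.mono inter_subset_left) fun p hp => hp.2) (x₀ := d₀) fun u hu => by
      refine ⟨hd₀.2, ?_⟩
      refine mk_mem_of_mem_uIcc hDc (hsD _ hd₀.2) hd₀.1 ?_
      rw [← segment_eq_uIcc]
      exact ⟨1 - u, u, by linarith [hu.2], hu.1, by ring, by simp only [smul_eq_mul]; ring⟩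
  have h2 : ContDiffAt ℝ ∞ (fun d : R2 => d.2 - s d.1) d₀ :=
    contDiffAt_snd.sub (ContDiffAt.comp d₀ (hs.contDiffAt (hI.mem_nhds hd₀.2)) contDiffAt_fst)
  refine (h2.mul h1).congr_of_eventuallyEq (.of_forall fun d => ?_)
  have h3 := intervalIntegral.mul_integral_comp_add_mul (f := fun t => w (d.1, t)) (a := 0)
    (b := 1) (d.2 - s d.1) (s d.1)
  rw [mul_zero, add_zero, mul_one, add_sub_cancel] at h3
  exact h3.symm

lemma hasDerivAt_primitive {r a t : ℝ} (ha : (r, a) ∈ D) (ht : (r, t) ∈ D) :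
    HasDerivAt (fun t => ∫ τ in a..t, w (r, τ)) (w (r, t)) t := by
  have hc : ContinuousOn (fun τ : ℝ => w (r, τ)) {τ | (r, τ) ∈ D} :=
    hw.continuousOn.comp (by fun_prop) fun τ hτ => hτ
  have ho : IsOpen {τ : ℝ | (r, τ) ∈ D} := hD.preimage (by fun_prop)
  refine intervalIntegral.integral_hasDerivAt_right
    (hc.mono fun τ hτ => mk_mem_of_mem_uIcc hDc ha ht hτ).intervalIntegrable
    (hc.stronglyMeasurableAtFilter ho _ ht) (hc.continuousAt (ho.mem_nhds ht))

omit hw in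
/-- The projection of a convex open set to the first coordinate has a smooth section. -/
lemma exists_smooth_section : ∃ s : ℝ → ℝ, ContDiffOn ℝ ∞ s (fst '' D) ∧
    ∀ r ∈ fst '' D, (r, s r) ∈ D := by
  have hI : IsOpen (fst '' D) := isOpenMap_fst D hD
  let I : TopologicalSpace.Opens ℝ := ⟨fst '' D, hI⟩
  haveI : LocallyCompactSpace I := hI.locallyCompactSpace
  obtain ⟨f, hf⟩ := exists_contMDiffMap_forall_mem_convex_of_local_const (n := ⊤) (F := ℝ)
    (M := I) 𝓘(ℝ, ℝ) (t := fun r => {t | ((r : ℝ), t) ∈ D})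
    (fun r => by
      intro a ha b hb x y hx hy hxy
      have h1 := hDc ha hb hx hy hxy
      have h2 : x * (r : ℝ) + y * r = r := by rw [← add_mul, hxy, one_mul]
      simpa [h2] using h1)
    fun r => by
      obtain ⟨d, hd, hdr⟩ := r.2
      refine ⟨d.2, ?_⟩
      have h1 : Continuous fun r' : I => ((r' : ℝ), d.2) := by fun_prop
      exact h1.continuousAt.eventually (hD.mem_nhds (show ((r : ℝ), d.2) ∈ D from hdr ▸ hd))
  classical
  let s : ℝ → ℝ := fun r => if h : r ∈ fst '' D then f ⟨r, h⟩ else 0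
  have hs : ∀ r (hr : r ∈ fst '' D), s r = f ⟨r, hr⟩ := fun r hr => dif_pos hr
  refine ⟨s, fun r hr => ?_, fun r hr => ?_⟩
  · have h1 : ContMDiffAt 𝓘(ℝ, ℝ) 𝓘(ℝ, ℝ) ∞ (fun r' : I => s r') (⟨r, hr⟩ : I) :=
      (f.contMDiff ⟨r, hr⟩).congr_of_eventuallyEq
        (.of_forall fun r' => hs r' r'.2)
    have h2 := (contMDiffAt_subtype_iff (U := I) (x := ⟨r, hr⟩)).1 h1
    exact h2.contDiffAt.contDiffWithinAt
  · rw [hs r hr]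
    exact hf ⟨r, hr⟩

end Primitive

lemma hasMFDerivAt_gexp_smul (hact : SmoothAction M) {E : Type*} [NormedAddCommGroup E]
    [NormedSpace ℝ E] {f : E → LieT} {g : E → M} {z : E} {f' : E →L[ℝ] LieT} {g' : E →L[ℝ] E7}
    (hf : HasFDerivAt f f' z) (hg : HasMFDerivAt 𝓘(ℝ, E) I7 g z g') (h0 : f z = 0) :
    HasMFDerivAt 𝓘(ℝ, E) I7 (fun z => gexp (f z) • g z) z ((infAct (g z)).comp f' + g') := by
  set a : LieT × M → M := fun p => gexp p.1 • p.2 with ha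
  have has : ContMDiff (𝓘(ℝ, LieT).prod I7) I7 ∞ a :=
    ContMDiff.comp hact ((contMDiff_gexp.comp contMDiff_fst).prodMk contMDiff_snd)
  have h1 : MDifferentiableAt (𝓘(ℝ, LieT).prod I7) I7 a (f z, g z) :=
    (has _).mdifferentiableAt (by simp)
  have h3 : HasMFDerivAt 𝓘(ℝ, LieT) I7 (fun v : LieT => a (v, g z)) (f z) (infAct (g z)) := by
    rw [h0]; exact hasMFDerivAt_infAct hact (g z)
  have h4 : HasMFDerivAt I7 I7 (fun y : M => a (f z, y)) (g z)
      (.id ℝ E7) := by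
    refine (hasMFDerivAt_id (g z)).congr_of_eventuallyEq (.of_forall fun y => ?_)
    rw [ha, h0]
    change gexp 0 • y = y
    rw [gexp_zero, one_smul]
  have h5 := HasMFDerivAt.comp z (g := a) (f := fun z => (f z, g z)) h1.hasMFDerivAt
    (hf.hasMFDerivAt.prodMk hg)
  refine h5.congr_mfderiv (ContinuousLinearMap.ext fun w => ?_)
  have h6 := mfderiv_prod_eq_add_apply (v := ((f' w, g' w) : LieT × E7)) h1
  refine Eq.trans h6 ?_
  have h7 : (mfderiv 𝓘(ℝ, LieT) I7 (fun v : LieT => a (v, g z)) (f z) : LieT →L[ℝ] E7)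
      = infAct (g z) := h3.mfderiv
  have h8 : (mfderiv I7 I7 (fun y : M => a (f z, y)) (g z) : L7)
      = .id ℝ E7 := h4.mfderiv
  change (mfderiv 𝓘(ℝ, LieT) I7 (fun v : LieT => a (v, g z)) (f z) : LieT →L[ℝ] E7) (f' w)
    + (mfderiv I7 I7 (fun y : M => a (f z, y)) (g z) : L7) (g' w) = _
  rw [h7, h8]
  rfl

lemma dact_mem_Kd (hact : SmoothAction M) (hpres : PreservesG2 φ) {k : T2SU2} {w : E7}
    (hw : w ∈ φ.Kd x) : dact k x w ∈ φ.Kd (k • x) := by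
  obtain ⟨a, b, c, rfl⟩ := φ.exists_of_mem_Kd hw
  have h1 : dact k x (φ.Xf x) = φ.Xf (k • x) := by
    rw [G2Structure.Xf, G2Structure.Xf, ← pres_cr hpres, dact_tv hact, dact_tv hact]
  rw [map_add, map_add, map_smul, map_smul, map_smul, dact_tv hact, dact_tv hact, h1]
  exact add_mem (add_mem (smul_mem _ _ (φ.tv_mem_Kd _ _))
    (smul_mem _ _ (φ.tv_mem_Kd _ _)))
    (smul_mem _ _ (φ.Xf_mem_Kd _))

namespace MultiMoment

variable (hW : IsOpen W) (hσ : IsSlice μ ν A W σ)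
include S hW hσ

lemma exists_infAct_add_dslice (hd : d ∈ W)
    (hinj : Injective (infAct (σ d))) (z : E7) :
    ∃ v w, infAct (σ d) v + dslice σ d w = z := by
  set L : LR →ₗ[ℝ] E7 := (infAct (σ d) : LieT →ₗ[ℝ] E7).coprod (dslice σ d : R2 →ₗ[ℝ] E7) with hL
  have h1 : Injective L := by
    refine (injective_iff_map_eq_zero _).2 fun p hp => ?_
    have h2 : infAct (σ d) p.1 + dslice σ d p.2 = 0 := hp
    have h3 := S.slice_transversal hW hσ hd h2
    rw [h3, map_zero, add_zero] at h2
    exact Prod.ext (hinj (h2.trans (map_zero _).symm)) h3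
  obtain ⟨p, hp⟩ := (LinearMap.injective_iff_surjective_of_finrank_eq_finrank
    (show finrank ℝ LR = finrank ℝ E7 by simp)).1 h1 z
  exact ⟨p.1, p.2, hp⟩

/-- The rate at which a slice turns in the direction of `ν`, relative to the associatives. -/
def turnRate (φ : G2Structure M) (σ : R2 → M) (d : R2) : ℝ :=
  φ.om (σ d) (dslice σ d (0, 1)) (dslice σ d (1, 0))

lemma dslice_sub_mem_Kd (hd : d ∈ W) (hinj : Injective (infAct (σ d))) :
    dslice σ d (0, 1) - turnRate φ σ d • infAct (σ d) (sv (single 0 1)) ∈ φ.Kd (σ d) := by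
  rw [φ.mem_Kd_iff (uind_of_injective hinj)]
  intro z
  obtain ⟨v, w, rfl⟩ := S.exists_infAct_add_dslice hW hσ hd hinj z
  have hw : w = w.1 • (1, 0) + w.2 • (0, 1) := by ext <;> simp
  have h0 : ∀ w, φ.om (σ d) (dslice σ d w) (dslice σ d w) = 0 := fun w => by
    have := φ.om_swap (σ d) (dslice σ d w) (dslice σ d w); linarith
  have h1 : ∀ w, φ.om (σ d) (infAct (σ d) (sv (single 0 1))) (dslice σ d w) = w.1 := fun w => by
    rw [S.om_infAct_left, S.dmu_dslice hW hσ hd]; simp [sv]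
  have h2 : φ.om (σ d) (dslice σ d (0, 1)) (infAct (σ d) v) = 0 := by
    rw [φ.om_swap, S.om_infAct_left, S.dmu_dslice hW hσ hd]; simp
  have h3 : φ.om (σ d) (infAct (σ d) (sv (single 0 1))) (infAct (σ d) v) = 0 := by
    rw [φ.om_swap, S.om_infAct_left, S.dmu_infAct, hσ.mu d hd]; simp [sv]
  rw [map_sub, map_smul, LinearMap.sub_apply, LinearMap.smul_apply, map_add, map_add, h2, h3, h1]
  nth_rw 1 [hw]
  rw [map_add, map_smul, map_smul, map_add, map_smul, map_smul, h0, turnRate]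
  simp only [smul_eq_mul]
  ring

lemma contDiffOn_turnRate : ContDiffOn ℝ ∞ (turnRate φ σ) W := by
  intro d₀ hd₀
  refine ContDiffAt.contDiffWithinAt ?_
  set e := ch (σ d₀)
  have hV : IsOpen (W ∩ σ ⁻¹' e.source) :=
    hσ.smooth.continuousOn.isOpen_inter_preimage hW e.open_source
  have hd₀V : d₀ ∈ W ∩ σ ⁻¹' e.source := ⟨hd₀, mem_chart_source E7 (σ d₀)⟩
  have hc : ContDiffOn ℝ ∞ (fun d => (e (σ d) : E7)) (W ∩ σ ⁻¹' e.source) := fun d hd =>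
    (ContMDiffAt.comp d (contMDiffAt_chart hd.2)
      (hσ.smooth.contMDiffAt (hW.mem_nhds hd.1))).contDiffAt.contDiffWithinAt
  have hf : ∀ w : R2,
      ContDiffAt ℝ ∞ (fun d => fderiv ℝ (fun d => (e (σ d) : E7)) d w) d₀ := fun w =>
    ((hc.contDiffAt (hV.mem_nhds hd₀V)).fderiv_right (m := ∞) (by simp)).clm_apply contDiffAt_const
  refine (S.contDiffAt_omC (x := σ d₀) (f := fun d => (e (σ d) : E7)) (e.map_source hd₀V.2)
    (hc.contDiffAt (hV.mem_nhds hd₀V)) (hf (0, 1)) (hf (1, 0))).congr_of_eventuallyEq ?_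
  filter_upwards [hV.mem_nhds hd₀V] with d hd
  have h1 : ∀ w, dsy (σ d₀) (e (σ d)) (fderiv ℝ (fun d => (e (σ d) : E7)) d w) = dslice σ d w := by
    intro w
    have h2 := HasMFDerivAt.comp d
      ((contMDiffAt_chart (x := σ d₀) hd.2).mdifferentiableAt (by simp)).hasMFDerivAt
      (hasMFDerivAt_slice hW hσ hd.1)
    have h3 : HasFDerivAt (fun d => (e (σ d) : E7))
      ((mfderiv I7 I7 e (σ d) : L7).comp (dslice σ d)) d := h2.hasFDerivAt
    have h4 := ((hc.contDiffAt (hV.mem_nhds hd)).differentiableAt (by simp)).hasFDerivAt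
    exact (congrArg (fun L : R2 →L[ℝ] E7 => dsy (σ d₀) (e (σ d)) (L w)) (h4.unique h3)).trans
      (mfderiv_chart_symm_comp (σ d₀) hd.2 _)
  rw [omC_eq S.act (σ d₀) (e.map_source hd.2), h1, h1, turnRate]
  exact congrArg (fun x => φ.om x (dslice σ d (0, 1)) (dslice σ d (1, 0)))
    (e.left_inv hd.2).symm

omit hσ in
lemma dslice_smul (hσ : IsSlice μ ν A W σ) {w : R2 → (Fin 2 → ℝ) × ℝ}
    (hw : ContDiffOn ℝ ∞ w W) (hd : d ∈ W) (z : R2) :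
    dslice (fun d => gexp (cartan (w d)) • σ d) d z =
      dact (gexp (cartan (w d))) (σ d) (dslice σ d z) +
        infAct (gexp (cartan (w d)) • σ d) (cartan (fderiv ℝ w d z)) := by
  have hw' : HasFDerivAt w (fderiv ℝ w d) d :=
    ((hw.contDiffAt (hW.mem_nhds hd)).differentiableAt (by simp)).hasFDerivAt
  have h1 : HasFDerivAt (fun d' => cartan (w d' - w d)) (cartan.comp (fderiv ℝ w d)) d :=
    cartan.hasFDerivAt.comp d (hw'.sub_const _)
  have h2 := HasMFDerivAt.comp d (hasMFDerivAt_dact S.act (gexp (cartan (w d))) (σ d))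
    (hasMFDerivAt_slice hW hσ hd)
  have h3 := hasMFDerivAt_gexp_smul S.act h1 h2 (by rw [sub_self, map_zero])
  have h4 : HasMFDerivAt 𝓘(ℝ, R2) I7 (fun d => gexp (cartan (w d)) • σ d) d _ :=
    h3.congr_of_eventuallyEq (.of_forall fun d' => (gexp_cartan_sub_smul (w d') (w d) (σ d')).symm)
  have h5 : dslice (fun d => gexp (cartan (w d)) • σ d) d = _ := h4.mfderiv
  rw [h5]
  exact add_comm _ _

lemma exists_horizontal_slice (hA : IsSeparated μ ν A) (hc : Convex ℝ W) :
    ∃ τ, IsSlice μ ν A W τ ∧ ∀ d ∈ W, dslice τ d (0, 1) ∈ φ.Kd (τ d) := by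
  obtain ⟨s, hs, hsW⟩ := exists_smooth_section hW hc
  have hg := S.contDiffOn_turnRate hW hσ
  have hI : IsOpen (fst '' W) := isOpenMap_fst W hW
  set θ : R2 → ℝ := fun d => ∫ t in s d.1..d.2, turnRate φ σ (d.1, t)
  have hθ : ContDiffOn ℝ ∞ θ W := (contDiffOn_primitive hW hc hg hI hs hsW).mono fun d hd =>
    ⟨hd, mem_image_of_mem _ hd⟩
  have hθ' : ∀ d ∈ W, fderiv ℝ θ d (0, 1) = turnRate φ σ d := by
    intro d hd
    have h1 := ((hθ.contDiffAt (hW.mem_nhds hd)).differentiableAt (by simp)).hasFDerivAt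
    have h2 := h1.comp_hasDerivAt d.2 ((hasDerivAt_const d.2 d.1).prodMk (hasDerivAt_id d.2))
    exact h2.unique (hasDerivAt_primitive hW hc hg (hsW d.1 (mem_image_of_mem _ hd)) hd)
  set w : R2 → (Fin 2 → ℝ) × ℝ := fun d => (0, -θ d)
  have hw : ContDiffOn ℝ ∞ w W := contDiffOn_const.prodMk hθ.neg
  refine ⟨_, S.isSlice_smul hA hW hσ hw, fun d hd => ?_⟩
  have hwd : fderiv ℝ w d (0, 1) = (0, -turnRate φ σ d) := by
    have h1 := ((hθ.contDiffAt (hW.mem_nhds hd)).differentiableAt (by simp)).hasFDerivAt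
    have h2 : HasFDerivAt w _ d := (hasFDerivAt_const (0 : Fin 2 → ℝ) d).prodMk h1.neg
    rw [h2.fderiv, ← hθ' d hd]
    rfl
  rw [S.dslice_smul hW hσ hw hd, hwd]
  have h1 := dact_mem_Kd S.act S.pres (k := gexp (cartan (w d)))
    (S.dslice_sub_mem_Kd hW hσ hd (hA.inj _ (hσ.mem d hd)))
  rw [map_sub, map_smul, dact_sv S.act, rot_gexp_cartan, sub_eq_add_neg, ← neg_smul,
    ← map_smul] at h1
  convert h1 using 3
  rw [cartan_apply, ← sv_smul]
  rfl

end MultiMoment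

/-! ### Horizontal slices and the projection to `G^{SU(2)}` -/

lemma mem_ker_toPermHom_iff {k : T2SU2} :
    k ∈ (MulAction.toPermHom T2SU2 M).ker ↔ ∀ y : M, k • y = y := by
  rw [MonoidHom.mem_ker, Equiv.ext_iff]
  rfl

lemma mem_gammaTwo_iff {s : SU2} :
    s ∈ gammaTwo M ↔ ∃ t : Circle × Circle, ∀ y : M, ((t, s) : T2SU2) • y = y := by
  rw [gammaTwo, Subgroup.mem_map]
  constructor
  · rintro ⟨⟨t, s'⟩, h1, rfl⟩
    exact ⟨t, mem_ker_toPermHom_iff.1 h1⟩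
  · rintro ⟨t, ht⟩
    exact ⟨(t, s), mem_ker_toPermHom_iff.2 ht, rfl⟩

lemma baseProj_eq_iff {x y : M} : baseProj x = baseProj y ↔ ∃ k : T2SU2, y = k • x := by
  rw [eq_comm, baseProj, baseProj, Quotient.eq'', MulAction.orbitRel_apply, MulAction.mem_orbit_iff]
  exact exists_congr fun _ => eq_comm

lemma baseProj_smul (k : T2SU2) (x : M) : baseProj (k • x) = baseProj x :=
  (baseProj_eq_iff.2 ⟨k, rfl⟩).symm

lemma torusProj_eq_iff {x y : M} :
    torusProj x = torusProj y ↔ ∃ t : Circle × Circle, y = ((t, 1) : T2SU2) • x := by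
  rw [eq_comm, torusProj, torusProj, Quotient.eq'', MulAction.orbitRel_apply,
    MulAction.mem_orbit_iff]
  constructor
  · rintro ⟨⟨⟨t, s⟩, hk⟩, rfl⟩
    have h1 : s = 1 := (Subgroup.mem_prod.1 hk).2
    subst h1
    exact ⟨t, rfl⟩
  · rintro ⟨t, rfl⟩
    exact ⟨⟨(t, 1), Subgroup.mem_prod.2 ⟨Subgroup.mem_top _, Subgroup.mem_bot.2 rfl⟩⟩, rfl⟩

lemma torusProj_smul (t : Circle × Circle) (x : M) :
    torusProj (((t, 1) : T2SU2) • x) = torusProj x := (torusProj_eq_iff.2 ⟨t, rfl⟩).symm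

/-- A slice over the convex open set `D`, meeting all orbits in the open set `A`, along which
`∂σ/∂ν` is tangent to the associatives. -/
structure HorizontalSlice (φ : G2Structure M) (μ : M → E3) (ν : M → ℝ)
    (A : Set M) (D : Set R2) (σ : R2 → M) : Prop where
  isOpen_carrier : IsOpen A
  separated : IsSeparated μ ν A
  isOpen_domain : IsOpen D
  convex : Convex ℝ D
  slice : IsSlice μ ν A D σ
  horizontal : ∀ d ∈ D, dslice σ d (0, 1) ∈ φ.Kd (σ d)
  mem : ∀ x ∈ A, (‖μ x‖, ν x) ∈ D

/-- The map to `G^{SU(2)}` given by `g • σ d ↦ [g.2]`. -/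
def fibProj (μ : M → E3) (ν : M → ℝ) (σ : R2 → M) (x : M) : GSU2 M := open Classical in
  if h : ∃ g : T2SU2, x = g • σ (‖μ x‖, ν x) then (h.choose.2 : GSU2 M) else ((1 : SU2) : GSU2 M)

namespace MultiMoment

include S

lemma baseMap_baseProj (x : M) : baseMap μ ν (baseProj x) = (‖μ x‖, ν x) := by
  obtain ⟨k, hk⟩ := baseProj_eq_iff.1 (Quotient.out_eq' (baseProj x))
  rw [baseMap]
  nth_rw 3 [hk]
  nth_rw 4 [hk]
  rw [norm_mu_smul S.pres S.act S.mu, nu_smul S.pres S.act S.nu]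

lemma hasSlice_singleton {A : Set M} (hA : IsOpen A) (hx : x ∈ A)
    (hinj : Injective (infAct x)) {r : ℝ} (hr : 0 < r)
    (hμ : (μ x).ofLp = r • single 0 1) : HasSlice μ ν A {(r, ν x)} := by
  set e := ch x with he
  have hex : e.symm (e x) = x := e.left_inv (mem_chart_source E7 x)
  set m : M → E3 × ℝ := fun y => (μ y, ν y) with hm
  set dm : E7 →L[ℝ] E3 × ℝ := (dmu μ x).prod (dnu ν x) with hdm
  have hdms : Surjective dm := by
    rintro ⟨a, t⟩
    obtain ⟨w, rfl⟩ := S.dmu_surjective hinj a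
    have h0 := S.dnu_Xf (uind_of_injective hinj)
    refine ⟨w + ((t - dnu ν x w) / dnu ν x (φ.Xf x)) • φ.Xf x, Prod.ext ?_ ?_⟩
    · change dmu μ x _ = _
      rw [map_add, map_smul, S.dmu_of_mem_Kd (φ.Xf_mem_Kd x), smul_zero, add_zero]
    · change dnu ν x _ = _
      rw [map_add, map_smul, smul_eq_mul, div_mul_cancel₀ _ h0]
      ring
  obtain ⟨R, hR⟩ := dm.exists_rightInverse_of_surjective (LinearMap.range_eq_top.2 hdms)
  set ψ : E3 × ℝ → E7 := fun z => e x + R z with hψ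
  have hψs : ContDiff ℝ ∞ ψ := contDiff_const.add R.contDiff
  have hψ0 : ψ 0 = e x := by rw [hψ]; simp
  set W : Set (E3 × ℝ) := ψ ⁻¹' (e.target ∩ e.symm ⁻¹' A)
  have hW : IsOpen W := (e.symm.isOpen_inter_preimage hA).preimage hψs.continuous
  have h0W : (0 : E3 × ℝ) ∈ W := by
    refine ⟨?_, ?_⟩ <;> rw [hψ0]
    · exact e.map_source (mem_chart_source E7 x)
    · rw [mem_preimage, hex]; exact hx
  have hms : ContDiffOn ℝ ∞ (fun y => m (e.symm y)) e.target := by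
    intro y hy
    have h1 := contMDiffAt_chart_symm (x := x) hy
    exact ((S.mu.smooth.contMDiffAt.comp y h1).contDiffAt.prodMk
      (S.nu.smooth.contMDiffAt.comp y h1).contDiffAt).contDiffWithinAt
  have hfs : ContDiffOn ℝ ∞ (fun z => m (e.symm (ψ z))) W :=
    hms.comp hψs.contDiffOn fun z hz => hz.1
  have hmd : HasFDerivAt (fun y => m (e.symm y)) dm (e x) :=
    (hasFDerivAt_mu_chart S.mu x).prodMk (hasFDerivAt_nu_chart S.nu x)
  have hfd : HasFDerivAt (fun z => m (e.symm (ψ z)))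
      ((ContinuousLinearEquiv.refl ℝ (E3 × ℝ) :
        E3 × ℝ →L[ℝ] E3 × ℝ)) 0 := by
    have h1 : HasFDerivAt ψ R 0 := R.hasFDerivAt.const_add _
    have h2 := HasFDerivAt.comp (0 : E3 × ℝ) (hψ0.symm ▸ hmd) h1
    rwa [hR] at h2
  obtain ⟨h, hh1, hh2, hh3, hh4⟩ := exists_smooth_localInverse hW hfs h0W hfd
  set ι : R2 → E3 × ℝ := fun d => (d.1 • EuclideanSpace.single 0 1, d.2)
  have hι : ContDiff ℝ ∞ ι := (contDiff_fst.smul contDiff_const).prodMk contDiff_snd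
  have hU : IsOpen ({d : R2 | 0 < d.1} ∩ ι ⁻¹' h.target) :=
    (isOpen_lt continuous_const continuous_fst).inter (h.open_target.preimage hι.continuous)
  have hmσ : ∀ d ∈ ι ⁻¹' h.target, m (e.symm (ψ (h.symm (ι d)))) = ι d := by
    intro d hd
    have h1 := h.right_inv hd
    rwa [hh3] at h1
  refine ⟨_, hU, ?_, fun d => e.symm (ψ (h.symm (ι d))), ?_, ?_, ?_, fun d hd => hd.1, ?_⟩
  · rintro _ rfl
    refine ⟨hr, ?_⟩
    have h1 : ι (r, ν x) = h 0 := by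
      rw [hh3]
      dsimp only
      rw [hψ0, hex]
      refine Prod.ext ?_ rfl
      change r • EuclideanSpace.single 0 1 = μ x
      apply WithLp.ofLp_injective
      rw [hμ]
      simp
    rw [mem_preimage, h1]
    exact h.map_source hh1
  · intro d hd
    have h1 : ContDiffAt ℝ ∞ (fun d => ψ (h.symm (ι d))) d :=
      hψs.contDiffAt.comp d ((hh4.contDiffAt (h.open_target.mem_nhds hd.2)).comp d hι.contDiffAt)
    exact (ContMDiffAt.comp d (contMDiffAt_chart_symm (hh2 (h.map_target hd.2)).1)
      h1.contMDiffAt).contMDiffWithinAt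
  · exact fun d hd => (hh2 (h.map_target hd.2)).2
  · intro d hd
    have h1 : μ (e.symm (ψ (h.symm (ι d)))) = d.1 • EuclideanSpace.single 0 1 :=
      congrArg fst (hmσ d hd.2)
    rw [h1]
    simp
  · exact fun d hd => congrArg snd (hmσ d hd.2)

lemma smul_mem_principalSet_iff (k : T2SU2) (x : M) :
    k • x ∈ (principalSet : Set M) ↔ x ∈ (principalSet : Set M) := by
  rw [S.mem_principalSet_iff, S.mem_principalSet_iff]
  refine ⟨fun h => ?_, fun h => injective_infAct_smul S.act h⟩
  have := injective_infAct_smul S.act (k := k⁻¹) h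
  rwa [inv_smul_smul k x] at this

lemma mem_baseB_iff (x : M) : baseProj x ∈ baseB M ↔ Injective (infAct x) := by
  rw [← S.mem_principalSet_iff]
  refine ⟨?_, fun h => mem_image_of_mem _ h⟩
  rintro ⟨y, hy, hyx⟩
  obtain ⟨k, rfl⟩ := baseProj_eq_iff.1 hyx
  exact (S.smul_mem_principalSet_iff k y).2 hy

lemma exists_horizontalSlice [Nonempty M] {𝓤 O : Set (MulAction.orbitRel.Quotient T2SU2 M)}
    (hO : IsOpen O) (h𝓤 : 𝓤 = O ∩ baseB M) (hc : IsConvexChart μ ν 𝓤) :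
    ∃ σ, HorizontalSlice φ μ ν (baseProj ⁻¹' 𝓤) (baseMap μ ν '' 𝓤) σ := by
  obtain ⟨hD, hDc, hq⟩ := hc
  have hA : IsOpen (baseProj ⁻¹' 𝓤 : Set M) := by
    have h1 : (baseProj ⁻¹' 𝓤 : Set M) = baseProj ⁻¹' O ∩ {x | Injective (infAct x)} := by
      ext x; rw [h𝓤]; exact and_congr_right fun _ => S.mem_baseB_iff x
    rw [h1]
    exact (hO.preimage continuous_quotient_mk').inter (S.isOpen_injective)
  have hinj : ∀ x ∈ (baseProj ⁻¹' 𝓤 : Set M), Injective (infAct x) := fun x hx => by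
    rw [mem_preimage, h𝓤] at hx; exact (S.mem_baseB_iff x).1 hx.2
  have hsmul : ∀ (k : T2SU2), ∀ x ∈ (baseProj ⁻¹' 𝓤 : Set M), k • x ∈ (baseProj ⁻¹' 𝓤 : Set M) :=
    fun k x hx => by rwa [mem_preimage, baseProj_smul]
  have hsep : IsSeparated μ ν (baseProj ⁻¹' 𝓤 : Set M) := by
    refine ⟨hinj, hsmul, fun x hx y hy h1 h2 => baseProj_eq_iff.1 (hq.bijOn.injOn
      (mem_image_of_mem _ hx) (mem_image_of_mem _ hy) ?_)⟩
    rw [S.baseMap_baseProj, S.baseMap_baseProj, h1, h2]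
  have hloc : ∀ d ∈ baseMap μ ν '' 𝓤, HasSlice μ ν (baseProj ⁻¹' 𝓤 : Set M) {d} := by
    rintro _ ⟨b, hb, rfl⟩
    obtain ⟨x, rfl⟩ := Quotient.exists_rep b
    obtain ⟨s, hs⟩ := exists_rot_eq (μ x)
    have hx : x ∈ (baseProj ⁻¹' 𝓤 : Set M) := hb
    have h1 := S.hasSlice_singleton hA (hsmul (1, s) x hx) (hinj _ (hsmul (1, s) x hx))
      (norm_pos_iff.2 (S.mu_ne_zero (hinj x hx))) (by rw [mu_smul S.pres S.act S.mu, hs])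
    rw [nu_smul S.pres S.act S.nu] at h1
    exact (S.baseMap_baseProj x).symm ▸ h1
  obtain ⟨σ, hσ⟩ := S.exists_slice hsep hloc hD hDc
  obtain ⟨τ, hτ, hτ'⟩ := S.exists_horizontal_slice hD hσ hsep hDc
  refine ⟨τ, hA, hsep, hD, hDc, hτ, hτ', fun x hx => ?_⟩
  rw [← S.baseMap_baseProj]
  exact mem_image_of_mem _ hx

variable (H : HorizontalSlice φ μ ν A D σ)
include H

lemma exists_smul_slice (hx : x ∈ A) : ∃ g : T2SU2, x = g • σ (‖μ x‖, ν x) := by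
  have hd := H.mem x hx
  exact H.separated.sep _ (H.slice.mem _ hd) x hx (H.slice.norm_mu hd) (H.slice.nu _ hd)

lemma invariants_smul_slice (hd : d ∈ D) (g : T2SU2) :
    (‖μ (g • σ d)‖, ν (g • σ d)) = d := by
  rw [norm_mu_smul S.pres S.act S.mu, nu_smul S.pres S.act S.nu, H.slice.norm_mu hd,
    H.slice.nu d hd]

lemma smul_slice_mem (hd : d ∈ D) (g : T2SU2) : g • σ d ∈ A :=
  H.separated.smul _ _ (H.slice.mem d hd)

lemma snd_eq_of_smul_slice_eq (hd : d ∈ D) {g g' : T2SU2}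
    (h : g • σ d = g' • σ d) : (g.2 : GSU2 M) = g'.2 := by
  rw [QuotientGroup.eq]
  have h1 : (g⁻¹ * g') • σ d = σ d := by rw [mul_smul g⁻¹ g' (σ d), ← h, inv_smul_smul g (σ d)]
  have h2 := S.smul_eq_of_injective (H.separated.inj _ (H.slice.mem d hd)) h1
  exact mem_gammaTwo_iff.2 ⟨(g⁻¹ * g').1, h2⟩

lemma fibProj_smul_slice (hd : d ∈ D) (g : T2SU2) :
    fibProj μ ν σ (g • σ d) = (g.2 : GSU2 M) := by
  have h1 := S.invariants_smul_slice H hd g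
  have h2 : ∃ g' : T2SU2, g • σ d = g' • σ (‖μ (g • σ d)‖, ν (g • σ d)) := ⟨g, by rw [h1]⟩
  rw [fibProj, dif_pos h2]
  exact (S.snd_eq_of_smul_slice_eq H hd (h2.choose_spec.trans
    (congrArg (fun d => h2.choose • σ d) h1))).symm

lemma fibProj_smul (k : T2SU2) (hx : x ∈ A) {s : SU2} (hs : fibProj μ ν σ x = s) :
    fibProj μ ν σ (k • x) = ((k.2 * s : SU2) : GSU2 M) := by
  obtain ⟨g, hg⟩ := S.exists_smul_slice H hx
  have hd := H.mem x hx
  rw [hg, S.fibProj_smul_slice H hd] at hs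
  rw [hg, smul_smul k g (σ _), S.fibProj_smul_slice H hd, Prod.snd_mul]
  rw [QuotientGroup.eq] at hs ⊢
  rwa [mul_inv_rev, mul_assoc, inv_mul_cancel_left]

lemma exists_lift (g : T2SU2) (hd : d ∈ D) :
    ∃ (P : M → LR) (O : Set M), IsOpen O ∧ g • σ d ∈ O ∧
      ContMDiffOn I7 𝓘(ℝ, LR) ∞ P O ∧ P (g • σ d) = (0, d) ∧
      (∀ y ∈ O, (P y).2 ∈ D ∧ (g * gexp (P y).1) • σ (P y).2 = y) ∧
      ∀ᶠ q in 𝓝 ((0, d) : LR), P ((g * gexp q.1) • σ q.2) = q := by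
  obtain ⟨P, O, hO, h1, h2, h3, h4, h5⟩ := S.exists_slice_inverse H.isOpen_domain H.slice hd
    (H.separated.inj _ (H.slice.mem d hd))
  have hs := contMDiff_smul_const S.act g⁻¹
  refine ⟨fun y => P (g⁻¹ • y), (g⁻¹ • ·) ⁻¹' O, hO.preimage hs.continuous, ?_, ?_, ?_, ?_, ?_⟩
  · rw [mem_preimage, inv_smul_smul g]; exact h1
  · exact h2.comp hs.contMDiffOn fun y hy => hy
  · dsimp only
    rw [inv_smul_smul g, h3]
  · intro y hy
    refine ⟨(h4 _ hy).1, ?_⟩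
    rw [mul_smul g (gexp _) (σ _), (h4 _ hy).2, smul_inv_smul g]
  · filter_upwards [h5] with q hq
    rw [mul_smul g (gexp _) (σ _), inv_smul_smul g, hq.2]

lemma infAct_add_dslice_mem_Kd_iff (hd : d ∈ D) (v : LieT) (u : R2) :
    infAct (σ d) v + dslice σ d u ∈ φ.Kd (σ d) ↔ v.2 = 0 ∧ u.1 = 0 := by
  have hinj := H.separated.inj _ (H.slice.mem d hd)
  have hu : u = u.1 • (1, 0) + u.2 • (0, 1) := by ext <;> simp
  constructor
  · intro h
    have h1 := congrArg (fun z : E3 => z.ofLp 0) (S.dmu_of_mem_Kd h)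
    have h2 : u.1 = 0 := by
      simpa [map_add, S.dmu_infAct, S.dmu_dslice H.isOpen_domain H.slice hd, H.slice.mu d hd,
        crossProduct, Matrix.vecHead, Matrix.vecTail] using h1
    refine ⟨?_, h2⟩
    rw [hu, h2, zero_smul, zero_add, map_smul] at h
    have h3 := (Submodule.add_mem_iff_left _
      (smul_mem _ u.2 (H.horizontal d hd))).1 h
    obtain ⟨w, hw⟩ := S.dmu_surjective hinj (WithLp.toLp 2 v.2)
    have h4 := φ.om_of_mem_Kd h3 w
    rw [S.om_infAct_left, hw] at h4
    exact dotProduct_self_eq_zero.1 h4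
  · rintro ⟨h1, h2⟩
    rw [hu, h2, zero_smul, zero_add, map_smul, lieT_eq v, h1]
    refine add_mem ?_ (smul_mem _ u.2 (H.horizontal d hd))
    have h3 : sv 0 = 0 := rfl
    rw [h3, add_zero, map_add, map_smul, map_smul]
    exact add_mem (smul_mem _ _ (φ.tv_mem_Kd _ _))
      (smul_mem _ _ (φ.tv_mem_Kd _ _))

lemma mem_Kd_iff_of_lift {g : T2SU2} (hd : d ∈ D) {P : M → LR}
    (hP : ∀ᶠ q in 𝓝 ((0, d) : LR), P ((g * gexp q.1) • σ q.2) = q)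
    {L : E7 →L[ℝ] LR}
    (hL : HasMFDerivAt I7 𝓘(ℝ, LR) P (g • σ d) L) (w : E7) :
    w ∈ φ.Kd (g • σ d) ↔ (L w).1.2 = 0 ∧ (L w).2.1 = 0 := by
  set T₀ : LR →L[ℝ] E7 := (infAct (σ d)).comp (.fst ℝ LieT R2) +
    (dslice σ d).comp (.snd ℝ LieT R2) with hT₀
  have h1 : HasMFDerivAt 𝓘(ℝ, LR) I7
      (fun q : LR => gexp q.1 • σ q.2) (0, d) T₀ :=
    hasMFDerivAt_gexp_smul S.act hasFDerivAt_fst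
      (HasMFDerivAt.comp ((0, d) : LR) (f := snd)
        (hasMFDerivAt_slice H.isOpen_domain H.slice hd) hasFDerivAt_snd.hasMFDerivAt) rfl
  have h00 : gexp ((0, d) : LR).1 • σ ((0, d) : LR).2 = σ d := by
    change gexp 0 • σ d = σ d
    rw [gexp_zero, one_smul]
  have h2 := HasMFDerivAt.comp ((0, d) : LR) (g := fun y => g • y)
    (by rw [h00]; exact hasMFDerivAt_dact S.act g (σ d)) h1
  have h3 := HasMFDerivAt.comp ((0, d) : LR) (g := P)
    (by rw [Function.comp_apply, h00]; exact hL) h2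
  have h4 : HasFDerivAt (fun q : LR => P ((g * gexp q.1) • σ q.2))
      (L.comp ((dact g (σ d)).comp T₀)) (0, d) := by
    refine h3.hasFDerivAt.congr_of_eventuallyEq (.of_forall fun q => ?_)
    exact congrArg P (mul_smul g (gexp q.1) (σ q.2))
  have h5 := h4.unique ((hasFDerivAt_id _).congr_of_eventuallyEq hP)
  have h6 : ∀ q, L (dact g (σ d) (T₀ q)) = q := fun q => DFunLike.congr_fun h5 q
  obtain ⟨w, rfl⟩ := dact_surjective S.act g (σ d) w
  obtain ⟨v, u, rfl⟩ := S.exists_infAct_add_dslice H.isOpen_domain H.slice hd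
    (H.separated.inj _ (H.slice.mem d hd)) w
  have h7 : L (dact g (σ d) (infAct (σ d) v + dslice σ d u)) = (v, u) := h6 (v, u)
  rw [h7, ← S.infAct_add_dslice_mem_Kd_iff H hd]
  refine ⟨fun h => ?_, fun h => dact_mem_Kd S.act S.pres h⟩
  have h8 := dact_mem_Kd S.act S.pres (k := g⁻¹) h
  rwa [dact_inv_left S.act, inv_smul_smul g] at h8

/-- The components of `P` that are constant on the associatives. -/
def transverseL : LR →L[ℝ] (Fin 4 → ℝ) := toContinuousLinearMap
    { toFun := fun q => ![q.1.2 0, q.1.2 1, q.1.2 2, q.2.1]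
      map_add' := fun p q => by ext i; fin_cases i <;> simp
      map_smul' := fun c p => by ext i; fin_cases i <;> simp }

omit S H in
lemma transverseL_eq_iff (q : LR) (c : ℝ) :
    transverseL q = ![0, 0, 0, c] ↔ q.1.2 = 0 ∧ q.2.1 = c := by
  change ![q.1.2 0, q.1.2 1, q.1.2 2, q.2.1] = _ ↔ _
  simp [funext_iff, Fin.forall_fin_succ, and_assoc]

lemma isAssociativeSubmanifold_fibre (c : ℝ) (h : GSU2 M) :
    φ.IsAssociativeSubmanifold {x ∈ A | ‖μ x‖ = c ∧ fibProj μ ν σ x = h} := by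
  rintro x ⟨hxA, hxc, hxh⟩
  obtain ⟨g, hg⟩ := S.exists_smul_slice H hxA
  set d : R2 := (‖μ x‖, ν x) with hdd
  have hd : d ∈ D := H.mem x hxA
  obtain ⟨P, O, hO, hxO, hPs, hP0, hPO, hPe⟩ := S.exists_lift H g hd
  rw [← hg] at hxO hP0
  have hgh : (g.2 : GSU2 M) = h := by rw [← hxh, hg, S.fibProj_smul_slice H hd]
  obtain ⟨N, hN, hN₀, h0N⟩ := eventually_nhds_iff.1 eventually_snd_eq_zero
  set e := ch x with he
  have hex : e.symm (e x) = x := e.left_inv (mem_chart_source E7 x)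
  have hO' : IsOpen (O ∩ P ⁻¹' (fst ⁻¹' N)) :=
    hPs.continuousOn.isOpen_inter_preimage hO (hN₀.preimage continuous_fst)
  set W : Set E7 := e.target ∩ e.symm ⁻¹' (O ∩ P ⁻¹' (fst ⁻¹' N)) with hWdef
  have hW : IsOpen W := e.symm.isOpen_inter_preimage hO'
  have hxW : e x ∈ W := by
    refine ⟨e.map_source (mem_chart_source E7 x), ?_⟩
    rw [mem_preimage, hex]
    exact ⟨hxO, by rw [mem_preimage, hP0]; exact h0N⟩
  have hPW : ContDiffOn ℝ ∞ (fun z => P (e.symm z)) W := fun z hz =>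
    (ContMDiffAt.comp z (hPs.contMDiffAt (hO.mem_nhds hz.2.1))
      (contMDiffAt_chart_symm hz.1)).contDiffAt.contDiffWithinAt
  have hPx : HasMFDerivAt I7 𝓘(ℝ, LR) P x
      (mfderiv I7 𝓘(ℝ, LR) P x) :=
    ((hPs.contMDiffAt (hO.mem_nhds hxO)).mdifferentiableAt (by simp)).hasMFDerivAt
  set L : E7 →L[ℝ] LR := mfderiv I7 𝓘(ℝ, LR) P x
  have hPe' : HasFDerivAt (fun z => P (e.symm z)) L (e x) :=
    (HasMFDerivAt.comp (e x) (g := P) (by rw [hex]; exact hPx) (hasMFDerivAt_chart_symm x)).hasFDerivAt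
  have hF : HasFDerivAt (fun z => transverseL (P (e.symm z)) - ![0, 0, 0, c])
      (transverseL.comp L) (e x) :=
    (transverseL.hasFDerivAt.comp (e x) hPe').sub_const _
  refine φ.exists_adapted_chart
    (uind_of_injective (H.separated.inj x hxA)) hW hxW
    (F := fun z => transverseL (P (e.symm z)) - ![0, 0, 0, c])
    ((transverseL.contDiff.comp_contDiffOn hPW).sub contDiffOn_const) (fun w => ?_)
    fun y hy hyW => ?_
  · have hLw := S.mem_Kd_iff_of_lift H hd hPe (L := L) (by rw [← hg]; exact hPx) w
    rw [← hg] at hLw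
    rw [hF.fderiv]
    have h00 : (0 : Fin 4 → ℝ) = ![0, 0, 0, 0] := by ext i; fin_cases i <;> rfl
    have h1 : transverseL (L w) = 0 ↔ (L w).1.2 = 0 ∧ (L w).2.1 = 0 := by
      rw [h00]; exact transverseL_eq_iff (L w) 0
    exact h1.trans hLw.symm
  · have hy' : y ∈ O ∩ P ⁻¹' (fst ⁻¹' N) := by
      have := hyW.2
      rwa [mem_preimage, e.left_inv hy] at this
    obtain ⟨h1, h2⟩ := hPO y hy'.1
    rw [e.left_inv hy, sub_eq_zero, transverseL_eq_iff]
    have h3 := S.invariants_smul_slice H h1 (g * gexp (P y).1)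
    have h4 := S.fibProj_smul_slice H h1 (g * gexp (P y).1)
    rw [h2] at h3 h4
    have h5 : ‖μ y‖ = (P y).2.1 := congrArg fst h3
    have h6 : fibProj μ ν σ y = h ↔ (P y).1.2 = 0 := by
      rw [h4, ← hgh, eq_comm, QuotientGroup.eq, Prod.snd_mul, inv_mul_cancel_left]
      constructor
      · exact fun h => hN _ hy'.2 (rot_of_mem_gammaTwo S h)
      · intro h
        have h7 : (gexp (P y).1).2 = 1 := by
          rw [← su2Exp_zero]
          simp only [gexp, h]
          simp [su2Exp, Pi.zero_def]
        rw [h7]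
        exact one_mem _
    have h7 : y ∈ A := h2 ▸ S.smul_slice_mem H h1 _
    rw [← h5, ← h6]
    exact ⟨fun h => ⟨h.2.2, h.2.1⟩, fun h => ⟨h7, h.2, h.1⟩⟩

end MultiMoment

/-! ### Quotients by discrete subgroups -/

section LatticeQuotient

variable {E : Type*} [NormedAddCommGroup E] [NormedSpace ℝ E] {Λ : AddSubgroup E}

lemma contDiffOn_of_sub_mem (hΛ : ∀ᶠ u in 𝓝 (0 : E), u ∈ Λ → u = 0) {X : Type*}
    [NormedAddCommGroup X] [NormedSpace ℝ X] {f g : X → E} {s : Set X} (hs : IsOpen s)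
    (hf : ContinuousOn f s) (hg : ContDiffOn ℝ ∞ g s) (hfg : ∀ z ∈ s, f z - g z ∈ Λ) :
    ContDiffOn ℝ ∞ f s := by
  intro z hz
  have hsz := hs.mem_nhds hz
  have h1 : ContinuousAt (fun x => f x - g x - (f z - g z)) z :=
    ((hf.continuousAt hsz).sub (hg.continuousOn.continuousAt hsz)).sub continuousAt_const
  have h2 := h1.tendsto
  rw [sub_self] at h2
  refine (((hg.contDiffAt hsz).add (contDiffAt_const (c := f z - g z))).congr_of_eventuallyEq
    ?_).contDiffWithinAt
  filter_upwards [h2.eventually hΛ, hsz] with x hx hxs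
  have h3 := hx (Λ.sub_mem (hfg x hxs) (hfg z hz))
  rw [← sub_eq_zero]
  rw [← h3]
  abel

variable (hΛ : ∀ᶠ u in 𝓝 (0 : E), u ∈ Λ → u = 0)
include hΛ

lemma isLocalHomeomorph_latticeMk : IsLocalHomeomorph (QuotientAddGroup.mk : E → E ⧸ Λ) := by
  refine (AddSubgroup.isAddQuotientCoveringMap_of_comm Λ
    (isDiscrete_iff_forall_mem_exists_isOpen.2 fun x hx => ?_)).isCoveringMap.isLocalHomeomorph
  obtain ⟨N, hN, hNo, h0⟩ := eventually_nhds_iff.1 hΛ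
  refine ⟨(fun y => y - x) ⁻¹' N, hNo.preimage (by fun_prop), ?_⟩
  ext y
  constructor
  · rintro ⟨h1, h2⟩
    exact sub_eq_zero.1 (hN _ h1 (Λ.sub_mem h2 hx))
  · rintro rfl
    exact ⟨by rw [mem_preimage, sub_self]; exact h0, hx⟩

/-- The charts of `E ⧸ Λ` are the local inverses of the projection. -/
@[reducible] def latticeChartedSpace : ChartedSpace E (E ⧸ Λ) where
  atlas := {e | ∀ z ∈ e.source, ((e z : E) : E ⧸ Λ) = z}
  chartAt z := (isLocalHomeomorph_latticeMk hΛ).localInverseAt z.out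
  mem_chart_source z := by
    have h := (isLocalHomeomorph_latticeMk hΛ).apply_self_mem_localInverseAt_source (x := z.out)
    rwa [QuotientAddGroup.out_eq'] at h
  chart_mem_atlas z := by
    intro y hy
    exact (isLocalHomeomorph_latticeMk hΛ).apply_localInverseAt_of_mem hy

lemma latticeMk_eq_symm {e : OpenPartialHomeomorph (E ⧸ Λ) E}
    (he : ∀ z ∈ e.source, ((e z : E) : E ⧸ Λ) = z) {w : E} (hw : w ∈ e.target) :
    e.symm w = (w : E ⧸ Λ) := by
  have h := he _ (e.map_target hw)
  rw [e.right_inv hw] at h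
  exact h.symm

lemma isManifold_lattice :
    letI := latticeChartedSpace hΛ
    IsManifold 𝓘(ℝ, E) ∞ (E ⧸ Λ) := by
  letI := latticeChartedSpace hΛ
  refine isManifold_of_contDiffOn 𝓘(ℝ, E) ∞ _ fun e e' he he' => ?_
  have h1 : ContDiffOn ℝ ∞ (e.symm ≫ₕ e') (e.symm ≫ₕ e').source := by
    refine contDiffOn_of_sub_mem hΛ (e.symm ≫ₕ e').open_source (e.symm ≫ₕ e').continuousOn
      contDiffOn_id fun z hz => ?_
    rw [OpenPartialHomeomorph.trans_source, OpenPartialHomeomorph.symm_source] at hz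
    have h2 := he' _ hz.2
    rw [latticeMk_eq_symm hΛ he hz.1, eq_comm, QuotientAddGroup.eq] at h2
    rw [OpenPartialHomeomorph.trans_apply, latticeMk_eq_symm hΛ he hz.1]
    rwa [neg_add_eq_sub] at h2
  simpa using h1

lemma contMDiff_latticeMk :
    letI := latticeChartedSpace hΛ
    ContMDiff 𝓘(ℝ, E) 𝓘(ℝ, E) ∞ (QuotientAddGroup.mk : E → E ⧸ Λ) := by
  letI := latticeChartedSpace hΛ
  haveI := isManifold_lattice hΛ
  intro w
  set e := chartAt E (w : E ⧸ Λ)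
  have he : ∀ z ∈ e.source, ((e z : E) : E ⧸ Λ) = z := chart_mem_atlas E (w : E ⧸ Λ)
  have hw := mem_chart_source E (w : E ⧸ Λ)
  set w' := e (w : E ⧸ Λ)
  have h1 : ContMDiffAt 𝓘(ℝ, E) 𝓘(ℝ, E) ∞ e.symm w' :=
    contMDiffOn_chart_symm.contMDiffAt (e.open_target.mem_nhds (e.map_source hw))
  have h2 : ContMDiffAt 𝓘(ℝ, E) 𝓘(ℝ, E) ∞ (fun z => z + (w' - w)) w :=
    (contDiffAt_id.add contDiffAt_const).contMDiffAt
  have h3 : w + (w' - w) = w' := add_sub_cancel _ _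
  refine (ContMDiffAt.comp w (by rw [h3]; exact h1) h2).congr_of_eventuallyEq ?_
  have h4 : ∀ᶠ z in 𝓝 w, z + (w' - w) ∈ e.target :=
    (show Continuous fun z => z + (w' - w) by fun_prop).continuousAt.eventually
      (e.open_target.mem_nhds (by
        change w + (w' - w) ∈ e.target
        rw [h3]; exact e.map_source hw))
  filter_upwards [h4] with z hz
  rw [Function.comp_apply, latticeMk_eq_symm hΛ he hz, QuotientAddGroup.eq, neg_add_cancel_left,
    sub_eq_neg_add, ← QuotientAddGroup.eq]
  exact (he _ hw).symm

end LatticeQuotient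

/-! ### Coordinates on the fibres of a convex open set -/

section FibreCoordinate

lemma exists_le_integral_inv {f : ℝ → ℝ} (hf : ContDiff ℝ 1 f) (h0 : ∀ t, 0 ≤ f t)
    (h1 : ∀ t, f t ≤ 1) {a : ℝ} (ha : f a ≠ 0) (C : ℝ) :
    ∃ t, a ≤ t ∧ (∀ τ ∈ Icc a t, f τ ≠ 0) ∧ C ≤ ∫ τ in a..t, (f τ)⁻¹ := by
  have hpos : ∀ t, f t ≠ 0 → 0 < f t := fun t ht => lt_of_le_of_ne (h0 t) ht.symm
  have hint : ∀ t, a ≤ t → (∀ τ ∈ Icc a t, f τ ≠ 0) →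
      IntervalIntegrable (fun τ => (f τ)⁻¹) MeasureTheory.volume a t := fun t hat ht =>
    (hf.continuous.continuousOn.inv₀ (by rwa [uIcc_of_le hat])).intervalIntegrable
  by_cases hall : ∀ t, a ≤ t → f t ≠ 0
  · refine ⟨a + |C|, by simp, fun τ hτ => hall τ hτ.1, ?_⟩
    have h2 := intervalIntegral.integral_mono_on (a := a) (b := a + |C|) (f := fun _ => (1 : ℝ))
      (by simp) (by simp) (hint (a + |C|) (by simp) fun τ hτ => hall τ hτ.1)
      fun τ hτ => (one_le_inv₀ (hpos τ (hall τ hτ.1))).2 (h1 τ)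
    simp only [intervalIntegral.integral_const, smul_eq_mul, mul_one, add_sub_cancel_left] at h2
    exact (le_abs_self C).trans h2
  push Not at hall
  obtain ⟨b', hab', hb'⟩ := hall
  have hcl : IsClosed {t | a ≤ t ∧ f t = 0} :=
    (isClosed_le continuous_const continuous_id).inter (isClosed_eq hf.continuous continuous_const)
  have hleast := hcl.isLeast_csInf ⟨b', hab', hb'⟩ ⟨a, fun t ht => ht.1⟩
  set b := sInf {t | a ≤ t ∧ f t = 0}
  obtain ⟨⟨hab, hb⟩, hlb⟩ := hleast
  have hab : a < b := lt_of_le_of_ne hab fun h => ha (h ▸ hb)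
  have hne : ∀ t, a ≤ t → t < b → f t ≠ 0 := fun t hat htb h => absurd (hlb ⟨hat, h⟩) (not_le.2 htb)
  obtain ⟨K, hK⟩ := isCompact_Icc.exists_bound_of_continuousOn (s := Icc a b)
    (hf.continuous_deriv le_rfl).continuousOn
  set k := max K 1
  have hk : 0 < k := lt_max_of_lt_right one_pos
  have hlip : ∀ t ∈ Icc a b, f t ≤ k * (b - t) := by
    intro t ht
    have h2 := (convex_Icc a b).norm_image_sub_le_of_norm_deriv_le (f := f) (C := k)
      (fun x _ => (hf.differentiable (by simp)) x) (fun x hx => (hK x hx).trans (le_max_left _ _))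
      (right_mem_Icc.2 hab.le) ht
    rw [hb, sub_zero, Real.norm_eq_abs, Real.norm_eq_abs, abs_of_nonneg (h0 t), abs_sub_comm,
      abs_of_nonneg (by linarith [ht.2])] at h2
    exact h2
  set q := Real.exp (-(k * |C|)) with hq
  have hq0 : 0 < q := Real.exp_pos _
  have hq1 : q ≤ 1 := Real.exp_le_one_iff.2 (neg_nonpos.2 (by positivity))
  set t := b - (b - a) * q with ht
  have hba : 0 < b - a := sub_pos.2 hab
  have hat : a ≤ t := by rw [ht]; nlinarith
  have htb : t < b := by rw [ht]; nlinarith [mul_pos hba hq0]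
  have hne' : ∀ τ ∈ Icc a t, f τ ≠ 0 := fun τ hτ => hne τ hτ.1 (hτ.2.trans_lt htb)
  refine ⟨t, hat, hne', ?_⟩
  have hd : ∀ τ ∈ uIcc a t, HasDerivAt (fun τ => -(k⁻¹ * Real.log (b - τ))) (k * (b - τ))⁻¹ τ := by
    intro τ hτ
    rw [uIcc_of_le hat] at hτ
    have h2 : b - τ ≠ 0 := by linarith [hτ.2]
    refine ((((hasDerivAt_id τ).const_sub b).log h2).const_mul k⁻¹).neg.congr_deriv ?_
    rw [mul_inv]
    simp [div_eq_mul_inv]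
  have hc : ContinuousOn (fun τ => (k * (b - τ))⁻¹) (uIcc a t) := by
    refine ContinuousOn.inv₀ (by fun_prop) fun τ hτ => ?_
    rw [uIcc_of_le hat] at hτ
    exact (mul_pos hk (by linarith [hτ.2])).ne'
  have h2 := intervalIntegral.integral_mono_on hat hc.intervalIntegrable (hint t hat hne')
    fun τ hτ => inv_anti₀ (hpos τ (hne' τ hτ)) (hlip τ ⟨hτ.1, hτ.2.trans htb.le⟩)
  rw [intervalIntegral.integral_eq_sub_of_hasDerivAt hd hc.intervalIntegrable] at h2
  refine le_trans ?_ h2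
  have h3 : b - t = (b - a) * q := by rw [ht]; ring
  rw [h3, Real.log_mul hba.ne' hq0.ne', hq, Real.log_exp]
  have h4 : k⁻¹ * (k * |C|) = |C| := inv_mul_cancel_left₀ hk.ne' _
  linarith [le_abs_self C]

variable (hD : IsOpen D) (hDc : Convex ℝ D)
include hD hDc

/-- Locally over the first coordinate, a convex open set is a product with `ℝ`. -/
lemma exists_fibre_coordinate {r₀ : ℝ} (hr₀ : r₀ ∈ fst '' D) :
    ∃ (J : Set ℝ) (ρ η : R2 → ℝ), IsOpen J ∧ r₀ ∈ J ∧ J ⊆ fst '' D ∧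
      ContDiffOn ℝ ∞ ρ (D ∩ fst ⁻¹' J) ∧ ContDiffOn ℝ ∞ η (J ×ˢ univ) ∧
      (∀ r ∈ J, ∀ u, (r, η (r, u)) ∈ D ∧ ρ (r, η (r, u)) = u) ∧
      ∀ d ∈ D, d.1 ∈ J → η (d.1, ρ d) = d.2 := by
  obtain ⟨⟨_, ν₀⟩, hd₀, rfl⟩ := hr₀
  obtain ⟨f, hfD, hfs, hf01⟩ := hD.exists_contDiff_support_eq
  have hf01 : ∀ d, f d ∈ Icc (0 : ℝ) 1 := fun d => hf01 (mem_range_self d)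
  have hne : ∀ d, d ∈ D ↔ f d ≠ 0 := fun d => by rw [← hfD, Function.mem_support]
  have hw : ContDiffOn ℝ ∞ (fun d => (f d)⁻¹) D := hfs.contDiffOn.inv fun d hd => (hne d).1 hd
  set J : Set ℝ := {r | (r, ν₀) ∈ D} with hJ
  have hJo : IsOpen J := hD.preimage (by fun_prop)
  set ρ : R2 → ℝ := fun d => ∫ t in ν₀..d.2, (f (d.1, t))⁻¹ with hρ
  have hρs : ContDiffOn ℝ ∞ ρ (D ∩ fst ⁻¹' J) :=
    contDiffOn_primitive hD hDc hw hJo contDiffOn_const fun r hr => hr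
  have hρd : ∀ r ∈ J, ∀ t, (r, t) ∈ D → HasDerivAt (fun t => ρ (r, t)) (f (r, t))⁻¹ t :=
    fun r hr t ht => hasDerivAt_primitive hD hDc hw hr ht
  have hslice : ∀ r, Convex ℝ {t | (r, t) ∈ D} := fun r x hx y hy a b ha hb hab => by
    have h1 := hDc hx hy ha hb hab
    simpa [← add_mul, hab] using h1
  have hmono : ∀ r ∈ J, StrictMonoOn (fun t => ρ (r, t)) {t | (r, t) ∈ D} := fun r hr =>
    strictMonoOn_of_deriv_pos (hslice r)
      (fun t ht => (hρd r hr t ht).continuousAt.continuousWithinAt) fun t ht => by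
        have ht' : t ∈ {t | (r, t) ∈ D} := interior_subset ht
        have ht' : (r, t) ∈ D := ht'
        rw [(hρd r hr t ht').deriv]
        exact inv_pos.2 (lt_of_le_of_ne (hf01 _).1 ((hne _).1 ht').symm)
  have hsurj : ∀ r ∈ J, ∀ u, ∃ t, (r, t) ∈ D ∧ ρ (r, t) = u := by
    intro r hr u
    have hf1 : ContDiff ℝ 1 fun t => f (r, t) :=
      (hfs.of_le (by simp)).comp (contDiff_const.prodMk contDiff_id)
    obtain ⟨t₂, h2, h2D, h2u⟩ := exists_le_integral_inv hf1 (fun t => (hf01 _).1)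
      (fun t => (hf01 _).2) (a := ν₀) ((hne _).1 hr) u
    obtain ⟨t₁, h1, h1D, h1u⟩ := exists_le_integral_inv (hf1.comp contDiff_neg)
      (fun t => (hf01 _).1) (fun t => (hf01 _).2) (a := -ν₀)
      (by rw [Function.comp_apply, neg_neg]; exact (hne _).1 hr) (-u)
    have h3 : ρ (r, -t₁) ≤ u := by
      simp only [Function.comp_apply] at h1u
      rw [intervalIntegral.integral_comp_neg (fun t => (f (r, t))⁻¹), neg_neg,
        intervalIntegral.integral_symm] at h1u
      linarith
    have hsub : Icc (-t₁) t₂ ⊆ {t | (r, t) ∈ D} := by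
      intro t ht
      rcases le_total t ν₀ with h | h
      · have := h1D (-t) ⟨by linarith, by linarith [ht.1]⟩
        rw [Function.comp_apply, neg_neg] at this
        exact (hne _).2 this
      · exact (hne _).2 (h2D t ⟨h, ht.2⟩)
    obtain ⟨t, ht, htu⟩ := intermediate_value_Icc (a := -t₁) (b := t₂) (f := fun t => ρ (r, t))
      (by linarith) (fun t ht => (hρd r hr t (hsub ht)).continuousAt.continuousWithinAt)
      ⟨h3, h2u⟩
    exact ⟨t, hsub ht, htu⟩
  have hex : ∀ p : R2, ∃ t, p.1 ∈ J → (p.1, t) ∈ D ∧ ρ (p.1, t) = p.2 := by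
    intro p
    by_cases hp : p.1 ∈ J
    · obtain ⟨t, ht⟩ := hsurj p.1 hp p.2
      exact ⟨t, fun _ => ht⟩
    · exact ⟨0, fun h => absurd h hp⟩
  choose η hη using hex
  refine ⟨J, ρ, η, hJo, hd₀, fun r hr => ⟨_, hr, rfl⟩, hρs, ?_, fun r hr u => hη (r, u) hr,
    fun d hd hdJ => ?_⟩
  · rintro ⟨r₁, u₁⟩ ⟨hr₁, -⟩
    have hr₁ : r₁ ∈ J := hr₁
    set d₁ : R2 := (r₁, η (r₁, u₁)) with hd₁
    have hd₁D : d₁ ∈ D ∩ fst ⁻¹' J := ⟨(hη (r₁, u₁) hr₁).1, hr₁⟩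
    have hDJ : IsOpen (D ∩ fst ⁻¹' J) := hD.inter (hJo.preimage continuous_fst)
    have hρ1 : HasFDerivAt ρ (fderiv ℝ ρ d₁) d₁ :=
      ((hρs.contDiffAt (hDJ.mem_nhds hd₁D)).differentiableAt (by simp)).hasFDerivAt
    have hρ2 : fderiv ℝ ρ d₁ (0, 1) = (f d₁)⁻¹ :=
      (hρ1.comp_hasDerivAt d₁.2 ((hasDerivAt_const d₁.2 r₁).prodMk (hasDerivAt_id d₁.2))).unique
        (hρd r₁ hr₁ _ hd₁D.1)
    set Θ : R2 → R2 := fun d => (d.1, ρ d) with hΘ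
    have hΘd : HasFDerivAt Θ ((ContinuousLinearMap.fst ℝ ℝ ℝ).prod (fderiv ℝ ρ d₁)) d₁ :=
      hasFDerivAt_fst.prodMk hρ1
    have hinj : Injective
        ((ContinuousLinearMap.fst ℝ ℝ ℝ).prod (fderiv ℝ ρ d₁) : R2 →ₗ[ℝ] R2) := by
      refine (injective_iff_map_eq_zero _).2 fun p hp => ?_
      have h1 : p.1 = 0 := congrArg fst hp
      have h2 : fderiv ℝ ρ d₁ p = 0 := congrArg snd hp
      have h3 : p = p.2 • (0, 1) := by ext <;> simp [h1]
      rw [h3, map_smul, hρ2, smul_eq_mul] at h2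
      have h4 : p.2 = 0 := (mul_eq_zero.1 h2).resolve_right (inv_ne_zero ((hne _).1 hd₁D.1))
      rw [h3, h4, zero_smul]
    obtain ⟨h, hh1, hh2, hh3, hh4⟩ := exists_smooth_localInverse hDJ
      (contDiff_fst.contDiffOn.prodMk hρs) hd₁D
      (f' := (LinearEquiv.ofInjectiveEndo _ hinj).toContinuousLinearEquiv)
      (hΘd.congr_fderiv (ContinuousLinearMap.ext fun p => rfl))
    have h5 : h d₁ = (r₁, u₁) := by rw [hh3]; exact Prod.ext rfl (hη (r₁, u₁) hr₁).2
    have h6 : (r₁, u₁) ∈ h.target := h5 ▸ h.map_source hh1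
    have h7 := contDiffAt_snd.comp _ (hh4.contDiffAt (h.open_target.mem_nhds h6))
    refine (h7.congr_of_eventuallyEq ?_).contDiffWithinAt
    filter_upwards [h.open_target.mem_nhds h6] with p hp
    have h8 := h.right_inv hp
    rw [hh3] at h8
    have h8 : Θ (h.symm p) = p := h8
    have h9 := hh2 (h.map_target hp)
    have h10 : (Θ (h.symm p)).1 = p.1 := congrArg fst h8
    have h12 : (Θ (h.symm p)).2 = p.2 := congrArg snd h8
    change (h.symm p).1 = p.1 at h10
    have h11 : p.1 ∈ J := h10 ▸ h9.2
    refine (hmono p.1 h11).injOn (hη p h11).1 ?_ ?_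
    · change (p.1, (h.symm p).2) ∈ D
      rw [← h10]; exact h9.1
    · change ρ (p.1, η p) = ρ (p.1, (h.symm p).2)
      rw [(hη p h11).2, ← h10]
      exact h12.symm
  · exact (hmono d.1 hdJ).injOn (hη (d.1, ρ d) hdJ).1 hd (hη (d.1, ρ d) hdJ).2

end FibreCoordinate

/-! ### The fibre bundle over the space of associatives -/

lemma eq_one_or_neg_one_of_rot {s : SU2} (h : ∀ a, rot s a = a) :
    s = 1 ∨ (s : ℍ) = -1 := by
  have h1 := mul_eq_of_rot_eq (h (single 0 1))
  have h2 := mul_eq_of_rot_eq (h (single 1 1))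
  have hs : ‖(s : ℍ)‖ = 1 := mem_sphere_zero_iff_norm.1 s.2
  have key : ∀ a, ((s : ℍ) * imQ a).imJ = (imQ a * (s : ℍ)).imJ →
      ((s : ℍ) * imQ a).imK = (imQ a * (s : ℍ)).imK →
      (s : ℍ).imK * a 0 = (s : ℍ).imI * a 2 ∧ (s : ℍ).imI * a 1 = (s : ℍ).imJ * a 0 := by
    intro a h1 h2
    obtain ⟨p0, p1, p2, p3⟩ := imQ_parts a
    rw [imJ_mul, imJ_mul, p0, p1, p2, p3] at h1
    rw [imK_mul, imK_mul, p0, p1, p2, p3] at h2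
    constructor <;> linarith
  obtain ⟨k1, k2⟩ := key _ (congrArg (·.imJ) h1) (congrArg (·.imK) h1)
  obtain ⟨-, k3⟩ := key _ (congrArg (·.imJ) h2) (congrArg (·.imK) h2)
  have hK : (s : ℍ).imK = 0 := by simpa using k1
  have hJ : (s : ℍ).imJ = 0 := by simpa using k2.symm
  have hI : (s : ℍ).imI = 0 := by simpa using k3
  have h4 : (s : ℍ) = ((s : ℍ).re : ℍ) := by ext <;> simp [hI, hJ, hK]
  rw [h4, Quaternion.norm_coe] at hs
  rcases eq_or_eq_neg_of_abs_eq hs with h5 | h5 <;> rw [h5] at h4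
  · exact Or.inl (Subtype.ext h4)
  · right; rw [h4]; simp

/-- Near `s₀`, the elements of `SU(2)` are determined by their class modulo `±1`. -/
def halfSphere (s₀ : SU2) : Set SU2 := {s | 0 < ((s : ℍ) * star (s₀ : ℍ)).re}

lemma isOpen_halfSphere (s₀ : SU2) : IsOpen (halfSphere s₀) := isOpen_lt continuous_const
    (Quaternion.continuous_re.comp (continuous_subtype_val.mul continuous_const))

lemma self_mem_halfSphere (s₀ : SU2) : s₀ ∈ halfSphere s₀ := by
  rw [halfSphere, mem_ofPred_eq, SU2.self_mul_star]
  simp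

lemma eq_of_mem_halfSphere {s₀ s s' : SU2} (hs : s ∈ halfSphere s₀) (hs' : s' ∈ halfSphere s₀)
    (h : ∀ a, rot (s⁻¹ * s') a = a) : s = s' := by
  rcases eq_one_or_neg_one_of_rot h with h1 | h1
  · exact (inv_mul_eq_one.1 h1)
  · have h2 : (s' : ℍ) = -(s : ℍ) := by
      have h3 : s' = s * (s⁻¹ * s') := (mul_inv_cancel_left _ _).symm
      rw [h3]
      change (s : ℍ) * ((s⁻¹ * s' : SU2) : ℍ) = _
      rw [h1, mul_neg, mul_one]
    rw [halfSphere, mem_ofPred_eq] at hs hs'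
    rw [h2, neg_mul, Quaternion.re_neg] at hs'
    linarith

lemma contMDiff_mul_left_SU2 (s : SU2) : ContMDiff (𝓡 3) (𝓡 3) ∞ fun t : SU2 => s * t := by
  have h : ContMDiff (𝓡 3) 𝓘(ℝ, ℍ) ∞ fun t : SU2 => (s : ℍ) * (t : ℍ) :=
    ((ContinuousLinearMap.mul ℝ ℍ) (s : ℍ)).contMDiff.comp contMDiff_coe_sphere
  exact h.codRestrict_sphere fun t => (s * t).2

/-- The torus directions of `ℝ³ = ℝ² × ℝ`. -/
def torL : E3 →L[ℝ] LieT := toContinuousLinearMap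
    { toFun := fun w => (![w 0, w 1], 0)
      map_add' := fun p q => by ext i <;> [fin_cases i; skip] <;> simp
      map_smul' := fun c p => by ext i <;> [fin_cases i; skip] <;> simp }

lemma torL_apply (w : E3) : torL w = (![w 0, w 1], 0) := rfl

lemma gexp_torL_add (v w : E3) : gexp (torL (v + w)) = gexp (torL v) * gexp (torL w) := by
  rw [map_add]
  exact gexp_add_of_commute (commute_of_left rfl)

lemma gexp_torL (w : E3) : gexp (torL w) = ((Circle.exp (-w 0), Circle.exp (-w 1)), 1) := by
  have h : (gexp (torL w)).2 = 1 := by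
    rw [← su2Exp_zero]
    change su2Exp _ = su2Exp 0
    congr 1
    ext i
    simp [torL_apply]
  exact Prod.ext rfl h

/-- The elements of `ℝ² × {0}` which exponentiate to elements acting trivially on `M`. -/
def fibreLattice (M : Type*) [MulAction T2SU2 M] : AddSubgroup E3 where
  carrier := {w | w 2 = 0 ∧ ∀ x : M, gexp (torL w) • x = x}
  add_mem' {u v} hu hv := by
    refine ⟨by simp [hu.1, hv.1], fun x => ?_⟩
    rw [gexp_torL_add, mul_smul (gexp (torL u)) (gexp (torL v)) x, hv.2, hu.2]
  zero_mem' := ⟨by simp, fun x => by rw [map_zero, gexp_zero, one_smul]⟩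
  neg_mem' {u} hu := by
    refine ⟨by simp [hu.1], fun x => ?_⟩
    rw [map_neg, gexp_neg, inv_smul_eq_iff (a := x), hu.2]

/-- The parametrization of the fibre over `(r, s)`, in terms of coordinates `η` for `D`. -/
def fibreMap (σ : R2 → M) (η : R2 → ℝ) (n : ℝ × SU2) (w : E3) : M :=
  gexp (torL w) • ((1, n.2) : T2SU2) • σ (n.1, η (n.1, w 2))

lemma fibreMap_eq_smul (σ : R2 → M) (η : R2 → ℝ) (n : ℝ × SU2) (w : E3) :
    fibreMap σ η n w = (((Circle.exp (-w 0), Circle.exp (-w 1)), n.2) : T2SU2) •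
      σ (n.1, η (n.1, w 2)) := by
  rw [fibreMap, smul_smul (gexp (torL w)) _ (σ _), gexp_torL]
  congr 1
  ext <;> simp

lemma fibreMap_mk (σ : R2 → M) (η : R2 → ℝ) (n : ℝ × SU2) (a b c : ℝ) :
    fibreMap σ η n !₂[a, b, c] = (((Circle.exp (-a), Circle.exp (-b)), n.2) : T2SU2) •
      σ (n.1, η (n.1, c)) := fibreMap_eq_smul σ η n _

namespace MultiMoment

variable (H : HorizontalSlice φ μ ν A D σ)
include S H

lemma eventually_fibreLattice (hD : D.Nonempty) :
    ∀ᶠ w in 𝓝 (0 : E3), w ∈ fibreLattice M → w = 0 := by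
  obtain ⟨d, hd⟩ := hD
  have hc : Continuous fun w : E3 => ((![w 0, w 1], 0) : (Fin 2 → ℝ) × ℝ) := by
    refine Continuous.prodMk (continuous_pi fun i => ?_) continuous_const
    fin_cases i <;> (simp; fun_prop)
  have h0 : (fun w : E3 => ((![w 0, w 1], 0) : (Fin 2 → ℝ) × ℝ)) 0 = 0 := by
    ext i <;> [fin_cases i; skip] <;> simp
  have h1 := hc.continuousAt.eventually (h0.symm ▸ S.eventually_lattice_eq_zero
    H.separated H.isOpen_domain H.slice hd)
  filter_upwards [h1] with w hw hwΛ
  have h2 : ((![w 0, w 1], 0) : (Fin 2 → ℝ) × ℝ) ∈ cartanLattice M := by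
    rw [mem_cartanLattice]
    intro x
    rw [cartan_apply, zero_smul]
    exact hwΛ.2 x
  have h3 := congrArg fst (hw h2)
  ext i
  fin_cases i
  · exact congrFun h3 0
  · exact congrFun h3 1
  · exact hwΛ.1

variable {J : Set ℝ} {ρ η : R2 → ℝ} (hJ : IsOpen J)
  (hρ : ContDiffOn ℝ ∞ ρ (D ∩ fst ⁻¹' J)) (hη : ContDiffOn ℝ ∞ η (J ×ˢ univ))
  (hηρ : ∀ r ∈ J, ∀ u, (r, η (r, u)) ∈ D ∧ ρ (r, η (r, u)) = u)
  (hρη : ∀ d ∈ D, d.1 ∈ J → η (d.1, ρ d) = d.2)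

include hJ hη hηρ in
lemma contMDiffAt_fibreMap {n : ℝ × SU2} (hn : n.1 ∈ J) (w : E3) :
    ContMDiffAt ((𝓘(ℝ, ℝ).prod (𝓡 3)).prod (𝓡 3)) I7 ∞
      (fun p : (ℝ × SU2) × E3 => fibreMap σ η p.1 p.2) (n, w) := by
  have h1 : ContMDiff ((𝓘(ℝ, ℝ).prod (𝓡 3)).prod (𝓡 3)) 𝓘(ℝ, ℝ) ∞
      fun p : (ℝ × SU2) × E3 => p.1.1 := contMDiff_fst.comp contMDiff_fst
  have h2 : ContMDiff ((𝓘(ℝ, ℝ).prod (𝓡 3)).prod (𝓡 3)) 𝓘(ℝ, ℝ) ∞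
      fun p : (ℝ × SU2) × E3 => p.2 2 :=
    (EuclideanSpace.proj (2 : Fin 3) : E3 →L[ℝ] ℝ).contMDiff.comp contMDiff_snd
  have h3 := ContMDiffAt.comp (n, w) (g := η) (f := fun p : (ℝ × SU2) × E3 => (p.1.1, p.2 2))
    (hη.contDiffAt ((hJ.prod isOpen_univ).mem_nhds ⟨hn, mem_univ _⟩)).contMDiffAt
    ((h1 _).prodMk_space (h2 _))
  have h4 := ContMDiffAt.comp (n, w) (g := σ)
    (f := fun p : (ℝ × SU2) × E3 => (p.1.1, η (p.1.1, p.2 2)))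
    (H.slice.smooth.contMDiffAt (H.isOpen_domain.mem_nhds (hηρ n.1 hn (w 2)).1))
    ((h1 _).prodMk_space h3)
  have h5 := contMDiffAt_act S.act
    (f := fun p : (ℝ × SU2) × E3 => ((1, p.1.2) : T2SU2))
    (contMDiffAt_const.prodMk (contMDiff_snd.comp contMDiff_fst _)) h4
  exact contMDiffAt_act S.act (f := fun p : (ℝ × SU2) × E3 => gexp (torL p.2))
    ((contMDiff_gexp.comp torL.contMDiff).comp contMDiff_snd _) h5

include hηρ in
lemma fibreMap_mem {n : ℝ × SU2} (hn : n.1 ∈ J) (w : E3) :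
    fibreMap σ η n w ∈ A ∧ ‖μ (fibreMap σ η n w)‖ = n.1 := by
  rw [fibreMap_eq_smul]
  have h1 := (hηρ n.1 hn (w 2)).1
  exact ⟨S.smul_slice_mem H h1 _, congrArg fst (S.invariants_smul_slice H h1 _)⟩

include hηρ in
lemma fibProj_fibreMap {n : ℝ × SU2} (hn : n.1 ∈ J) (w : E3) :
    fibProj μ ν σ (fibreMap σ η n w) = (n.2 : GSU2 M) := by
  rw [fibreMap_eq_smul, S.fibProj_smul_slice H (hηρ n.1 hn (w 2)).1]

include hηρ in
lemma fibreMap_eq_iff {n : ℝ × SU2} (hn : n.1 ∈ J) {w w' : E3} :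
    fibreMap σ η n w = fibreMap σ η n w' ↔ (w : E3 ⧸ fibreLattice M) = w' := by
  rw [QuotientAddGroup.eq, neg_add_eq_sub]
  have hadd : gexp (torL w') = gexp (torL w) * gexp (torL (w' - w)) := by
    rw [← gexp_torL_add, add_sub_cancel]
  constructor
  · intro h
    have h1 := (hηρ n.1 hn (w 2)).1
    have h2 := (hηρ n.1 hn (w' 2)).1
    have h4 : w 2 = w' 2 := by
      rw [fibreMap_eq_smul, fibreMap_eq_smul] at h
      have h3 := S.invariants_smul_slice H h1
        ((Circle.exp (-w 0), Circle.exp (-w 1)), n.2)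
      rw [h, S.invariants_smul_slice H h2] at h3
      rw [← (hηρ n.1 hn (w 2)).2, ← (hηρ n.1 hn (w' 2)).2, h3]
    refine ⟨by simp [h4], ?_⟩
    rw [fibreMap, fibreMap, hadd, ← h4,
      mul_smul (gexp (torL w)) (gexp (torL (w' - w))) (_ : M)] at h
    exact S.smul_eq_of_injective (H.separated.inj _ (H.separated.smul _ _ (H.slice.mem _ h1)))
      (smul_left_cancel _ h).symm
  · rintro ⟨h1, h2⟩
    have h4 : w' 2 = w 2 := by simpa [sub_eq_zero] using h1
    rw [fibreMap, fibreMap, hadd, h4, mul_smul (gexp (torL w)) (gexp (torL (w' - w))) (_ : M), h2]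

include hρη in
lemma exists_eq_fibreMap (hx : x ∈ A) (hxJ : ‖μ x‖ ∈ J) {s : SU2}
    (hs : fibProj μ ν σ x = s) : ∃ w, x = fibreMap σ η (‖μ x‖, s) w := by
  obtain ⟨g, hg⟩ := S.exists_smul_slice H hx
  have hd := H.mem x hx
  have h1 := hs
  rw [hg, S.fibProj_smul_slice H hd, QuotientGroup.eq, mem_gammaTwo_iff] at h1
  obtain ⟨t, ht⟩ := h1
  obtain ⟨v, hv⟩ := gexp_surjective (g.1 * t, 1)
  refine ⟨!₂[v.1 0, v.1 1, ρ (‖μ x‖, ν x)], ?_⟩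
  have h3 := hρη _ hd hxJ
  have h5 : (gexp v).1 = g.1 * t := by rw [hv]
  have h4 : (((Circle.exp (-v.1 0), Circle.exp (-v.1 1)), s) : T2SU2) = g * (t, g.2⁻¹ * s) :=
    Prod.ext h5 (mul_inv_cancel_left g.2 s).symm
  rw [fibreMap_mk]
  dsimp only at h3 ⊢
  rw [h3, h4, mul_smul g (t, g.2⁻¹ * s) (σ _), ht, ← hg]

lemma exists_fibreMap_lift (hJ : IsOpen J) (hρ : ContDiffOn ℝ ∞ ρ (D ∩ fst ⁻¹' J))
    (hηρ : ∀ r ∈ J, ∀ u, (r, η (r, u)) ∈ D ∧ ρ (r, η (r, u)) = u)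
    (hρη : ∀ d ∈ D, d.1 ∈ J → η (d.1, ρ d) = d.2) (hx : x ∈ A) (hxJ : ‖μ x‖ ∈ J)
    {s : SU2} (hs : fibProj μ ν σ x = s) :
    ∃ (P : M → SU2) (w : M → E3), P x = s ∧ ContMDiffAt I7 (𝓡 3) ∞ P x ∧
      ContMDiffAt I7 (𝓡 3) ∞ w x ∧ ∀ᶠ y in 𝓝 x, y = fibreMap σ η (‖μ y‖, P y) (w y) := by
  obtain ⟨w₀, hw₀⟩ := S.exists_eq_fibreMap H hρη hx hxJ hs
  have hd := H.mem x hx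
  set d : R2 := (‖μ x‖, ν x) with hdd
  set g : T2SU2 := ((Circle.exp (-w₀ 0), Circle.exp (-w₀ 1)), s) with hg
  have hxg : x = g • σ d := by
    have h1 := hηρ _ hxJ (w₀ 2)
    rw [fibreMap_eq_smul] at hw₀
    have h2 := S.invariants_smul_slice H h1.1 g
    rw [← hw₀] at h2
    rw [hdd, h2]
    exact hw₀
  obtain ⟨Q, O, hO, hxO, hQs, hQ0, hQO, -⟩ := S.exists_lift H g hd
  rw [← hxg] at hxO hQ0
  have hQx := hQs.contMDiffAt (hO.mem_nhds hxO)
  have hdJ : d ∈ D ∩ fst ⁻¹' J := ⟨hd, hxJ⟩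
  have hDJ : IsOpen (D ∩ fst ⁻¹' J) := H.isOpen_domain.inter (hJ.preimage continuous_fst)
  refine ⟨fun y => g.2 * (gexp (Q y).1).2,
    fun y => !₂[w₀ 0 + (Q y).1.1 0, w₀ 1 + (Q y).1.1 1, ρ (Q y).2], ?_, ?_, ?_, ?_⟩
  · dsimp only
    rw [hQ0, gexp_zero]
    exact mul_one s
  · have h1 : ContMDiff 𝓘(ℝ, LR) (𝓡 3) ∞
        fun q : LR => g.2 * (gexp q.1).2 :=
      (contMDiff_mul_left_SU2 g.2).comp
        ((contMDiff_snd.comp contMDiff_gexp).comp contDiff_fst.contMDiff)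
    exact ContMDiffAt.comp x (f := Q) (h1 _) hQx
  · have h1 : ContDiffAt ℝ ∞ (fun q : LR =>
        (!₂[w₀ 0 + q.1.1 0, w₀ 1 + q.1.1 1, ρ q.2] : E3)) (Q x) := by
      rw [contDiffAt_euclidean]
      intro i
      have h2 : ContDiffAt ℝ ∞ (fun q : LR => ρ q.2) (Q x) := by
        rw [hQ0]
        exact ContDiffAt.comp ((0, d) : LR) (hρ.contDiffAt (hDJ.mem_nhds hdJ))
          contDiffAt_snd
      have h3 : ∀ j : Fin 2, ContDiffAt ℝ ∞ (fun q : LR => w₀ (j.castSucc) +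
          q.1.1 j) (Q x) := fun j => by fun_prop
      fin_cases i
      · exact h3 0
      · exact h3 1
      · exact h2
    exact ContMDiffAt.comp x (f := Q) h1.contMDiffAt hQx
  · have h1 : ∀ᶠ y in 𝓝 x, ‖μ y‖ ∈ J :=
      (S.mu.smooth.continuous.norm.continuousAt).eventually (hJ.mem_nhds hxJ)
    filter_upwards [hO.mem_nhds hxO, h1] with y hyO hyJ
    obtain ⟨h2, h3⟩ := hQO y hyO
    have h4 := S.invariants_smul_slice H h2 (g * gexp (Q y).1)
    rw [h3] at h4
    have h5 : (Q y).2.1 = ‖μ y‖ := (congrArg fst h4).symm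
    have h6 : η (‖μ y‖, ρ (Q y).2) = (Q y).2.2 := by
      rw [← h5]; exact hρη _ h2 (h5 ▸ hyJ)
    have h8 : (((Circle.exp (-(w₀ 0 + (Q y).1.1 0)), Circle.exp (-(w₀ 1 + (Q y).1.1 1))),
        g.2 * (gexp (Q y).1).2) : T2SU2) = g * gexp (Q y).1 := by
      refine Prod.ext (Prod.ext ?_ ?_) rfl
      · change Circle.exp (-(w₀ 0 + _)) = Circle.exp _ * Circle.exp _
        rw [neg_add, Circle.exp_add]
      · change Circle.exp (-(w₀ 1 + _)) = Circle.exp _ * Circle.exp _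
        rw [neg_add, Circle.exp_add]
    rw [fibreMap_mk]
    dsimp only
    rw [h6, h8, ← h5]
    exact h3.symm

end MultiMoment

/-- `V` is identified with the open set `N ⊆ ℝ × SU(2)`, compatibly with maps `r` and `π` to a
common base. -/
structure IsBaseChart {E' H' Y R : Type*} [NormedAddCommGroup E'] [NormedSpace ℝ E']
    [TopologicalSpace H'] [TopologicalSpace Y] [ChartedSpace H' Y]
    (J : ModelWithCorners ℝ E' H') (μ : M → E3) (p : M → GSU2 M)
    (A A' : Set M) (r : Y → R) (π : M → R) (V : Set Y) (N : Set (ℝ × SU2)) (b : Y → ℝ × SU2)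
    (c : ℝ × SU2 → Y) : Prop where
  isOpen_source : IsOpen V
  isOpen_target : IsOpen N
  smooth : ContMDiffOn J (𝓘(ℝ, ℝ).prod (𝓡 3)) ∞ b V
  smooth_symm : ContMDiffOn (𝓘(ℝ, ℝ).prod (𝓡 3)) J ∞ c N
  map_source : ∀ y ∈ V, b y ∈ N
  map_target : ∀ n ∈ N, c n ∈ V
  left_inv : ∀ y ∈ V, c (b y) = y
  right_inv : ∀ n ∈ N, b (c n) = n
  base_eq : ∀ y ∈ V, ∀ y' ∈ V, r y = r y' → (b y).1 = (b y').1 ∧ ((b y).2 : GSU2 M) = (b y').2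
  proj_eq_iff : ∀ x ∈ A', ∀ y ∈ V, π x = r y ↔ ‖μ x‖ = (b y).1 ∧ p x = (b y).2
  mem : ∀ x ∈ A, ∀ y ∈ V, ‖μ x‖ = (b y).1 → p x = (b y).2 → x ∈ A'

namespace MultiMoment

variable (H : HorizontalSlice φ μ ν A D σ)
include S H

lemma isSmoothFibreBundle {E' H' Y R : Type*} [NormedAddCommGroup E'] [NormedSpace ℝ E']
    [TopologicalSpace H'] [TopologicalSpace Y] [ChartedSpace H' Y]
    {I : ModelWithCorners ℝ E' H'} {A' : Set M} (hA' : IsOpen A') (hA'A : A' ⊆ A)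
    {Dy : Set Y} {r : Y → R} {π : M → R} (hDy : Dy.Nonempty → D.Nonempty)
    (himage : π '' A' ⊆ r '' Dy)
    (hbase : ∀ y ∈ Dy, ∃ V N b c, y ∈ V ∧ V ⊆ Dy ∧ (b y).1 ∈ fst '' D ∧
      IsBaseChart I μ (fibProj μ ν σ) A A' r π V N b c) :
    IsSmoothFibreBundle I7 I 3 A' Dy r π := by
  rcases Dy.eq_empty_or_nonempty with rfl | hne
  · exact ⟨hA', subset_antisymm himage (by simp), E3, inferInstance, inferInstance, inferInstance,
      fun y hy => hy.elim⟩
  have hΛ := S.eventually_fibreLattice H (hDy hne)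
  letI := latticeChartedSpace hΛ
  haveI := isManifold_lattice hΛ
  have local_triv : ∀ y ∈ Dy, ∃ V : Set Y, IsOpen V ∧ y ∈ V ∧ V ⊆ Dy ∧
      ∃ Ψ : R × (E3 ⧸ fibreLattice M) → M,
        IsQuotientDiffeo (I.prod (𝓡 3)) I7 (V ×ˢ univ) (A' ∩ π ⁻¹' (r '' V))
          (Prod.map r id) id Ψ ∧
        ∀ b ∈ r '' V, ∀ z, π (Ψ (b, z)) = b := by
    intro y₀ hy₀
    obtain ⟨V₀, N, b, c, hyV, hVD, hbD, hB⟩ := hbase y₀ hy₀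
    obtain ⟨J, ρ, η, hJ, hr₀, -, hρ, hη, hηρ, hρη⟩ :=
      exists_fibre_coordinate H.isOpen_domain H.convex hbD
    set N' : Set (ℝ × SU2) := N ∩ J ×ˢ halfSphere (b y₀).2
    have hN' : IsOpen N' := hB.isOpen_target.inter (hJ.prod (isOpen_halfSphere _))
    set V : Set Y := V₀ ∩ b ⁻¹' N' with hVdef
    have hV : IsOpen V := hB.smooth.continuousOn.isOpen_inter_preimage hB.isOpen_source hN'
    have hy₀V : y₀ ∈ V := ⟨hyV, hB.map_source _ hyV, hr₀, self_mem_halfSphere _⟩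
    have hinj : ∀ y ∈ V, ∀ y' ∈ V, r y = r y' → y = y' := by
      intro y hy y' hy' h
      obtain ⟨h1, h2⟩ := hB.base_eq y hy.1 y' hy'.1 h
      rw [QuotientGroup.eq] at h2
      have h3 : (b y).2 = (b y').2 := eq_of_mem_halfSphere hy.2.2.2 hy'.2.2.2
        fun a => rot_of_mem_gammaTwo S h2 a
      rw [← hB.left_inv y hy.1, ← hB.left_inv y' hy'.1, Prod.ext h1 h3]
    set T : Y → E3 → M := fun y w => fibreMap σ η (b y) w
    have hTA : ∀ y ∈ V, ∀ w, T y w ∈ A' ∧ π (T y w) = r y := by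
      intro y hy w
      have h1 := S.fibreMap_mem H hηρ hy.2.2.1 w
      have h2 := S.fibProj_fibreMap H hηρ hy.2.2.1 w
      have h3 := hB.mem _ h1.1 y hy.1 h1.2 h2
      exact ⟨h3, (hB.proj_eq_iff _ h3 y hy.1).2 ⟨h1.2, h2⟩⟩
    classical
    set Ψ : R × (E3 ⧸ fibreLattice M) → M := fun q =>
      if h : ∃ y ∈ V, r y = q.1 then T h.choose q.2.out else T y₀ q.2.out with hΨ
    have hΨT : ∀ y ∈ V, ∀ w : E3, Ψ (r y, ↑w) = T y w := by
      intro y hy w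
      have hex : ∃ y' ∈ V, r y' = r y := ⟨y, hy, rfl⟩
      have h1 : Ψ (r y, ↑w) =
        T hex.choose (w : E3 ⧸ fibreLattice M).out := dif_pos hex
      rw [h1, hinj _ hex.choose_spec.1 y hy hex.choose_spec.2]
      exact (S.fibreMap_eq_iff H hηρ hy.2.2.1).2 (QuotientAddGroup.out_eq' _)
    refine ⟨V, hV, hy₀V, inter_subset_left.trans hVD, Ψ, ⟨⟨?_, ?_, ?_⟩, ?_, ?_⟩, ?_⟩
    · rintro _ ⟨⟨y, z⟩, ⟨hy, -⟩, rfl⟩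
      obtain ⟨w, rfl⟩ := QuotientAddGroup.mk_surjective z
      rw [image_id, Prod.map_apply, id_eq, hΨT y hy]
      exact ⟨(hTA y hy w).1, y, hy, (hTA y hy w).2.symm⟩
    · rintro _ ⟨⟨y, z⟩, ⟨hy, -⟩, rfl⟩ _ ⟨⟨y', z'⟩, ⟨hy', -⟩, rfl⟩ h
      obtain ⟨w, rfl⟩ := QuotientAddGroup.mk_surjective z
      obtain ⟨w', rfl⟩ := QuotientAddGroup.mk_surjective z'
      rw [Prod.map_apply, Prod.map_apply, id_eq, id_eq] at h ⊢
      rw [hΨT y hy, hΨT y' hy'] at h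
      have h1 : r y = r y' := by rw [← (hTA y hy w).2, h, (hTA y' hy' w').2]
      obtain rfl := hinj y hy y' hy' h1
      rw [(S.fibreMap_eq_iff H hηρ hy.2.2.1).1 h]
    · rw [image_id]
      rintro x ⟨hx, y, hy, hxy⟩
      obtain ⟨h1, h2⟩ := (hB.proj_eq_iff x hx y hy.1).1 hxy.symm
      obtain ⟨w, hw⟩ := S.exists_eq_fibreMap H hρη (hA'A hx) (h1.symm ▸ hy.2.2.1) h2
      refine ⟨(r y, ↑w), ⟨(y, ↑w), ⟨hy, mem_univ _⟩, rfl⟩, ?_⟩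
      rw [hΨT y hy, hw, h1]
    · rintro ⟨y, z⟩ ⟨hy, -⟩
      set e := chartAt E3 z
      have he : ∀ z ∈ e.source, ((e z : E3) : E3 ⧸ fibreLattice M) = z := chart_mem_atlas E3 z
      refine ⟨fun q => T q.1 (e q.2), ContMDiffAt.contMDiffWithinAt ?_, ?_⟩
      · have h1 : ContMDiffAt (I.prod (𝓡 3)) (𝓡 3) ∞
            (fun q : Y × (E3 ⧸ fibreLattice M) => e q.2) (y, z) :=
          (contMDiffAt_of_mem_maximalAtlas (IsManifold.chart_mem_maximalAtlas z)
            (mem_chart_source E3 z)).comp (y, z) contMDiffAt_snd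
        have h2 : ContMDiffAt (I.prod (𝓡 3)) (𝓘(ℝ, ℝ).prod (𝓡 3)) ∞
            (fun q : Y × (E3 ⧸ fibreLattice M) => b q.1) (y, z) :=
          (hB.smooth.contMDiffAt (hB.isOpen_source.mem_nhds hy.1)).comp (y, z) contMDiffAt_fst
        exact ContMDiffAt.comp (y, z)
          (f := fun q : Y × (E3 ⧸ fibreLattice M) => (b q.1, e q.2))
          (S.contMDiffAt_fibreMap H hJ hη hηρ hy.2.2.1 (e z)) (h2.prodMk h1)
      · refine Filter.Eventually.filter_mono nhdsWithin_le_nhds ?_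
        filter_upwards [(hV.prod e.open_source).mem_nhds ⟨hy, mem_chart_source E3 z⟩]
          with q hq
        refine ⟨⟨(hTA _ hq.1 _).1, q.1, hq.1, (hTA _ hq.1 _).2.symm⟩, ?_⟩
        have h1 := hΨT q.1 hq.1 (e q.2)
        rw [he _ hq.2] at h1
        exact h1.symm
    · rintro x ⟨hx, y, hy, hxy⟩
      obtain ⟨h1, h2⟩ := (hB.proj_eq_iff x hx y hy.1).1 hxy.symm
      have hxJ : ‖μ x‖ ∈ J := h1.symm ▸ hy.2.2.1
      obtain ⟨P, w, hPx, hP, hw, hPw⟩ := S.exists_fibreMap_lift H hJ hρ hηρ hρη (hA'A hx) hxJ h2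
      have hn : ContMDiffAt I7 (𝓘(ℝ, ℝ).prod (𝓡 3)) ∞ (fun x' => (‖μ x'‖, P x')) x := by
        refine ContMDiffAt.prodMk ?_ hP
        exact ((contDiffAt_norm ℝ (S.mu_ne_zero (H.separated.inj x (hA'A hx)))).contMDiffAt).comp x
          S.mu.smooth.contMDiffAt
      have hnx : (‖μ x‖, P x) = b y := Prod.ext h1 hPx
      have hnN : (‖μ x‖, P x) ∈ N' := hnx ▸ hy.2
      refine ⟨fun x' => (c (‖μ x'‖, P x'), ↑(w x')),
        ContMDiffAt.contMDiffWithinAt ?_, Filter.Eventually.filter_mono nhdsWithin_le_nhds ?_⟩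
      · refine ContMDiffAt.prodMk ?_ ((contMDiff_latticeMk hΛ _).comp x hw)
        exact ContMDiffAt.comp x (f := fun x' => (‖μ x'‖, P x'))
          (hB.smooth_symm.contMDiffAt (hB.isOpen_target.mem_nhds hnN.1)) hn
      · filter_upwards [hPw, hn.continuousAt.eventually (hN'.mem_nhds hnN)] with x' hx' hx'N
        have h3 : c (‖μ x'‖, P x') ∈ V :=
          ⟨hB.map_target _ hx'N.1, by rw [mem_preimage, hB.right_inv _ hx'N.1]; exact hx'N⟩
        refine ⟨⟨h3, mem_univ _⟩, ?_⟩
        rw [Prod.map_apply, id_eq, hΨT _ h3]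
        change fibreMap σ η (b _) _ = x'
        rw [hB.right_inv _ hx'N.1]
        exact hx'.symm
    · rintro _ ⟨y, hy, rfl⟩ z
      obtain ⟨w, rfl⟩ := QuotientAddGroup.mk_surjective z
      rw [hΨT y hy]
      exact (hTA y hy w).2
  refine ⟨hA', subset_antisymm himage ?_, E3 ⧸ fibreLattice M, inferInstance, inferInstance,
    inferInstance, local_triv⟩
  rintro _ ⟨y, hy, rfl⟩
  obtain ⟨V, -, hyV, -, Ψ, hΨ, hπ⟩ := local_triv y hy
  have h1 := hΨ.bijOn.mapsTo ⟨(y, ↑(0 : E3)), ⟨hyV, mem_univ _⟩, rfl⟩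
  rw [image_id] at h1
  exact ⟨_, h1.1, hπ _ (mem_image_of_mem _ hyV) _⟩

lemma isSmoothFibreBundle_fibProj :
    IsSmoothFibreBundle I7 (𝓘(ℝ, ℝ).prod (𝓡 3)) 3 A
      (((fun x => ‖μ x‖) '' A) ×ˢ (univ : Set SU2))
      (Prod.map id (fun s : SU2 => (s : GSU2 M))) (fun x => (‖μ x‖, fibProj μ ν σ x)) := by
  have himage : (fun x => ‖μ x‖) '' A = fst '' D := by
    ext r
    constructor
    · rintro ⟨x, hx, rfl⟩
      exact ⟨_, H.mem x hx, rfl⟩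
    · rintro ⟨d, hd, rfl⟩
      exact ⟨σ d, H.slice.mem d hd, H.slice.norm_mu hd⟩
  rw [himage]
  have hI : IsOpen ((fst '' D) ×ˢ (univ : Set SU2)) :=
    (isOpenMap_fst D H.isOpen_domain).prod isOpen_univ
  refine S.isSmoothFibreBundle H H.isOpen_carrier subset_rfl ?_ ?_ fun y hy =>
    ⟨_, _, id, id, hy, subset_rfl, hy.1, hI, hI, contMDiffOn_id, contMDiffOn_id, fun _ h => h,
      fun _ h => h, fun _ _ => rfl, fun _ _ => rfl, fun y _ y' _ h => Prod.ext_iff.1 h,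
      fun x _ y _ => Prod.ext_iff, fun x hx _ _ _ _ => hx⟩
  · rintro ⟨y, ⟨d, hd, -⟩, -⟩
    exact ⟨d, hd⟩
  · rintro _ ⟨x, hx, rfl⟩
    obtain ⟨s, hs⟩ := QuotientGroup.mk_surjective (fibProj μ ν σ x)
    exact ⟨(‖μ x‖, s), ⟨⟨_, H.mem x hx, rfl⟩, mem_univ _⟩, Prod.ext rfl hs⟩

lemma smul_slice_torusProj {s s' : SU2} (h : (s : GSU2 M) = s') :
    torusProj (((1, s) : T2SU2) • σ d) = torusProj (((1, s') : T2SU2) • σ d) := by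
  rw [QuotientGroup.eq, mem_gammaTwo_iff] at h
  obtain ⟨t, ht⟩ := h
  refine torusProj_eq_iff.2 ⟨t⁻¹, ?_⟩
  have h1 : ((1, s') : T2SU2) = (t⁻¹, 1) * (1, s) * (t, s⁻¹ * s') := by
    ext <;> simp
  rw [h1, mul_smul ((t⁻¹, 1) * (1, s) : T2SU2) (t, s⁻¹ * s') (σ d), ht,
    mul_smul ((t⁻¹, 1) : T2SU2) (1, s) (σ d)]

lemma torusProj_eq_iff_fibProj (hx : x ∈ A) (hd : d ∈ D) (s : SU2) :
    torusProj x = torusProj (((1, s) : T2SU2) • σ d) ↔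
      (‖μ x‖, ν x) = d ∧ fibProj μ ν σ x = (s : GSU2 M) := by
  constructor
  · intro h
    obtain ⟨t, ht⟩ := torusProj_eq_iff.1 h.symm
    rw [ht, smul_smul _ _ (σ d), S.invariants_smul_slice H hd, S.fibProj_smul_slice H hd]
    simp
  · rintro ⟨rfl, h⟩
    obtain ⟨g, hg⟩ := S.exists_smul_slice H hx
    rw [hg, S.fibProj_smul_slice H hd] at h
    have h1 : ((1, g.2) : T2SU2) • σ (‖μ x‖, ν x) = ((g.1⁻¹, 1) : T2SU2) • x := by
      nth_rw 3 [hg]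
      rw [smul_smul ((g.1⁻¹, 1) : T2SU2) g (σ _)]
      congr 1
      ext <;> simp
    rw [← S.smul_slice_torusProj H h, h1, torusProj_smul]

lemma exists_trivialization {𝓤 : Set (MulAction.orbitRel.Quotient T2SU2 M)}
    (hA : A = baseProj ⁻¹' 𝓤) (hDA : D = baseMap μ ν '' 𝓤) :
    ∃ Φ : MulAction.orbitRel.Quotient T2SU2 M × GSU2 M →
        MulAction.orbitRel.Quotient torusSubgroup M,
      IsPrincipalTrivialization 𝓤 Φ ∧ ∀ x ∈ A, Φ (baseProj x, fibProj μ ν σ x) = torusProj x := by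
  let Φ := fun q : MulAction.orbitRel.Quotient T2SU2 M × GSU2 M =>
    torusProj (((1, q.2.out) : T2SU2) • σ (baseMap μ ν q.1))
  have hΦs : ∀ b (s : SU2), Φ (b, (s : GSU2 M)) =
      torusProj (((1, s) : T2SU2) • σ (baseMap μ ν b)) := fun b s =>
    S.smul_slice_torusProj H (QuotientGroup.out_eq' _)
  have hbD : ∀ b ∈ 𝓤, baseMap μ ν b ∈ D := fun b hb => hDA ▸ mem_image_of_mem _ hb
  have hxb : ∀ x ∈ A, ∀ b ∈ 𝓤, (‖μ x‖, ν x) = baseMap μ ν b → baseProj x = b := by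
    intro x hx b hb h
    obtain ⟨y, rfl⟩ := Quotient.exists_rep b
    have hy : y ∈ A := hA ▸ hb
    have h1 := h.trans (S.baseMap_baseProj y)
    exact baseProj_eq_iff.2 (H.separated.sep x hx y hy (congrArg fst h1)
      (congrArg snd h1))
  have hAΦ : ∀ x b (h : GSU2 M), b ∈ 𝓤 → torusProj x = Φ (b, h) → x ∈ A := by
    intro x b h hb hx
    obtain ⟨t, rfl⟩ := torusProj_eq_iff.1 hx.symm
    exact H.separated.smul _ _ (S.smul_slice_mem H (hbD b hb) _)
  have hp : ∀ x ∈ A, ∀ s : SU2, fibProj μ ν σ x = s → Φ (baseProj x, (s : GSU2 M)) = torusProj x := by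
    intro x hx s hs
    rw [hΦs, S.baseMap_baseProj]
    exact ((S.torusProj_eq_iff_fibProj H hx (H.mem x hx) s).2 ⟨rfl, hs⟩).symm
  have hΦinj : ∀ x b (s : SU2), b ∈ 𝓤 → torusProj x = Φ (b, (s : GSU2 M)) →
      baseProj x = b ∧ fibProj μ ν σ x = s := by
    intro x b s hb hx
    have hxA := hAΦ x b _ hb hx
    rw [hΦs] at hx
    obtain ⟨h1, h2⟩ := (S.torusProj_eq_iff_fibProj H hxA (hbD b hb) s).1 hx
    exact ⟨hxb x hxA b hb h1, h2⟩
  have hmem : ∀ x, x ∈ A ↔ baseProj x ∈ 𝓤 := fun x => by rw [hA]; rfl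
  refine ⟨Φ, ⟨⟨⟨?_, ?_, ?_⟩, ?_, ?_⟩, ?_, ?_⟩, fun x hx => ?_⟩
  · rintro _ ⟨⟨x, s⟩, ⟨hx, -⟩, rfl⟩
    rw [Prod.map_apply, hΦs, ← hA]
    exact mem_image_of_mem _ (S.smul_slice_mem H (hbD _ hx) _)
  · rintro _ ⟨⟨x, s⟩, ⟨hx, -⟩, rfl⟩ _ ⟨⟨x', s'⟩, ⟨hx', -⟩, rfl⟩ h
    rw [Prod.map_apply, Prod.map_apply] at h ⊢
    obtain ⟨y, hy⟩ := Quotient.exists_rep (Φ (baseProj x, (s : GSU2 M)))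
    have hy : torusProj y = Φ (baseProj x, (s : GSU2 M)) := hy
    obtain ⟨h1, h2⟩ := hΦinj y _ s hx hy
    obtain ⟨h3, h4⟩ := hΦinj y _ s' hx' (hy.trans h)
    rw [← h1, ← h2, ← h3, ← h4]
  · rintro _ ⟨x, hx, rfl⟩
    obtain ⟨s, hs⟩ := QuotientGroup.mk_surjective (fibProj μ ν σ x)
    exact ⟨_, ⟨(x, s), ⟨hx, mem_univ _⟩, rfl⟩, hp x ((hmem x).2 hx) s hs.symm⟩
  · rintro ⟨x, s⟩ ⟨hx, -⟩
    have hxA : x ∈ A := (hmem x).2 hx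
    refine ⟨fun q => ((1, q.2) : T2SU2) • σ (‖μ q.1‖, ν q.1), ?_, ?_⟩
    · have h1 : ContMDiffAt I7 𝓘(ℝ, R2) ∞ (fun y : M => (‖μ y‖, ν y)) x :=
        (((contDiffAt_norm ℝ (S.mu_ne_zero (H.separated.inj x hxA))).contMDiffAt).comp x
          S.mu.smooth.contMDiffAt).prodMk_space S.nu.smooth.contMDiffAt
      have h2 : ContMDiffAt I7 I7 ∞ (fun y : M => σ (‖μ y‖, ν y)) x :=
        ContMDiffAt.comp x (f := fun y : M => (‖μ y‖, ν y))
          (H.slice.smooth.contMDiffAt (H.isOpen_domain.mem_nhds (H.mem x hxA))) h1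
      exact (contMDiffAt_act S.act (f := fun q : M × SU2 => ((1, q.2) : T2SU2))
        (g := fun q : M × SU2 => σ (‖μ q.1‖, ν q.1)) (z := (x, s))
        (contMDiffAt_const.prodMk contMDiffAt_snd)
        (ContMDiffAt.comp (x, s) (g := fun y : M => σ (‖μ y‖, ν y)) (f := fst) h2
          contMDiffAt_fst)).contMDiffWithinAt
    · filter_upwards [self_mem_nhdsWithin] with q hq
      rw [Prod.map_apply, hΦs, S.baseMap_baseProj]
      refine ⟨(hmem _).1 (S.smul_slice_mem H (H.mem _ ((hmem _).2 hq.1)) _), rfl⟩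
  · intro x hx
    have hxA : x ∈ A := (hmem x).2 hx
    obtain ⟨g, hg⟩ := S.exists_smul_slice H hxA
    have hd := H.mem x hxA
    obtain ⟨Q, O, hO, hxO, hQs, hQ0, hQO, -⟩ := S.exists_lift H g hd
    rw [← hg] at hxO
    have h1 : ContMDiff 𝓘(ℝ, LR) (𝓡 3) ∞
        fun q : LR => g.2 * (gexp q.1).2 :=
      (contMDiff_mul_left_SU2 g.2).comp
        ((contMDiff_snd.comp contMDiff_gexp).comp contDiff_fst.contMDiff)
    refine ⟨fun y => (y, g.2 * (gexp (Q y).1).2),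
      (contMDiffAt_id.prodMk (ContMDiffAt.comp x (f := Q) (h1 _)
        (hQs.contMDiffAt (hO.mem_nhds hxO)))).contMDiffWithinAt, ?_⟩
    filter_upwards [self_mem_nhdsWithin, nhdsWithin_le_nhds (hO.mem_nhds hxO)] with y hy hyO
    refine ⟨⟨hy, mem_univ _⟩, ?_⟩
    obtain ⟨h2, h3⟩ := hQO y hyO
    have h4 := S.fibProj_smul_slice H h2 (g * gexp (Q y).1)
    rw [h3] at h4
    exact hp y ((hmem y).2 hy) _ h4
  · intro b hb h x hx
    obtain ⟨s, rfl⟩ := QuotientGroup.mk_surjective h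
    exact (hΦinj x b s hb hx).1
  · intro b hb s h x hx
    obtain ⟨h1, h2⟩ := hΦinj x b h hb hx
    have hxA := hAΦ x b _ hb hx
    have h3 := S.fibProj_smul H (1, s) hxA h2
    rw [← hp _ (H.separated.smul (1, s) x hxA) _ h3, baseProj_smul, h1]
  · obtain ⟨s, hs⟩ := QuotientGroup.mk_surjective (fibProj μ ν σ x)
    rw [← hs]
    exact hp x hx s hs.symm

lemma isConstantAlongCross {𝓤 : Set (MulAction.orbitRel.Quotient T2SU2 M)}
    (hA : A = baseProj ⁻¹' 𝓤) : IsConstantAlongCross φ 𝓤 (fibProj μ ν σ) := by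
  intro x hx
  rw [← hA] at hx
  obtain ⟨g, hg⟩ := S.exists_smul_slice H hx
  have hd := H.mem x hx
  obtain ⟨Q, O, hO, hxO, hQs, hQ0, hQO, hQe⟩ := S.exists_lift H g hd
  rw [← hg] at hxO hQ0
  have hQx := hQs.contMDiffAt (hO.mem_nhds hxO)
  have h1 : ContMDiff 𝓘(ℝ, R3) (𝓡 3) ∞
      fun a : R3 => g.2 * su2Exp fun i => -(a i / 2) :=
    (contMDiff_mul_left_SU2 g.2).comp (contMDiff_su2Exp.comp
      (contMDiff_iff_contDiff.2 (by fun_prop : ContDiff ℝ ∞ fun a : R3 => fun i => -(a i / 2))))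
  let B : LR →L[ℝ] R3 := (ContinuousLinearMap.snd ℝ (Fin 2 → ℝ) R3).comp (.fst ℝ LieT R2)
  have hBQ : ContMDiffAt I7 𝓘(ℝ, R3) ∞ (fun y => B (Q y)) x := B.contMDiff.contMDiffAt.comp x hQx
  refine ⟨fun y => g.2 * (gexp (Q y).1).2, ContMDiffAt.comp x (f := fun y => B (Q y)) (h1 _) hBQ,
    ?_, ?_⟩
  · filter_upwards [hO.mem_nhds hxO] with y hyO
    obtain ⟨h2, h3⟩ := hQO y hyO
    have h4 := S.fibProj_smul_slice H h2 (g * gexp (Q y).1)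
    rw [h3] at h4
    exact h4.symm
  · have hQd : HasMFDerivAt I7 𝓘(ℝ, LR) Q x
        (mfderiv I7 𝓘(ℝ, LR) Q x) :=
      (hQx.mdifferentiableAt (by simp)).hasMFDerivAt
    set L : E7 →L[ℝ] LR := mfderiv I7 𝓘(ℝ, LR) Q x with hL
    have h2 := HasMFDerivAt.comp x (g := fun q => B q) B.hasMFDerivAt hQd
    have h3 := HasMFDerivAt.comp x (f := fun y => B (Q y))
      ((h1 (B (Q x))).mdifferentiableAt (by simp)).hasMFDerivAt h2
    have h4 := (S.mem_Kd_iff_of_lift H hd hQe (L := L) (by rw [← hg]; exact hQd) (φ.Xf x)).1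
      (by rw [← hg]; exact φ.Xf_mem_Kd x)
    have h5 : B (L (φ.Xf x)) = 0 := h4.1
    have h6 : φ.cross x (genU 0 x) (genU 1 x) = φ.Xf x := by
      rw [G2Structure.cross_eq, genU_eq S.act, genU_eq S.act]
      rfl
    rw [h6]
    refine (congrArg (fun T : E7 →L[ℝ] E3 => T (φ.Xf x)) h3.mfderiv).trans ?_
    refine Eq.trans (congrArg (mfderiv 𝓘(ℝ, R3) (𝓡 3)
      (fun a : R3 => g.2 * su2Exp fun i => -(a i / 2)) (B (Q x)) :
        R3 →L[ℝ] E3) h5) (map_zero _)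

end MultiMoment

/-! ### The singular members of the fibration -/

/-- The points where `U₁, U₂` are independent, the element `n` of `𝔰𝔲(2)` belongs to the isotropy
algebra modulo `𝔱²`, and `μ = r n`. -/
def singularLeaf (μ : M → E3) (r : ℝ) (n : R3) : Set M :=
  {x | Uind x ∧ (μ x).ofLp = r • n ∧ ∃ θ, infAct x (θ, n) = 0}

def singularFibre (μ : M → E3) (r : ℝ) (n : R3) : Set M :=
  singularLeaf μ r n ∪ {x | ¬ Uind x ∧ ∃ θ, infAct x (θ, n) = 0} ∩ closure (singularLeaf μ r n)

lemma singularFibre_inter (r : ℝ) (n : R3) :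
    singularFibre μ r n ∩ {x : M | Uind x} = singularLeaf μ r n := by
  ext x
  exact ⟨fun h => h.1.resolve_right fun h' => h'.1.1 h.2, fun h => ⟨Or.inl h, h.1⟩⟩

namespace MultiMoment

include S

lemma smul_mem_singularLeaf (k : T2SU2) {r : ℝ} {n : R3}
    (hx : x ∈ singularLeaf μ r n) : k • x ∈ singularLeaf μ r (rot k.2 n) := by
  obtain ⟨h1, h2, θ, h3⟩ := hx
  refine ⟨h1.smul S.act k, by rw [mu_smul S.pres S.act S.mu, h2, rot_smul], θ, ?_⟩
  have h4 := dact_infAct S.act k x (θ, n)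
  rw [h3, map_zero, adj_apply] at h4
  exact h4.symm

lemma smul_mem_singularFibre (k : T2SU2) {r : ℝ} {n : R3}
    (hx : x ∈ singularFibre μ r n) : k • x ∈ singularFibre μ r (rot k.2 n) := by
  rcases hx with hx | ⟨⟨h1, θ, h2⟩, h3⟩
  · exact Or.inl (S.smul_mem_singularLeaf k hx)
  · refine Or.inr ⟨⟨fun h => h1 ?_, θ, ?_⟩, ?_⟩
    · have := h.smul S.act k⁻¹
      rwa [inv_smul_smul k x] at this
    · have h4 := dact_infAct S.act k x (θ, n)
      rw [h2, map_zero, adj_apply] at h4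
      exact h4.symm
    · exact map_mem_closure (contMDiff_smul_const S.act k).continuous h3
        fun y hy => S.smul_mem_singularLeaf k hy

variable (H : HorizontalSlice φ μ ν {x : M | Injective (infAct x)} D σ)
include H

lemma invariants_mem_closure (x : M) : (‖μ x‖, ν x) ∈ closure D :=
  map_mem_closure (f := fun y => (‖μ y‖, ν y)) (S.mu.smooth.continuous.norm.prodMk S.nu.smooth.continuous)
    (S.dense_injective x) fun y hy => H.mem y hy

lemma injective_of_invariants_mem (hx : (‖μ x‖, ν x) ∈ D) :
    Injective (infAct x) := by
  set d : M → R2 := fun y => (‖μ y‖, ν y) with hd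
  have hdc : Continuous d := S.mu.smooth.continuous.norm.prodMk S.nu.smooth.continuous
  by_contra hinj
  have hK : IsCompact (range fun k : T2SU2 => k • σ (d x)) :=
    isCompact_range (continuous_smul_left S.act _)
  have hxK : x ∉ range fun k : T2SU2 => k • σ (d x) := by
    rintro ⟨k, hk⟩
    have h := S.smul_slice_mem H hx k
    rw [show k • σ (‖μ x‖, ν x) = x from hk] at h
    exact hinj h
  have hF : ContinuousOn (fun p : T2SU2 × R2 => p.1 • σ p.2) (univ ×ˢ D) :=
    S.act.continuous.comp_continuousOn (continuousOn_fst.prodMk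
      (H.slice.smooth.continuousOn.comp continuousOn_snd fun p hp => hp.2))
  obtain ⟨U, V, hU, hV, hxU, hKV, hUV⟩ := SeparatedNhds.of_isCompact_isCompact
    (isCompact_singleton (x := x)) hK (disjoint_singleton_left.2 hxK)
  obtain ⟨N, O, hN, hO, hsub, hdO, hNO⟩ := generalized_tube_lemma (s := (univ : Set T2SU2))
    isCompact_univ (t := {d x}) isCompact_singleton
    (hF.isOpen_inter_preimage (isOpen_univ.prod H.isOpen_domain) hV) (by
      rintro ⟨k, e⟩ ⟨-, rfl⟩
      exact ⟨⟨mem_univ _, hx⟩, hKV ⟨k, rfl⟩⟩)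
  obtain ⟨y, ⟨hyU, hyO⟩, hy⟩ := S.dense_injective.inter_open_nonempty _
    (hU.inter (hO.preimage hdc)) ⟨x, hxU rfl, hdO rfl⟩
  obtain ⟨g, hg⟩ := S.exists_smul_slice H hy
  have h1 := hNO (show (g, d y) ∈ N ×ˢ O from ⟨hsub (mem_univ _), hyO⟩)
  have h2 : g • σ (d y) ∈ V := h1.2
  rw [← hg] at h2
  exact disjoint_left.1 hUV hyU h2

/-- At singular points where `U₁, U₂` are independent, `|μ|` is zero or extremal. -/
lemma norm_mu_extremal (hx : Uind x) (hs : ¬ Injective (infAct x))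
    (hμ : μ x ≠ 0) :
    ((∀ y, ‖μ y‖ ≤ ‖μ x‖) ∨ ∀ y, ‖μ x‖ ≤ ‖μ y‖) ∧ ‖μ x‖ ∉ fst '' D := by
  have hxD : (‖μ x‖, ν x) ∉ D := fun h => hs (S.injective_of_invariants_mem H h)
  obtain ⟨f, hf⟩ := geometric_hahn_banach_open_point H.convex H.isOpen_domain hxD
  set a := f (1, 0) with ha
  set b := f (0, 1) with hb
  have hfd : ∀ d : R2, f d = a * d.1 + b * d.2 := by
    intro d
    have h1 : d = d.1 • (1, 0) + d.2 • (0, 1) := by ext <;> simp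
    nth_rw 1 [h1]
    rw [map_add, map_smul, map_smul, smul_eq_mul, smul_eq_mul, mul_comm, mul_comm d.2]
  have hmax : ∀ y, f (‖μ y‖, ν y) ≤ f (‖μ x‖, ν x) := fun y =>
    closure_minimal (s := D) (t := {d | f d ≤ f (‖μ x‖, ν x)}) (fun d hd => (hf d hd).le)
      (isClosed_le f.continuous continuous_const) (S.invariants_mem_closure H y)
  have hb0 : b = 0 := by
    set e := ch x with he
    have hex : e.symm (e x) = x := e.left_inv (mem_chart_source E7 x)
    have h3 : HasFDerivAt (fun v : E3 => ‖v‖)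
        (fderiv ℝ (fun v : E3 => ‖v‖) (μ (e.symm (e x)))) (μ (e.symm (e x))) := by
      rw [hex]
      exact ((contDiffAt_norm ℝ hμ).differentiableAt (by simp : (1 : ℕ∞ω) ≠ 0)).hasFDerivAt
    have h4 := ((h3.comp (e x) (hasFDerivAt_mu_chart S.mu x)).const_mul a).add
      ((hasFDerivAt_nu_chart S.nu x).const_mul b)
    have h5 : IsLocalMax (fun y => a * ‖μ (e.symm y)‖ + b * ν (e.symm y)) (e x) := by
      refine .of_forall fun y => ?_
      have := hmax (e.symm y)
      rw [hfd, hfd] at this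
      change a * ‖μ (e.symm y)‖ + b * ν (e.symm y)
        ≤ a * ‖μ (e.symm (e x))‖ + b * ν (e.symm (e x))
      rw [hex]
      exact this
    have h6 := DFunLike.congr_fun (h5.hasFDerivAt_eq_zero h4) (φ.Xf x)
    have h7 : a * fderiv ℝ (fun v : E3 => ‖v‖) (μ (e.symm (e x)))
        (dmu μ x (φ.Xf x)) + b * dnu ν x (φ.Xf x) = 0 := h6
    rw [S.dmu_of_mem_Kd (φ.Xf_mem_Kd x), map_zero, mul_zero, zero_add] at h7
    exact (mul_eq_zero.1 h7).resolve_right (S.dnu_Xf hx)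
  refine ⟨?_, ?_⟩
  · rcases lt_trichotomy a 0 with h | h | h
    · refine Or.inr fun y => (mul_le_mul_left_of_neg h).1 ?_
      simpa [hfd, hb0] using hmax y
    · obtain ⟨y, hy⟩ := S.exists_injective
      have h1 := hf _ (H.mem y hy)
      simp [hfd, hb0, h] at h1
    · refine Or.inl fun y => le_of_mul_le_mul_left ?_ h
      simpa [hfd, hb0] using hmax y
  · rintro ⟨d, hd, hdr⟩
    have h1 := hf d hd
    simp [hfd, hb0, hdr] at h1

lemma eventually_norm_mu_eq (x : M) : ∀ᶠ y in 𝓝 x, Uind y →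
    ¬ Injective (infAct y) → ‖μ y‖ = ‖μ x‖ := by
  set T : Set ℝ := {t | t = 0 ∨ IsGreatest (range fun y => ‖μ y‖) t ∨
    IsLeast (range fun y => ‖μ y‖) t}
  have hT : T.Finite := by
    refine (finite_singleton (0 : ℝ)).union ((Set.Subsingleton.finite ?_).union
      (Set.Subsingleton.finite ?_))
    · exact fun t ht t' ht' => IsGreatest.unique ht ht'
    · exact fun t ht t' ht' => IsLeast.unique ht ht'
  have h1 : (T \ {‖μ x‖})ᶜ ∈ 𝓝 ‖μ x‖ :=
    (hT.subset sdiff_subset).isClosed.isOpen_compl.mem_nhds fun h => h.2 rfl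
  filter_upwards [S.mu.smooth.continuous.norm.continuousAt.eventually h1] with y hy hU hs
  by_contra hne
  refine hy ⟨?_, hne⟩
  by_cases h0 : μ y = 0
  · exact Or.inl (by rw [h0, norm_zero])
  · rcases (S.norm_mu_extremal H hU hs h0).1 with h | h
    · exact Or.inr (Or.inl ⟨⟨y, rfl⟩, by rintro _ ⟨z, rfl⟩; exact h z⟩)
    · exact Or.inr (Or.inr ⟨⟨y, rfl⟩, by rintro _ ⟨z, rfl⟩; exact h z⟩)

end MultiMoment

/-- If `G` vanishes on the image of a curved copy `Y` of `K` and `K` contains the kernel of the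
derivative, then the zero set of `G` is locally the image of `Y`. -/
lemma eventually_mem_image_of_eq_zero {F : Type*} [NormedAddCommGroup F] [NormedSpace ℝ F]
    [FiniteDimensional ℝ F]
    {G : E7 → F} {G' : E7 →L[ℝ] F} {p : E7} (hG : HasStrictFDerivAt G G' p)
    {K : Submodule ℝ E7} (hK : ∀ w, G' w = 0 → w ∈ K) {Y : E7 → E7}
    (hY : HasStrictFDerivAt Y (.id ℝ E7) 0) (hY0 : Y 0 = p)
    (hGY : ∀ᶠ w in 𝓝 0, w ∈ K → G (Y w) = 0) {s : Set E7} (hs : s ∈ 𝓝 0) :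
    ∀ᶠ y in 𝓝 p, G y = 0 → ∃ w ∈ s, w ∈ K ∧ y = Y w := by
  set P : E7 →L[ℝ] K := K.orthogonalProjectionOnto
  have hPK : ∀ w (hw : w ∈ K), P w = ⟨w, hw⟩ := fun w hw =>
    K.orthogonalProjectionOnto_mem_subspace_eq_self ⟨w, hw⟩
  have h1 : HasStrictFDerivAt (fun y => (G y, P y)) (G'.prod P) p := hG.prodMk P.hasStrictFDerivAt
  have h2 : ker ((G'.prod P : E7 →L[ℝ] F × K) : E7 →ₗ[ℝ] F × K) = ⊥ := by
    rw [LinearMap.ker_eq_bot']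
    intro w hw
    obtain ⟨h3, h4⟩ := Prod.mk.inj (show (G' w, P w) = (0, 0) from hw)
    rw [hPK w (hK w h3)] at h4
    exact congrArg Subtype.val h4
  obtain ⟨L, hL⟩ := LinearMap.exists_leftInverse_of_injective _ h2
  set L' : F × K →L[ℝ] E7 := toContinuousLinearMap L
  have h3 : HasStrictFDerivAt (fun y => L' (G y, P y))
      ((ContinuousLinearEquiv.refl ℝ E7 : E7 ≃L[ℝ] E7) : L7) p := by
    refine (L'.hasStrictFDerivAt.comp p h1).congr_fderiv ?_
    ext1 w
    exact congrArg (fun f : E7 →ₗ[ℝ] E7 => f w) hL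
  set h := h3.toOpenPartialHomeomorph
  have hN : h.source ∈ 𝓝 p := h.open_source.mem_nhds h3.mem_toOpenPartialHomeomorph_source
  have hYK : HasStrictFDerivAt (fun w : K => P (Y w)) (.id ℝ K) 0 := by
    refine (P.hasStrictFDerivAt.comp (0 : K) (HasStrictFDerivAt.comp (0 : K) (g := Y) (f := K.subtypeL)
      hY K.subtypeL.hasStrictFDerivAt)).congr_fderiv ?_
    ext1 w
    exact hPK w w.2
  have hmap : Filter.map (fun w : K => P (Y w)) (𝓝 0) = 𝓝 (P p) := by
    rw [hYK.map_nhds_eq_of_surj (LinearMap.range_eq_top.2 fun w => ⟨w, rfl⟩)]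
    simp only [ZeroMemClass.coe_zero, hY0]
  have hT : {w : E7 | w ∈ s ∧ Y w ∈ h.source ∧ (w ∈ K → G (Y w) = 0)} ∈ 𝓝 (0 : E7) := by
    refine inter_mem hs (inter_mem (hY.continuousAt.preimage_mem_nhds ?_) hGY)
    rwa [hY0]
  have hT' : (fun w : K => P (Y w)) '' (Subtype.val ⁻¹'
      {w : E7 | w ∈ s ∧ Y w ∈ h.source ∧ (w ∈ K → G (Y w) = 0)}) ∈ 𝓝 (P p) := by
    rw [← hmap]
    exact Filter.image_mem_map (continuous_subtype_val.continuousAt.preimage_mem_nhds hT)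
  filter_upwards [P.continuous.continuousAt.preimage_mem_nhds hT', hN] with y ⟨w, hw, hwy⟩ hyN hy0
  refine ⟨w, hw.1, w.2, h.injOn hyN hw.2.1 ?_⟩
  change L' (G y, P y) = L' (G (Y w), P (Y w))
  rw [hy0, hw.2.2 w.2, show P (Y w) = P y from hwy]

namespace MultiMoment

include S
variable (H : HorizontalSlice φ μ ν {x : M | Injective (infAct x)} D σ)
include H

lemma eventually_mem_singularLeaf {n : R3} (hn : n ≠ 0) {r : ℝ}
    (hx : x ∈ singularLeaf μ r n) :
    ∀ᶠ y in 𝓝 x, (∃ θ, infAct y (θ, n) = 0) → y ∈ singularLeaf μ r n := by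
  have h1 : ∀ᶠ y in 𝓝 x, μ x ≠ 0 → ‖μ y - μ x‖ < ‖μ x‖ := by
    by_cases h0 : μ x = 0
    · exact .of_forall fun y h => absurd h0 h
    · have h2 : Tendsto (fun y => ‖μ y - μ x‖) (𝓝 x) (𝓝 ‖μ x - μ x‖) :=
        (S.mu.smooth.continuous.sub continuous_const).norm.continuousAt
      rw [sub_self, norm_zero] at h2
      exact (h2.eventually_lt_const (norm_pos_iff.2 h0)).mono fun y hy _ => hy
  filter_upwards [S.eventually_norm_mu_eq H x, S.isOpen_Uind.mem_nhds hx.1, h1]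
    with y hy hyU hyμ ⟨θ, hθ⟩
  refine ⟨hyU, ?_, θ, hθ⟩
  have h2 := hy hyU fun hinj => hn (congrArg snd (hinj (hθ.trans (map_zero _).symm)))
  obtain ⟨c, hc⟩ := exists_smul_of_cross_eq_zero hn (S.cross_mu_of_isotropy hθ)
  have hx2 : μ x = r • WithLp.toLp 2 n := by ext i; exact congrFun hx.2.1 i
  have hy2 : μ y = c • WithLp.toLp 2 n := by ext i; exact congrFun hc i
  have hn0 : ‖(WithLp.toLp 2 n : E3)‖ ≠ 0 := fun h => hn (congrArg WithLp.ofLp (norm_eq_zero.1 h))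
  rw [hx2, hy2, norm_smul, norm_smul, mul_left_inj' hn0, Real.norm_eq_abs, Real.norm_eq_abs,
    abs_eq_abs] at h2
  rw [hc]
  rcases h2 with rfl | rfl
  · rfl
  · by_cases h0 : μ x = 0
    · rw [hx2] at h0
      rw [neg_smul, ← hx.2.1, hx2, h0, WithLp.ofLp_zero, neg_zero]
    · have h3 := hyμ h0
      rw [hy2, neg_smul, ← hx2, ← norm_neg, neg_sub, sub_neg_eq_add, ← two_smul ℝ, norm_smul] at h3
      have := norm_nonneg (μ x)
      norm_num at h3
      linarith

lemma isAssociativeSubmanifold_singularLeaf {n : R3} (hn : n ≠ 0) (r : ℝ) :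
    φ.IsAssociativeSubmanifold (singularLeaf μ r n : Set M) := by
  intro x hx
  obtain ⟨hU, hxμ, θ, hθ⟩ := id hx
  set e := ch x with he
  have hex : e.symm (e x) = x := e.left_inv (mem_chart_source E7 x)
  have hxt : e x ∈ e.target := mem_chart_target E7 x
  have hv0 : ((θ, n) : LieT) ≠ 0 := fun h => hn (congrArg snd h)
  have hfin : finrank ℝ (φ.Kd x)ᗮ = 4 := by
    have h1 := (φ.Kd x).finrank_add_finrank_orthogonal
    rw [φ.finrank_Kd hU, finrank_euclideanSpace_fin] at h1
    omega
  set z := Module.finBasisOfFinrankEq ℝ (φ.Kd x)ᗮ hfin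
  set F : E7 → Fin 4 → ℝ := fun y i =>
    n ⬝ᵥ (fderiv ℝ (fun y => μ (e.symm y)) y (z i : E7)).ofLp with hF
  have hFs : ContDiffOn ℝ ∞ F e.target := contDiffOn_pi.2 fun i y hy =>
    (S.contDiffAt_dot_fderiv_mu x hy n (z i)).contDiffWithinAt
  have hFd : ∀ i w, fderiv ℝ F (e x) w i = φ.om x (lin x (θ, n) w) (z i) := by
    intro i w
    have h1 := (hFs.contDiffAt (e.open_target.mem_nhds hxt)).differentiableAt (by simp)
    have h2 := (hasFDerivAt_pi'.1 h1.hasFDerivAt i).unique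
      (S.hasFDerivAt_dot_fderiv_mu hθ (z i : E7))
    exact DFunLike.congr_fun h2 w
  have hk : ∀ w, fderiv ℝ F (e x) w = 0 ↔ w ∈ φ.Kd x := by
    intro w
    constructor
    · intro h
      refine S.om_lin_eq_zero hU hθ hv0 fun u => ?_
      obtain ⟨a, ha, b, hb, rfl⟩ := (φ.Kd x).exists_add_mem_mem_orthogonal u
      rw [map_add, φ.om_of_mem_Kd_right ha, zero_add]
      have h1 : ∀ b : (φ.Kd x)ᗮ, φ.om x (lin x (θ, n) w) b = 0 := by
        have h2 : (φ.om x (lin x (θ, n) w)).comp (φ.Kd x)ᗮ.subtype = 0 := z.ext fun i => by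
            rw [LinearMap.zero_apply, LinearMap.comp_apply, Submodule.subtype_apply, ← hFd, h]
            rfl
        exact fun b => congrArg (fun f : (φ.Kd x)ᗮ →ₗ[ℝ] ℝ => f b) h2
      exact h1 ⟨b, hb⟩
    · intro h
      ext i
      rw [hFd, (S.lin_eq_zero_iff hU hθ hv0 w).2 h, map_zero, LinearMap.zero_apply]
      rfl
  have hleaf : ∀ y ∈ e.target, (∃ θ', infAct (e.symm y) (θ', n) = 0) → F y = 0 := by
    rintro y hy ⟨θ', h⟩
    ext i
    rw [← cI_eq_zero_iff S.act x (e.map_target hy), ← he, e.right_inv hy] at h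
    have := S.dot_fderiv_mu x hy (θ', n) (z i)
    rw [h, omC_zero] at this
    exact this
  obtain ⟨Y, hY, hY0, hYz⟩ := exists_zeros_of_lin_eq_zero S.act hθ
  have hFst : HasStrictFDerivAt F (fderiv ℝ F (e x)) (e x) :=
    (hFs.contDiffAt (e.open_target.mem_nhds hxt)).hasStrictFDerivAt (by simp)
  have hes : Tendsto (fun w => e.symm (Y w)) (𝓝 0) (𝓝 x) := by
    have h1 : ContinuousAt e.symm (Y 0) := by rw [hY0]; exact e.continuousAt_symm hxt
    have h2 := ContinuousAt.comp (f := Y) (g := e.symm) h1 hY.continuousAt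
    rw [ContinuousAt, Function.comp_apply, hY0, hex] at h2
    exact h2
  have hYt : ∀ᶠ w in 𝓝 0, Y w ∈ e.target := hY.continuousAt.eventually
    (by rw [hY0]; exact e.open_target.mem_nhds hxt)
  have hYl : ∀ᶠ w in 𝓝 0, w ∈ φ.Kd x → ∃ θ', infAct (e.symm (Y w)) (θ', n) = 0 := by
    filter_upwards [hYz] with w hw hwK
    exact ⟨θ, hw ((S.lin_eq_zero_iff hU hθ hv0 w).2 hwK)⟩
  have hs : ∀ᶠ w in 𝓝 0, w ∈ φ.Kd x → e.symm (Y w) ∈ singularLeaf μ r n := by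
    filter_upwards [hes.eventually (S.eventually_mem_singularLeaf H hn hx), hYl] with w h1 h2 h3
    exact h1 (h2 h3)
  have hev := eventually_mem_image_of_eq_zero hFst (fun w => (hk w).1) hY hY0
    (by filter_upwards [hYt, hYl] with w h1 h2 h3; exact hleaf _ h1 (h2 h3)) hs
  obtain ⟨W, hW, hWo, hxW⟩ := eventually_nhds_iff.1 hev
  refine φ.exists_adapted_chart hU (hWo.inter e.open_target) ⟨hxW, hxt⟩
    (hFs.mono inter_subset_right) hk fun y hy hyW => ?_
  constructor
  · rintro ⟨-, -, h⟩
    exact hleaf _ hyW.2 (by rwa [e.left_inv hy])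
  · intro h
    obtain ⟨w, hw, hwK, hyw⟩ := hW _ hyW.1 h
    have h1 : e.symm (Y w) ∈ singularLeaf μ r n := hw hwK
    rwa [← hyw, e.left_inv hy] at h1

lemma isPossiblySingularAssociative_singularFibre {n : R3} (hn : n ≠ 0) (r : ℝ) :
    φ.IsPossiblySingularAssociative (singularFibre μ r n : Set M) := by
  refine ⟨{x | Uind x}, S.isOpen_Uind, ?_, ?_, fun x => ?_⟩
  · rw [singularFibre_inter]
    rintro x (h | h)
    exacts [subset_closure h, h.2]
  · rw [singularFibre_inter]
    exact S.isAssociativeSubmanifold_singularLeaf H hn r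
  · refine MeasureTheory.measure_mono_null (image_mono (inter_subset_inter_right _ ?_))
      (S.hausdorffMeasure_not_Uind hn x)
    rintro y ⟨h | h, hyU⟩
    exacts [absurd h.1 hyU, h.1]

end MultiMoment

/-! ### Inductive dimension of locally Euclidean spaces -/

section InductiveDimension

open TopologicalSpace

lemma HasSmallInductiveDimensionLT.of_isInducing {X Y : Type} [TopologicalSpace X]
    [TopologicalSpace Y] {n : ℕ} (hY : HasSmallInductiveDimensionLT Y n) {f : X → Y}
    (hf : IsInducing f) : HasSmallInductiveDimensionLT X n := by
  induction n generalizing X Y with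
  | zero =>
    rw [hasSmallInductiveDimensionLT_zero_iff] at hY ⊢
    exact Function.isEmpty f
  | succ n ih =>
    cases hY with | succ _ s hs h =>
    refine .succ n _ (IsTopologicalBasis.isInducing hf hs) ?_
    rintro _ ⟨U, hU, rfl⟩
    exact ih (h U hU) ((hf.comp IsInducing.subtypeVal).codRestrict fun y =>
      hf.continuous.frontier_preimage_subset U y.2)

lemma HasSmallInductiveDimensionLT.of_isOpenEmbedding {X : Type} [TopologicalSpace X]
    [RegularSpace X] {n : ℕ}
    (h : ∀ x : X, ∃ (Z : Type) (_ : TopologicalSpace Z) (f : Z → X), IsOpenEmbedding f ∧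
      x ∈ range f ∧ HasSmallInductiveDimensionLT Z (n + 1)) :
    HasSmallInductiveDimensionLT X (n + 1) := by
  refine .succ n {V | IsOpen V ∧ HasSmallInductiveDimensionLT (frontier V) n}
    (isTopologicalBasis_of_isOpen_of_nhds (fun V hV => hV.1) fun x W hx hW => ?_)
    fun V hV => hV.2
  obtain ⟨Z, _, f, hf, ⟨z, rfl⟩, hZ⟩ := h x
  cases hZ with | succ _ s hs hfr =>
  obtain ⟨C, hC, hCc, hCW⟩ := exists_mem_nhds_isClosed_subset
    (inter_mem (hW.mem_nhds hx) (hf.isOpen_range.mem_nhds ⟨z, rfl⟩))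
  obtain ⟨V, hV, hzV, hVC⟩ := hs.mem_nhds_iff.1 (hf.continuous.continuousAt.preimage_mem_nhds hC)
  have hVC' : closure (f '' V) ⊆ C := closure_minimal (image_subset_iff.2 hVC) hCc
  have hVo : IsOpen (f '' V) := hf.isOpenMap V (hs.isOpen hV)
  refine ⟨f '' V, ⟨hVo, ?_⟩, ⟨z, hzV, rfl⟩,
    (subset_closure.trans hVC').trans (hCW.trans inter_subset_left)⟩
  have hsub : frontier (f '' V) ⊆ f '' frontier V := by
    intro y hy
    obtain ⟨w, rfl⟩ := (hCW (hVC' hy.1)).2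
    refine ⟨w, ?_, rfl⟩
    have : w ∈ f ⁻¹' frontier (f '' V) := hy
    rwa [hf.isOpenMap.preimage_frontier_eq_frontier_preimage hf.continuous,
      preimage_image_eq _ hf.injective] at this
  have h1 : HasSmallInductiveDimensionLT (f '' frontier V) n := (hfr V hV).of_isInducing
      (hf.isEmbedding.homeomorphImage (frontier V)).symm.isInducing
  exact h1.of_isInducing (IsInducing.subtypeVal.codRestrict fun y => hsub y.2)

lemma hasSmallInductiveDimensionLT_of_chartedSpace {n : ℕ}
    (hE : HasSmallInductiveDimensionLT (EuclideanSpace ℝ (Fin n)) (n + 1))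
    (X : Type) [TopologicalSpace X] [RegularSpace X] [ChartedSpace (EuclideanSpace ℝ (Fin n)) X] :
    HasSmallInductiveDimensionLT X (n + 1) :=
  .of_isOpenEmbedding fun x =>
    ⟨(chartAt (EuclideanSpace ℝ (Fin n)) x).source, inferInstance, Subtype.val,
      (chartAt (EuclideanSpace ℝ (Fin n)) x).open_source.isOpenEmbedding_subtypeVal,
      by rw [Subtype.range_coe]; exact mem_chart_source _ x,
      hE.of_isInducing (chartAt (EuclideanSpace ℝ (Fin n)) x).isOpenEmbedding_restrict.isInducing⟩

lemma hasSmallInductiveDimensionLT_euclideanSpace (n : ℕ) :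
    HasSmallInductiveDimensionLT (EuclideanSpace ℝ (Fin n)) (n + 1) := by
  have hbasis : ∀ n, IsTopologicalBasis {U : Set (EuclideanSpace ℝ (Fin n)) |
      ∃ x r, 0 < r ∧ U = ball x r} := fun n =>
    isTopologicalBasis_of_isOpen_of_nhds
      (by rintro _ ⟨x, r, -, rfl⟩; exact Metric.isOpen_ball)
      fun x W hx hW => by
        obtain ⟨r, hr, h⟩ := Metric.isOpen_iff.1 hW x hx
        exact ⟨_, ⟨x, r, hr, rfl⟩, Metric.mem_ball_self hr, h⟩
  induction n with
  | zero =>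
    refine .succ 0 _ (hbasis 0) ?_
    rintro _ ⟨x, r, hr, rfl⟩
    rw [hasSmallInductiveDimensionLT_zero_iff]
    refine ⟨fun y => ?_⟩
    have h1 := Metric.frontier_ball_subset_sphere y.2
    rw [Subsingleton.elim (y : EuclideanSpace ℝ (Fin 0)) x, Metric.mem_sphere, dist_self] at h1
    exact hr.ne h1
  | succ n ih =>
    refine .succ (n + 1) _ (hbasis (n + 1)) ?_
    rintro _ ⟨x, r, hr, rfl⟩
    haveI : Fact (finrank ℝ (EuclideanSpace ℝ (Fin (n + 1))) = n + 1) :=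
      ⟨finrank_euclideanSpace_fin⟩
    have h1 := hasSmallInductiveDimensionLT_of_chartedSpace ih
      (Metric.sphere (0 : EuclideanSpace ℝ (Fin (n + 1))) 1)
    let g : EuclideanSpace ℝ (Fin (n + 1)) ≃ₜ EuclideanSpace ℝ (Fin (n + 1)) :=
      (Homeomorph.addRight (-x)).trans (Homeomorph.smulOfNeZero r⁻¹ (inv_ne_zero hr.ne'))
    have hg : ∀ y ∈ frontier (ball x r),
        g y ∈ Metric.sphere (0 : EuclideanSpace ℝ (Fin (n + 1))) 1 := by
      intro y hy
      have h2 := Metric.frontier_ball_subset_sphere hy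
      rw [Metric.mem_sphere, dist_eq_norm] at h2
      rw [mem_sphere_zero_iff_norm]
      change ‖r⁻¹ • (y + -x)‖ = 1
      rw [← sub_eq_add_neg, norm_smul, h2, norm_inv, Real.norm_of_nonneg hr.le,
        inv_mul_cancel₀ hr.ne']
    exact h1.of_isInducing ((g.isInducing.comp IsInducing.subtypeVal).codRestrict
      fun y => hg y y.2)

end InductiveDimension

/-! ### The family of associatives -/

/-- The members of the fibration: regular ones over the values of `|μ|` on principal orbits and
singular ones over the other values. -/
def fibration (μ : M → E3) (ν : M → ℝ) (D : Set R2) (σ : R2 → M)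
    (b : range (fun x => ‖μ x‖) × GSU2 M) : Set M :=
  {x | (b.1 : ℝ) ∈ fst '' D ∧ Injective (infAct x) ∧ ‖μ x‖ = b.1 ∧ fibProj μ ν σ x = b.2} ∪
  {x | (b.1 : ℝ) ∉ fst '' D ∧ x ∈ singularFibre μ b.1 (rot b.2.out (single 0 1))}

lemma exists_openPartialHomeomorph_mk {T : Set SU2} (hT : IsOpen T)
    (hinj : InjOn (fun s : SU2 => (s : GSU2 M)) T) :
    ∃ κ : OpenPartialHomeomorph SU2 (GSU2 M), κ.source = T ∧
      (κ : SU2 → GSU2 M) = fun s : SU2 => (s : GSU2 M) :=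
  ⟨.ofContinuousOpen (hinj.bijOn_image.toPartialEquiv _ _ _)
    (QuotientGroup.continuous_mk).continuousOn QuotientGroup.isOpenMap_coe hT, rfl, rfl⟩

lemma exists_smul_rot {n : R3} (hn : n ≠ 0) :
    ∃ (s : SU2) (c : ℝ), 0 < c ∧ n = c • rot s (single 0 1) ∧ c = ‖(WithLp.toLp 2 n : E3)‖ := by
  obtain ⟨s, hs⟩ := exists_rot_eq (WithLp.toLp 2 n)
  refine ⟨s⁻¹, _, norm_pos_iff.2 fun h => hn (congrArg WithLp.ofLp h), ?_, rfl⟩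
  rw [← rot_smul, ← hs, rot_inv_rot]

lemma rot_single_ne_zero (s : SU2) : rot s (single 0 1) ≠ 0 := by
  intro h
  have h1 := rot_inv_rot s (single 0 1)
  rw [h, rot_zero] at h1
  have := congrFun h1 0
  simp at this

lemma fibration_of_mem {D : Set R2} {σ : R2 → M}
    {b : range (fun x => ‖μ x‖) × GSU2 M} (hb : (b.1 : ℝ) ∈ fst '' D) :
    fibration μ ν D σ b = {x ∈ {x : M | Injective (infAct x)} |
      ‖μ x‖ = b.1 ∧ fibProj μ ν σ x = b.2} := by
  ext x
  simp [fibration, hb]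

lemma fibration_of_notMem {D : Set R2} {σ : R2 → M}
    {b : range (fun x => ‖μ x‖) × GSU2 M}
    (hb : (b.1 : ℝ) ∉ fst '' D) :
    fibration μ ν D σ b = singularFibre μ b.1 (rot b.2.out (single 0 1)) := by
  ext x
  simp [fibration, hb]

namespace MultiMoment

include S

lemma mu_eq_zero_of_not_Uind (h : ¬ Uind x) : μ x = 0 := by
  have h1 : ∀ a b : TangentSpace I7 x, φ.star x ![genU 0 x, genU 1 x, a, b] = 0 := by
    intro a b
    refine (φ.star x).toAlternatingMap.map_linearDependent _ fun hl => h ?_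
    have h2 := hl.comp ![0, 1] (by decide)
    have h3 : (![genU 0 x, genU 1 x, a, b] ∘ ![0, 1] : Fin 2 → TangentSpace I7 x) =
        ![infAct x (tv 0), infAct x (tv 1)] := by
      funext i
      fin_cases i
      · exact genU_eq S.act 0 x
      · exact genU_eq S.act 1 x
    rw [h3] at h2
    exact h2
  ext k
  rw [S.mu.normalised x k, h1, neg_zero]
  rfl

lemma finite_gammaTwo : (gammaTwo M : Set SU2).Finite := by
  refine ((finite_singleton (1 : SU2)).union (t := {s : SU2 | (s : ℍ) = -1})
    (Set.Subsingleton.finite fun s hs t ht => Subtype.ext ?_)).subset fun s hs =>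
      eq_one_or_neg_one_of_rot fun a => rot_of_mem_gammaTwo S hs a
  rw [show (s : ℍ) = -1 from hs, show (t : ℍ) = -1 from ht]

lemma normal_gammaTwo : (gammaTwo M).Normal := by
  refine ⟨fun s hs t => ?_⟩
  have h : t * s = s * t := by
    rcases eq_one_or_neg_one_of_rot fun a => rot_of_mem_gammaTwo S hs a with rfl | h
    · rw [mul_one, one_mul]
    · apply Subtype.ext
      change (t : ℍ) * (s : ℍ) = (s : ℍ) * (t : ℍ)
      rw [h, mul_neg, neg_mul, mul_one, one_mul]
  rwa [h, mul_inv_cancel_right]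

lemma t3Space_GSU2 : T3Space (GSU2 M) := by
  have := S.normal_gammaTwo
  have : IsClosed (gammaTwo M : Set SU2) := S.finite_gammaTwo.isClosed
  infer_instance

lemma rot_out (s : SU2) (a : R3) : rot (s : GSU2 M).out a = rot s a := by
  have h : s⁻¹ * (s : GSU2 M).out ∈ gammaTwo M :=
    QuotientGroup.eq.1 (QuotientGroup.out_eq' (s : GSU2 M)).symm
  have h1 := rot_of_mem_gammaTwo S h a
  nth_rw 2 [← h1]
  rw [← rot_mul, mul_inv_cancel_left]

lemma hasSmallInductiveDimensionLE_base (T : Set ℝ) :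
    HasSmallInductiveDimensionLE (T × GSU2 M) 4 := by
  have := S.t3Space_GSU2
  refine .of_isOpenEmbedding fun x => ?_
  obtain ⟨s, hs⟩ := QuotientGroup.mk_surjective x.2
  have hinj : InjOn (fun s : SU2 => (s : GSU2 M)) (halfSphere s) := fun a ha b hb hab =>
    eq_of_mem_halfSphere ha hb fun c => rot_of_mem_gammaTwo S (QuotientGroup.eq.1 hab) c
  obtain ⟨κ, hκ, hκs⟩ := exists_openPartialHomeomorph_mk (isOpen_halfSphere s) hinj
  set e := κ.symm.trans (chartAt E3 s)
  have hsκ : s ∈ κ.source := by rw [hκ]; exact self_mem_halfSphere s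
  have hκx : κ s = x.2 := by rw [hκs]; exact hs
  have hx : x.2 ∈ e.source := by
    rw [← hκx, OpenPartialHomeomorph.trans_source]
    refine ⟨κ.map_source hsκ, ?_⟩
    rw [mem_preimage, κ.left_inv hsκ]
    exact mem_chart_source _ s
  refine ⟨T × e.source, inferInstance, Prod.map id Subtype.val,
    IsOpenEmbedding.id.prodMap e.open_source.isOpenEmbedding_subtypeVal, ⟨(x.1, ⟨x.2, hx⟩), rfl⟩,
    ?_⟩
  have hL : finrank ℝ (ℝ × E3) = finrank ℝ (EuclideanSpace ℝ (Fin 4)) := by simp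
  exact (hasSmallInductiveDimensionLT_euclideanSpace 4).of_isInducing
    ((ContinuousLinearEquiv.ofFinrankEq hL).toHomeomorph.isInducing.comp
      (IsInducing.subtypeVal.prodMap e.isOpenEmbedding_restrict.isInducing))

variable (H : HorizontalSlice φ μ ν {x : M | Injective (infAct x)} D σ)
include H

lemma exists_mem_singularFibre (hx : ¬ Injective (infAct x)) :
    ‖μ x‖ ∉ fst '' D ∧ ∃ s : SU2, x ∈ singularFibre μ ‖μ x‖ (rot s (single 0 1)) := by
  have hpos : (0 : ℝ) ∉ fst '' D := by
    rintro ⟨d, hd, h⟩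
    exact (H.slice.pos d hd).ne' h
  have hscale : ∀ (y : M) (θ : Fin 2 → ℝ) (n : R3) (c : ℝ), 0 < c →
      infAct y (θ, c • n) = 0 → infAct y (c⁻¹ • θ, n) = 0 := by
    intro y θ n c hc h
    have h1 : ((c⁻¹ • θ, n) : LieT) = c⁻¹ • (θ, c • n) := by
      rw [Prod.smul_mk, inv_smul_smul₀ hc.ne']
    rw [h1, map_smul, h, smul_zero]
  by_cases hU : Uind x
  · by_cases hμ : μ x = 0
    · obtain ⟨⟨θ, n⟩, hv, hn⟩ := exists_isotropy hU hx
      obtain ⟨s, c, hc, rfl, -⟩ := exists_smul_rot hn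
      rw [hμ, norm_zero]
      refine ⟨hpos, s, Or.inl ⟨hU, ?_, _, hscale x θ _ c hc hv⟩⟩
      rw [hμ, zero_smul]; rfl
    · refine ⟨(S.norm_mu_extremal H hU hx hμ).2, ?_⟩
      obtain ⟨θ, hθ⟩ := S.exists_isotropy_mu hU hx
      obtain ⟨s, c, hc, hn, hcn⟩ := exists_smul_rot (n := (μ x).ofLp) fun h => hμ (by
        ext i; exact congrFun h i)
      have hcn' : c = ‖μ x‖ := hcn
      rw [hn] at hθ
      exact ⟨s, Or.inl ⟨hU, by rw [← hcn']; exact hn, _, hscale x θ _ c hc hθ⟩⟩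
  · have hμ := S.mu_eq_zero_of_not_Uind hU
    rw [hμ, norm_zero]
    refine ⟨hpos, ?_⟩
    obtain ⟨η, hη, hη2⟩ := S.exists_isotropy_of_not_Uind hU
    obtain ⟨⟨θ, n⟩, hv, hn, hcl⟩ := S.mem_closure_of_not_Uind hU hη hη2
    obtain ⟨s, c, hc, hs, -⟩ := exists_smul_rot (n := n) (by rw [show n = η.2 from hn]; exact hη2)
    subst hs
    refine ⟨s, Or.inr ⟨⟨hU, _, hscale x θ _ c hc hv⟩, ?_⟩⟩
    rw [mem_closure_iff_frequently] at hcl ⊢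
    refine (hcl.and_eventually (S.eventually_norm_mu_eq H x)).mono ?_
    rintro y ⟨⟨hyU, hy⟩, hyμ⟩
    refine ⟨hyU, ?_, _, hscale y θ _ c hc hy⟩
    have hy0 : μ y = 0 := by
      rw [← norm_eq_zero, hyμ hyU fun hinj => rot_single_ne_zero s ?_, hμ, norm_zero]
      have h2 := congrArg snd (hinj (hy.trans (map_zero _).symm))
      exact (smul_eq_zero.1 (show c • rot s (single 0 1) = 0 from h2)).resolve_left hc.ne'
    rw [hy0, zero_smul]; rfl

lemma nonempty_fibration (b : range (fun x => ‖μ x‖) × GSU2 M) :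
    (fibration μ ν D σ b).Nonempty := by
  obtain ⟨⟨r, x, rfl⟩, h⟩ := b
  obtain ⟨s, rfl⟩ := QuotientGroup.mk_surjective h
  by_cases hb : ‖μ x‖ ∈ fst '' D
  · rw [fibration_of_mem hb]
    obtain ⟨d, hd, hdx⟩ := id hb
    refine ⟨((1, s) : T2SU2) • σ d, S.smul_slice_mem H hd _, ?_, S.fibProj_smul_slice H hd _⟩
    exact (congrArg fst (S.invariants_smul_slice H hd (1, s))).trans hdx
  · rw [fibration_of_notMem hb]
    obtain ⟨-, t, ht⟩ := S.exists_mem_singularFibre H fun hx => hb ⟨_, H.mem x hx, rfl⟩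
    have h1 := S.smul_mem_singularFibre (1, s * t⁻¹) ht
    rw [← rot_mul, inv_mul_cancel_right] at h1
    rw [S.rot_out]
    exact ⟨_, h1⟩

lemma isPossiblySingularAssociative_fibration (b : range (fun x => ‖μ x‖) × GSU2 M) :
    φ.IsPossiblySingularAssociative (fibration μ ν D σ b) := by
  by_cases hb : (b.1 : ℝ) ∈ fst '' D
  · rw [fibration_of_mem hb]
    refine ⟨univ, isOpen_univ, ?_, ?_, fun x => ?_⟩
    · rw [inter_univ]; exact subset_closure
    · rw [inter_univ]; exact S.isAssociativeSubmanifold_fibre H _ _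
    · simp
  · rw [fibration_of_notMem hb]
    exact S.isPossiblySingularAssociative_singularFibre H (rot_single_ne_zero _) _

lemma iUnion_fibration : ⋃ b, fibration μ ν D σ b = univ := by
  refine eq_univ_of_forall fun x => mem_iUnion.2 ?_
  by_cases hx : Injective (infAct x)
  · refine ⟨(⟨‖μ x‖, x, rfl⟩, fibProj μ ν σ x), ?_⟩
    rw [fibration_of_mem ⟨_, H.mem x hx, rfl⟩]
    exact ⟨hx, rfl, rfl⟩
  · obtain ⟨h1, s, hs⟩ := S.exists_mem_singularFibre H hx
    refine ⟨(⟨‖μ x‖, x, rfl⟩, (s : GSU2 M)), ?_⟩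
    rw [fibration_of_notMem h1, S.rot_out]
    exact hs

lemma smul_mem_fibration (b : range (fun x => ‖μ x‖) × GSU2 M) (t : Circle × Circle)
    (hx : x ∈ fibration μ ν D σ b) : ((t, 1) : T2SU2) • x ∈ fibration μ ν D σ b := by
  by_cases hb : (b.1 : ℝ) ∈ fst '' D
  · rw [fibration_of_mem hb] at hx ⊢
    obtain ⟨h1, h2, h3⟩ := hx
    have hμ : μ (((t, 1) : T2SU2) • x) = μ x := by
      ext i
      rw [mu_smul S.pres S.act S.mu, rot_one]
    obtain ⟨s, hs⟩ := QuotientGroup.mk_surjective b.2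
    rw [← hs] at h3 ⊢
    refine ⟨H.separated.smul _ _ h1, by rw [hμ, h2], ?_⟩
    rw [S.fibProj_smul H (t, 1) h1 h3, one_mul]
  · rw [fibration_of_notMem hb] at hx ⊢
    have := S.smul_mem_singularFibre (t, 1) hx
    rwa [rot_one] at this

lemma isOpen_dense_regular :
    IsOpen {r : range (fun x => ‖μ x‖) | (r : ℝ) ∈ fst '' D} ∧
      Dense {r : range (fun x => ‖μ x‖) | (r : ℝ) ∈ fst '' D} := by
  refine ⟨(isOpenMap_fst D H.isOpen_domain).preimage continuous_subtype_val, ?_⟩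
  have h1 : Continuous (rangeFactorization fun x => ‖μ x‖) :=
    S.mu.smooth.continuous.norm.subtype_mk _
  refine (rangeFactorization_surjective.denseRange.dense_image h1 S.dense_injective).mono ?_
  rintro _ ⟨x, hx, rfl⟩
  exact ⟨_, H.mem x hx, rfl⟩

end MultiMoment

/-! ### The bundle of regular associatives -/

lemma dense_re_ne_zero : Dense {s : SU2 | (s : ℍ).re ≠ 0} := by
  intro s
  by_cases hs : (s : ℍ).re = 0
  · have hn : Quaternion.normSq (s : ℍ) = 1 := by
      rw [normSq_eq_norm_mul_self, norm_eq_of_mem_sphere s, one_mul]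
    rw [normSq_def', hs] at hn
    have hu : ∀ t : ℝ, Real.cos t • (s : ℍ) + ((Real.sin t : ℝ) : ℍ) ∈ Metric.sphere (0 : ℍ) 1 := by
      intro t
      have h1 : Quaternion.normSq (Real.cos t • (s : ℍ) + ((Real.sin t : ℝ) : ℍ)) = 1 := by
        rw [normSq_def']
        simp only [Quaternion.re_add, Quaternion.imI_add, Quaternion.imJ_add, Quaternion.imK_add,
          Quaternion.re_smul, Quaternion.imI_smul, Quaternion.imJ_smul, Quaternion.imK_smul,
          Quaternion.re_coe, Quaternion.imI_coe, Quaternion.imJ_coe, Quaternion.imK_coe, hs,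
          smul_eq_mul]
        linear_combination (Real.cos t) ^ 2 * hn + Real.sin_sq_add_cos_sq t
      rw [normSq_eq_norm_mul_self] at h1
      rw [mem_sphere_zero_iff_norm]
      nlinarith [norm_nonneg (Real.cos t • (s : ℍ) + ((Real.sin t : ℝ) : ℍ))]
    have hcont : Continuous fun t : ℝ =>
        (⟨Real.cos t • (s : ℍ) + ((Real.sin t : ℝ) : ℍ), hu t⟩ : SU2) := by
      refine Continuous.subtype_mk ?_ _
      exact (Real.continuous_cos.smul continuous_const).add
        (Quaternion.continuous_coe.comp Real.continuous_sin)
    have h0 : Tendsto (fun t : ℝ =>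
        (⟨Real.cos t • (s : ℍ) + ((Real.sin t : ℝ) : ℍ), hu t⟩ : SU2)) (𝓝[>] 0) (𝓝 s) := by
      have h1 := hcont.tendsto 0
      have h2 : (⟨Real.cos 0 • (s : ℍ) + ((Real.sin 0 : ℝ) : ℍ), hu 0⟩ : SU2) = s := by
        apply Subtype.ext; simp
      rw [h2] at h1
      exact h1.mono_left nhdsWithin_le_nhds
    refine mem_closure_of_tendsto h0 ?_
    filter_upwards [Ioo_mem_nhdsGT Real.pi_pos] with t ht
    rw [Quaternion.re_add, Quaternion.re_smul, hs, smul_zero, zero_add, Quaternion.re_coe]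
    exact (Real.sin_pos_of_mem_Ioo ht).ne'
  · exact subset_closure hs

lemma exists_openPartialHomeomorph_val {R I : Set ℝ} (hI : IsOpen I) (hIR : I ⊆ R)
    (hne : I.Nonempty) : ∃ χ : OpenPartialHomeomorph R ℝ,
      χ.source = {r : R | (r : ℝ) ∈ I} ∧ χ.target = I ∧ (χ : R → ℝ) = Subtype.val := by
  classical
  obtain ⟨t₀, ht₀⟩ := hne
  refine ⟨{ toFun := Subtype.val
            invFun := fun t => if h : t ∈ I then ⟨t, hIR h⟩ else ⟨t₀, hIR ht₀⟩
            source := {r : R | (r : ℝ) ∈ I}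
            target := I
            map_source' := fun r hr => hr
            map_target' := fun t ht => by simp [ht]
            left_inv' := fun r hr => by
              apply Subtype.ext
              rw [dif_pos (show (r : ℝ) ∈ I from hr)]
            right_inv' := fun t ht => by simp [ht]
            open_source := hI.preimage continuous_subtype_val
            open_target := hI
            continuousOn_toFun := continuous_subtype_val.continuousOn
            continuousOn_invFun := ?_ }, rfl, rfl, rfl⟩
  rw [continuousOn_iff_continuous_domRestrict]
  refine (continuous_subtype_val.subtype_mk fun t : I => hIR t.2).congr fun t => ?_
  rw [domRestrict_apply, dif_pos t.2]

/-- A space with a global chart in `ℝ × SU(2)` is a `4`-manifold. -/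
lemma exists_chartedSpace_source {X : Type} [TopologicalSpace X]
    (Z : OpenPartialHomeomorph X (ℝ × SU2)) (s₀ : SU2)
    (hZ : Z.target ⊆ snd ⁻¹' (chartAt E3 s₀).source)
    (hne : Z.source.Nonempty) :
    ∃ _ : ChartedSpace (EuclideanSpace ℝ (Fin 4)) Z.source, IsManifold (𝓡 4) ∞ Z.source ∧
      ∃ c : ℝ × SU2 → Z.source, ContMDiff (𝓡 4) (𝓘(ℝ, ℝ).prod (𝓡 3)) ∞ (fun y : Z.source => Z y) ∧
        ContMDiffOn (𝓘(ℝ, ℝ).prod (𝓡 3)) (𝓡 4) ∞ c Z.target ∧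
        ∀ n ∈ Z.target, (c n : X) = Z.symm n := by
  have hL : finrank ℝ (ℝ × E3) = finrank ℝ (EuclideanSpace ℝ (Fin 4)) := by simp
  set L := ContinuousLinearEquiv.ofFinrankEq hL
  set ψ := chartAt E3 s₀
  set Ψ : OpenPartialHomeomorph (ℝ × SU2) (EuclideanSpace ℝ (Fin 4)) :=
    ((OpenPartialHomeomorph.refl ℝ).prod ψ).trans L.toHomeomorph.toOpenPartialHomeomorph with hΨ
  have hΨs : Z.target ⊆ Ψ.source := fun n hn => ⟨⟨mem_univ _, hZ hn⟩, mem_univ _⟩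
  have hfwd : ContMDiffOn (𝓘(ℝ, ℝ).prod (𝓡 3)) (𝓡 4) ∞ Ψ Ψ.source := by
    have h1 : ContMDiffOn (𝓘(ℝ, ℝ).prod (𝓡 3)) 𝓘(ℝ, ℝ × E3) ∞
        (fun q : ℝ × SU2 => (q.1, ψ q.2)) Ψ.source :=
      contMDiff_fst.contMDiffOn.prodMk_space
        ((contMDiffOn_chart (x := s₀)).comp contMDiff_snd.contMDiffOn fun q hq => hq.1.2)
    exact L.contDiff.contMDiff.comp_contMDiffOn h1
  have hbwd : ContMDiffOn (𝓡 4) (𝓘(ℝ, ℝ).prod (𝓡 3)) ∞ Ψ.symm Ψ.target := by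
    have h1 : ContMDiff (𝓡 4) 𝓘(ℝ, ℝ × E3) ∞ L.symm := L.symm.contDiff.contMDiff
    have h2 : ContMDiff (𝓡 4) 𝓘(ℝ, ℝ) ∞ fun e => (L.symm e).1 :=
      (ContinuousLinearMap.fst ℝ ℝ E3).contMDiff.comp h1
    have h3 : ContMDiff (𝓡 4) (𝓡 3) ∞ fun e => (L.symm e).2 :=
      (ContinuousLinearMap.snd ℝ ℝ E3).contMDiff.comp h1
    exact h2.contMDiffOn.prodMk
      ((contMDiffOn_chart_symm (x := s₀)).comp h3.contMDiffOn fun e he => he.2.2)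
  have hWs : (Z.trans Ψ).source = Z.source := by
    rw [OpenPartialHomeomorph.trans_source]
    exact inter_eq_left.2 fun x hx => hΨs (Z.map_source hx)
  have hf : IsOpenEmbedding fun y : Z.source => Ψ (Z y) :=
    (Z.trans Ψ).isOpenEmbedding_restrict.comp (Homeomorph.setCongr hWs.symm).isOpenEmbedding
  have : Nonempty Z.source := hne.to_subtype
  let _ := hf.singletonChartedSpace
  have hval : ∀ n (hn : n ∈ Z.target),
      (hf.toOpenPartialHomeomorph _).symm (Ψ n) = ⟨Z.symm n, Z.map_target hn⟩ := by
    intro n hn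
    have h1 := (hf.toOpenPartialHomeomorph _).left_inv
      (show (⟨Z.symm n, Z.map_target hn⟩ : Z.source) ∈ _ from mem_univ _)
    rw [IsOpenEmbedding.toOpenPartialHomeomorph_apply] at h1
    dsimp only at h1
    rwa [Z.right_inv hn] at h1
  refine ⟨inferInstance, hf.isManifold_singleton, fun n => (hf.toOpenPartialHomeomorph _).symm (Ψ n),
    ?_, ?_, fun n hn => congrArg Subtype.val (hval n hn)⟩
  · have h1 : ContMDiff (𝓡 4) (𝓡 4) ∞ fun y : Z.source => Ψ (Z y) := contMDiff_isOpenEmbedding hf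
    have h2 := hbwd.comp_contMDiff h1 fun y => Ψ.map_source (hΨs (Z.map_source y.2))
    refine h2.congr fun y => (Ψ.left_inv (hΨs (Z.map_source y.2))).symm
  · refine (contMDiffOn_isOpenEmbedding_symm hf).comp (hfwd.mono hΨs) fun n hn => ?_
    exact ⟨⟨Z.symm n, Z.map_target hn⟩, congrArg Ψ (Z.right_inv hn)⟩

namespace MultiMoment

include S

/-- A dense open subset of `G^{SU(2)}` with a single chart. -/
lemma exists_dense_chart : ∃ (κ : OpenPartialHomeomorph SU2 (GSU2 M)) (s₀ : SU2),
    (κ : SU2 → GSU2 M) = (fun s : SU2 => (s : GSU2 M)) ∧ Dense κ.target ∧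
      κ.source ⊆ (chartAt E3 s₀).source := by
  have hi : imQ (single 0 1) ∈ Metric.sphere (0 : ℍ) 1 := by
    have h1 : Quaternion.normSq (imQ (single 0 1)) = 1 := by
      rw [normSq_def']; simp [imQuaternion]
    rw [normSq_eq_norm_mul_self] at h1
    rw [mem_sphere_zero_iff_norm]
    nlinarith [norm_nonneg (imQ (single 0 1))]
  set s₀ : SU2 := ⟨_, hi⟩
  have hs₀ : {s : SU2 | (s : ℍ).re ≠ 0} ⊆ (chartAt E3 s₀).source := by
    intro s hs
    have h1 : (chartAt E3 s₀).source = {-s₀}ᶜ := stereographic'_source (-s₀)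
    rw [h1]
    rintro rfl
    refine hs ?_
    change (-imQ (single 0 1)).re = 0
    rw [Quaternion.re_neg]
    simp [imQuaternion]
  have hre : Continuous fun s : SU2 => (s : ℍ).re :=
    Quaternion.continuous_re.comp continuous_subtype_val
  have hdense : Dense ((fun s : SU2 => (s : GSU2 M)) '' {s : SU2 | (s : ℍ).re ≠ 0}) :=
    QuotientGroup.mk_surjective.denseRange.dense_image QuotientGroup.continuous_mk dense_re_ne_zero
  by_cases hΓ : ∃ s ∈ gammaTwo M, (s : ℍ) = -1
  · obtain ⟨z, hz, hz1⟩ := hΓ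
    obtain ⟨κ, hκ, hκs⟩ := exists_openPartialHomeomorph_mk (M := M)
      (T := {s : SU2 | 0 < (s : ℍ).re}) (isOpen_lt continuous_const hre) (by
        intro a ha b hb hab
        refine eq_of_mem_halfSphere (s₀ := 1) ?_ ?_
          fun c => rot_of_mem_gammaTwo S (QuotientGroup.eq.1 hab) c
        · change 0 < ((a : ℍ) * star ((1 : SU2) : ℍ)).re
          simpa using ha
        · change 0 < ((b : ℍ) * star ((1 : SU2) : ℍ)).re
          simpa using hb)
    refine ⟨κ, s₀, hκs, hdense.mono ?_, ?_⟩
    · rw [← κ.image_source_eq_target, hκ, hκs]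
      rintro _ ⟨s, hs, rfl⟩
      rcases lt_or_gt_of_ne hs with h | h
      · refine ⟨s * z, ?_, (QuotientGroup.mk_mul_of_mem s hz)⟩
        change 0 < ((s : ℍ) * (z : ℍ)).re
        rw [hz1, mul_neg, mul_one, Quaternion.re_neg]
        linarith
      · exact ⟨s, h, rfl⟩
    · rw [hκ]
      exact fun s hs => hs₀ (show (s : ℍ).re ≠ 0 from ne_of_gt hs)
  · obtain ⟨κ, hκ, hκs⟩ := exists_openPartialHomeomorph_mk (M := M)
      (T := {s : SU2 | (s : ℍ).re ≠ 0}) (isOpen_ne_fun hre continuous_const) (by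
        intro a ha b hb hab
        have h1 := QuotientGroup.eq.1 hab
        rcases eq_one_or_neg_one_of_rot fun c => rot_of_mem_gammaTwo S h1 c with h | h
        · exact inv_mul_eq_one.1 h
        · exact absurd ⟨_, h1, h⟩ hΓ)
    refine ⟨κ, s₀, hκs, ?_, by rw [hκ]; exact hs₀⟩
    rw [← κ.image_source_eq_target, hκ, hκs]
    exact hdense

variable (H : HorizontalSlice φ μ ν {x : M | Injective (infAct x)} D σ)
include H

lemma isOpen_fibProj_preimage {U : Set (GSU2 M)} (hU : IsOpen U) :
    IsOpen {x : M | Injective (infAct x) ∧ fibProj μ ν σ x ∈ U} := by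
  rw [isOpen_iff_mem_nhds]
  rintro x ⟨hx, hxU⟩
  obtain ⟨g, hg⟩ := S.exists_smul_slice H hx
  have hd := H.mem x hx
  obtain ⟨P, O, hO, hxO, hPs, -, hPO, -⟩ := S.exists_lift H g hd
  rw [← hg] at hxO
  have hyO : ∀ y ∈ O, Injective (infAct y) ∧ fibProj μ ν σ y = ((g * gexp (P y).1).2 : GSU2 M) := by
    intro y hy
    obtain ⟨h1, h2⟩ := hPO y hy
    have h3 := S.smul_slice_mem H h1 (g * gexp (P y).1)
    have h4 := S.fibProj_smul_slice H h1 (g * gexp (P y).1)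
    rw [h2] at h3 h4
    exact ⟨h3, h4⟩
  have hc : ContinuousOn (fun y => ((g * gexp (P y).1).2 : GSU2 M)) O :=
    QuotientGroup.continuous_mk.comp_continuousOn (continuous_snd.comp_continuousOn
      (continuousOn_const.mul (contMDiff_gexp.continuous.comp_continuousOn
        (continuous_fst.comp_continuousOn hPs.continuousOn))))
  have h1 := (hc.isOpen_inter_preimage hO hU).mem_nhds
    ⟨hxO, by rw [mem_preimage, ← (hyO x hxO).2]; exact hxU⟩
  filter_upwards [h1] with y hy
  exact ⟨(hyO y hy.1).1, by rw [(hyO y hy.1).2]; exact hy.2⟩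

lemma dense_fibProj_preimage {U : Set (GSU2 M)} (hU : Dense U) :
    Dense {x : M | Injective (infAct x) ∧ fibProj μ ν σ x ∈ U} := by
  refine dense_closure.1 (S.dense_injective.mono fun x hx => ?_)
  obtain ⟨g, hg⟩ := S.exists_smul_slice H hx
  have hd := H.mem x hx
  have h1 : Dense {k : T2SU2 | (k.2 : GSU2 M) ∈ U} :=
    hU.preimage (f := fun k : T2SU2 => (k.2 : GSU2 M))
      (QuotientGroup.isOpenMap_coe.comp isOpenMap_snd)
  rw [hg]
  refine map_mem_closure (f := fun k : T2SU2 => k • σ (‖μ x‖, ν x))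
    (continuous_smul_left S.act _) (h1 g) fun k hk => ?_
  refine ⟨S.smul_slice_mem H hd k, ?_⟩
  rw [S.fibProj_smul_slice H hd]
  exact hk

lemma isAssociativeFibration :
    IsAssociativeFibration φ (fibration μ ν D σ) := by
  have hT3 := S.t3Space_GSU2
  obtain ⟨hRo, hRd⟩ := S.isOpen_dense_regular H
  have hT2 : T2Space (GSU2 M) := @T25Space.t2Space _ _ (@T3Space.t25Space _ _ hT3)
  refine ⟨Prod.t2Space, S.hasSmallInductiveDimensionLE_base _, fun b =>
    ⟨S.nonempty_fibration H b, S.isPossiblySingularAssociative_fibration H b⟩,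
    S.iUnion_fibration H, ⟨fst ⁻¹' {r : range (fun x => ‖μ x‖) | (r : ℝ) ∈ fst '' D},
      hRo.preimage continuous_fst, hRd.preimage isOpenMap_fst, fun b hb => ?_⟩, ?_⟩
  · rw [fibration_of_mem hb]
    exact S.isAssociativeSubmanifold_fibre H _ _
  obtain ⟨κ, s₀, hκ, hκd, hκs⟩ := S.exists_dense_chart
  have hDR : fst '' D ⊆ range (fun x => ‖μ x‖) := by
    rintro _ ⟨d, hd, rfl⟩
    exact ⟨σ d, H.slice.norm_mu hd⟩
  obtain ⟨x₀, hx₀⟩ := S.exists_injective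
  obtain ⟨χ, hχs, hχt, hχ⟩ := exists_openPartialHomeomorph_val
    (isOpenMap_fst D H.isOpen_domain) hDR ⟨_, _, H.mem x₀ hx₀, rfl⟩
  set Z := χ.prod κ.symm with hZ
  have hZs : ∀ b, b ∈ Z.source ↔ (b.1 : ℝ) ∈ fst '' D ∧ b.2 ∈ κ.target := fun b => by
    rw [hZ, OpenPartialHomeomorph.prod_source, mem_prod, hχs]; rfl
  have hZ1 : ∀ b, (Z b).1 = b.1 := fun b => congrFun hχ b.1
  have hZ2 : ∀ b ∈ Z.source, ((Z b).2 : GSU2 M) = b.2 := fun b hb => by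
    have h := κ.right_inv ((hZs b).1 hb).2
    rw [hκ] at h
    exact h
  set M' : Set M := {x | Injective (infAct x) ∧ fibProj μ ν σ x ∈ κ.target} with hM'
  have hM'd := S.dense_fibProj_preimage H hκd
  let β : M → range (fun x => ‖μ x‖) × GSU2 M := fun x => (⟨‖μ x‖, x, rfl⟩, fibProj μ ν σ x)
  have hβ : ∀ x ∈ M', β x ∈ Z.source := fun x hx => (hZs _).2 ⟨⟨_, H.mem x hx.1, rfl⟩, hx.2⟩
  obtain ⟨x₁, hx₁⟩ := hM'd.nonempty_iff.2 ⟨x₀⟩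
  obtain ⟨hcs, hman, c, hb, hc, hcZ⟩ := exists_chartedSpace_source Z s₀
    (fun n hn => hκs (by
      rw [hZ, OpenPartialHomeomorph.prod_target] at hn
      exact hn.2)) ⟨_, hβ x₁ hx₁⟩
  classical
  let π : M → Z.source := fun x => if h : β x ∈ Z.source then ⟨β x, h⟩ else ⟨_, hβ x₁ hx₁⟩
  have hπ : ∀ x ∈ M', (π x : range (fun x => ‖μ x‖) × GSU2 M) = β x := fun x hx => by
    simp only [π, dif_pos (hβ x hx)]
  have hπb : ∀ x ∈ M', ∀ b : Z.source, π x = b ↔ ‖μ x‖ = b.1.1 ∧ fibProj μ ν σ x = b.1.2 := by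
    intro x hx b
    rw [← Subtype.coe_inj, hπ x hx, Prod.ext_iff, Subtype.ext_iff]
  refine ⟨M', Z.source, S.isOpen_fibProj_preimage H κ.open_target, hM'd, Z.open_source, ?_, hcs,
    hman, π, ?_, fun b => ?_⟩
  · have h1 : Z.source = {r : range (fun x => ‖μ x‖) | (r : ℝ) ∈ fst '' D} ×ˢ κ.target := by
      rw [hZ, OpenPartialHomeomorph.prod_source, hχs]; rfl
    rw [h1]
    exact hRd.prod hκd
  · refine S.isSmoothFibreBundle H (S.isOpen_fibProj_preimage H κ.open_target) (fun x hx => hx.1)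
      (fun _ => ⟨_, H.mem x₀ hx₀⟩) (by rw [image_id]; exact subset_univ _) fun y _ =>
      ⟨univ, Z.target, fun y => Z y, c, mem_univ _, subset_univ _, ?_, ?_⟩
    · rw [hZ1]; exact ((hZs y).1 y.2).1
    · refine ⟨isOpen_univ, Z.open_target, hb.contMDiffOn, hc, fun y _ => Z.map_source y.2,
        fun _ _ => mem_univ _, fun y _ => Subtype.ext ?_, fun n hn => ?_, ?_, ?_, ?_⟩
      · rw [hcZ _ (Z.map_source y.2), Z.left_inv y.2]
      · rw [hcZ n hn, Z.right_inv hn]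
      · rintro y - y' - rfl
        exact ⟨rfl, rfl⟩
      · intro x hx y _
        rw [id, hπb x hx, hZ1, hZ2 y y.2]
      · intro x hx y _ h1 h2
        rw [hZ2 y y.2] at h2
        exact ⟨hx, by rw [h2]; exact ((hZs y).1 y.2).2⟩
  · rw [fibration_of_mem ((hZs b).1 b.2).1]
    ext x
    constructor
    · rintro ⟨hx, hxb⟩
      exact ⟨⟨hx.1, (hπb x hx b).1 hxb⟩, hx⟩
    · rintro ⟨⟨-, h⟩, hx⟩
      exact ⟨hx, (hπb x hx b).2 h⟩

end MultiMoment

end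

theorem mainTheorem9 {M : Type*} [TopologicalSpace M] [T2Space M] [SecondCountableTopology M]
    [SimplyConnectedSpace M] [ChartedSpace E7 M] [IsManifold (𝓡 7) ∞ M]
    (φ : G2Structure M) (hφ : φ.IsG2Manifold)
    [MulAction T2SU2 M]
    (hact : ContMDiff (modelT2SU2.prod (𝓡 7)) (𝓡 7) ∞ (fun a : T2SU2 × M => a.1 • a.2))
    (hpres : PreservesG2 φ) (hcoh : IsCohomogeneityTwo M)
    (μ : M → EuclideanSpace ℝ (Fin 3)) (hμ : IsMultimomentMu φ μ)
    (ν : M → ℝ) (hν : IsMultimomentNu φ ν) :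
    (∀ 𝓤 : Set (MulAction.orbitRel.Quotient T2SU2 M),
      (∃ O : Set (MulAction.orbitRel.Quotient T2SU2 M), IsOpen O ∧ 𝓤 = O ∩ baseB M) →
      IsConvexChart μ ν 𝓤 →
      ∃ (Φ : MulAction.orbitRel.Quotient T2SU2 M × GSU2 M →
          MulAction.orbitRel.Quotient torusSubgroup M) (p : M → GSU2 M),
        IsPrincipalTrivialization 𝓤 Φ ∧
        (∀ x ∈ (baseProj ⁻¹' 𝓤 : Set M), Φ (baseProj x, p x) = torusProj x) ∧
        IsConstantAlongCross φ 𝓤 p ∧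
        IsSmoothFibreBundle (𝓡 7) (𝓘(ℝ, ℝ).prod (𝓡 3)) 3 (baseProj ⁻¹' 𝓤 : Set M)
          (((fun x => ‖μ x‖) '' (baseProj ⁻¹' 𝓤 : Set M)) ×ˢ (univ : Set SU2))
          (Prod.map id (fun s : SU2 => (s : GSU2 M))) (fun x => (‖μ x‖, p x)) ∧
        ∀ (c : ℝ) (h : GSU2 M),
          φ.IsAssociativeSubmanifold {x ∈ (baseProj ⁻¹' 𝓤 : Set M) | ‖μ x‖ = c ∧ p x = h}) ∧
    (IsConvexChart μ ν (baseB M) →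
      ∃ (𝓑 : Type) (_ : TopologicalSpace 𝓑) (N : 𝓑 → Set M),
        IsAssociativeFibration φ N ∧
        ∀ (b : 𝓑) (t : Circle × Circle), ∀ x ∈ N b, ((t, 1) : T2SU2) • x ∈ N b) := by
  have S : MultiMoment φ μ ν := ⟨hφ, hact, hpres, hcoh, hμ, hν⟩
  refine ⟨fun 𝓤 ⟨O, hO, h𝓤⟩ hc => ?_, fun hc => ?_⟩
  · obtain ⟨σ, H⟩ := S.exists_horizontalSlice hO h𝓤 hc
    obtain ⟨Φ, hΦ, hΦp⟩ := S.exists_trivialization H rfl rfl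
    exact ⟨Φ, fibProj μ ν σ, hΦ, hΦp, S.isConstantAlongCross H rfl, S.isSmoothFibreBundle_fibProj H,
      S.isAssociativeSubmanifold_fibre H⟩
  · obtain ⟨σ, H⟩ := S.exists_horizontalSlice isOpen_univ (univ_inter (baseB M)).symm hc
    have hA : (baseProj ⁻¹' baseB M : Set M) = {x | Function.Injective (infAct x)} :=
      Set.ext S.mem_baseB_iff
    rw [hA] at H
    exact ⟨_, _, _, S.isAssociativeFibration H, fun b t x hx => S.smul_mem_fibration H b t hx⟩
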